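/- Let $\Lambda$ be a (unital, associative) ring containing a semisimple subring $E$ such that $\Lambda$ is finitely generated as a left $E$-module; then $\Lambda$ is left artinian. For a ring $R$, let $R\text{-mod}$ denote the category of finitely presented left $R$-modules, $R\text{-proj}$ its full subcategory of finitely generated projective modules, and $R\text{-}\underline{\mathrm{mod}}$ the factor category of $R\text{-mod}$ modulo the morphisms factoring through $R\text{-proj}$. Let $\Omega_{\mathrm{nc}}=(\Lambda/E)\otimes_E\Lambda$ be the $\Lambda$-$\Lambda$-bimodule of $E$-relative noncommutative differential $1$-forms, with right action $(\overline a\otimes x)b=\overline a\otimes xb$ and left action $b(\overline a\otimes x)=\overline{ba}\otimes x-\overline b\otimes ax$; it is finitely generated projective as a left $\Lambda$-module. Let $\Omega_{\mathrm{nc}}^*=\mathrm{Hom}_\Lambda(\Omega_{\mathrm{nc}},\Lambda)$ (left module homomorphisms) with the bimodule structure $(af)(x)=f(xa)$, $(fb)(x)=f(x)b$. Let $$L=T_\Lambda(\Omega_{\mathrm{nc}}^*\oplus\Omega_{\mathrm{nc}})\big/\bigl(x\otimes f-f(x),\ c-1\ \big|\ x\in\Omega_{\mathrm{nc}},\,f\in\Omega_{\mathrm{nc}}^*\bigr)$$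 be the Leavitt ring, where $c=\sum_j\alpha_j^*\otimes\alpha_j$ is the Casimir element of any finite dual basis $(\alpha_j,\alpha_j^*)$ (that is, $x=\sum_j\alpha_j^*(x)\alpha_j$ for all $x\in\Omega_{\mathrm{nc}}$), $\mathbb Z$-graded by $\deg a=0$ for $a\in\Lambda$, $\deg x=-1$ for $x\in\Omega_{\mathrm{nc}}$ and $\deg f=1$ for $f\in\Omega_{\mathrm{nc}}^*$. Let $L_0$ be its component of degree zero. Let $\mathcal S$ be the stabilization of $\Lambda\text{-mod}$ with respect to $\Omega=\Omega_{\mathrm{nc}}\otimes_\Lambda-$: its objects are the pairs $(X,n)$ with $X\in\Lambda\text{-mod}$ and $n\in\mathbb Z$, and its morphism sets are $\mathcal S((X,n),(Y,m))=\mathrm{colim}_{p\ge\max\{n,m\}}\mathrm{Hom}_\Lambda(\Omega^{p-n}X,\Omega^{p-m}Y)$, with transition maps and composition induced by $\Omega$. Let $\mathbf D_{\mathrm{sg}}(\Lambda)=\mathbf D^b(\Lambda\text{-mod})/\mathbf K^b(\Lambda\text{-proj})$ be the singularity category (Verdier quotient). Then: 1. $L$ is strongly graded, i.e. $L=\bigoplus_{n\in\mathbb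 Z}L_n$ is a graded ring and $L_mL_n=L_{m+n}$ for all $m,n\in\mathbb Z$. 2. $L_0$ is an FC ring: it is left and right coherent, $\mathrm{Ext}^1_{L_0}(M,L_0)=0$ for every finitely presented left $L_0$-module $M$, and $\mathrm{Ext}^1_{L_0^{\mathrm{op}}}(N,L_0)=0$ for every finitely presented right $L_0$-module $N$. 3. There is an equivalence of categories $\mathcal S\simeq L_0\text{-mod}$. 4. $L_0\text{-mod}$ is a Frobenius abelian category (abelian, with enough projectives and enough injectives, and with the same projective and injective objects), and there is a triangle equivalence $\mathbf D_{\mathrm{sg}}(\Lambda)\simeq L_0\text{-}\underline{\mathrm{mod}}$, where $L_0\text{-}\underline{\mathrm{mod}}$ carries the canonical triangulated structure of the stable category of a Frobenius category. -/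

import Mathlib

open CategoryTheory CategoryTheory.Limits MulOpposite
open scoped TensorProduct
universe u v w

/-! ### Tensor products over a noncommutative ring -/

section BalTensor

/-- The subgroup of `M ⊗[ℤ] N` generated by the elements `(m r) ⊗ n - m ⊗ (r n)`. -/
def balancedRelations (R : Type*) [Ring R] (M N : Type*) [AddCommGroup M] [AddCommGroup N]
    [Module Rᵐᵒᵖ M] [Module R N] : AddSubgroup (M ⊗[ℤ] N) :=
  AddSubgroup.closure {z | ∃ (m : M) (r : R) (n : N), z = (op r • m) ⊗ₜ[ℤ] n - m ⊗ₜ[ℤ] (r • n)}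

/-- The tensor product `M ⊗_R N` of a right `R`-module `M` and a left `R`-module `N` over a
not necessarily commutative ring `R`; right `R`-modules are modules over `Rᵐᵒᵖ`. -/
def BalTensor (R : Type*) [Ring R] (M N : Type*) [AddCommGroup M] [AddCommGroup N]
    [Module Rᵐᵒᵖ M] [Module R N] : Type _ :=
  (M ⊗[ℤ] N) ⧸ balancedRelations R M N

namespace BalTensor

variable {R : Type*} [Ring R] {M N : Type*} [AddCommGroup M] [AddCommGroup N]
  [Module Rᵐᵒᵖ M] [Module R N]

instance : AddCommGroup (BalTensor R M N) :=
  inferInstanceAs (AddCommGroup ((M ⊗[ℤ] N) ⧸ balancedRelations R M N))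

variable (R) in
/-- The elementary tensor `m ⊗ n`. -/
def tmul (m : M) (n : N) : BalTensor R M N :=
  QuotientAddGroup.mk' (balancedRelations R M N) (m ⊗ₜ[ℤ] n)

theorem add_tmul (m m' : M) (n : N) : tmul R (m + m') n = tmul R m n + tmul R m' n := by
  simp only [tmul, TensorProduct.add_tmul, map_add]; rfl

theorem tmul_add (m : M) (n n' : N) : tmul R m (n + n') = tmul R m n + tmul R m n' := by
  simp only [tmul, TensorProduct.tmul_add, map_add]; rfl

theorem smul_tmul (m : M) (r : R) (n : N) : tmul R (op r • m) n = tmul R m (r • n) := by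
  refine (QuotientAddGroup.eq_iff_sub_mem (N := balancedRelations R M N)).2 ?_
  exact AddSubgroup.subset_closure ⟨m, r, n, rfl⟩

theorem zero_tmul (n : N) : tmul R (0 : M) n = 0 := by
  have h := add_tmul (R := R) (0 : M) 0 n
  rwa [add_zero, left_eq_add] at h

theorem tmul_zero (m : M) : tmul R m (0 : N) = 0 := by
  have h := tmul_add (R := R) m (0 : N) 0
  rwa [add_zero, left_eq_add] at h

/-- The biadditive map `(m, n) ↦ m ⊗ n`. -/
def tmulHom : M →+ N →+ BalTensor R M N :=
  AddMonoidHom.mk' (fun m => AddMonoidHom.mk' (fun n => tmul R m n) (tmul_add m))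
    (fun m m' => by ext n; exact add_tmul m m' n)

/-- The additive map out of `M ⊗_R N` given by a balanced biadditive map. -/
def lift {A : Type*} [AddCommGroup A] (f : M →+ N →+ A)
    (hf : ∀ (m : M) (r : R) (n : N), f (op r • m) n = f m (r • n)) : BalTensor R M N →+ A :=
  QuotientAddGroup.lift (balancedRelations R M N)
    (TensorProduct.liftAddHom f (fun k m n => by simp)) (by
      refine (AddSubgroup.closure_le _).2 ?_
      rintro _ ⟨m, r, n, rfl⟩
      simp [AddMonoidHom.mem_ker, hf])

@[simp] theorem lift_tmul {A : Type*} [AddCommGroup A] (f : M →+ N →+ A)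
    (hf : ∀ (m : M) (r : R) (n : N), f (op r • m) n = f m (r • n)) (m : M) (n : N) :
    lift f hf (tmul R m n) = f m n := by
  rfl

theorem induction_on {p : BalTensor R M N → Prop} (z : BalTensor R M N) (h0 : p 0)
    (ht : ∀ m n, p (tmul R m n)) (ha : ∀ x y, p x → p y → p (x + y)) : p z := by
  obtain ⟨z, rfl⟩ := QuotientAddGroup.mk'_surjective (balancedRelations R M N) z
  induction z using TensorProduct.induction_on with
  | zero => rw [map_zero]; exact h0
  | tmul m n => exact ht m n
  | add x y hx hy => rw [map_add]; exact ha _ _ hx hy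

theorem addHom_ext {A : Type*} [AddCommGroup A] {f g : BalTensor R M N →+ A}
    (h : ∀ m n, f (tmul R m n) = g (tmul R m n)) : f = g := by
  ext z
  induction z using induction_on with
  | h0 => simp
  | ht m n => exact h m n
  | ha x y hx hy => simp [hx, hy]

/-- The additive map `f ⊗ g` for additive maps compatible with the actions of `R`. -/
def map {M' N' : Type*} [AddCommGroup M'] [AddCommGroup N'] [Module Rᵐᵒᵖ M'] [Module R N']
    (f : M →ₗ[Rᵐᵒᵖ] M') (g : N →ₗ[R] N') : BalTensor R M N →+ BalTensor R M' N' :=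
  lift (AddMonoidHom.mk' (fun m => AddMonoidHom.mk' (fun n => tmul R (f m) (g n))
      (fun n n' => by rw [map_add, tmul_add]))
    (fun m m' => by ext n; simp [add_tmul])) (fun m r n => by simp [smul_tmul])

@[simp] theorem map_tmul {M' N' : Type*} [AddCommGroup M'] [AddCommGroup N'] [Module Rᵐᵒᵖ M']
    [Module R N'] (f : M →ₗ[Rᵐᵒᵖ] M') (g : N →ₗ[R] N') (m : M) (n : N) :
    map f g (tmul R m n) = tmul R (f m) (g n) := rfl

/-- The left action `s (m ⊗ n) = (s m) ⊗ n` on `M ⊗_R N` for an `S`-`R`-bimodule `M`. -/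
def leftAction (S : Type*) [Ring S] [Module S M] [SMulCommClass S Rᵐᵒᵖ M] :
    S →+* AddMonoid.End (BalTensor R M N) where
  toFun s := map (Module.toModuleEnd Rᵐᵒᵖ (S := S) M s) LinearMap.id
  map_one' := addHom_ext (fun m n => by
    change tmul R ((1 : S) • m) n = tmul R m n
    rw [one_smul])
  map_mul' s t := addHom_ext (fun m n => by
    change tmul R ((s * t) • m) n = tmul R (s • t • m) n
    rw [mul_smul])
  map_zero' := addHom_ext (fun m n => by
    change tmul R ((0 : S) • m) n = 0
    rw [zero_smul, zero_tmul])
  map_add' s t := addHom_ext (fun m n => by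
    change tmul R ((s + t) • m) n = tmul R (s • m) n + tmul R (t • m) n
    rw [add_smul, add_tmul])

instance (priority := 900) {S : Type*} [Ring S] [Module S M] [SMulCommClass S Rᵐᵒᵖ M] :
    Module S (BalTensor R M N) :=
  Module.compHom _ (leftAction (R := R) (M := M) (N := N) S)

theorem smul_tmul_left {S : Type*} [Ring S] [Module S M] [SMulCommClass S Rᵐᵒᵖ M]
    (s : S) (m : M) (n : N) : s • tmul R m n = tmul R (s • m) n := rfl

/-- The `S`-linear map `id ⊗ g`. -/
def lTensor (S : Type*) [Ring S] (M : Type*) [AddCommGroup M] [Module Rᵐᵒᵖ M] [Module S M]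
    [SMulCommClass S Rᵐᵒᵖ M] {N' : Type*} [AddCommGroup N'] [Module R N'] (g : N →ₗ[R] N') :
    BalTensor R M N →ₗ[S] BalTensor R M N' where
  toFun := map LinearMap.id g
  map_add' := map_add _
  map_smul' s z := by
    induction z using induction_on with
    | h0 => simp
    | ht m n => simp [smul_tmul_left]
    | ha x y hx hy => simp only [smul_add, map_add, hx, hy]

@[simp] theorem lTensor_tmul (S : Type*) [Ring S] {M : Type*} [AddCommGroup M] [Module Rᵐᵒᵖ M]
    [Module S M] [SMulCommClass S Rᵐᵒᵖ M] {N' : Type*} [AddCommGroup N'] [Module R N']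
    (g : N →ₗ[R] N') (m : M) (n : N) : lTensor S M g (tmul R m n) = tmul R m (g n) := rfl

theorem finite_left (M N : Type*) [AddCommGroup M] [AddCommGroup N] [Module Rᵐᵒᵖ M] [Module R N]
    [Module R M] [SMulCommClass R Rᵐᵒᵖ M] [Module.Finite R M] [Module.Finite R N] :
    Module.Finite R (BalTensor R M N) := by
  obtain ⟨s, hs⟩ := (inferInstance : Module.Finite R M).fg_top
  obtain ⟨t, ht⟩ := (inferInstance : Module.Finite R N).fg_top
  rw [Module.finite_def, Submodule.fg_def]
  refine ⟨Set.image2 (tmul R) s t, s.finite_toSet.image2 _ t.finite_toSet, ?_⟩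
  set W := Submodule.span R (Set.image2 (tmul (R := R) (M := M) (N := N)) s t) with hW
  have h1 : ∀ n ∈ t, ∀ m : M, tmul R m n ∈ W := by
    intro n hn m
    have hm : m ∈ Submodule.span R (s : Set M) := by rw [hs]; trivial
    induction hm using Submodule.span_induction with
    | mem x hx => exact Submodule.subset_span ⟨x, hx, n, hn, rfl⟩
    | zero => rw [zero_tmul]; exact W.zero_mem
    | add x y _ _ hx hy => rw [add_tmul]; exact W.add_mem hx hy
    | smul r x _ hx => rw [← smul_tmul_left]; exact W.smul_mem r hx
  have h2 : ∀ (n : N) (m : M), tmul R m n ∈ W := by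
    intro n
    have hn : n ∈ Submodule.span R (t : Set N) := by rw [ht]; trivial
    induction hn using Submodule.span_induction with
    | mem x hx => exact h1 x hx
    | zero => intro m; rw [tmul_zero]; exact W.zero_mem
    | add x y _ _ hx hy => intro m; rw [tmul_add]; exact W.add_mem (hx m) (hy m)
    | smul r x _ hx => intro m; rw [← smul_tmul]; exact hx _
  refine eq_top_iff.2 (fun z _ => ?_)
  induction z using induction_on with
  | h0 => exact W.zero_mem
  | ht m n => exact h2 n m
  | ha x y hx hy => exact W.add_mem (hx trivial) (hy trivial)

/-- The right action `(m ⊗ n) s = m ⊗ (n s)` on `M ⊗_R N` for an `R`-`S`-bimodule `N`. -/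
def rightAction (S : Type*) [Ring S] [Module Sᵐᵒᵖ N] [SMulCommClass Sᵐᵒᵖ R N] :
    Sᵐᵒᵖ →+* AddMonoid.End (BalTensor R M N) where
  toFun s := map LinearMap.id (Module.toModuleEnd R (S := Sᵐᵒᵖ) N s)
  map_one' := addHom_ext (fun m n => by
    change tmul R m ((1 : Sᵐᵒᵖ) • n) = tmul R m n
    rw [one_smul])
  map_mul' s t := addHom_ext (fun m n => by
    change tmul R m ((s * t) • n) = tmul R m (s • t • n)
    rw [mul_smul])
  map_zero' := addHom_ext (fun m n => by
    change tmul R m ((0 : Sᵐᵒᵖ) • n) = 0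
    rw [zero_smul, tmul_zero])
  map_add' s t := addHom_ext (fun m n => by
    change tmul R m ((s + t) • n) = tmul R m (s • n) + tmul R m (t • n)
    rw [add_smul, tmul_add])

end BalTensor
end BalTensor

/-! ### Noncommutative relative differential forms -/

section OmegaNC

variable {Λ : Type u} [Ring Λ] (E : Subring Λ)

/-- The right `E`-module structure of `Λ`, for a subring `E` of `Λ`. -/
instance subringRightModule : Module (E : Type u)ᵐᵒᵖ Λ :=
  Module.compHom Λ (RingHom.op E.subtype)

theorem op_smul_eq_mul_coe (e : E) (a : Λ) : (op e) • a = a * (e : Λ) := rfl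

/-- The subring `E` of `Λ`, as a right `E`-submodule of `Λ`. -/
def subringAsRightSubmodule : Submodule (E : Type u)ᵐᵒᵖ Λ where
  carrier := E
  add_mem' := E.add_mem
  zero_mem' := E.zero_mem
  smul_mem' e _ ha := E.mul_mem ha (e.unop).2

/-- The quotient `Λ / E`, as a right `E`-module. -/
abbrev RelQuotient : Type u := Λ ⧸ subringAsRightSubmodule E

/-- The projection `a ↦ ā` from `Λ` to `Λ / E`. -/
abbrev RelQuotient.mk (a : Λ) : RelQuotient E := (subringAsRightSubmodule E).mkQ a

theorem RelQuotient.mk_eq_zero {a : Λ} (ha : a ∈ E) : RelQuotient.mk E a = 0 :=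
  (Submodule.Quotient.mk_eq_zero _).2 ha

/-- The bimodule `(Λ / E) ⊗_E Λ` of `E`-relative noncommutative differential `1`-forms. -/
def OmegaNC : Type u := BalTensor E (RelQuotient E) Λ

namespace OmegaNC

instance : AddCommGroup (OmegaNC E) :=
  inferInstanceAs (AddCommGroup (BalTensor E (RelQuotient E) Λ))

variable {E} in
/-- The element `ā ⊗ x`. -/
def tmul (a x : Λ) : OmegaNC E := BalTensor.tmul E (RelQuotient.mk E a) x

theorem add_tmul (a a' x : Λ) : (tmul (a + a') x : OmegaNC E) = tmul a x + tmul a' x :=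
  (congrArg (fun m => BalTensor.tmul E m x) (map_add _ a a')).trans (BalTensor.add_tmul _ _ _)

theorem tmul_add (a x x' : Λ) : (tmul a (x + x') : OmegaNC E) = tmul a x + tmul a x' :=
  BalTensor.tmul_add _ _ _

theorem tmul_of_mem {a : Λ} (ha : a ∈ E) (x : Λ) : (tmul a x : OmegaNC E) = 0 := by
  unfold tmul; rw [RelQuotient.mk_eq_zero E ha]; exact BalTensor.zero_tmul _

theorem mul_tmul (a : Λ) (e : E) (x : Λ) : (tmul (a * e) x : OmegaNC E) = tmul a (e * x) :=
  BalTensor.smul_tmul (RelQuotient.mk E a) e x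

theorem addHom_ext {A : Type*} [AddCommGroup A] {f g : OmegaNC E →+ A}
    (h : ∀ a x, f (tmul a x) = g (tmul a x)) : f = g := by
  refine BalTensor.addHom_ext (R := E) (M := RelQuotient E) (N := Λ) (fun m x => ?_)
  obtain ⟨a, rfl⟩ := (subringAsRightSubmodule E).mkQ_surjective m
  exact h a x

theorem induction_on {p : OmegaNC E → Prop} (z : OmegaNC E) (h0 : p 0)
    (ht : ∀ a x, p (tmul a x)) (ha : ∀ x y, p x → p y → p (x + y)) : p z := by
  refine BalTensor.induction_on (R := E) (M := RelQuotient E) (N := Λ) z h0 (fun m x => ?_) ha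
  obtain ⟨a, rfl⟩ := (subringAsRightSubmodule E).mkQ_surjective m
  exact ht a x

/-- The additive map out of `(Λ / E) ⊗_E Λ` given by a balanced biadditive map on `Λ × Λ` which
vanishes on `E × Λ`. -/
def lift {A : Type*} [AddCommGroup A] (f : Λ →+ Λ →+ A) (h0 : ∀ a ∈ E, f a = 0)
    (hf : ∀ (a : Λ) (e : E) (x : Λ), f (a * e) x = f a (e * x)) : OmegaNC E →+ A :=
  BalTensor.lift (R := E) (M := RelQuotient E) (N := Λ)
    (QuotientAddGroup.lift (subringAsRightSubmodule E).toAddSubgroup f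
      (fun a ha => h0 a ha)) (by
    intro m e x
    obtain ⟨a, rfl⟩ := (subringAsRightSubmodule E).mkQ_surjective m
    exact hf a e x)

theorem lift_tmul {A : Type*} [AddCommGroup A] (f : Λ →+ Λ →+ A) (h0 : ∀ a ∈ E, f a = 0)
    (hf : ∀ (a : Λ) (e : E) (x : Λ), f (a * e) x = f a (e * x)) (a x : Λ) :
    lift E f h0 hf (tmul a x) = f a x := rfl

/-- The additive map `ā ⊗ x ↦ (b a)‾ ⊗ x - b̄ ⊗ a x`. -/
def leftMul (b : Λ) : OmegaNC E →+ OmegaNC E :=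
  lift E (AddMonoidHom.mk' (fun a => AddMonoidHom.mk'
      (fun x => tmul (b * a) x - tmul b (a * x))
      (fun x y => by rw [mul_add, tmul_add, tmul_add]; abel))
    (fun a a' => by
      ext x
      change tmul (b * (a + a')) x - tmul b ((a + a') * x) =
        (tmul (b * a) x - tmul b (a * x)) + (tmul (b * a') x - tmul b (a' * x))
      rw [mul_add, add_mul, tmul_add, add_tmul]; abel))
    (fun a ha => by
      ext x
      change tmul (b * a) x - tmul b (a * x) = 0
      rw [mul_tmul E b ⟨a, ha⟩ x, sub_self])
    (fun a e x => by
      change tmul (b * (a * e)) x - tmul b (a * e * x) =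
        tmul (b * a) (e * x) - tmul b (a * (e * x))
      rw [← mul_assoc, mul_tmul, mul_assoc])

theorem leftMul_tmul (b a x : Λ) :
    leftMul E b (tmul a x) = tmul (b * a) x - tmul b (a * x) := rfl

/-- The left action of `Λ` on the noncommutative differential forms, as a ring homomorphism. -/
def leftAction : Λ →+* AddMonoid.End (OmegaNC E) where
  toFun := leftMul E
  map_one' := addHom_ext E (fun a x => by
    change leftMul E 1 (tmul a x) = tmul a x
    rw [leftMul_tmul, one_mul, tmul_of_mem E E.one_mem, sub_zero])
  map_mul' b c := addHom_ext E (fun a x => by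
    change leftMul E (b * c) (tmul a x) = leftMul E b (leftMul E c (tmul a x))
    simp only [leftMul_tmul, map_sub, mul_assoc]
    abel)
  map_zero' := addHom_ext E (fun a x => by
    change leftMul E 0 (tmul a x) = 0
    rw [leftMul_tmul, zero_mul, tmul_of_mem E E.zero_mem, tmul_of_mem E E.zero_mem, sub_zero])
  map_add' b c := addHom_ext E (fun a x => by
    change leftMul E (b + c) (tmul a x) = leftMul E b (tmul a x) + leftMul E c (tmul a x)
    simp only [leftMul_tmul, add_mul, add_tmul]
    abel)

/-- The left `Λ`-module structure `b (ā ⊗ x) = (b a)‾ ⊗ x - b̄ ⊗ a x`. -/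
instance : Module Λ (OmegaNC E) := Module.compHom _ (leftAction E)

theorem smul_tmul (b a x : Λ) :
    b • (tmul a x : OmegaNC E) = tmul (b * a) x - tmul b (a * x) := rfl

/-- The right `Λ`-module structure `(ā ⊗ x) b = ā ⊗ (x b)`. -/
instance : Module Λᵐᵒᵖ (OmegaNC E) :=
  Module.compHom (OmegaNC E)
    (show Λᵐᵒᵖ →+* AddMonoid.End (OmegaNC E) from
      BalTensor.rightAction (R := E) (M := RelQuotient E) (N := Λ) Λ)

theorem op_smul_tmul (b a x : Λ) : op b • (tmul a x : OmegaNC E) = tmul a (x * b) := rfl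

instance : SMulCommClass Λ Λᵐᵒᵖ (OmegaNC E) where
  smul_comm b c z := by
    induction z using induction_on with
    | h0 => simp
    | ht a x =>
      obtain ⟨c, rfl⟩ := op_surjective c
      rw [op_smul_tmul, smul_tmul, smul_tmul, smul_sub, op_smul_tmul, op_smul_tmul, mul_assoc]
    | ha x y hx hy => simp only [smul_add, hx, hy]

instance [Module.Finite E Λ] : Module.Finite Λ (OmegaNC E) := by
  obtain ⟨s, hs⟩ := (inferInstance : Module.Finite E Λ).fg_top
  rw [Module.finite_def, Submodule.fg_def]
  refine ⟨(fun a : Λ => (tmul a 1 : OmegaNC E)) '' s, s.finite_toSet.image _, ?_⟩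
  set W := Submodule.span Λ ((fun a : Λ => (tmul a 1 : OmegaNC E)) '' s) with hW
  have h1 : ∀ a : Λ, (tmul a 1 : OmegaNC E) ∈ W := by
    intro a
    have ha : a ∈ Submodule.span E (s : Set Λ) := by rw [hs]; trivial
    induction ha using Submodule.span_induction with
    | mem x hx => exact Submodule.subset_span ⟨x, hx, rfl⟩
    | zero => rw [tmul_of_mem E E.zero_mem]; exact W.zero_mem
    | add x y _ _ hx hy => rw [add_tmul]; exact W.add_mem hx hy
    | smul e x _ hx =>
      have h := W.smul_mem (e : Λ) hx
      rwa [smul_tmul, tmul_of_mem E e.2, sub_zero] at h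
  refine eq_top_iff.2 (fun z _ => ?_)
  induction z using induction_on with
  | h0 => exact W.zero_mem
  | ht a x =>
    have h := W.sub_mem (h1 (a * x)) (W.smul_mem a (h1 x))
    rwa [smul_tmul, mul_one, sub_sub_cancel] at h
  | ha x y hx hy => exact W.add_mem (hx trivial) (hy trivial)

end OmegaNC

theorem isNoetherianRing_of_finite_subring [IsSemisimpleRing E] [Module.Finite E Λ] :
    IsNoetherianRing Λ := by
  have : IsNoetherian E Λ := inferInstance
  exact isNoetherian_of_tower E this

end OmegaNC

/-! ### Tensor rings and Leavitt rings -/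

section Leavitt

/-- The defining relations of the tensor ring. -/
inductive TensorRing.Rel (R : Type u) [Ring R] (N : Type v) [AddCommGroup N] [Module R N]
    [Module Rᵐᵒᵖ N] : FreeAlgebra ℤ (R ⊕ N) → FreeAlgebra ℤ (R ⊕ N) → Prop
  | one : Rel R N (FreeAlgebra.ι ℤ (Sum.inl 1)) 1
  | add (r s : R) : Rel R N (FreeAlgebra.ι ℤ (Sum.inl (r + s)))
      (FreeAlgebra.ι ℤ (Sum.inl r) + FreeAlgebra.ι ℤ (Sum.inl s))
  | mul (r s : R) : Rel R N (FreeAlgebra.ι ℤ (Sum.inl (r * s)))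
      (FreeAlgebra.ι ℤ (Sum.inl r) * FreeAlgebra.ι ℤ (Sum.inl s))
  | vadd (x y : N) : Rel R N (FreeAlgebra.ι ℤ (Sum.inr (x + y)))
      (FreeAlgebra.ι ℤ (Sum.inr x) + FreeAlgebra.ι ℤ (Sum.inr y))
  | left (r : R) (x : N) : Rel R N (FreeAlgebra.ι ℤ (Sum.inr (r • x)))
      (FreeAlgebra.ι ℤ (Sum.inl r) * FreeAlgebra.ι ℤ (Sum.inr x))
  | right (r : R) (x : N) : Rel R N (FreeAlgebra.ι ℤ (Sum.inr (op r • x)))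
      (FreeAlgebra.ι ℤ (Sum.inr x) * FreeAlgebra.ι ℤ (Sum.inl r))

/-- The tensor ring `T_R(N)` of an `R`-`R`-bimodule `N`: the universal ring with a ring
homomorphism from `R` and an `R`-`R`-bimodule homomorphism from `N`. -/
def TensorRing (R : Type u) [Ring R] (N : Type v) [AddCommGroup N] [Module R N]
    [Module Rᵐᵒᵖ N] : Type (max u v) :=
  RingQuot (TensorRing.Rel R N)

namespace TensorRing

variable (R : Type u) [Ring R] (N : Type v) [AddCommGroup N] [Module R N] [Module Rᵐᵒᵖ N]

instance : Ring (TensorRing R N) := inferInstanceAs (Ring (RingQuot (TensorRing.Rel R N)))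

/-- The canonical ring homomorphism from `R` to the tensor ring. -/
def scalar : R →+* TensorRing R N where
  toFun r := RingQuot.mkRingHom (Rel R N) (FreeAlgebra.ι ℤ (Sum.inl r))
  map_one' := (RingQuot.mkRingHom_rel Rel.one).trans (map_one _)
  map_mul' r s := (RingQuot.mkRingHom_rel (Rel.mul r s)).trans (map_mul _ _ _)
  map_add' r s := (RingQuot.mkRingHom_rel (Rel.add r s)).trans (map_add _ _ _)
  map_zero' := by
    have h := (RingQuot.mkRingHom_rel (Rel.add (N := N) (0 : R) 0)).trans (map_add _ _ _)
    rwa [add_zero, left_eq_add] at h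

/-- The canonical map from the bimodule to the tensor ring. -/
def vec (x : N) : TensorRing R N :=
  RingQuot.mkRingHom (Rel R N) (FreeAlgebra.ι ℤ (Sum.inr x))

end TensorRing

/-- The left dual `M^* = Hom_R(M, R)` of an `R`-`R`-bimodule `M`. -/
def LeftDual (R : Type u) [Ring R] (M : Type v) [AddCommGroup M] [Module R M] : Type (max u v) :=
  M →ₗ[R] R

namespace LeftDual

variable (R : Type u) [Ring R] (M : Type v) [AddCommGroup M] [Module R M]

instance : AddCommGroup (LeftDual R M) := inferInstanceAs (AddCommGroup (M →ₗ[R] R))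

instance : FunLike (LeftDual R M) M R := inferInstanceAs (FunLike (M →ₗ[R] R) M R)

/-- The right action `(f b)(x) = f(x) b`. -/
instance : Module Rᵐᵒᵖ (LeftDual R M) := inferInstanceAs (Module Rᵐᵒᵖ (M →ₗ[R] R))

theorem op_smul_apply (b : R) (f : LeftDual R M) (x : M) : (op b • f) x = f x * b := rfl

variable [Module Rᵐᵒᵖ M] [SMulCommClass R Rᵐᵒᵖ M]

/-- The left action `(a f)(x) = f(x a)`. -/
instance : Module R (LeftDual R M) where
  smul a f := LinearMap.comp (show M →ₗ[R] R from f)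
    (show M →ₗ[R] M from
      { toFun := fun x => op a • x
        map_add' := smul_add (op a)
        map_smul' := fun r x => (smul_comm r (op a) x).symm })
  one_smul f := LinearMap.ext fun x => congrArg f (one_smul Rᵐᵒᵖ x)
  mul_smul a b f := LinearMap.ext fun x => congrArg f (mul_smul (op b) (op a) x)
  smul_zero _ := rfl
  smul_add _ _ _ := rfl
  add_smul a b f := LinearMap.ext fun x => by
    change f ((op a + op b) • x) = f (op a • x) + f (op b • x)
    rw [add_smul]; exact LinearMap.map_add f _ _
  zero_smul f := LinearMap.ext fun x => by
    change f ((0 : Rᵐᵒᵖ) • x) = 0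
    rw [zero_smul]; exact LinearMap.map_zero f

theorem smul_apply (a : R) (f : LeftDual R M) (x : M) : (a • f) x = f (op a • x) := rfl

end LeftDual

/-- A finite dual basis of the left `R`-module `M`. -/
def IsDualBasis {R : Type u} [Ring R] {M : Type v} [AddCommGroup M] [Module R M] {n : ℕ}
    (α : Fin n → M) (α' : Fin n → LeftDual R M) : Prop :=
  ∀ x : M, x = ∑ j, (α' j x) • α j

variable (R : Type u) [Ring R] (M : Type v) [AddCommGroup M] [Module R M] [Module Rᵐᵒᵖ M]
  [SMulCommClass R Rᵐᵒᵖ M]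

/-- The defining relations `x ⊗ f = f(x)` and `c = 1` of the Leavitt ring, where
`c = ∑ j, α_j^* ⊗ α_j` is the Casimir element, given by any finite dual basis. -/
inductive LeavittRing.Rel :
    TensorRing R (LeftDual R M × M) → TensorRing R (LeftDual R M × M) → Prop
  | eval (x : M) (f : LeftDual R M) :
      Rel (TensorRing.vec R _ (0, x) * TensorRing.vec R _ (f, 0)) (TensorRing.scalar R _ (f x))
  | casimir {n : ℕ} (α : Fin n → M) (α' : Fin n → LeftDual R M) (h : IsDualBasis α α') :
      Rel (∑ j, TensorRing.vec R _ (α' j, 0) * TensorRing.vec R _ (0, α j)) 1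

/-- The Leavitt ring `L_R(M)` of an `R`-`R`-bimodule `M` that is finitely generated projective
as a left `R`-module. -/
def LeavittRing : Type (max u v) := RingQuot (LeavittRing.Rel R M)

namespace LeavittRing

instance : Ring (LeavittRing R M) := inferInstanceAs (Ring (RingQuot (LeavittRing.Rel R M)))

/-- The projection from the tensor ring to the Leavitt ring. -/
def proj : TensorRing R (LeftDual R M × M) →+* LeavittRing R M :=
  RingQuot.mkRingHom (LeavittRing.Rel R M)

/-- The monomials of degree `n` in the Leavitt ring, where elements of `R`, `M` and `M^*` have
degree `0`, `-1` and `1`. -/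
inductive IsMonomial : ℤ → LeavittRing R M → Prop
  | scalar (r : R) : IsMonomial 0 (proj R M (TensorRing.scalar R _ r))
  | vec (x : M) : IsMonomial (-1) (proj R M (TensorRing.vec R _ (0, x)))
  | dual (f : LeftDual R M) : IsMonomial 1 (proj R M (TensorRing.vec R _ (f, 0)))
  | mul {m n : ℤ} {y z : LeavittRing R M} (hy : IsMonomial m y) (hz : IsMonomial n z) :
      IsMonomial (m + n) (y * z)

/-- The homogeneous component of degree `n` of the Leavitt ring. -/
def component (n : ℤ) : AddSubgroup (LeavittRing R M) :=
  AddSubgroup.closure {y | IsMonomial R M n y}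

instance : SetLike.GradedMonoid (component R M) where
  one_mem := by
    refine AddSubgroup.subset_closure ?_
    have h := IsMonomial.scalar (M := M) (1 : R)
    rwa [map_one, map_one] at h
  mul_mem m n y z hy hz := by
    induction hy using AddSubgroup.closure_induction with
    | mem y hy =>
      induction hz using AddSubgroup.closure_induction with
      | mem z hz => exact AddSubgroup.subset_closure (IsMonomial.mul hy hz)
      | zero => rw [mul_zero]; exact AddSubgroup.zero_mem _
      | add a b _ _ ha hb => rw [mul_add]; exact AddSubgroup.add_mem _ ha hb
      | neg a _ ha => rw [mul_neg]; exact AddSubgroup.neg_mem _ ha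
    | zero => rw [zero_mul]; exact AddSubgroup.zero_mem _
    | add a b _ _ ha hb => rw [add_mul]; exact AddSubgroup.add_mem _ ha hb
    | neg a _ ha => rw [neg_mul]; exact AddSubgroup.neg_mem _ ha

/-- The zeroth component of the Leavitt ring, as a ring. -/
abbrev DegreeZero : Type (max u v) := SetLike.GradeZero.subring (component R M)

end LeavittRing

/-- A family of additive subgroups indexed by the integers is a strong grading of the ring `A`:
`A` is the internal direct sum of the `𝒜 n`, `1 ∈ 𝒜 0`, and the additive subgroup generated by
the products of elements of `𝒜 m` and `𝒜 n` is equal to `𝒜 (m + n)`. -/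
structure IsStronglyGraded {A : Type*} [Ring A] (𝒜 : ℤ → AddSubgroup A) : Prop where
  graded : SetLike.GradedMonoid 𝒜
  isInternal : DirectSum.IsInternal 𝒜
  mul_eq (m n : ℤ) : AddSubgroup.closure (Set.image2 (· * ·) (𝒜 m : Set A) (𝒜 n)) = 𝒜 (m + n)

end Leavitt

/-! ### FC rings -/

section FC

open CategoryTheory.Abelian

/-- The left-handed half of the definition of an FC ring: `R` is left coherent and
`Ext¹_R(M, R) = 0` for every finitely presented left `R`-module `M`. -/
structure IsLeftFC (R : Type u) [Ring R] : Prop where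
  coherent (I : Ideal R) : I.FG → Module.FinitePresentation R I
  ext_eq_zero (M : ModuleCat.{u} R) [Module.FinitePresentation R M] :
    Subsingleton (Ext M (ModuleCat.of R R) 1)

/-- FC rings: two-sided coherent rings `R` such that `Ext¹(M, R) = 0` for all finitely presented
left `R`-modules and for all finitely presented right `R`-modules `M`. Right `R`-modules are
left modules over the opposite ring. -/
def IsFCRing (R : Type u) [Ring R] : Prop := IsLeftFC R ∧ IsLeftFC Rᵐᵒᵖ

end FC

/-! ### The stabilization of a category with an endofunctor -/

section Stabilization

variable {C : Type u} [Category.{v} C]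

/-- The object `Ω^a X`. -/
def iterObj (Ω : C ⥤ C) (X : C) : ℕ → C
  | 0 => X
  | a + 1 => Ω.obj (iterObj Ω X a)

/-- The objects `(X, n)` of the stabilization of `(C, Ω)`. -/
structure Stabilization (Ω : C ⥤ C) where
  /-- the underlying object of `C` -/
  obj : C
  /-- the integer -/
  deg : ℤ

namespace Stabilization

variable {Ω : C ⥤ C}

/-- A representative of a morphism `(X, n) ⟶ (Y, m)`: a morphism `f : Ω^(p-n) X ⟶ Ω^(p-m) Y` where
`p ≥ max n m`. We store the natural numbers `a = p - n` and `b = p - m`, so `p = n + a = m + b`. -/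
structure Rep (X Y : Stabilization Ω) where
  /-- the number `p - n` -/
  a : ℕ
  /-- the number `p - m` -/
  b : ℕ
  eq : X.deg + a = Y.deg + b
  /-- the morphism -/
  f : iterObj Ω X.obj a ⟶ iterObj Ω Y.obj b

/-- The structure map of the direct system: `(p, f)` is sent to `(p + 1, Ω f)`. -/
def Rep.step {X Y : Stabilization Ω} (r : Rep X Y) : Rep X Y where
  a := r.a + 1
  b := r.b + 1
  eq := by have := r.eq; push_cast; omega
  f := Ω.map r.f

/-- The colimit of the sets of morphisms `Ω^(p-n) X ⟶ Ω^(p-m) Y` over `p`, that is, the quotient of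
their disjoint union by the equivalence relation generated by `(p, f) ∼ (p + 1, Ω f)`. -/
def Hom (X Y : Stabilization Ω) : Type v :=
  Quot (fun r s : Rep X Y => s = r.step)

/-- The class of a representative. -/
def Rep.cls {X Y : Stabilization Ω} (r : Rep X Y) : Hom X Y := Quot.mk _ r

theorem cls_step {X Y : Stabilization Ω} (r : Rep X Y) : r.step.cls = r.cls :=
  (Quot.sound (r := fun r s : Rep X Y => s = r.step) rfl).symm

/-- The morphism `Ω^k f : Ω^(a+k) X ⟶ Ω^(b+k) Y`. -/
def raise {X Y : C} {a b : ℕ} (f : iterObj Ω X a ⟶ iterObj Ω Y b) :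
    (k : ℕ) → (iterObj Ω X (a + k) ⟶ iterObj Ω Y (b + k))
  | 0 => f
  | k + 1 => Ω.map (raise f k)

theorem raise_comp {X Y Z : C} {a b c : ℕ} (f : iterObj Ω X a ⟶ iterObj Ω Y b)
    (g : iterObj Ω Y b ⟶ iterObj Ω Z c) (k : ℕ) : raise (f ≫ g) k = raise f k ≫ raise g k := by
  induction k with
  | zero => rfl
  | succ k ih => exact (congrArg Ω.map ih).trans (Ω.map_comp _ _)

theorem raise_id (X : C) (a k : ℕ) :
    raise (Ω := Ω) (𝟙 (iterObj Ω X a)) k = 𝟙 (iterObj Ω X (a + k)) := by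
  induction k with
  | zero => rfl
  | succ k ih => exact (congrArg Ω.map ih).trans (Ω.map_id _)

/-- Transport of a morphism along equalities of exponents. -/
def transport {X Y : C} {a b a' b' : ℕ} (ha : a = a') (hb : b = b')
    (f : iterObj Ω X a ⟶ iterObj Ω Y b) : iterObj Ω X a' ⟶ iterObj Ω Y b' :=
  eqToHom (congrArg (iterObj Ω X) ha.symm) ≫ f ≫ eqToHom (congrArg (iterObj Ω Y) hb)

theorem transport_refl {X Y : C} {a b : ℕ} (f : iterObj Ω X a ⟶ iterObj Ω Y b) :
    transport rfl rfl f = f := by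
  simp [transport]

theorem map_transport {X Y : C} {a b a' b' : ℕ} (ha : a = a') (hb : b = b')
    (f : iterObj Ω X a ⟶ iterObj Ω Y b) :
    Ω.map (transport ha hb f) =
      transport (congrArg (· + 1) ha) (congrArg (· + 1) hb)
        (show iterObj Ω X (a + 1) ⟶ iterObj Ω Y (b + 1) from Ω.map f) := by
  subst ha hb
  rw [transport_refl, transport_refl]

theorem raise_map {X Y : C} {a b : ℕ} (f : iterObj Ω X a ⟶ iterObj Ω Y b) (k : ℕ) :
    raise (show iterObj Ω X (a + 1) ⟶ iterObj Ω Y (b + 1) from Ω.map f) k =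
      transport (by omega) (by omega) (raise f (k + 1)) := by
  induction k with
  | zero => exact (transport_refl _).symm
  | succ k ih => exact (congrArg Ω.map ih).trans (map_transport _ _ _)

theorem cls_transport {X Y : Stabilization Ω} (r : Rep X Y) {a' b' : ℕ} (ha : r.a = a')
    (hb : r.b = b') :
    (Rep.mk a' b' (by rw [← ha, ← hb]; exact r.eq) (transport ha hb r.f)).cls = r.cls := by
  obtain ⟨a, b, h, f⟩ := r
  dsimp only at ha hb ⊢
  subst ha hb
  rw [transport_refl]

theorem cls_raise {X Y : Stabilization Ω} (r : Rep X Y) (k : ℕ) :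
    (Rep.mk (r.a + k) (r.b + k) (by have := r.eq; push_cast; omega) (raise r.f k)).cls =
      r.cls := by
  induction k with
  | zero => rfl
  | succ k ih => exact (cls_step (Rep.mk _ _ _ (raise r.f k))).trans ih

/-- The composition of two representatives: if `f : Ω^a X ⟶ Ω^b Y` and `g : Ω^c Y ⟶ Ω^d Z`, this is
`Ω^b g ∘ Ω^c f : Ω^(a+c) X ⟶ Ω^(b+c) Y = Ω^(c+b) Y ⟶ Ω^(d+b) Z`. -/
def Rep.comp {X Y Z : Stabilization Ω} (r : Rep X Y) (s : Rep Y Z) : Rep X Z where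
  a := r.a + s.a
  b := s.b + r.b
  eq := by have := r.eq; have := s.eq; push_cast; omega
  f := raise r.f s.a ≫ eqToHom (congrArg (iterObj Ω Y.obj) (Nat.add_comm r.b s.a)) ≫ raise s.f r.b

theorem map_comp_left {X Y Z : C} {p q q' s p' q'' : ℕ} (A : iterObj Ω X p ⟶ iterObj Ω Y q)
    (B : iterObj Ω Y q' ⟶ iterObj Ω Z s) (h : q = q') (hp : p + 1 = p') (hq : q + 1 = q'')
    (h' : q'' = q' + 1) :
    transport hp rfl (show iterObj Ω X (p + 1) ⟶ iterObj Ω Z (s + 1) from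
      Ω.map (A ≫ eqToHom (congrArg (iterObj Ω Y) h) ≫ B)) =
    transport hp hq (show iterObj Ω X (p + 1) ⟶ iterObj Ω Y (q + 1) from Ω.map A) ≫
      eqToHom (congrArg (iterObj Ω Y) h') ≫
      (show iterObj Ω Y (q' + 1) ⟶ iterObj Ω Z (s + 1) from Ω.map B) := by
  subst h hp hq
  rw [transport_refl, transport_refl, eqToHom_refl, eqToHom_refl, Category.id_comp]
  exact (Ω.map_comp _ _).trans (congrArg _ (Category.id_comp _).symm)

theorem map_comp_right {X Y Z : C} {p q q' s s' q'' : ℕ} (A : iterObj Ω X p ⟶ iterObj Ω Y q)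
    (B : iterObj Ω Y q' ⟶ iterObj Ω Z s) (h : q = q') (hs : s + 1 = s') (hq : q' + 1 = q'')
    (h' : q + 1 = q'') :
    transport rfl hs (show iterObj Ω X (p + 1) ⟶ iterObj Ω Z (s + 1) from
      Ω.map (A ≫ eqToHom (congrArg (iterObj Ω Y) h) ≫ B)) =
    (show iterObj Ω X (p + 1) ⟶ iterObj Ω Y (q + 1) from Ω.map A) ≫
      eqToHom (congrArg (iterObj Ω Y) h') ≫
      transport hq hs (show iterObj Ω Y (q' + 1) ⟶ iterObj Ω Z (s + 1) from Ω.map B) := by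
  subst h hs hq
  rw [transport_refl, transport_refl, eqToHom_refl, eqToHom_refl, Category.id_comp]
  exact (Ω.map_comp _ _).trans (congrArg _ (Category.id_comp _).symm)

/-- Composition may be computed at any common level. -/
theorem cls_comp_of_eq {X Y Z : Stabilization Ω} {a b c : ℕ} (h : X.deg + a = Y.deg + b)
    (h' : Y.deg + b = Z.deg + c) (f : iterObj Ω X.obj a ⟶ iterObj Ω Y.obj b)
    (g : iterObj Ω Y.obj b ⟶ iterObj Ω Z.obj c) :
    ((Rep.mk a b h f).comp (Rep.mk b c h' g)).cls = (Rep.mk a c (h.trans h') (f ≫ g)).cls := by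
  rw [← cls_raise (Rep.mk a c (h.trans h') (f ≫ g)) b]
  simp only [Rep.comp, raise_comp, eqToHom_refl, Category.id_comp]

theorem comp_step_left {X Y Z : Stabilization Ω} (r : Rep X Y) (s : Rep Y Z) :
    (r.step.comp s).cls = (r.comp s).cls := by
  rw [← cls_step (r.comp s)]
  have ha : (r.comp s).step.a = (r.step.comp s).a := by simp only [Rep.step, Rep.comp]; omega
  rw [← cls_transport (r.comp s).step ha rfl]
  have key := map_comp_left (raise r.f s.a) (raise s.f r.b) (Nat.add_comm r.b s.a)
    (p' := r.a + 1 + s.a) (q'' := r.b + 1 + s.a) (by omega) (by omega) (by omega)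
  have key' := raise_map r.f s.a
  exact congrArg (fun g => (Rep.mk _ _ _ g).cls) (key.trans (congrArg (· ≫ _) key'.symm)).symm

theorem comp_step_right {X Y Z : Stabilization Ω} (r : Rep X Y) (s : Rep Y Z) :
    (r.comp s.step).cls = (r.comp s).cls := by
  rw [← cls_step (r.comp s)]
  have hb : (r.comp s).step.b = (r.comp s.step).b := by simp only [Rep.step, Rep.comp]; omega
  rw [← cls_transport (r.comp s).step rfl hb]
  have key := map_comp_right (raise r.f s.a) (raise s.f r.b) (Nat.add_comm r.b s.a)
    (s' := s.b + 1 + r.b) (q'' := s.a + 1 + r.b) (by omega) (by omega) (by omega)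
  have key' := raise_map s.f r.b
  exact congrArg (fun g => (Rep.mk _ _ _ g).cls)
    (key.trans (congrArg (fun t => _ ≫ _ ≫ t) key'.symm)).symm

/-- The composition of morphisms in the stabilization. -/
def Hom.comp {X Y Z : Stabilization Ω} (f : Hom X Y) (g : Hom Y Z) : Hom X Z :=
  Quot.lift₂ (fun r s => (r.comp s).cls)
    (by rintro r s _ rfl; exact (comp_step_right r s).symm)
    (by rintro r _ s rfl; exact (comp_step_left r s).symm) f g

/-- A class is represented at every sufficiently high level. -/
theorem exists_rep {X Y : Stabilization Ω} (f : Hom X Y) :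
    ∃ p₀ : ℤ, ∀ p ≥ p₀, ∃ (a b : ℕ) (_ : X.deg + a = p) (_ : Y.deg + b = p)
      (h : X.deg + a = Y.deg + b) (f' : iterObj Ω X.obj a ⟶ iterObj Ω Y.obj b),
      f = (Rep.mk a b h f').cls := by
  obtain ⟨r, rfl⟩ := Quot.exists_rep f
  refine ⟨X.deg + r.a, fun p hp => ?_⟩
  obtain ⟨k, rfl⟩ : ∃ k : ℕ, p = X.deg + r.a + k := ⟨(p - (X.deg + r.a)).toNat, by omega⟩
  have := r.eq
  exact ⟨r.a + k, r.b + k, by push_cast; omega, by push_cast; omega, by push_cast; omega,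
    raise r.f k, (cls_raise r k).symm⟩

theorem comp_cls {X Y Z : Stabilization Ω} {a b c : ℕ} (h : X.deg + a = Y.deg + b)
    (h' : Y.deg + b = Z.deg + c) (f : iterObj Ω X.obj a ⟶ iterObj Ω Y.obj b)
    (g : iterObj Ω Y.obj b ⟶ iterObj Ω Z.obj c) :
    Hom.comp (Rep.mk a b h f).cls (Rep.mk b c h' g).cls = (Rep.mk a c (h.trans h') (f ≫ g)).cls :=
  cls_comp_of_eq h h' f g

/-- The identity of an object of the stabilization. -/
def Hom.id (X : Stabilization Ω) : Hom X X := (Rep.mk 0 0 rfl (𝟙 _)).cls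

theorem id_eq (X : Stabilization Ω) (a : ℕ) :
    Hom.id X = (Rep.mk a a rfl (𝟙 (iterObj Ω X.obj a))).cls := by
  induction a with
  | zero => rfl
  | succ a ih =>
    rw [ih, ← cls_step]
    exact congrArg (fun g => (Rep.mk (a + 1) (a + 1) rfl g).cls) (Ω.map_id _)

theorem exists_cls {X Y : Stabilization Ω} (f : Hom X Y) :
    ∃ (a b : ℕ) (h : X.deg + a = Y.deg + b) (f' : iterObj Ω X.obj a ⟶ iterObj Ω Y.obj b),
      f = (Rep.mk a b h f').cls := by
  obtain ⟨r, rfl⟩ := Quot.exists_rep f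
  exact ⟨r.a, r.b, r.eq, r.f, rfl⟩

instance : Category (Stabilization Ω) where
  Hom := Hom
  id X := Hom.id X
  comp f g := f.comp g
  id_comp {X Y} f := by
    obtain ⟨a, b, h, f, rfl⟩ := exists_cls f
    rw [id_eq X a, comp_cls, Category.id_comp]
  comp_id {X Y} f := by
    obtain ⟨a, b, h, f, rfl⟩ := exists_cls f
    rw [id_eq Y b, comp_cls, Category.comp_id]
  assoc {W X Y Z} f g h := by
    obtain ⟨p₁, h₁⟩ := exists_rep f
    obtain ⟨p₂, h₂⟩ := exists_rep g
    obtain ⟨p₃, h₃⟩ := exists_rep h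
    obtain ⟨a, b, ha, hb, e₁, f, rfl⟩ := h₁ (max p₁ (max p₂ p₃)) (by omega)
    obtain ⟨b', c, hb', hc, e₂, g, rfl⟩ := h₂ (max p₁ (max p₂ p₃)) (by omega)
    obtain ⟨c', d, hc', hd, e₃, h, rfl⟩ := h₃ (max p₁ (max p₂ p₃)) (by omega)
    obtain rfl : b = b' := by omega
    obtain rfl : c = c' := by omega
    rw [comp_cls, comp_cls, comp_cls, comp_cls, Category.assoc]

end Stabilization

end Stabilization

/-! ### Frobenius abelian categories and their stable categories -/

section Frobenius

/-- A preadditive category is Frobenius abelian if it is an abelian category with enough projective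
objects and enough injective objects in which projective and injective objects coincide. -/
class IsFrobeniusAbelian (C : Type u) [Category.{v} C] [Preadditive C] : Prop where
  hasFiniteProducts : HasFiniteProducts C
  hasKernels : HasKernels C
  hasCokernels : HasCokernels C
  isNormalMono : IsNormalMonoCategory C
  isNormalEpi : IsNormalEpiCategory C
  enoughProjectives : EnoughProjectives C
  enoughInjectives : EnoughInjectives C
  projective_iff_injective (X : C) : Projective X ↔ Injective X

attribute [instance] IsFrobeniusAbelian.hasCokernels IsFrobeniusAbelian.enoughInjectives

variable (C : Type u) [Category.{v} C] [Preadditive C]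

/-- Two morphisms are identified in the stable category if their difference factors through a
projective object. -/
def stableRel : HomRel C := fun X Y f g =>
  ∃ (P : C) (_ : Projective P) (s : X ⟶ P) (t : P ⟶ Y), f - g = s ≫ t

/-- The stable category: the factor category modulo morphisms factoring through projective
objects. -/
abbrev StableCategory : Type u := CategoryTheory.Quotient (stableRel C)

variable {C}

/-- The object of the stable category given by `X`. -/
abbrev StableCategory.of (X : C) : StableCategory C := (CategoryTheory.Quotient.functor (stableRel C)).obj X

/-- The class in the stable category of a morphism. -/
abbrev stableMap {X Y : C} (f : X ⟶ Y) : StableCategory.of X ⟶ StableCategory.of Y :=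
  (CategoryTheory.Quotient.functor (stableRel C)).map f

theorem stableMap_eq {X Y : C} {f g : X ⟶ Y} (h : stableRel C f g) : stableMap f = stableMap g :=
  CategoryTheory.Quotient.sound (stableRel C) h

variable [IsFrobeniusAbelian C]

namespace StableCategory

/-- The object `Σ X` in a short exact sequence `0 ⟶ X ⟶ I(X) ⟶ Σ X ⟶ 0` with `I(X)` injective. -/
noncomputable def suspObj (X : C) : C := cokernel (Injective.ι X)

/-- The projection `I(X) ⟶ Σ X`. -/
noncomputable def suspπ (X : C) : Injective.under X ⟶ suspObj X := cokernel.π (Injective.ι X)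

theorem ι_suspπ (X : C) : Injective.ι X ≫ suspπ X = 0 := cokernel.condition _

instance (X : C) : Epi (suspπ X) := inferInstanceAs (Epi (cokernel.π _))

/-- An extension `I(X) ⟶ I(Y)` of a morphism `X ⟶ Y`. -/
noncomputable def underMap {X Y : C} (f : X ⟶ Y) : Injective.under X ⟶ Injective.under Y :=
  Injective.factorThru (f ≫ Injective.ι Y) (Injective.ι X)

theorem ι_underMap {X Y : C} (f : X ⟶ Y) :
    Injective.ι X ≫ underMap f = f ≫ Injective.ι Y :=
  Injective.comp_factorThru _ _

/-- The morphism `Σ X ⟶ Σ Y` induced by a morphism `X ⟶ Y`. -/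
noncomputable def suspMap {X Y : C} (f : X ⟶ Y) : suspObj X ⟶ suspObj Y :=
  cokernel.desc _ (underMap f ≫ suspπ Y) (by
    rw [← Category.assoc, ι_underMap, Category.assoc, ι_suspπ, comp_zero])

theorem suspπ_suspMap {X Y : C} (f : X ⟶ Y) : suspπ X ≫ suspMap f = underMap f ≫ suspπ Y :=
  cokernel.π_desc _ _ _

/-- The class of `Σ X ⟶ Σ Y` in the stable category depends only on the class of `X ⟶ Y`. -/
theorem stableRel_of_fill {X Y : C} (f : X ⟶ Y) (hf : ∃ (P : C) (_ : Projective P) (s : X ⟶ P)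
    (t : P ⟶ Y), f = s ≫ t) (F : Injective.under X ⟶ Injective.under Y)
    (hF : Injective.ι X ≫ F = f ≫ Injective.ι Y) (g : suspObj X ⟶ suspObj Y)
    (hg : suspπ X ≫ g = F ≫ suspπ Y) :
    ∃ (P : C) (_ : Projective P) (s : suspObj X ⟶ P) (t : P ⟶ suspObj Y), g = s ≫ t := by
  obtain ⟨P, hP, s, t, rfl⟩ := hf
  have : Injective P := (IsFrobeniusAbelian.projective_iff_injective P).1 hP
  let s' := Injective.factorThru s (Injective.ι X)
  have hs' : Injective.ι X ≫ s' = s := Injective.comp_factorThru _ _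
  let d : suspObj X ⟶ Injective.under Y := cokernel.desc (Injective.ι X)
    (F - s' ≫ t ≫ Injective.ι Y) (by
      rw [Preadditive.comp_sub, hF, ← Category.assoc _ s', hs', Category.assoc, sub_self])
  have hd : suspπ X ≫ d = F - s' ≫ t ≫ Injective.ι Y := cokernel.π_desc _ _ _
  refine ⟨Injective.under Y, (IsFrobeniusAbelian.projective_iff_injective _).2 inferInstance,
    d, suspπ Y, ?_⟩
  rw [← cancel_epi (suspπ X), hg, ← Category.assoc, hd, Preadditive.sub_comp, Category.assoc,
    Category.assoc, ι_suspπ, comp_zero, comp_zero, sub_zero]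

theorem suspMap_rel {X Y : C} (f g : X ⟶ Y) (h : stableRel C f g) :
    stableRel C (suspMap f) (suspMap g) :=
  stableRel_of_fill (f - g) h (underMap f - underMap g)
    (by rw [Preadditive.comp_sub, ι_underMap, ι_underMap, Preadditive.sub_comp]) _
    (by rw [Preadditive.comp_sub, suspπ_suspMap, suspπ_suspMap, Preadditive.sub_comp])

theorem zero_factors (X Y : C) : ∃ (P : C) (_ : Projective P) (s : X ⟶ P) (t : P ⟶ Y),
    (0 : X ⟶ Y) = s ≫ t :=
  ⟨Injective.under X, (IsFrobeniusAbelian.projective_iff_injective _).2 inferInstance, 0, 0,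
    zero_comp.symm⟩

theorem suspMap_id (X : C) : stableMap (suspMap (𝟙 X)) = 𝟙 _ := by
  rw [← (CategoryTheory.Quotient.functor (stableRel C)).map_id]
  refine stableMap_eq (stableRel_of_fill 0 (zero_factors X X) (underMap (𝟙 X) - 𝟙 _) ?_ _ ?_)
  · rw [Preadditive.comp_sub, ι_underMap, Category.id_comp, Category.comp_id, sub_self, zero_comp]
  · rw [Preadditive.comp_sub, suspπ_suspMap, Preadditive.sub_comp, Category.comp_id,
      Category.id_comp]

theorem suspMap_comp {X Y Z : C} (f : X ⟶ Y) (g : Y ⟶ Z) :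
    stableMap (suspMap (f ≫ g)) = stableMap (suspMap f) ≫ stableMap (suspMap g) := by
  rw [← (CategoryTheory.Quotient.functor (stableRel C)).map_comp]
  refine stableMap_eq (stableRel_of_fill 0 (zero_factors X Z)
    (underMap (f ≫ g) - underMap f ≫ underMap g) ?_ _ ?_)
  · rw [Preadditive.comp_sub, ι_underMap, ← Category.assoc, ι_underMap, Category.assoc,
      Category.assoc, ι_underMap, sub_self, zero_comp]
  · rw [Preadditive.comp_sub, suspπ_suspMap, Preadditive.sub_comp, ← Category.assoc, suspπ_suspMap,
      Category.assoc, suspπ_suspMap, Category.assoc]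

variable (C) in
/-- The suspension functor of the stable category of a Frobenius abelian category. -/
noncomputable def susp : StableCategory C ⥤ StableCategory C :=
  CategoryTheory.Quotient.lift (stableRel C)
    { obj X := StableCategory.of (suspObj X)
      map f := stableMap (suspMap f)
      map_id X := suspMap_id X
      map_comp f g := suspMap_comp f g }
    (fun _ _ f g h => stableMap_eq (suspMap_rel f g h))

/-- The triangles of the stable category of a Frobenius abelian category: those isomorphic to the
standard triangle `A ⟶ B ⟶ D ⟶ Σ A` of a morphism `a : A ⟶ B`, where `D` is the pushout of `a` and
`A ⟶ I(A)`, and `D ⟶ Σ A` vanishes on `B` and restricts to the projection `I(A) ⟶ Σ A`. -/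
def IsTriangle {X Y Z : StableCategory C} (u : X ⟶ Y) (v : Y ⟶ Z) (w : Z ⟶ (susp C).obj X) :
    Prop :=
  ∃ (A B D : C) (a : A ⟶ B) (b : B ⟶ D) (i : Injective.under A ⟶ D) (c : D ⟶ suspObj A)
    (_ : IsPushout a (Injective.ι A) b i) (_ : b ≫ c = 0) (_ : i ≫ c = suspπ A)
    (eX : X ≅ StableCategory.of A) (eY : Y ≅ StableCategory.of B) (eZ : Z ≅ StableCategory.of D),
    u ≫ eY.hom = eX.hom ≫ stableMap a ∧ v ≫ eZ.hom = eY.hom ≫ stableMap b ∧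
      w ≫ ((susp C).map eX.hom : _ ⟶ StableCategory.of (suspObj A)) = eZ.hom ≫ stableMap c

end StableCategory

open Pretriangulated in
/-- A triangle equivalence from a triangulated category `T` to the stable category of a Frobenius
abelian category `C`: an equivalence of categories `F`, together with a natural isomorphism between
`F ∘ [1]` and `Σ ∘ F`, such that a triangle in `T` is distinguished if and only if its image is a
triangle of the stable category. -/
structure TriangleEquivalenceToStable (T : Type*) [Category* T] [HasZeroObject T] [HasShift T ℤ]
    [Preadditive T] [∀ n : ℤ, (shiftFunctor T n).Additive] [Pretriangulated T]
    (C : Type*) [Category* C] [Preadditive C] [IsFrobeniusAbelian C] where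
  /-- the equivalence of categories -/
  equiv : T ≌ StableCategory C
  /-- the compatibility with the suspension functors -/
  commShift : shiftFunctor T (1 : ℤ) ⋙ equiv.functor ≅ equiv.functor ⋙ StableCategory.susp C
  distinguished_iff (t : Triangle T) : t ∈ distTriang T ↔
    StableCategory.IsTriangle (equiv.functor.map t.mor₁) (equiv.functor.map t.mor₂)
      (equiv.functor.map t.mor₃ ≫ commShift.hom.app t.obj₁)

end Frobenius

/-! ### Finitely presented modules and singularity categories -/

section SingularityCategory

/-- The property of being a finitely presented module. -/
def isFP (R : Type u) [Ring R] : ObjectProperty (ModuleCat.{u} R) :=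
  fun M => Module.FinitePresentation R M

/-- The category `R-mod` of finitely presented left `R`-modules. -/
abbrev FPMod (R : Type u) [Ring R] : Type (u + 1) := (isFP R).FullSubcategory

/-- Epimorphisms of finitely presented modules are surjective. -/
theorem FPMod.surjective_of_epi (R : Type u) [Ring R] {X Y : FPMod R} (f : X ⟶ Y) [Epi f] :
    Function.Surjective f.hom.hom := by
  rw [← LinearMap.range_eq_top]
  have : Module.FinitePresentation R X.obj := X.property
  have : Module.FinitePresentation R Y.obj := Y.property
  have hQ : Module.FinitePresentation R (Y.obj ⧸ LinearMap.range f.hom.hom) :=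
    Module.finitePresentation_of_surjective _ (Submodule.mkQ_surjective _) (by
      rw [Submodule.ker_mkQ, ← Submodule.map_top]; exact Submodule.FG.map _ Module.Finite.fg_top)
  let Q : FPMod R := ⟨ModuleCat.of R (Y.obj ⧸ LinearMap.range f.hom.hom), hQ⟩
  let g : Y ⟶ Q := ObjectProperty.homMk (ModuleCat.ofHom (Submodule.mkQ _))
  have h : g = 0 := by
    rw [← cancel_epi f]
    ext x
    exact (Submodule.Quotient.mk_eq_zero _).2 ⟨x, rfl⟩
  refine eq_top_iff.2 fun y _ => ?_
  exact (Submodule.Quotient.mk_eq_zero _).1 (congrArg (fun k : Y ⟶ Q => k.hom.hom y) h)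

/-- The projective objects of `R-mod` are the finitely generated projective modules. -/
theorem FPMod.projective_iff (R : Type u) [Ring R] (P : FPMod R) :
    Projective P ↔ Module.Projective R P.obj := by
  constructor
  · intro h
    have : Module.FinitePresentation R P.obj := P.property
    obtain ⟨n, g, hg⟩ := Module.Finite.exists_fin' R P.obj
    let F : FPMod R := ⟨ModuleCat.of R (Fin n → R), (inferInstance :
      Module.FinitePresentation R (Fin n → R))⟩
    let p : F ⟶ P := ObjectProperty.homMk (ModuleCat.ofHom g)
    have : Epi p := ⟨fun a b hab => by
      ext y
      obtain ⟨x, rfl⟩ := hg y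
      exact congrArg (fun k : F ⟶ _ => k.hom.hom x) hab⟩
    have hs := Projective.factorThru_comp (𝟙 P) p
    exact Module.Projective.of_split (M := Fin n → R) (Projective.factorThru (𝟙 P) p).hom.hom g
      (congrArg (fun k : P ⟶ P => k.hom.hom) hs)
  · intro h
    refine ⟨fun {X Y} f e he => ?_⟩
    obtain ⟨g, hg⟩ := Module.projective_lifting_property e.hom.hom f.hom.hom (FPMod.surjective_of_epi R e)
    exact ⟨ObjectProperty.homMk (ModuleCat.ofHom g), by
      ext x; exact DFunLike.congr_fun hg x⟩

section Noetherian

variable (R : Type u) [Ring R] [IsNoetherianRing R]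

theorem isFP_of_finite (M : ModuleCat.{u} R) [Module.Finite R M] : isFP R M :=
  Module.finitePresentation_of_finite R M

theorem isFP.finite {R : Type u} [Ring R] {M : ModuleCat.{u} R} (h : isFP R M) :
    Module.Finite R M :=
  have : Module.FinitePresentation R M := h
  inferInstance

instance : (isFP R).IsClosedUnderSubobjects where
  prop_of_mono {X Y} f hf hY := by
    have := hY.finite
    have : Module.Finite R X :=
      Module.Finite.of_injective f.hom ((ModuleCat.mono_iff_injective f).1 hf)
    exact isFP_of_finite R X

instance : (isFP R).IsClosedUnderQuotients where
  prop_of_epi {X Y} f hf hX := by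
    have := hX.finite
    have : Module.Finite R Y :=
      Module.Finite.of_surjective f.hom ((ModuleCat.epi_iff_surjective f).1 hf)
    exact isFP_of_finite R Y

instance : (isFP R).ContainsZero where
  exists_zero := ⟨ModuleCat.of R PUnit, ModuleCat.isZero_of_subsingleton _, isFP_of_finite R _⟩

instance : (isFP R).IsClosedUnderFiniteProducts where
  isClosedUnderLimitsOfShape J _ :=
    { limitsOfShape_le := by
        rintro X ⟨p⟩
        have := fun j => (p.prop_diag_obj j).finite
        let Z : J → ModuleCat.{u} R := fun j => p.diag.obj ⟨j⟩
        have hZ : ∀ j, Module.Finite R (Z j) := fun j => this ⟨j⟩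
        let g : X →ₗ[R] (∀ j, Z j) := LinearMap.pi fun j => (p.π.app ⟨j⟩).hom
        have hg : Function.Injective g := by
          intro x y hxy
          refine Concrete.isLimit_ext p.diag p.isLimit x y (fun j => ?_)
          exact congrFun hxy j.as
        have : Module.Finite R X := Module.Finite.of_injective g hg
        exact isFP_of_finite R X }

noncomputable instance : Abelian (FPMod R) := inferInstance

end Noetherian

/-- The functor `M ⊗_R -` on the category of finitely presented modules over a left noetherian
ring `R`, for an `R`-`R`-bimodule `M` which is finitely generated as a left module. -/
def tensorFunctor (R : Type u) [Ring R] [IsNoetherianRing R] (M : Type u) [AddCommGroup M]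
    [Module R M] [Module Rᵐᵒᵖ M] [SMulCommClass R Rᵐᵒᵖ M] [Module.Finite R M] :
    FPMod R ⥤ FPMod R where
  obj X := ⟨ModuleCat.of R (BalTensor R M X.obj), by
    have := X.property.finite
    have := BalTensor.finite_left (R := R) M X.obj
    exact isFP_of_finite R _⟩
  map f := ObjectProperty.homMk (ModuleCat.ofHom (BalTensor.lTensor R M f.hom.hom))
  map_id X := by
    ext z
    exact DFunLike.congr_fun (BalTensor.addHom_ext
      (f := (BalTensor.lTensor R M (LinearMap.id (M := X.obj))).toAddMonoidHom)
      (g := AddMonoidHom.id _) (fun m n => rfl)) z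
  map_comp {X Y Z} f g := by
    ext z
    exact DFunLike.congr_fun (BalTensor.addHom_ext
      (f := (BalTensor.lTensor R M (g.hom.hom ∘ₗ f.hom.hom)).toAddMonoidHom)
      (g := ((BalTensor.lTensor R M g.hom.hom) ∘ₗ
        (BalTensor.lTensor R M f.hom.hom)).toAddMonoidHom) (fun m n => rfl)) z

section Perfect

attribute [local instance] HasDerivedCategory.standard

variable (A : Type u) [Category.{v} A] [Abelian A]

/-- The complexes in the derived category isomorphic to bounded complexes of projective objects. -/
def perfectComplexes : ObjectProperty (DerivedCategory A) := fun X =>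
  ∃ (K : CochainComplex A ℤ) (a b : ℤ) (_ : K.IsStrictlyGE a) (_ : K.IsStrictlyLE b)
    (_ : ∀ n, Projective (K.X n)), Nonempty (X ≅ DerivedCategory.Q.obj K)

open Pretriangulated DerivedCategory

instance : (perfectComplexes A).IsClosedUnderIsomorphisms where
  of_iso := by
    rintro X Y e ⟨K, a, b, h₁, h₂, h₃, ⟨e'⟩⟩
    exact ⟨K, a, b, h₁, h₂, h₃, ⟨e.symm ≪≫ e'⟩⟩

instance : (perfectComplexes A).ContainsZero where
  exists_zero := by
    obtain ⟨Z, hZ⟩ : ∃ Z : CochainComplex A ℤ, IsZero Z := HasZeroObject.zero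
    have hX : ∀ n, IsZero (Z.X n) := fun n =>
      Functor.map_isZero (HomologicalComplex.eval A (.up ℤ) n) hZ
    refine ⟨Q.obj Z, Functor.map_isZero _ hZ, Z, 0, 0, ?_, ?_, fun n => (hX n).projective,
      ⟨Iso.refl _⟩⟩
    · rw [CochainComplex.isStrictlyGE_iff]; exact fun i _ => hX i
    · rw [CochainComplex.isStrictlyLE_iff]; exact fun i _ => hX i

instance : (perfectComplexes A).IsStableUnderShift ℤ where
  isStableUnderShiftBy n :=
    { le_shift := by
        rintro X ⟨K, a, b, h₁, h₂, h₃, ⟨e⟩⟩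
        refine ⟨K⟦n⟧, a - n, b - n, K.isStrictlyGE_shift a n (a - n) (by lia),
          K.isStrictlyLE_shift b n (b - n) (by lia), fun i => h₃ (i + n), ⟨?_⟩⟩
        exact (shiftFunctor _ n).mapIso e ≪≫ (Q.commShiftIso n).symm.app K }

instance : (perfectComplexes A).IsTriangulatedClosed₃ where
  ext₃' T hT := by
    rintro ⟨K, a, b, h₁, h₂, h₃, ⟨e⟩⟩ ⟨L, a', b', h₁', h₂', h₃', ⟨e'⟩⟩
    have : K.IsKProjective := CochainComplex.isKProjective_of_projective K b
    let eK : T.obj₁ ≅ Qh.obj ((HomotopyCategory.quotient A (.up ℤ)).obj K) :=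
      e ≪≫ ((quotientCompQhIso A).app K).symm
    let eL : T.obj₂ ≅ Qh.obj ((HomotopyCategory.quotient A (.up ℤ)).obj L) :=
      e' ≪≫ ((quotientCompQhIso A).app L).symm
    obtain ⟨f', hf'⟩ := (CochainComplex.IsKProjective.Qh_map_bijective K
      ((HomotopyCategory.quotient A (.up ℤ)).obj L)).surjective (eK.inv ≫ T.mor₁ ≫ eL.hom)
    obtain ⟨f, rfl⟩ := (HomotopyCategory.quotient _ _).map_surjective f'
    refine ⟨Qh.obj ((HomotopyCategory.quotient A (.up ℤ)).obj (CochainComplex.mappingCone f)),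
      ⟨CochainComplex.mappingCone f, min (a - 1) a', max b b', ?_, ?_, fun n => ?_,
        ⟨(quotientCompQhIso A).app _⟩⟩,
      ⟨Triangle.π₃.mapIso (isoTriangleOfIso₁₂ T _ hT
        (Qh.map_distinguished _ (HomotopyCategory.mappingCone_triangleh_distinguished f))
        eK eL ?_)⟩⟩
    · exact CochainComplex.isStrictlyGE_mappingCone f a a' _ (by lia) (by lia)
    · rw [CochainComplex.isStrictlyLE_iff]
      intro i hi
      rw [CochainComplex.mappingCone.isZero_X_iff]
      exact ⟨K.isZero_of_isStrictlyLE b _ (by lia), L.isZero_of_isStrictlyLE b' _ (by lia)⟩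
    · have := h₃ (n + 1)
      have := h₃' n
      exact Projective.of_iso (HomologicalComplex.homotopyCofiber.XIsoBiprod f n (n + 1) rfl).symm
        inferInstance
    · have h : T.mor₁ ≫ eL.hom =
          eK.hom ≫ Qh.map ((HomotopyCategory.quotient A (.up ℤ)).map f) := by
        rw [hf', Iso.hom_inv_id_assoc]
      exact h

instance : (perfectComplexes A).IsTriangulated where
  toIsTriangulatedClosed₂ := .of_isTriangulatedClosed₃

/-- The subcategory `K^b(proj A)` of the bounded derived category `D^b(A)`: the objects isomorphic
to bounded complexes of projective objects. -/
abbrev boundedPerfect : ObjectProperty (DerivedCategory.Bounded A) :=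
  (perfectComplexes A).inverseImage DerivedCategory.Bounded.ι

/-- The singularity category of an abelian category `A`: the Verdier quotient
`D^b(A) / K^b(proj A)`. -/
abbrev AbelianSingularityCategory : Type _ := (boundedPerfect A).trW.Localization

end Perfect

/-- The singularity category `D^b(R-mod) / K^b(R-proj)` of a left noetherian ring `R`. -/
abbrev SingularityCategory (R : Type u) [Ring R] [IsNoetherianRing R] : Type _ :=
  AbelianSingularityCategory (FPMod R)

end SingularityCategory

/-! The link between the bimodule and homological algebra is the relative bar sequence `0 ⟶ Ω ⊗_Λ X
⟶ Λ ⊗_E X ⟶ X ⟶ 0`. Its middle term is projective since all `E`-modules are, and `Λ ⊗_E -` turns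
monomorphisms into split ones. So tensoring with the bimodule is an exact functorial syzygy `Ω`
(`OmegaNC.syzygyData`, `OmegaNC.syzygyData_isExact`). The category `L_0`-mod and the singularity
category are then both compared with the stabilization of `Ω`: functors `q n` with `q (n + 1) ∘ Ω ≅
q n` induce a functor out of it (`LevelFunctors.lift`).

Leavitt side. The Casimir relation gives `1 ∈ L_k L_{-k}` for `k ≥ 0`. In the opposite direction,
the products `M^k (M^*)^k` lie in the image of the base ring and form a descending chain of left
ideals, which stabilizes because the base ring is left artinian; this yields `1 ∈ L_{-1} L_1`
(`LeavittRing.one_le_comp_neg_one_mul_comp_one`) and hence the strong grading. So each `L_n` is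
finitely generated projective over `L_0`, multiplication identifies `L_{n+1} ⊗ M` with `L_n`
(`LeavittRing.Part.contract_bijective`), and `q n = L_n ⊗_Λ -` are level functors. Two facts control
them. A right action of `L` on germs of sequences of tensors shows that a morphism killed by `q n`
is killed by a power of `Ω` (`LeavittRing.exists_iter_eq_zero`). And every element of `L_n ⊗ X`,
multiplied by a high power of `M`, takes the form `1 ⊗ w` with `w` in some `Ω^b X`
(`LeavittRing.exists_act_eq_sig`). Exactness of the `q n`, faithfulness and fullness follow;
essential surjectivity follows since finitely presented `L_0`-modules are cokernels of maps of free
modules. Hence the stabilization is equivalent to `L_0`-mod, and kernels in the latter are computed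
over `Λ`, so they are finitely presented.

Frobenius and FC properties. An extension problem against a projective becomes solvable after
applying `Ω` once, because monomorphisms split under `Λ ⊗_E -`; as `Ω` is invertible on the
stabilization, images of projectives are injective there (`AbelianModel.injective_obj`). The left
and the right halves of the FC property are both deduced from left modules, through statements on
matrices (`IsFCRing.of_embedding`).

Triangulated side. In the bounded derived category the connecting morphism `X⟦n⟧ ⟶ (Ω X)⟦n + 1⟧` has
a shifted projective as its third vertex, so it is inverted in the Verdier quotient, and `q n X =
X⟦n⟧` are level functors too. Since perfect complexes have no morphisms to modules placed in
sufficiently negative degrees, the functor from the stabilization to the quotient is full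
(`DeltaEmbedding.lift_full`) and identifies only morphisms which differ, after a power of `Ω`, by
one through a projective. It is essentially surjective because modules generate the bounded derived
category. Connecting morphisms are transported to `L_0`-mod; a sign `(-1)^n` compensates for their
anticommutation with syzygies (`DeltaEmbedding.δl_comp_ε`). The resulting functor kills exactly the
morphisms through projectives and sends short exact sequences to triangles, so it induces the
triangle equivalence (`StableDeltaFunctor.triangleEquivalence`). -/

/-! ### Functors out of a stabilization -/

section StabilizationLift

variable {C : Type u} [Category.{v} C]

/-- A family of functors `q n : C ⥤ B` indexed by the integers with isomorphisms
`q (n + 1) (Ω X) ≅ q n X`. -/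
structure LevelFunctors (Ω : C ⥤ C) (B : Type*) [Category* B] where
  /-- the functor at level `n` -/
  q : ℤ → C ⥤ B
  /-- the comparison of two consecutive levels -/
  τ (n p : ℤ) (h : n + 1 = p) : Ω ⋙ q p ≅ q n

namespace LevelFunctors

variable {Ω : C ⥤ C} {B : Type*} [Category* B] (S : LevelFunctors Ω B)

/-- The isomorphism `q (n + a) (Ω^a X) ≅ q n X`. -/
def σ (X : C) (n : ℤ) : (a : ℕ) → (p : ℤ) → n + a = p →
    ((S.q p).obj (iterObj Ω X a) ≅ (S.q n).obj X)
  | 0, p, h => eqToIso (by obtain rfl : n = p := by simpa using h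
                           rfl)
  | a + 1, p, h => (S.τ (n + a) p (by rw [← h]; push_cast; ring)).app (iterObj Ω X a) ≪≫
      σ X n a (n + a) rfl

theorem σ_succ (X : C) (n p p' : ℤ) (a : ℕ) (h : n + a = p) (h' : p + 1 = p')
    (h'' : n + (a + 1 : ℕ) = p') :
    S.σ X n (a + 1) p' h'' = (S.τ p p' h').app (iterObj Ω X a) ≪≫ S.σ X n a p h := by
  subst h
  rfl

theorem conj_eq_conj {P P' A Q Q' A' : B} (σ : P ≅ A) (τ : P' ≅ P) (σ' : Q ≅ A') (τ' : Q' ≅ Q)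
    (g : P ⟶ Q) (g' : P' ⟶ Q') (h : g' ≫ τ'.hom = τ.hom ≫ g) :
    (τ ≪≫ σ).inv ≫ g' ≫ (τ' ≪≫ σ').hom = σ.inv ≫ g ≫ σ'.hom := by
  simp [reassoc_of% h]

/-- The morphism `q n X ⟶ q m Y` induced by `f : Ω^a X ⟶ Ω^b Y` at level `p = n + a = m + b`. -/
def lev {X Y : C} {a b : ℕ} (f : iterObj Ω X a ⟶ iterObj Ω Y b) (n m p : ℤ) (h : n + a = p)
    (h' : m + b = p) : (S.q n).obj X ⟶ (S.q m).obj Y :=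
  (S.σ X n a p h).inv ≫ (S.q p).map f ≫ (S.σ Y m b p h').hom

/-- Passing from level `p` to `p + 1` conjugates by `τ` on both sides, and naturality of `τ` cancels
the two. This is compatibility with the relation generating the colimit, so `liftMap` is well
defined. -/
theorem lev_step {X Y : C} {a b : ℕ} (f : iterObj Ω X a ⟶ iterObj Ω Y b) (n m p p' : ℤ)
    (h : n + a = p) (h' : m + b = p) (hp : p + 1 = p') (k : n + (a + 1 : ℕ) = p')
    (k' : m + (b + 1 : ℕ) = p') :
    S.lev (a := a + 1) (b := b + 1) (Ω.map f) n m p' k k' = S.lev f n m p h h' := by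
  unfold lev
  rw [S.σ_succ X n p p' a h hp, S.σ_succ Y m p p' b h' hp]
  exact conj_eq_conj _ _ _ _ _ _ ((S.τ p p' hp).hom.naturality f)

theorem lev_comp {X Y Z : C} {a b c : ℕ} (f : iterObj Ω X a ⟶ iterObj Ω Y b)
    (g : iterObj Ω Y b ⟶ iterObj Ω Z c) (n m l p : ℤ)
    (h : n + a = p) (h' : m + b = p) (h'' : l + c = p) :
    S.lev f n m p h h' ≫ S.lev g m l p h' h'' = S.lev (f ≫ g) n l p h h'' := by
  simp [lev]

theorem lev_id {X : C} (a : ℕ) (n p : ℤ) (h : n + a = p) :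
    S.lev (𝟙 (iterObj Ω X a)) n n p h h = 𝟙 _ := by
  simp [lev]

/-- The action on morphisms of the functor out of the stabilization. -/
def liftMap {X Y : Stabilization Ω} : Stabilization.Hom X Y →
    ((S.q X.deg).obj X.obj ⟶ (S.q Y.deg).obj Y.obj) :=
  Quot.lift (fun r => S.lev r.f X.deg Y.deg (X.deg + r.a) rfl r.eq.symm) (by
    rintro r _ rfl
    exact (S.lev_step r.f _ _ _ _ rfl r.eq.symm (by simp [Stabilization.Rep.step]; ring) _ _).symm)

theorem liftMap_cls {X Y : Stabilization Ω} {a b : ℕ} (h : X.deg + a = Y.deg + b)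
    (f : iterObj Ω X.obj a ⟶ iterObj Ω Y.obj b) (p : ℤ) (h₁ : X.deg + a = p)
    (h₂ : Y.deg + b = p) :
    S.liftMap (Stabilization.Rep.mk a b h f).cls = S.lev f X.deg Y.deg p h₁ h₂ := by
  subst h₁
  rfl

/-- The functor out of the stabilization given by `q` and `τ`. -/
def lift : Stabilization Ω ⥤ B where
  obj X := (S.q X.deg).obj X.obj
  map f := S.liftMap f
  map_id X := by
    refine (S.liftMap_cls (X := X) (Y := X) rfl (𝟙 _) X.deg (by simp) (by simp)).trans ?_
    exact S.lev_id 0 X.deg X.deg (by simp)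
  map_comp {X Y Z} f g := by
    obtain ⟨p₁, h₁⟩ := Stabilization.exists_rep f
    obtain ⟨p₂, h₂⟩ := Stabilization.exists_rep g
    obtain ⟨a, b, ha, hb, e₁, f, rfl⟩ := h₁ (max p₁ p₂) (by omega)
    obtain ⟨b', c, hb', hc, e₂, g, rfl⟩ := h₂ (max p₁ p₂) (by omega)
    obtain rfl : b = b' := by omega
    have := Stabilization.comp_cls e₁ e₂ f g
    refine (congrArg S.liftMap this).trans ?_
    rw [S.liftMap_cls _ _ _ ha hb, S.liftMap_cls _ _ _ hb hc, S.liftMap_cls _ _ _ ha hc,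
      S.lev_comp]

theorem lift_map_cls {X Y : Stabilization Ω} {a b : ℕ} (h : X.deg + a = Y.deg + b)
    (f : iterObj Ω X.obj a ⟶ iterObj Ω Y.obj b) (p : ℤ) (h₁ : X.deg + a = p)
    (h₂ : Y.deg + b = p) :
    S.lift.map (show X ⟶ Y from (Stabilization.Rep.mk a b h f).cls) =
      S.lev f X.deg Y.deg p h₁ h₂ :=
  S.liftMap_cls h f p h₁ h₂

end LevelFunctors

namespace Stabilization

/-- The morphism `(X, n) ⟶ (Y, n)` given by a morphism `X ⟶ Y`. -/
def incMap {Ω : C ⥤ C} (n : ℤ) {X Y : C} (f : X ⟶ Y) : (⟨X, n⟩ : Stabilization Ω) ⟶ ⟨Y, n⟩ :=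
  (Rep.mk (X := ⟨X, n⟩) (Y := ⟨Y, n⟩) 0 0 rfl f).cls

/-- The functor `X ↦ (X, n)`. -/
abbrev inc (Ω : C ⥤ C) (n : ℤ) : C ⥤ Stabilization Ω where
  obj X := ⟨X, n⟩
  map f := incMap n f
  map_id _ := rfl
  map_comp {X Y Z} f g := (comp_cls (X := ⟨X, n⟩) (Y := ⟨Y, n⟩) (Z := ⟨Z, n⟩) (a := 0) (b := 0)
    (c := 0) rfl rfl f g).symm

variable {Ω : C ⥤ C}

/-- The isomorphism `(Ω^a X, p) ≅ (X, n)` for `p = n + a`. -/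
def shiftIso (X : C) (n : ℤ) (a : ℕ) (p : ℤ) (h : n + a = p) :
    (⟨iterObj Ω X a, p⟩ : Stabilization Ω) ≅ ⟨X, n⟩ where
  hom := (Rep.mk (X := ⟨iterObj Ω X a, p⟩) (Y := ⟨X, n⟩) 0 a (by simp [h]) (𝟙 (iterObj Ω X a))).cls
  inv := (Rep.mk (Y := ⟨iterObj Ω X a, p⟩) (X := ⟨X, n⟩) a 0 (by simp [h]) (𝟙 (iterObj Ω X a))).cls
  hom_inv_id := by
    refine (comp_cls (X := ⟨iterObj Ω X a, p⟩) (Y := ⟨X, n⟩) (Z := ⟨iterObj Ω X a, p⟩)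
      (a := 0) (b := a) (c := 0) (by simp [h]) (by simp [h]) _ _).trans ?_
    exact congrArg (fun g => (Rep.mk (X := ⟨iterObj Ω X a, p⟩) (Y := ⟨iterObj Ω X a, p⟩) 0 0 rfl
      g).cls) (Category.id_comp (𝟙 (iterObj Ω X a)))
  inv_hom_id := by
    refine (comp_cls (Y := ⟨iterObj Ω X a, p⟩) (X := ⟨X, n⟩) (Z := ⟨X, n⟩)
      (a := a) (b := 0) (c := a) (by simp [h]) (by simp [h]) _ _).trans ?_
    exact (congrArg (fun g => (Rep.mk (X := ⟨X, n⟩) (Y := ⟨X, n⟩) a a rfl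
      g).cls) (Category.id_comp (𝟙 (iterObj Ω X a)))).trans
      (id_eq (⟨X, n⟩ : Stabilization Ω) a).symm

/-- A normal form for morphisms: an honest morphism at level `p` between two canonical isomorphisms.
Later arguments apply functors to this composite instead of handling representatives. -/
theorem cls_eq {X Y : C} {n m : ℤ} {a b : ℕ} (f : iterObj Ω X a ⟶ iterObj Ω Y b)
    (p : ℤ) (h₁ : n + a = p) (h₂ : m + b = p) (h : n + a = m + b) :
    (show (⟨X, n⟩ : Stabilization Ω) ⟶ ⟨Y, m⟩ from
      (Rep.mk (X := ⟨X, n⟩) (Y := ⟨Y, m⟩) a b h f).cls) =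
      (shiftIso X n a p h₁).inv ≫ incMap p f ≫ (shiftIso Y m b p h₂).hom := by
  symm
  refine (congrArg ((shiftIso X n a p h₁).inv ≫ ·) (comp_cls (X := ⟨iterObj Ω X a, p⟩)
    (Y := ⟨iterObj Ω Y b, p⟩) (Z := ⟨Y, m⟩) (a := 0) (b := 0) (c := b) rfl
    (by simp [h₂]) f (𝟙 _))).trans ?_
  refine (comp_cls (X := ⟨X, n⟩) (Y := ⟨iterObj Ω X a, p⟩) (Z := ⟨Y, m⟩) (a := a) (b := 0) (c := b)
    (by simp [h₁]) (by simp [h₂]) (𝟙 _) _).trans ?_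
  exact congrArg (fun g => (Rep.mk (X := ⟨X, n⟩) (Y := ⟨Y, m⟩) a b h g).cls)
    ((Category.id_comp (f ≫ 𝟙 (iterObj Ω Y b))).trans (Category.comp_id f))

theorem exists_eq {X Y : Stabilization Ω} (f : X ⟶ Y) :
    ∃ (a b : ℕ) (p : ℤ) (h₁ : X.deg + a = p) (h₂ : Y.deg + b = p)
      (f' : iterObj Ω X.obj a ⟶ iterObj Ω Y.obj b),
      f = (shiftIso X.obj X.deg a p h₁).inv ≫ incMap p f' ≫
        (shiftIso Y.obj Y.deg b p h₂).hom := by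
  obtain ⟨a, b, h, f', rfl⟩ := exists_cls f
  exact ⟨a, b, _, rfl, h.symm, f', cls_eq f' _ rfl h.symm h⟩

/-- The isomorphism `(Ω X, n + 1) ≅ (X, n)`. -/
def stepIso (X : C) (n p : ℤ) (h : n + 1 = p) :
    (⟨Ω.obj X, p⟩ : Stabilization Ω) ≅ ⟨X, n⟩ := shiftIso X n 1 p (by exact_mod_cast h)

theorem shiftIso_zero (X : C) (n : ℤ) (h : n + (0 : ℕ) = n) :
    shiftIso (Ω := Ω) X n 0 n h = Iso.refl _ := by
  ext
  rfl

theorem shiftIso_succ (X : C) (n : ℤ) (a : ℕ) (p p' : ℤ) (h : n + a = p) (h' : p + 1 = p')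
    (h'' : n + (a + 1 : ℕ) = p') :
    shiftIso (Ω := Ω) X n (a + 1) p' h'' =
      stepIso (iterObj Ω X a) p p' h' ≪≫ shiftIso X n a p h := by
  apply Iso.ext
  symm
  have e := cls_step (Rep.mk (X := ⟨iterObj Ω X a, p⟩) (Y := ⟨X, n⟩) 0 a (by simp [h])
    (𝟙 (iterObj Ω X a)))
  refine (congrArg (fun z => (stepIso (iterObj Ω X a) p p' h').hom ≫ z) e.symm).trans ?_
  refine (comp_cls (X := ⟨iterObj Ω X (a + 1), p'⟩) (Y := ⟨iterObj Ω X a, p⟩) (Z := ⟨X, n⟩)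
    (a := 0) (b := 1) (c := a + 1) (by simp [h']) (by simp; omega) (𝟙 _) (Ω.map (𝟙 _))).trans ?_
  exact congrArg (fun g => (Rep.mk (X := ⟨iterObj Ω X (a + 1), p'⟩) (Y := ⟨X, n⟩) 0 (a + 1)
    (by simp; omega) g).cls) ((Category.id_comp _).trans (Ω.map_id (iterObj Ω X a)))

end Stabilization

namespace LevelFunctors

variable {Ω : C ⥤ C} {B : Type*} [Category* B] (S : LevelFunctors Ω B)

theorem lift_map_inc {X Y : C} (n : ℤ) (f : X ⟶ Y) :
    S.lift.map (Stabilization.incMap n f) =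
      show S.lift.obj ⟨X, n⟩ ⟶ S.lift.obj ⟨Y, n⟩ from (S.q n).map f := by
  refine (S.lift_map_cls (X := ⟨X, n⟩) (Y := ⟨Y, n⟩) (a := 0) (b := 0) rfl f n (by simp)
    (by simp)).trans ?_
  exact (Category.id_comp _).trans (Category.comp_id _)

theorem lift_map_stepIso (X : C) (n p : ℤ) (h : n + 1 = p) :
    S.lift.map (Stabilization.stepIso X n p h).hom = (S.τ n p h).hom.app X := by
  refine (S.lift_map_cls (X := ⟨Ω.obj X, p⟩) (Y := ⟨X, n⟩) (a := 0) (b := 1) (by simp [h])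
    (𝟙 (Ω.obj X)) p (by simp) (by exact_mod_cast h)).trans ?_
  unfold lev
  rw [S.σ_succ X n n p 0 (by simp) h]
  refine (Category.id_comp _).trans ((congrArg (· ≫ _) ((S.q p).map_id (Ω.obj X))).trans ?_)
  exact (Category.id_comp _).trans (Category.comp_id _)

end LevelFunctors

end StabilizationLift

/-! ### Functorial syzygies and Verdier quotients -/

section VerdierStabilization

open Pretriangulated

variable {A : Type u} [Category.{v} A] [Abelian A]

/-- A functorial syzygy: an endofunctor `Ω` with natural short exact sequences
`0 ⟶ Ω X ⟶ P X ⟶ X ⟶ 0` in which `P X` is projective. -/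
structure SyzygyData (Ω : A ⥤ A) where
  /-- the functorial projective cover -/
  P : A ⥤ A
  /-- the inclusion -/
  i : Ω ⟶ P
  /-- the projection -/
  p : P ⟶ 𝟭 A
  w (X : A) : i.app X ≫ p.app X = 0
  exact (X : A) : (ShortComplex.mk (i.app X) (p.app X) (w X)).ShortExact
  projective (X : A) : Projective (P.obj X)

namespace SyzygyData

variable {Ω : A ⥤ A} (Y : SyzygyData Ω)

/-- The short complex `Ω X ⟶ P X ⟶ X`. -/
abbrev sc (X : A) : ShortComplex A := ShortComplex.mk (Y.i.app X) (Y.p.app X) (Y.w X)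

/-- The morphism of short complexes induced by `f`. -/
@[simps]
def scMap {X X' : A} (f : X ⟶ X') : Y.sc X ⟶ Y.sc X' where
  τ₁ := Ω.map f
  τ₂ := Y.P.map f
  τ₃ := f
  comm₁₂ := Y.i.naturality f
  comm₂₃ := Y.p.naturality f

end SyzygyData

variable (A) (D : Type*) [Category* D] [Preadditive D] [HasZeroObject D] [HasShift D ℤ]
  [∀ n : ℤ, (shiftFunctor D n).Additive] [Pretriangulated D]

/-- A fully faithful functor from an abelian category to a triangulated category, which sends short
exact sequences naturally to distinguished triangles. -/
structure DeltaEmbedding where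
  /-- the functor -/
  s : A ⥤ D
  additive : s.Additive
  full : s.Full
  faithful : s.Faithful
  /-- the connecting morphism -/
  δ {S : ShortComplex A} (hS : S.ShortExact) : s.obj S.X₃ ⟶ (s.obj S.X₁)⟦(1 : ℤ)⟧
  dist {S : ShortComplex A} (hS : S.ShortExact) :
    Triangle.mk (s.map S.f) (s.map S.g) (δ hS) ∈ distTriang D
  nat {S S' : ShortComplex A} (hS : S.ShortExact) (hS' : S'.ShortExact) (φ : S ⟶ S') :
    s.map φ.τ₃ ≫ δ hS' = δ hS ≫ (s.map φ.τ₁)⟦(1 : ℤ)⟧'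

attribute [instance] DeltaEmbedding.additive DeltaEmbedding.full DeltaEmbedding.faithful

variable {A D}

namespace DeltaEmbedding

variable (F : DeltaEmbedding A D) {Ω : A ⥤ A} (Y : SyzygyData Ω)

/-- The functor `X ↦ s X ⟦n⟧`. -/
abbrev q (n : ℤ) : A ⥤ D := F.s ⋙ shiftFunctor D n

/-- The connecting morphism `s X ⟦n⟧ ⟶ s (Ω X) ⟦n + 1⟧`. -/
def ε (X : A) (n p : ℤ) (h : n + 1 = p) : (F.q n).obj X ⟶ (F.q p).obj (Ω.obj X) :=
  (F.δ (Y.exact X))⟦n⟧' ≫ (shiftFunctorAdd' D 1 n p (by omega)).inv.app (F.s.obj (Ω.obj X))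

theorem ε_naturality {X X' : A} (f : X ⟶ X') (n p : ℤ) (h : n + 1 = p) :
    (F.q n).map f ≫ F.ε Y X' n p h = F.ε Y X n p h ≫ (F.q p).map (Ω.map f) := by
  have h1 := congrArg (fun g => g⟦n⟧') (F.nat (Y.exact X) (Y.exact X') (Y.scMap f))
  have h2 := (shiftFunctorAdd' D 1 n p (by omega)).inv.naturality (F.s.map (Ω.map f))
  simp only [Functor.map_comp, SyzygyData.scMap_τ₁, SyzygyData.scMap_τ₃] at h1
  simp only [Functor.comp_map] at h2
  simp only [ε, Functor.comp_map, Category.assoc]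
  rw [reassoc_of% h1, h2]

/-- A shifted triangle carries the sign `(-1)^n` on its morphisms. Signs are units, so they can be
moved into the factorizing morphism and exactness survives. -/
theorem exists_eq_comp_of_shift {X Y Z : D} {f : X ⟶ Y} {g : Y ⟶ Z} {h : Z ⟶ X⟦(1 : ℤ)⟧}
    (hT : Triangle.mk f g h ∈ distTriang D) (n : ℤ) {W : D}
    (w : Y⟦n⟧ ⟶ W) (hw : f⟦n⟧' ≫ w = 0) : ∃ w' : Z⟦n⟧ ⟶ W, w = g⟦n⟧' ≫ w' := by
  have hT' : Triangle.mk (n.negOnePow • f⟦n⟧') (n.negOnePow • g⟦n⟧')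
      (n.negOnePow • h⟦n⟧' ≫ (shiftFunctorComm D 1 n).hom.app X) ∈ distTriang D :=
    Triangle.shift_distinguished _ hT n
  obtain ⟨w', hw'⟩ := Triangle.yoneda_exact₂ _ hT' w (by
    change (n.negOnePow • f⟦n⟧') ≫ w = 0
    rw [Linear.units_smul_comp, hw, smul_zero])
  refine ⟨n.negOnePow • (show Z⟦n⟧ ⟶ W from w'), hw'.trans ?_⟩
  change (n.negOnePow • g⟦n⟧') ≫ (show Z⟦n⟧ ⟶ W from w') = _
  rw [Linear.units_smul_comp, Linear.comp_units_smul]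

theorem dist_ses {S : ShortComplex A} (hS : S.ShortExact) :
    Triangle.mk (F.s.map S.g) (F.δ hS) (-(F.s.map S.f)⟦(1 : ℤ)⟧') ∈ distTriang D :=
  rot_of_distTriang _ (F.dist hS)

theorem dist_ses' {S : ShortComplex A} (hS : S.ShortExact) :
    Triangle.mk (F.δ hS) (-(F.s.map S.f)⟦(1 : ℤ)⟧') (-(F.s.map S.g)⟦(1 : ℤ)⟧') ∈ distTriang D :=
  rot_of_distTriang _ (F.dist_ses hS)

/-- Rotating the triangle of the syzygy sequence to `P X ⟶ X ⟶ (Ω X)⟦1⟧` shows that the only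
obstruction to factoring through `ε` is the restriction to `P X`. -/
theorem exists_eq_ε_comp (X : A) (n p : ℤ) (h : n + 1 = p) {W : D} (g : (F.q n).obj X ⟶ W)
    (hg : (F.q n).map (Y.p.app X) ≫ g = 0) : ∃ g', g = F.ε Y X n p h ≫ g' := by
  obtain ⟨g', hg'⟩ := exists_eq_comp_of_shift (F.dist_ses (Y.exact X)) n g hg
  refine ⟨(shiftFunctorAdd' D 1 n p (by omega)).hom.app (F.s.obj (Ω.obj X)) ≫ g', ?_⟩
  refine hg'.trans ?_
  rw [ε, Category.assoc, Iso.inv_hom_id_app_assoc]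

theorem exists_eq_i_comp (X : A) (n p : ℤ) (h : n + 1 = p) {W : D}
    (g : (F.q p).obj (Ω.obj X) ⟶ W) (hg : F.ε Y X n p h ≫ g = 0) :
    ∃ g', g = (F.q p).map (Y.i.app X) ≫ g' := by
  obtain ⟨g', hg'⟩ := exists_eq_comp_of_shift (F.dist_ses' (Y.exact X)) n
    ((shiftFunctorAdd' D 1 n p (by omega)).inv.app (F.s.obj (Ω.obj X)) ≫ g)
    ((Category.assoc _ _ _).symm.trans hg)
  -- The second rotation puts a minus sign on the shift of `i`; the sign of the witness cancels it.
  refine ⟨-((shiftFunctorAdd' D 1 n p (by omega)).hom.app (F.s.obj (Y.P.obj X)) ≫ g'), ?_⟩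
  have h2 := (shiftFunctorAdd' D 1 n p (by omega)).hom.naturality (F.s.map (Y.i.app X))
  simp only [Functor.comp_map] at h2
  rw [← cancel_epi ((shiftFunctorAdd' D 1 n p (by omega)).inv.app (F.s.obj (Ω.obj X)))]
  refine hg'.trans ?_
  simp only [Functor.comp_map, Preadditive.comp_neg, reassoc_of% h2,
    Iso.inv_hom_id_app_assoc, Functor.map_neg, Preadditive.neg_comp]

/-- The iterated connecting morphism `s (Ω^a X) ⟦n⟧ ⟶ s (Ω^(a + k) X) ⟦n + k⟧`. -/
def εIter (X : A) (a : ℕ) (n : ℤ) : (k : ℕ) → (p : ℤ) → n + k = p →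
    ((F.q n).obj (iterObj Ω X a) ⟶ (F.q p).obj (iterObj Ω X (a + k)))
  | 0, p, h => eqToHom (by obtain rfl : n = p := by simpa using h
                           rfl)
  | k + 1, p, h => εIter X a n k (n + k) rfl ≫
      F.ε Y (iterObj Ω X (a + k)) (n + k) p (by rw [← h]; push_cast; ring)

theorem εIter_succ (X : A) (a : ℕ) (n : ℤ) (k : ℕ) (p p' : ℤ) (h : n + k = p) (h' : p + 1 = p')
    (h'' : n + (k + 1 : ℕ) = p') :
    F.εIter Y X a n (k + 1) p' h'' =
      F.εIter Y X a n k p h ≫ F.ε Y (iterObj Ω X (a + k)) p p' h' := by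
  subst h
  rfl

theorem comp_square {C : Type*} [Category* C] {X₁ X₂ X₃ Y₁ Y₂ Y₃ : C} {f₁ : X₁ ⟶ Y₁} {f₂ : X₂ ⟶ Y₂}
    {f₃ : X₃ ⟶ Y₃} {g : X₁ ⟶ X₂} {g' : X₂ ⟶ X₃} {h : Y₁ ⟶ Y₂} {h' : Y₂ ⟶ Y₃}
    (H : f₁ ≫ h = g ≫ f₂) (H' : f₂ ≫ h' = g' ≫ f₃) : f₁ ≫ h ≫ h' = (g ≫ g') ≫ f₃ := by
  rw [reassoc_of% H, H', Category.assoc]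

theorem εIter_naturality {X X' : A} {a b : ℕ} (f : iterObj Ω X a ⟶ iterObj Ω X' b) (n : ℤ)
    (k : ℕ) (p : ℤ) (h : n + k = p) :
    (F.q n).map f ≫ F.εIter Y X' b n k p h =
      F.εIter Y X a n k p h ≫ (F.q p).map (Stabilization.raise f k) := by
  induction k generalizing p with
  | zero =>
    obtain rfl : n = p := by simpa using h
    exact (Category.comp_id _).trans (Category.id_comp _).symm
  | succ k ih =>
    rw [F.εIter_succ Y X' b n k (n + k) p rfl (by rw [← h]; push_cast; ring) h,
      F.εIter_succ Y X a n k (n + k) p rfl (by rw [← h]; push_cast; ring) h]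
    exact comp_square (ih (n + k) rfl) (F.ε_naturality Y _ _ _ _)

variable (N : ObjectProperty D)

/-- The conditions on a triangulated subcategory that make the Verdier quotient by it
a stabilization. -/
structure IsPerfect : Prop where
  of_projective (P : A) : Projective P → N (F.s.obj P)
  hom_projective (P V : A) (n p : ℤ) : Projective P → n < p →
    ∀ f : (F.q n).obj P ⟶ (F.q p).obj V, f = 0
  hom_perfect (K : D) : N K → ∃ p₀ : ℤ, ∀ p ≥ p₀, ∀ (V : A) (f : K ⟶ (F.q p).obj V), f = 0

variable {N}

/-- At each step the obstruction is a morphism from a projective at a level strictly below `r` to an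
object at level `r`, which vanishes. The last step starts at level `p - 1`, so `p ≤ r` is enough. -/
theorem exists_eq_εIter_comp (hF : F.IsPerfect N) (X V : A) (n : ℤ) (k : ℕ) (p r : ℤ)
    (h : n + k = p) (hr : p ≤ r)
    (g : (F.q n).obj (iterObj Ω X 0) ⟶ (F.q r).obj V) :
    ∃ g', g = F.εIter Y X 0 n k p h ≫ g' := by
  induction k generalizing p with
  | zero =>
    obtain rfl : n = p := by simpa using h
    exact ⟨g, (Category.id_comp g).symm⟩
  | succ k ih =>
    obtain ⟨g₁, hg₁⟩ := ih (n + k) rfl (by omega)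
    obtain ⟨g₂, hg₂⟩ := F.exists_eq_ε_comp Y (iterObj Ω X (0 + k)) (n + k) p
      (by rw [← h]; push_cast; ring) g₁ (hF.hom_projective _ _ _ _ (Y.projective _) (by omega) _)
    refine ⟨g₂, ?_⟩
    rw [hg₁, hg₂, F.εIter_succ Y X 0 n k (n + k) p rfl (by rw [← h]; push_cast; ring) h]
    exact (Category.assoc _ _ _).symm

/-- Once `ε ≫ g = 0`, the morphism `g` factors through a projective at level `p`, and there are no
nonzero morphisms from it to level `r > p`. Unlike the existence of factorizations, this needs the
strict inequality. -/
theorem eq_zero_of_εIter_comp (hF : F.IsPerfect N) (X V : A) (a : ℕ) (n : ℤ) (k : ℕ) (p r : ℤ)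
    (h : n + k = p)
    (hr : p < r) (g : (F.q p).obj (iterObj Ω X (a + k)) ⟶ (F.q r).obj V)
    (hg : F.εIter Y X a n k p h ≫ g = 0) : g = 0 := by
  induction k generalizing p with
  | zero =>
    obtain rfl : n = p := by simpa using h
    exact (Category.id_comp g).symm.trans hg
  | succ k ih =>
    rw [F.εIter_succ Y X a n k (n + k) p rfl (by rw [← h]; push_cast; ring) h] at hg
    have h1 := ih (n + k) rfl (by omega) (F.ε Y (iterObj Ω X (a + k)) (n + k) p
      (by rw [← h]; push_cast; ring) ≫ g) ((Category.assoc _ _ _).symm.trans hg)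
    obtain ⟨g', hg'⟩ := F.exists_eq_i_comp Y _ _ _ _ g h1
    exact hg'.trans ((congrArg (_ ≫ ·) (hF.hom_projective _ _ _ _ (Y.projective _) hr g')).trans
      comp_zero)

variable [IsTriangulated D] [N.IsTriangulated] (hF : F.IsPerfect N)

include hF in
-- The third vertex of the triangle on the connecting morphism is `s (P X)`, which lies in `N`
-- because `P X` is projective.
theorem trW_ε (X : A) (n p : ℤ) (h : n + 1 = p) : N.trW (F.ε Y X n p h) := by
  have h1 : N.trW (F.δ (Y.exact X)) := by
    rw [ObjectProperty.trW_iff']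
    exact ⟨_, _, _, F.dist_ses (Y.exact X), hF.of_projective _ (Y.projective X)⟩
  exact MorphismProperty.RespectsIso.postcomp _ _ _ (h1.shift n)

/-- The level functors with values in the Verdier quotient. -/
noncomputable def levels : LevelFunctors Ω N.trW.Localization where
  q n := F.q n ⋙ N.trW.Q
  τ n p h := (NatIso.ofComponents (F := F.q n ⋙ N.trW.Q) (G := Ω ⋙ F.q p ⋙ N.trW.Q)
    (fun X => Localization.isoOfHom N.trW.Q N.trW (F.ε Y X n p h) (F.trW_ε Y hF X n p h))
    (fun f => (N.trW.Q.map_comp _ _).symm.trans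
      ((congrArg N.trW.Q.map (F.ε_naturality Y f n p h)).trans (N.trW.Q.map_comp _ _)))).symm

/-- In the quotient, the inverse of the comparison `Ω^(a + k) X` at level `p + k` with `X` at level
`n` is represented by actual morphisms of `D`, the iterated connecting morphisms. This makes
fractions computable. -/
theorem σ_inv_add (X : A) (n : ℤ) (a k : ℕ) (p p' : ℤ) (h : n + a = p) (h' : p + k = p')
    (h'' : n + (a + k : ℕ) = p') :
    ((F.levels Y hF).σ X n (a + k) p' h'').inv =
      ((F.levels Y hF).σ X n a p h).inv ≫ N.trW.Q.map (F.εIter Y X a p k p' h') := by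
  induction k generalizing p' with
  | zero =>
    obtain rfl : p = p' := by simpa using h'
    refine (Category.comp_id _).symm.trans ?_
    exact congrArg (_ ≫ ·) (N.trW.Q.map_id _).symm
  | succ k ih =>
    have h1 : N.trW.Q.map (F.εIter Y X a p (k + 1) p' h') =
        N.trW.Q.map (F.εIter Y X a p k (p + k) rfl) ≫ N.trW.Q.map (F.ε Y (iterObj Ω X (a + k))
          (p + k) p' (by rw [← h']; push_cast; ring)) :=
      (congrArg N.trW.Q.map (F.εIter_succ Y X a p k (p + k) p' rfl
        (by rw [← h']; push_cast; ring) h')).trans (N.trW.Q.map_comp _ _)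
    have h2 := (F.levels Y hF).σ_succ X n (p + k) p' (a + k) (by rw [← h]; push_cast; ring)
      (by rw [← h']; push_cast; ring) h''
    refine (congrArg Iso.inv h2).trans (Eq.trans ?_ (congrArg (_ ≫ ·) h1).symm)
    refine (congrArg (· ≫ _) (ih (p + k) rfl (by rw [← h]; push_cast; ring))).trans ?_
    exact Category.assoc _ _ _

theorem inv_comp_comp_hom {C : Type*} [Category* C] {X X' V V' : C} (σ : X' ≅ X) (τ : V' ≅ V)
    {f : X' ⟶ V'} {g : X ⟶ V} (h : σ.inv ≫ f = g ≫ τ.inv) : σ.inv ≫ f ≫ τ.hom = g := by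
  rw [reassoc_of% h, Iso.inv_hom_id, Category.comp_id]

/-- For a left fraction `X⟦n⟧ ⟶ Y' ⟵ V⟦m⟧`, a sufficiently long iterated connecting morphism out of
`V⟦m⟧` extends over the denominator. The composite into `(Ω^b V)⟦m + b⟧` lives in `D` and in turn
factors through the iterated connecting morphism of `X`, leaving a morphism of `A`. -/
theorem lift_full : (F.levels Y hF).lift.Full where
  map_surjective := by
    rintro ⟨X, n⟩ ⟨V, m⟩ g
    change N.trW.Q.obj ((F.q n).obj X) ⟶ N.trW.Q.obj ((F.q m).obj V) at g
    obtain ⟨φ, hφ⟩ := Localization.exists_leftFraction N.trW.Q N.trW g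
    obtain ⟨K, k, k', hT, hK⟩ := (N.trW_iff' φ.s).1 φ.hs
    obtain ⟨p₀, hp₀⟩ := hF.hom_perfect K hK
    -- The level `m + b` must be high enough for morphisms from `K` to vanish, and at least `n` so
    -- that the exponent `a` of `X` is a natural number.
    obtain ⟨b, hb⟩ : ∃ b : ℕ, p₀ ≤ m + b ∧ n ≤ m + b := ⟨(max (p₀ - m) (n - m)).toNat, by omega⟩
    obtain ⟨a, ha⟩ : ∃ a : ℕ, n + a = m + b := ⟨(m + b - n).toNat, by omega⟩
    -- The restriction to the perfect object `K` vanishes, so the iterated connecting morphism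
    -- factors through the denominator `φ.s`.
    obtain ⟨e, he⟩ : ∃ e : φ.Y' ⟶ _, F.εIter Y V 0 m b (m + b) rfl = φ.s ≫ e :=
      Triangle.yoneda_exact₂ _ hT _ (hp₀ _ hb.1 _ _)
    obtain ⟨h, hh⟩ := F.exists_eq_εIter_comp Y hF X (iterObj Ω V (0 + b)) n a (m + b) (m + b) ha
      le_rfl (φ.f ≫ e)
    obtain ⟨f, rfl⟩ := (F.q (m + b)).map_surjective h
    refine ⟨(Stabilization.Rep.mk (X := ⟨X, n⟩) (Y := ⟨V, m⟩) (0 + a) (0 + b) (by simp [ha]) f).cls,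
      ?_⟩
    refine ((F.levels Y hF).lift_map_cls (X := ⟨X, n⟩) (Y := ⟨V, m⟩) _ f (m + b) (by simp [ha])
      (by simp)).trans ?_
    have h1 := F.σ_inv_add Y hF X n 0 a n (m + b) (by simp) ha (by simp [ha])
    have h2 := F.σ_inv_add Y hF V m 0 b m (m + b) (by simp) rfl (by simp)
    refine inv_comp_comp_hom _ _ ?_
    refine (congrArg (· ≫ _) (h1.trans (Category.id_comp _))).trans ?_
    refine Eq.trans ?_ (congrArg (g ≫ ·) (h2.trans (Category.id_comp _))).symm
    refine (N.trW.Q.map_comp _ _).symm.trans ((congrArg N.trW.Q.map hh.symm).trans ?_)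
    refine (N.trW.Q.map_comp _ _).trans (Eq.trans ?_ (congrArg (g ≫ N.trW.Q.map ·) he).symm)
    refine Eq.trans ?_ (congrArg (g ≫ ·) (N.trW.Q.map_comp _ _)).symm
    rw [hφ, MorphismProperty.LeftFraction.map_comp_map_s_assoc]
    rfl

include Y hF in
/-- Two morphisms with the same image in the Verdier quotient agree, after applying a power of `Ω`,
up to a morphism which factors through a projective object. -/
theorem exists_factorization_of_map_eq {X V : A} {a b : ℕ} (f g : iterObj Ω X a ⟶ iterObj Ω V b)
    (p : ℤ) (h : N.trW.Q.map ((F.q p).map f) = N.trW.Q.map ((F.q p).map g)) :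
    ∃ (k : ℕ) (P : A) (_ : Projective P) (r : iterObj Ω X (a + k) ⟶ P)
      (t : P ⟶ iterObj Ω V (b + k)),
      Stabilization.raise f k - Stabilization.raise g k = r ≫ t := by
  obtain ⟨Z, s, hs, hfg⟩ := (MorphismProperty.map_eq_iff_postcomp N.trW.Q N.trW _ _).1 h
  obtain ⟨K, k, k', hT, hK⟩ := (N.trW_iff' s).1 hs
  obtain ⟨p₀, hp₀⟩ := hF.hom_perfect K hK
  obtain ⟨c, hc⟩ : ∃ c : ℕ, p₀ ≤ p + (c + 1 : ℕ) := ⟨(p₀ - p).toNat, by push_cast; omega⟩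
  obtain ⟨e, he⟩ : ∃ e : Z ⟶ _, F.εIter Y V b p (c + 1) (p + (c + 1 : ℕ)) rfl = s ≫ e :=
    Triangle.yoneda_exact₂ _ hT _ (hp₀ _ hc _ _)
  have h1 : F.εIter Y X a p (c + 1) (p + (c + 1 : ℕ)) rfl ≫ (F.q (p + (c + 1 : ℕ))).map
      (Stabilization.raise f (c + 1) - Stabilization.raise g (c + 1)) = 0 := by
    refine (congrArg (_ ≫ ·) ((F.q _).map_sub)).trans ((Preadditive.comp_sub _ _ _).trans
      (sub_eq_zero.2 ?_))
    refine (F.εIter_naturality Y f p _ _ rfl).symm.trans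
      (Eq.trans ?_ (F.εIter_naturality Y g p _ _ rfl))
    rw [he]
    refine (Category.assoc _ _ _).symm.trans (Eq.trans ?_ (Category.assoc _ _ _))
    exact congrArg (· ≫ e) hfg
  -- Only `c` of the `c + 1` connecting morphisms can be cancelled, since cancellation needs a
  -- target strictly above the source. The remaining one shows that the difference factors through
  -- `Ω ⟶ P`, which is the projective object sought.
  rw [F.εIter_succ Y X a p c (p + c) _ rfl (by push_cast; ring)] at h1
  obtain ⟨g', hg'⟩ := F.exists_eq_i_comp Y _ _ _ _ _ (F.eq_zero_of_εIter_comp Y hF X _ a p c (p + c)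
    (p + (c + 1 : ℕ)) rfl (by push_cast; omega) _ ((Category.assoc _ _ _).symm.trans h1))
  obtain ⟨t, rfl⟩ := (F.q _).map_surjective g'
  refine ⟨c + 1, _, Y.projective _, Y.i.app (iterObj Ω X (a + c)), t, ?_⟩
  exact (F.q _).map_injective (hg'.trans ((F.q _).map_comp _ _).symm)

end DeltaEmbedding

end VerdierStabilization

/-! ### Connecting morphisms at all levels -/

section ConnectingMorphisms

open Pretriangulated

variable {A : Type u} [Category.{v} A] [Abelian A] {D : Type*} [Category* D] [Preadditive D]
  [HasZeroObject D] [HasShift D ℤ] [∀ n : ℤ, (shiftFunctor D n).Additive] [Pretriangulated D]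

/-- The endofunctor `Ω` and the functorial projective cover of a syzygy are exact. -/
structure SyzygyData.IsExact {Ω : A ⥤ A} [Ω.PreservesZeroMorphisms] (Y : SyzygyData Ω) : Prop where
  map_shortExact {S : ShortComplex A} : S.ShortExact → (S.map Ω).ShortExact
  map_P {S : ShortComplex A} : S.ShortExact → Y.P.map S.f ≫ Y.P.map S.g = 0
  mono_P {S : ShortComplex A} : S.ShortExact → Mono (Y.P.map S.f)
  exact_P {S : ShortComplex A} : S.ShortExact → ∀ {T : A} (a : T ⟶ Y.P.obj S.X₂),
    a ≫ Y.P.map S.g = 0 → ∃ b : T ⟶ Y.P.obj S.X₁, b ≫ Y.P.map S.f = a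

namespace DeltaEmbedding

variable (F : DeltaEmbedding A D)

/-- The connecting morphism of the triangle at level `n`. -/
noncomputable def δl {S : ShortComplex A} (hS : S.ShortExact) (n : ℤ) :
    (F.q n).obj S.X₃ ⟶ ((F.q n).obj S.X₁)⟦(1 : ℤ)⟧ :=
  n.negOnePow • ((F.δ hS)⟦n⟧' ≫ (shiftFunctorComm D 1 n).hom.app (F.s.obj S.X₁))

theorem δl_nat {S S' : ShortComplex A} (hS : S.ShortExact) (hS' : S'.ShortExact) (φ : S ⟶ S')
    (n : ℤ) : (F.q n).map φ.τ₃ ≫ F.δl hS' n = F.δl hS n ≫ ((F.q n).map φ.τ₁)⟦(1 : ℤ)⟧' := by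
  have h1 := congrArg (fun g => g⟦n⟧') (F.nat hS hS' φ)
  have h2 := (shiftFunctorComm D 1 n).hom.naturality (F.s.map φ.τ₁)
  simp only [Functor.map_comp] at h1
  simp only [Functor.comp_map] at h2
  simp only [δl, Functor.comp_map, Linear.comp_units_smul, Linear.units_smul_comp, Category.assoc]
  rw [reassoc_of% h1, h2]

/-- An automorphism `e • 𝟙` of the middle vertex absorbs the signs of the first two morphisms. The
sign on the third morphism of a shifted triangle cannot be removed together with them, and is
therefore part of `δl`. -/
theorem unsigned_distinguished {X Y Z : D} {f : X ⟶ Y} {g : Y ⟶ Z} {h : Z ⟶ X⟦(1 : ℤ)⟧}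
    (e : ℤˣ) (hT : Triangle.mk (e • f) (e • g) h ∈ distTriang D) :
    Triangle.mk f g h ∈ distTriang D := by
  let E : Y ≅ Y := ⟨e • 𝟙 Y, e • 𝟙 Y, by
    simp [Linear.comp_units_smul, smul_smul], by simp [Linear.comp_units_smul, smul_smul]⟩
  refine isomorphic_distinguished _ hT _ (Triangle.isoMk _ _ (Iso.refl X) E (Iso.refl Z) ?_ ?_ ?_)
  · change f ≫ (e • 𝟙 Y) = 𝟙 X ≫ (e • f)
    rw [Linear.comp_units_smul, Category.comp_id, Category.id_comp]
  · change g ≫ 𝟙 Z = (e • 𝟙 Y) ≫ (e • g)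
    rw [Linear.comp_units_smul, Linear.units_smul_comp, smul_smul, Int.units_mul_self, one_smul,
      Category.comp_id, Category.id_comp]
  · change h ≫ (𝟙 X)⟦(1 : ℤ)⟧' = 𝟙 Z ≫ h
    rw [CategoryTheory.Functor.map_id, Category.comp_id, Category.id_comp]

theorem δl_dist {S : ShortComplex A} (hS : S.ShortExact) (n : ℤ) :
    Triangle.mk ((F.q n).map S.f) ((F.q n).map S.g) (F.δl hS n) ∈ distTriang D :=
  unsigned_distinguished n.negOnePow (Triangle.shift_distinguished _ (F.dist hS) n)

theorem shiftFunctorAdd'_inv_comm (n p : ℤ) (h : 1 + n = p) (Z : D) :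
    (shiftFunctorAdd' D 1 n p h).inv.app (Z⟦(1 : ℤ)⟧) ≫ (shiftFunctorComm D 1 p).hom.app Z =
      (shiftFunctorComm D 1 n).hom.app (Z⟦(1 : ℤ)⟧) ≫
        ((shiftFunctorAdd' D 1 n p h).inv.app Z)⟦(1 : ℤ)⟧' := by
  have h1 := shiftFunctorAdd'_assoc_hom_app (C := D) 1 n 1 p p (1 + p) h (by omega) (by omega) Z
  rw [shiftFunctorComm_eq D 1 p (1 + p) rfl, shiftFunctorComm_eq D 1 n p h]
  simp only [Iso.trans_hom, Iso.symm_hom, NatTrans.comp_app, Category.assoc]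
  congr 1
  rw [← cancel_epi ((shiftFunctorAdd' D 1 p (1 + p) rfl).hom.app Z), ← reassoc_of% h1,
    Iso.hom_inv_id_app_assoc, ← Functor.map_comp, Iso.hom_inv_id_app,
    CategoryTheory.Functor.map_id]
  exact (Category.comp_id _).symm

end DeltaEmbedding

namespace SyzygyData

variable {Ω : A ⥤ A} [Ω.PreservesZeroMorphisms] (Y : SyzygyData Ω)

theorem exists_lift {X T : A} (a : T ⟶ Y.P.obj X) (ha : a ≫ Y.p.app X = 0) :
    ∃ b : T ⟶ Ω.obj X, b ≫ Y.i.app X = a :=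
  have := (Y.exact X).mono_f
  ⟨(Y.exact X).exact.lift a ha, (Y.exact X).exact.lift_f a ha⟩

variable (S : ShortComplex A)

/-- The kernel of `P X₂ ⟶ X₃`. -/
noncomputable abbrev W : A := kernel (Y.P.map S.g ≫ Y.p.app S.X₃)

/-- The short complex `W ⟶ P X₂ ⟶ X₃`. -/
noncomputable abbrev scW : ShortComplex A :=
  ShortComplex.mk (kernel.ι (Y.P.map S.g ≫ Y.p.app S.X₃)) (Y.P.map S.g ≫ Y.p.app S.X₃)
    (kernel.condition _)

variable {S}

theorem scW_shortExact (hS : S.ShortExact) : (Y.scW S).ShortExact := by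
  have := hS.epi_g
  have := (Y.exact S.X₂).epi_g
  have e : Y.P.map S.g ≫ Y.p.app S.X₃ = Y.p.app S.X₂ ≫ S.g := Y.p.naturality S.g
  have : Epi (Y.P.map S.g ≫ Y.p.app S.X₃) := by
    rw [e]; exact epi_comp' (Y.exact S.X₂).epi_g hS.epi_g
  exact ShortComplex.ShortExact.mk' (ShortComplex.exact_kernel _) inferInstance this

/-- The extension `W ⟶ P X₂ ⟶ X₃` maps to `S` and to the syzygy sequence of `X₃`, both times by the
identity on `X₃`. Hence both connecting morphisms out of `X₃` factor through the one of this
extension. -/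
theorem exists_scW_hom (hS : S.ShortExact) : ∃ (φ : Y.scW S ⟶ S)
    (ψ : Y.scW S ⟶ Y.sc S.X₃),
    φ.τ₂ = Y.p.app S.X₂ ∧ φ.τ₃ = 𝟙 _ ∧ ψ.τ₂ = Y.P.map S.g ∧ ψ.τ₃ = 𝟙 _ := by
  have := hS.mono_f
  have := (Y.exact S.X₃).mono_f
  have e : Y.P.map S.g ≫ Y.p.app S.X₃ = Y.p.app S.X₂ ≫ S.g := Y.p.naturality S.g
  have h1 : (kernel.ι (Y.P.map S.g ≫ Y.p.app S.X₃) ≫ Y.p.app S.X₂) ≫ S.g = 0 := by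
    rw [Category.assoc]; exact (congrArg (_ ≫ ·) e.symm).trans (kernel.condition _)
  have h2 : (kernel.ι (Y.P.map S.g ≫ Y.p.app S.X₃) ≫ Y.P.map S.g) ≫ Y.p.app S.X₃ = 0 := by
    rw [Category.assoc]; exact kernel.condition _
  refine ⟨⟨hS.exact.lift _ h1, Y.p.app S.X₂, 𝟙 _, hS.exact.lift_f _ _,
    e.symm.trans (Category.comp_id _).symm⟩,
    ⟨(Y.exact S.X₃).exact.lift _ h2, Y.P.map S.g, 𝟙 _, (Y.exact S.X₃).exact.lift_f _ _,
    (Category.comp_id _).symm⟩, rfl, rfl, rfl, rfl⟩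

/-- `W` is the sum of `P X₁` and `Ω X₂`, glued along `Ω X₁`. The two projections of `P X₁ ⊕ Ω X₂`
give morphisms to the syzygy sequence of `X₁` and to `Ω S`; since `Ω X₁` is embedded antidiagonally,
they restrict to it as `1` and `-1`. This is the source of the sign in `δ_comp_δ`. -/
theorem exists_scW_cover (hY : Y.IsExact) (hS : S.ShortExact) (φ : Y.scW S ⟶ S)
    (ψ : Y.scW S ⟶ Y.sc S.X₃)
    (hφ : φ.τ₂ = Y.p.app S.X₂) (hψ : ψ.τ₂ = Y.P.map S.g) :
    ∃ (V : A) (f : Ω.obj S.X₁ ⟶ V) (g : V ⟶ Y.W S) (w : f ≫ g = 0)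
      (_ : (ShortComplex.mk f g w).ShortExact) (α : ShortComplex.mk f g w ⟶ Y.sc S.X₁)
      (β : ShortComplex.mk f g w ⟶ S.map Ω), α.τ₁ = 𝟙 (Ω.obj S.X₁) ∧ α.τ₃ = φ.τ₁ ∧
      β.τ₁ = -𝟙 (Ω.obj S.X₁) ∧ β.τ₃ = ψ.τ₁ := by
  have hS' := hY.map_shortExact hS
  have := hS.mono_f
  have := hS'.mono_f
  have : Epi (Ω.map S.g) := hS'.epi_g
  have := hY.mono_P hS
  have m1 := (Y.exact S.X₁).mono_f
  have m2 := (Y.exact S.X₂).mono_f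
  have m3 := (Y.exact S.X₃).mono_f
  have n1 : Ω.map S.f ≫ Y.i.app S.X₂ = Y.i.app S.X₁ ≫ Y.P.map S.f := Y.i.naturality S.f
  have n2 : Ω.map S.g ≫ Y.i.app S.X₃ = Y.i.app S.X₂ ≫ Y.P.map S.g := Y.i.naturality S.g
  have n3 : Y.P.map S.f ≫ Y.p.app S.X₂ = Y.p.app S.X₁ ≫ S.f := Y.p.naturality S.f
  have n4 : Y.P.map S.g ≫ Y.p.app S.X₃ = Y.p.app S.X₂ ≫ S.g := Y.p.naturality S.g
  let j₁ : Y.P.obj S.X₁ ⟶ Y.W S := kernel.lift _ (Y.P.map S.f) (by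
    rw [n4, ← Category.assoc, n3, Category.assoc, S.zero, comp_zero])
  let j₂ : Ω.obj S.X₂ ⟶ Y.W S := kernel.lift _ (Y.i.app S.X₂) (by
    rw [← Category.assoc, ← n2, Category.assoc, Y.w, comp_zero])
  have hj₁ : j₁ ≫ kernel.ι _ = Y.P.map S.f := kernel.lift_ι _ _ _
  have hj₂ : j₂ ≫ kernel.ι _ = Y.i.app S.X₂ := kernel.lift_ι _ _ _
  let V : ShortComplex A := ShortComplex.mk (biprod.lift (Y.i.app S.X₁) (-Ω.map S.f))
    (biprod.desc j₁ j₂) (by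
      rw [← cancel_mono (kernel.ι _), zero_comp, biprod.lift_desc, Preadditive.add_comp,
        Category.assoc, Category.assoc, hj₁, hj₂, Preadditive.neg_comp, n1, add_neg_cancel])
  have hV : V.ShortExact := by
    refine ShortComplex.ShortExact.mk' ?_ ?_ ?_
    · rw [ShortComplex.exact_iff_exact_up_to_refinements]
      intro T x hx
      have hx' : (x ≫ biprod.fst) ≫ Y.P.map S.f + (x ≫ biprod.snd) ≫ Y.i.app S.X₂ = 0 := by
        have h := congrArg (· ≫ kernel.ι _) hx
        have e : x = biprod.lift (x ≫ biprod.fst) (x ≫ biprod.snd) := by ext <;> simp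
        change (x ≫ biprod.desc j₁ j₂) ≫ kernel.ι _ = 0 ≫ kernel.ι _ at h
        rw [zero_comp, Category.assoc, biprod.desc_eq] at h
        simpa [hj₁, hj₂] using h
      have h1 : (x ≫ biprod.snd) ≫ Ω.map S.g = 0 := by
        rw [← cancel_mono (Y.i.app S.X₃), Category.assoc, n2, ← Category.assoc,
          eq_neg_of_add_eq_zero_right hx', Preadditive.neg_comp, Category.assoc,
          hY.map_P hS, comp_zero, neg_zero, zero_comp]
      obtain ⟨c, hc⟩ : ∃ c : T ⟶ Ω.obj S.X₁, c ≫ Ω.map S.f = x ≫ biprod.snd :=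
        ⟨hS'.exact.lift (x ≫ biprod.snd) h1, hS'.exact.lift_f _ h1⟩
      -- The second component of the embedding of `Ω X₁` is `-Ω f`, whence the sign of the preimage.
      refine ⟨T, 𝟙 T, inferInstance, -c, ?_⟩
      rw [Category.id_comp]
      have h2 : x ≫ biprod.fst = -(c ≫ Y.i.app S.X₁) := by
        rw [← cancel_mono (Y.P.map S.f), Preadditive.neg_comp, Category.assoc c, ← n1,
          ← Category.assoc, hc]
        exact eq_neg_of_add_eq_zero_left hx'
      change x = (-c) ≫ biprod.lift _ _
      apply biprod.hom_ext
      · rw [Category.assoc, biprod.lift_fst, h2, Preadditive.neg_comp]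
      · rw [Category.assoc, biprod.lift_snd, Preadditive.neg_comp, Preadditive.comp_neg, neg_neg,
          hc]
    · refine ⟨fun a b hab => ?_⟩
      have h := congrArg (· ≫ biprod.fst) hab
      simpa [V, cancel_mono] using h
    · rw [epi_iff_surjective_up_to_refinements]
      intro T w
      change T ⟶ Y.W S at w
      -- A point of `W` has image in `Ω X₃ ⊆ P X₃`. After a refinement this image lifts to `Ω X₂`,
      -- and subtracting the lift leaves a point of `P X₁`.
      obtain ⟨y, hy⟩ := Y.exists_lift (w ≫ kernel.ι _ ≫ Y.P.map S.g) (by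
        rw [Category.assoc, Category.assoc, kernel.condition, comp_zero])
      obtain ⟨T', π, hπ, z, hz⟩ := surjective_up_to_refinements_of_epi (Ω.map S.g) y
      obtain ⟨t, ht⟩ := hY.exact_P hS (π ≫ w ≫ kernel.ι _ - z ≫ Y.i.app S.X₂) (by
        rw [Preadditive.sub_comp, Category.assoc, Category.assoc, ← hy, Category.assoc, ← n2,
          ← Category.assoc, hz, Category.assoc, sub_self])
      refine ⟨T', π, hπ, biprod.lift t z, ?_⟩
      change π ≫ w = biprod.lift t z ≫ biprod.desc j₁ j₂
      rw [← cancel_mono (kernel.ι _), biprod.lift_desc, Preadditive.add_comp, Category.assoc t,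
        Category.assoc z, hj₁, hj₂, ht, sub_add_cancel, Category.assoc]
  have h1 : j₁ ≫ φ.τ₁ = Y.p.app S.X₁ := by
    rw [← cancel_mono S.f, Category.assoc, φ.comm₁₂, hφ, ← Category.assoc, ← n3]
    exact congrArg (· ≫ _) hj₁
  have h2 : j₂ ≫ φ.τ₁ = 0 := by
    rw [← cancel_mono S.f, Category.assoc, φ.comm₁₂, hφ, ← Category.assoc, zero_comp]
    exact (congrArg (· ≫ _) hj₂).trans (Y.w _)
  have h3 : j₁ ≫ ψ.τ₁ = 0 := by
    rw [← cancel_mono (Y.sc S.X₃).f, Category.assoc, ψ.comm₁₂, hψ, ← Category.assoc, zero_comp]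
    exact (congrArg (· ≫ _) hj₁).trans (hY.map_P hS)
  have h4 : j₂ ≫ ψ.τ₁ = Ω.map S.g := by
    rw [← cancel_mono (Y.sc S.X₃).f, Category.assoc, ψ.comm₁₂, hψ, ← Category.assoc]
    exact (congrArg (· ≫ _) hj₂).trans n2.symm
  refine ⟨_, _, _, V.zero, hV, ⟨𝟙 _, biprod.fst, φ.τ₁, ?_, ?_⟩, ⟨-𝟙 _, biprod.snd, ψ.τ₁, ?_, ?_⟩,
    rfl, rfl, rfl, rfl⟩
  · exact (Category.id_comp _).trans (biprod.lift_fst _ _).symm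
  · change biprod.fst ≫ Y.p.app S.X₁ = biprod.desc j₁ j₂ ≫ φ.τ₁
    ext <;> simp [h1, h2]
  · change (-𝟙 _) ≫ Ω.map S.f = biprod.lift _ _ ≫ biprod.snd
    simp
  · change biprod.snd ≫ Ω.map S.g = biprod.desc j₁ j₂ ≫ ψ.τ₁
    ext <;> simp [h3, h4]

end SyzygyData

namespace DeltaEmbedding

variable (F : DeltaEmbedding A D) {Ω : A ⥤ A} [Ω.PreservesZeroMorphisms] (Y : SyzygyData Ω)
  (hY : Y.IsExact) {S : ShortComplex A} (hS : S.ShortExact)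

/-- The two connecting morphisms of a short exact sequence and of the syzygies anticommute. -/
theorem δ_comp_δ : F.δ hS ≫ (F.δ (Y.exact S.X₁))⟦(1 : ℤ)⟧' =
    -(F.δ (Y.exact S.X₃) ≫ (F.δ (hY.map_shortExact hS))⟦(1 : ℤ)⟧') := by
  obtain ⟨φ, ψ, hφ₂, hφ₃, hψ₂, hψ₃⟩ := Y.exists_scW_hom hS
  obtain ⟨V, f, g, w, hV, α, β, hα₁, hα₃, hβ₁, hβ₃⟩ := Y.exists_scW_cover hY hS φ ψ hφ₂ hψ₂
  have h1 := F.nat (Y.scW_shortExact hS) hS φ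
  have h2 := F.nat (Y.scW_shortExact hS) (Y.exact _) ψ
  have h3 := F.nat hV (Y.exact _) α
  have h4 := F.nat hV (hY.map_shortExact hS) β
  rw [hφ₃] at h1
  rw [hψ₃] at h2
  rw [hα₁, hα₃] at h3
  rw [hβ₁, hβ₃] at h4
  replace h1 : F.δ hS = F.δ (Y.scW_shortExact hS) ≫ (F.s.map φ.τ₁)⟦(1 : ℤ)⟧' :=
    (Category.id_comp _).symm.trans ((congrArg (· ≫ _) (F.s.map_id _).symm).trans h1)
  replace h2 : F.δ (Y.exact S.X₃) = F.δ (Y.scW_shortExact hS) ≫ (F.s.map ψ.τ₁)⟦(1 : ℤ)⟧' :=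
    (Category.id_comp _).symm.trans ((congrArg (· ≫ _) (F.s.map_id _).symm).trans h2)
  replace h3 : F.s.map φ.τ₁ ≫ F.δ (Y.exact S.X₁) = F.δ hV := by
    refine h3.trans ((congrArg (fun z => F.δ hV ≫ z⟦(1 : ℤ)⟧') (F.s.map_id _)).trans ?_)
    exact (congrArg (F.δ hV ≫ ·) ((shiftFunctor D (1 : ℤ)).map_id _)).trans (Category.comp_id _)
  replace h4 : F.s.map ψ.τ₁ ≫ F.δ (hY.map_shortExact hS) = -F.δ hV := by
    refine h4.trans ((congrArg (fun z => F.δ hV ≫ z⟦(1 : ℤ)⟧')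
      (F.s.map_neg.trans (congrArg Neg.neg (F.s.map_id _)))).trans ?_)
    refine (congrArg (F.δ hV ≫ ·) ((shiftFunctor D (1 : ℤ)).map_neg)).trans
      ((Preadditive.comp_neg _ _).trans (congrArg Neg.neg ?_))
    exact (congrArg (F.δ hV ≫ ·) ((shiftFunctor D (1 : ℤ)).map_id _)).trans (Category.comp_id _)
  rw [h1, h2]
  have e1 : ((F.s.map φ.τ₁)⟦(1 : ℤ)⟧' ≫ (F.δ (Y.exact S.X₁))⟦(1 : ℤ)⟧') = (F.δ hV)⟦(1 : ℤ)⟧' :=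
    (Functor.map_comp _ _ _).symm.trans (congrArg (fun z => z⟦(1 : ℤ)⟧') h3)
  have e2 : ((F.s.map ψ.τ₁)⟦(1 : ℤ)⟧' ≫ (F.δ (hY.map_shortExact hS))⟦(1 : ℤ)⟧') =
      -(F.δ hV)⟦(1 : ℤ)⟧' :=
    (Functor.map_comp _ _ _).symm.trans ((congrArg (fun z => z⟦(1 : ℤ)⟧') h4).trans
      (Functor.map_neg _))
  refine (Category.assoc _ _ _).trans ((congrArg (_ ≫ ·) e1).trans ?_)
  refine Eq.trans ?_ (congrArg Neg.neg ((Category.assoc _ _ _).trans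
    ((congrArg (_ ≫ ·) e2).trans (Preadditive.comp_neg _ _)))).symm
  exact (neg_neg _).symm

/-- Shifting by `n` and reordering the shifts preserves the anticommutation. It is used with `u =
(-1)^n`, for which `-u` is the sign belonging to the next level. -/
theorem comp_shift_of_comp_eq_neg {X₃ X₁ Z₃ Z₁ : D} {a : X₃ ⟶ X₁⟦(1 : ℤ)⟧} {b : X₁ ⟶ Z₁⟦(1 : ℤ)⟧}
    {a' : X₃ ⟶ Z₃⟦(1 : ℤ)⟧} {b' : Z₃ ⟶ Z₁⟦(1 : ℤ)⟧}
    (H : a ≫ b⟦(1 : ℤ)⟧' = -(a' ≫ b'⟦(1 : ℤ)⟧')) (u : ℤˣ) (n p : ℤ) (h : 1 + n = p) :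
    (u • (a⟦n⟧' ≫ (shiftFunctorComm D 1 n).hom.app X₁)) ≫
      (b⟦n⟧' ≫ (shiftFunctorAdd' D 1 n p h).inv.app Z₁)⟦(1 : ℤ)⟧' =
    (a'⟦n⟧' ≫ (shiftFunctorAdd' D 1 n p h).inv.app Z₃) ≫
      ((-u) • (b'⟦p⟧' ≫ (shiftFunctorComm D 1 p).hom.app Z₁)) := by
  have h1 := congrArg (fun z => z⟦n⟧') H
  have n1 := (shiftFunctorComm D 1 n).hom.naturality b
  have n2 := (shiftFunctorAdd' D 1 n p h).inv.naturality b'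
  have n3 := shiftFunctorAdd'_inv_comm n p h Z₁
  simp only [Functor.map_comp, Functor.map_neg] at h1
  simp only [Functor.comp_map] at n1 n2
  rw [Functor.map_comp, Units.neg_smul, Preadditive.comp_neg, Linear.comp_units_smul,
    Linear.units_smul_comp, ← smul_neg, Category.assoc, Category.assoc, ← reassoc_of% n1,
    reassoc_of% h1, ← reassoc_of% n2, Preadditive.neg_comp, Category.assoc, n3]

/-- The signs `(-1)^n` and `(-1)^(n + 1)` built into `δl` turn the anticommutation into strict
commutation, so connecting morphisms are compatible with the transition isomorphisms of the
stabilization. -/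
theorem δl_comp_ε (n p : ℤ) (h : n + 1 = p) : F.δl hS n ≫ (F.ε Y S.X₁ n p h)⟦(1 : ℤ)⟧' =
    F.ε Y S.X₃ n p h ≫ F.δl (hY.map_shortExact hS) p := by
  obtain rfl : p = n + 1 := h.symm
  have h1 := comp_shift_of_comp_eq_neg (F.δ_comp_δ Y hY hS) n.negOnePow n (n + 1) (by omega)
  rw [← Int.negOnePow_succ] at h1
  exact h1

end DeltaEmbedding

end ConnectingMorphisms

/-! ### Level functors to a triangulated category -/

section DeltaLevels

open Pretriangulated ZeroObject

variable {A : Type u} [Category.{v} A] [Abelian A]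

/-- Level functors with values in a triangulated category which send short exact sequences to
distinguished triangles, naturally and compatibly with the transition isomorphisms. -/
structure DeltaLevels (Ω : A ⥤ A) [Ω.PreservesZeroMorphisms] (T : Type*) [Category* T]
    [Preadditive T] [HasZeroObject T] [HasShift T ℤ] [∀ n : ℤ, (shiftFunctor T n).Additive]
    [Pretriangulated T] extends LevelFunctors Ω T where
  additive (n : ℤ) : (q n).Additive
  isZero (n : ℤ) (P : A) : Projective P → IsZero ((q n).obj P)
  exact {S : ShortComplex A} : S.ShortExact → (S.map Ω).ShortExact
  shift (n p : ℤ) (h : n + 1 = p) (X : A) : Nonempty (((q n).obj X)⟦(1 : ℤ)⟧ ≅ (q p).obj X)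
  /-- the connecting morphism -/
  δ {S : ShortComplex A} (hS : S.ShortExact) (n : ℤ) :
    (q n).obj S.X₃ ⟶ ((q n).obj S.X₁)⟦(1 : ℤ)⟧
  dist {S : ShortComplex A} (hS : S.ShortExact) (n : ℤ) :
    Triangle.mk ((q n).map S.f) ((q n).map S.g) (δ hS n) ∈ distTriang T
  nat {S S' : ShortComplex A} (hS : S.ShortExact) (hS' : S'.ShortExact) (φ : S ⟶ S') (n : ℤ) :
    (q n).map φ.τ₃ ≫ δ hS' n = δ hS n ≫ ((q n).map φ.τ₁)⟦(1 : ℤ)⟧'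
  step {S : ShortComplex A} (hS : S.ShortExact) (n p : ℤ) (h : n + 1 = p) :
    (τ n p h).hom.app S.X₃ ≫ δ hS n = δ (exact hS) p ≫ ((τ n p h).hom.app S.X₁)⟦(1 : ℤ)⟧'

attribute [instance] DeltaLevels.additive

theorem distinguished_of_iso {T : Type*} [Category* T]
    [Preadditive T] [HasZeroObject T] [HasShift T ℤ] [∀ n : ℤ, (shiftFunctor T n).Additive]
    [Pretriangulated T] {t : Triangle T} (ht : t ∈ distTriang T) {X Y : T} (i₁ : X ≅ t.obj₁)
    (i₂ : Y ≅ t.obj₂) {f : X ⟶ Y} (hf : f ≫ i₂.hom = i₁.hom ≫ t.mor₁) :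
    Triangle.mk f (i₂.hom ≫ t.mor₂) (t.mor₃ ≫ i₁.inv⟦(1 : ℤ)⟧') ∈ distTriang T := by
  refine isomorphic_distinguished _ ht _ (Triangle.isoMk _ _ i₁ i₂ (Iso.refl _) hf
    (Category.comp_id _) ?_)
  refine (Category.assoc _ _ _).trans ((congrArg (_ ≫ ·) (Functor.map_comp _ _ _).symm).trans ?_)
  refine (congrArg (fun z => t.mor₃ ≫ z⟦(1 : ℤ)⟧') i₁.inv_hom_id).trans ?_
  refine (congrArg (t.mor₃ ≫ ·) ((shiftFunctor T (1 : ℤ)).map_id _)).trans ?_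
  exact (Category.comp_id _).trans (Category.id_comp _).symm

namespace DeltaLevels

variable {Ω : A ⥤ A} [Ω.PreservesZeroMorphisms] {T : Type*} [Category* T]
    [Preadditive T] [HasZeroObject T] [HasShift T ℤ] [∀ n : ℤ, (shiftFunctor T n).Additive]
    [Pretriangulated T] (S : DeltaLevels Ω T)

/-- The cone of a morphism between objects of level `n` is isomorphic to an object of the next
level. -/
theorem exists_cone {U V : A} (f : U ⟶ V) (n p : ℤ) (h : n + 1 = p) (P : A) [Projective P]
    (π : P ⟶ V) [Epi π] {Z : T} {g : (S.q n).obj V ⟶ Z} {k : Z ⟶ ((S.q n).obj U)⟦(1 : ℤ)⟧}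
    (hT : Triangle.mk ((S.q n).map f) g k ∈ distTriang T) :
    ∃ K : A, Nonempty (Z ≅ (S.q p).obj K) := by
  -- Adding a projective to the source makes `f` an epimorphism and changes nothing in `T`, where
  -- projectives vanish. The cone is then the shift of the kernel, that is, the kernel at the next
  -- level.
  have : Epi (biprod.desc f π) := by
    have : Epi (biprod.inr ≫ biprod.desc f π) := by rw [biprod.inr_desc]; infer_instance
    exact epi_of_epi biprod.inr _
  let E : ShortComplex A := ShortComplex.mk (kernel.ι (biprod.desc f π)) (biprod.desc f π)
    (kernel.condition _)
  have hE : E.ShortExact := ShortComplex.ShortExact.mk' (ShortComplex.exact_kernel _)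
    inferInstance this
  have h0 : (S.q n).map (biprod.snd : U ⊞ P ⟶ P) = 0 := (S.isZero n P inferInstance).eq_of_tgt _ _
  let e : (S.q n).obj U ≅ (S.q n).obj (U ⊞ P) := ⟨(S.q n).map biprod.inl, (S.q n).map biprod.fst, by
    rw [← Functor.map_comp, biprod.inl_fst, CategoryTheory.Functor.map_id], by
    have := congrArg (S.q n).map (biprod.total (X := U) (Y := P))
    rwa [Functor.map_add, Functor.map_comp, Functor.map_comp, h0, zero_comp, add_zero,
      CategoryTheory.Functor.map_id] at this⟩
  have h1 : (S.q n).map f ≫ 𝟙 _ = e.hom ≫ (S.q n).map (biprod.desc f π) := by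
    rw [Category.comp_id, ← Functor.map_comp, biprod.inl_desc]
  obtain ⟨i⟩ := S.shift n p h E.X₁
  exact ⟨E.X₁, ⟨Triangle.π₃.mapIso (isoTriangleOfIso₁₂ _ _ hT
    (rot_of_distTriang _ (S.dist hE n)) e (Iso.refl _) h1) ≪≫ i⟩⟩

end DeltaLevels

namespace DeltaEmbedding

variable {D : Type*} [Category* D] [Preadditive D] [HasZeroObject D] [HasShift D ℤ]
  [∀ n : ℤ, (shiftFunctor D n).Additive] [Pretriangulated D] [IsTriangulated D]
  (F : DeltaEmbedding A D) {Ω : A ⥤ A} [Ω.PreservesZeroMorphisms] (Y : SyzygyData Ω)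
  {N : ObjectProperty D} [N.IsTriangulated] (hF : F.IsPerfect N) (hY : Y.IsExact)

theorem map_comp_iso_nat {C C' : Type*} [Category* C] [Category* C'] {L : C ⥤ C'}
    {H : C ⥤ C} {H' : C' ⥤ C'}
    (e : H ⋙ L ≅ L ⋙ H') {X X' Z Z' : C} {f : X ⟶ X'} {d' : X' ⟶ H.obj Z'} {d : X ⟶ H.obj Z}
    {g : Z ⟶ Z'} (h : f ≫ d' = d ≫ H.map g) :
    L.map f ≫ L.map d' ≫ e.hom.app Z' = (L.map d ≫ e.hom.app Z) ≫ H'.map (L.map g) := by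
  have := e.hom.naturality g
  simp only [Functor.comp_map] at this
  rw [Category.assoc, ← this, ← Functor.map_comp_assoc, h, Functor.map_comp, Category.assoc]

theorem inv_square {C : Type*} [Category* C] {X X' Z Z' : C} (e : X' ≅ X) (e' : Z' ≅ Z)
    {d : X ⟶ Z} {d' : X' ⟶ Z'} (h : e.inv ≫ d' = d ≫ e'.inv) : e.hom ≫ d = d' ≫ e'.hom := by
  rw [← cancel_epi e.inv, Iso.inv_hom_id_assoc, reassoc_of% h, Iso.inv_hom_id, Category.comp_id]

/-- The level functors with values in the Verdier quotient, with their connecting morphisms. -/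
noncomputable def deltaLevels : DeltaLevels Ω N.trW.Localization where
  toLevelFunctors := F.levels Y hF
  additive n := inferInstanceAs (F.q n ⋙ N.trW.Q).Additive
  isZero n P hP := by
    have h := N.le_shift n _ (hF.of_projective P hP)
    have h0 : N.trW (0 : (0 : D) ⟶ (F.q n).obj P) := by
      rw [ObjectProperty.trW_iff]
      exact ⟨_, _, _, contractible_distinguished₁ _, h⟩
    exact (Functor.map_isZero N.trW.Q (isZero_zero D)).of_iso
      (Localization.isoOfHom N.trW.Q N.trW _ h0).symm
  exact hS := hY.map_shortExact hS
  shift n p h X := ⟨((N.trW.Q.commShiftIso (1 : ℤ)).app _).symm ≪≫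
    N.trW.Q.mapIso ((shiftFunctorAdd' D n 1 p h).app _).symm⟩
  δ hS n := N.trW.Q.map (F.δl hS n) ≫ (N.trW.Q.commShiftIso (1 : ℤ)).hom.app _
  dist hS n := N.trW.Q.map_distinguished _ (F.δl_dist hS n)
  nat hS hS' φ n := map_comp_iso_nat (N.trW.Q.commShiftIso (1 : ℤ)) (F.δl_nat hS hS' φ n)
  step {S} hS n p h := by
    refine inv_square (((F.levels Y hF).τ n p h).app S.X₃)
      ((shiftFunctor _ (1 : ℤ)).mapIso (((F.levels Y hF).τ n p h).app S.X₁)) ?_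
    exact map_comp_iso_nat (N.trW.Q.commShiftIso (1 : ℤ)) (F.δl_comp_ε Y hY hS n p h).symm

theorem conj_square {C : Type*} [Category* C] {X₁ X₂ X₃ Y₁ Y₂ Y₃ : C} (i : X₁ ≅ X₂) (e : X₂ ≅ X₃)
    (j : Y₁ ≅ Y₂) (e' : Y₂ ≅ Y₃) {f : X₁ ⟶ Y₁} {g : X₃ ⟶ Y₃}
    (h : i.inv ≫ f ≫ j.hom = e.hom ≫ g ≫ e'.inv) : f ≫ (j ≪≫ e').hom = (i ≪≫ e).hom ≫ g := by
  rw [Iso.inv_comp_eq] at h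
  rw [Iso.trans_hom, ← Category.assoc, h]
  simp

include hY in
/-- The functor from the stabilization to the Verdier quotient is essentially surjective if the
triangulated category is generated by the abelian category. -/
theorem lift_essSurj (hP : ∀ X : A, ∃ (P : A) (_ : Projective P) (π : P ⟶ X), Epi π)
    (hD : ∀ (P : ObjectProperty D) [P.IsTriangulated] [P.IsClosedUnderIsomorphisms],
    (∀ X, P (F.s.obj X)) → ∀ K, P K) : (F.levels Y hF).lift.EssSurj where
  mem_essImage Z := by
    let Θ := (F.levels Y hF).lift
    have : Θ.Full := F.lift_full Y hF
    -- The objects of `D` whose image in the quotient comes from the stabilization form a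
    -- triangulated subcategory containing all `s X`, hence everything.
    let P : ObjectProperty D := fun K => Θ.essImage (N.trW.Q.obj K)
    have hq : ∀ (X : A) (n : ℤ), P ((F.q n).obj X) := fun X n => ⟨⟨X, n⟩, ⟨Iso.refl _⟩⟩
    have hiso : ∀ {K K' : D}, (K ≅ K') → P K → P K' := fun e ⟨W, ⟨e'⟩⟩ =>
      ⟨W, ⟨e' ≪≫ N.trW.Q.mapIso e⟩⟩
    have : P.IsClosedUnderIsomorphisms := ⟨hiso⟩
    have hshift : ∀ (K : D) (m : ℤ), P K → P (K⟦m⟧) := by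
      rintro K m ⟨⟨X, n⟩, ⟨e⟩⟩
      refine ⟨⟨X, n + m⟩, ⟨?_⟩⟩
      exact N.trW.Q.mapIso ((shiftFunctorAdd' D n m (n + m) rfl).app (F.s.obj X)) ≪≫
        (N.trW.Q.commShiftIso m).app _ ≪≫ (shiftFunctor _ m).mapIso e ≪≫
        ((N.trW.Q.commShiftIso m).app _).symm
    have : P.IsStableUnderShift ℤ := ⟨fun m => ⟨fun K hK => hshift K m hK⟩⟩
    have : P.ContainsZero :=
      ⟨_, (F.q 0).map_isZero (isZero_zero A), hq 0 0⟩
    have : P.IsTriangulatedClosed₃ := by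
      refine ⟨fun t ht => ?_⟩
      rintro ⟨⟨X₁, n₁⟩, ⟨e₁⟩⟩ ⟨⟨X₂, n₂⟩, ⟨e₂⟩⟩
      -- By fullness the first morphism of the triangle comes from a morphism of `A` at a common
      -- level `p`, to which `exists_cone` applies.
      obtain ⟨φ, hφ⟩ := Θ.map_surjective (e₁.hom ≫ N.trW.Q.map t.mor₁ ≫ e₂.inv)
      obtain ⟨a, b, p, ha, hb, f, rfl⟩ := Stabilization.exists_eq φ
      obtain ⟨Q, hQ, π, hπ⟩ := hP (iterObj Ω X₂ b)
      let i₁ := Θ.mapIso (Stabilization.shiftIso X₁ n₁ a p ha) ≪≫ e₁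
      let i₂ := Θ.mapIso (Stabilization.shiftIso X₂ n₂ b p hb) ≪≫ e₂
      have hf : Θ.map (Stabilization.incMap p f) ≫ i₂.hom = i₁.hom ≫ N.trW.Q.map t.mor₁ := by
        have := Θ.map_comp (Stabilization.shiftIso X₁ n₁ a p ha).inv
          (Stabilization.incMap p f ≫ (Stabilization.shiftIso X₂ n₂ b p hb).hom)
        exact conj_square (Θ.mapIso (Stabilization.shiftIso X₁ n₁ a p ha)) e₁
          (Θ.mapIso (Stabilization.shiftIso X₂ n₂ b p hb)) e₂
          ((this.trans (congrArg (_ ≫ ·) (Θ.map_comp _ _))).symm.trans hφ)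
      obtain ⟨K, ⟨e⟩⟩ := (F.deltaLevels Y hF hY).exists_cone f p (p + 1) rfl Q π
        (distinguished_of_iso (N.trW.Q.map_distinguished t ht) i₁ i₂
          ((congrArg (· ≫ i₂.hom) ((F.levels Y hF).lift_map_inc p f)).symm.trans hf))
      exact ⟨t.obj₃, ⟨⟨K, p + 1⟩, ⟨e.symm⟩⟩, ⟨Iso.refl _⟩⟩
    have : P.IsTriangulated := { toIsTriangulatedClosed₂ := .of_isTriangulatedClosed₃ }
    obtain ⟨K, ⟨e⟩⟩ := Localization.essSurj N.trW.Q N.trW |>.mem_essImage Z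
    obtain ⟨W, ⟨e'⟩⟩ := hD P (fun X => hiso ((shiftFunctorZero D ℤ).app (F.s.obj X)) (hq X 0)) K
    exact ⟨W, ⟨e' ≪≫ e⟩⟩

end DeltaEmbedding

end DeltaLevels

/-! ### Connecting morphisms on an abelian model of the stabilization -/

namespace Stabilization

variable {C : Type u} [Category.{v} C] {Ω : C ⥤ C}

variable (Ω) in
/-- The iterates of `Ω`. -/
def iter (a : ℕ) : C ⥤ C where
  obj X := iterObj Ω X a
  map f := Nat.rec f (fun _ g => Ω.map g) a
  map_id X := by
    induction a with
    | zero => rfl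
    | succ a ih => exact (congrArg Ω.map ih).trans (Ω.map_id _)
  map_comp {X Y Z} f g := by
    induction a with
    | zero => rfl
    | succ a ih => exact (congrArg Ω.map ih).trans (Ω.map_comp _ _)

theorem stepIso_naturality {X Y : C} (f : X ⟶ Y) (n p : ℤ) (h : n + 1 = p) :
    incMap p (Ω.map f) ≫ (stepIso Y n p h).hom = (stepIso X n p h).hom ≫ incMap n f := by
  refine (comp_cls (X := ⟨Ω.obj X, p⟩) (Y := ⟨Ω.obj Y, p⟩) (Z := ⟨Y, n⟩) (a := 0) (b := 0)
    (c := 1) rfl (by simp [h]) (Ω.map f) (𝟙 _)).trans ?_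
  symm
  have e := cls_step (Rep.mk (Ω := Ω) (X := ⟨X, n⟩) (Y := ⟨Y, n⟩) 0 0 rfl f)
  refine (congrArg (fun z => (stepIso X n p h).hom ≫ z) e.symm).trans ?_
  refine (comp_cls (X := ⟨Ω.obj X, p⟩) (Y := ⟨X, n⟩) (Z := ⟨Y, n⟩)
    (a := 0) (b := 1) (c := 1) (by simp [h]) rfl (𝟙 _) (Ω.map f)).trans ?_
  exact congrArg (fun g => (Rep.mk (X := ⟨Ω.obj X, p⟩) (Y := ⟨Y, n⟩) 0 1
    (by simp [h]) g).cls) ((Category.id_comp _).trans (Category.comp_id (Ω.map f)).symm)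

theorem comp_square' {X₁ X₂ X₃ Y₁ Y₂ Y₃ : C} {f₁ : X₁ ⟶ Y₁} {f₂ : X₂ ⟶ Y₂}
    {f₃ : X₃ ⟶ Y₃} (g : X₁ ≅ X₂) (g' : X₂ ≅ X₃) (h : Y₁ ≅ Y₂) (h' : Y₂ ≅ Y₃)
    (H : f₁ ≫ h.hom = g.hom ≫ f₂) (H' : f₂ ≫ h'.hom = g'.hom ≫ f₃) :
    f₁ ≫ (h ≪≫ h').hom = (g ≪≫ g').hom ≫ f₃ := by
  simp [reassoc_of% H, H']

theorem shiftIso_naturality {X Y : C} (f : X ⟶ Y) (n : ℤ) (a : ℕ) (p : ℤ) (h : n + a = p) :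
    incMap p ((iter Ω a).map f) ≫ (shiftIso Y n a p h).hom =
      (shiftIso X n a p h).hom ≫ incMap n f := by
  induction a generalizing p with
  | zero =>
    obtain rfl : n = p := by simpa using h
    rw [shiftIso_zero, shiftIso_zero]
    exact (Category.comp_id _).trans (Category.id_comp _).symm
  | succ a ih =>
    rw [shiftIso_succ X n a (n + a) p rfl (by rw [← h]; push_cast; ring),
      shiftIso_succ Y n a (n + a) p rfl (by rw [← h]; push_cast; ring)]
    exact comp_square' _ _ _ _ (stepIso_naturality _ _ _ _) (ih (n + a) rfl)

theorem exists_eq_of_ge {X Y : Stabilization Ω} (f : X ⟶ Y) :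
    ∃ p₀ : ℤ, ∀ p ≥ p₀, ∃ (a b : ℕ) (h₁ : X.deg + a = p) (h₂ : Y.deg + b = p)
      (f' : iterObj Ω X.obj a ⟶ iterObj Ω Y.obj b),
      f = (shiftIso X.obj X.deg a p h₁).inv ≫ incMap p f' ≫
        (shiftIso Y.obj Y.deg b p h₂).hom := by
  obtain ⟨p₀, hp₀⟩ := exists_rep f
  refine ⟨p₀, fun p hp => ?_⟩
  obtain ⟨a, b, h₁, h₂, h, f', rfl⟩ := hp₀ p hp
  exact ⟨a, b, h₁, h₂, f', cls_eq f' _ h₁ h₂ h⟩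

end Stabilization

section AbelianModel

open Pretriangulated

variable {A : Type u} [Category.{v} A] [Abelian A]

/-- Exact level functors to an abelian category inducing an equivalence with the stabilization. -/
structure AbelianModel (Ω : A ⥤ A) (B : Type*) [Category* B] [Abelian B] extends
    LevelFunctors Ω B where
  additive (n : ℤ) : (q n).Additive
  isEquivalence : toLevelFunctors.lift.IsEquivalence
  shortExact (n : ℤ) {S : ShortComplex A} (hS : S.ShortExact) : (S.map (q n)).ShortExact
  exists_iter_eq_zero (n : ℤ) {X Y : A} (f : X ⟶ Y) : (q n).map f = 0 →
    ∃ k : ℕ, (Stabilization.iter Ω k).map f = 0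
  projective (n : ℤ) (P : A) : Projective P → Projective ((q n).obj P)
  exists_retract (Q : B) : Projective Q → ∃ (P : A) (_ : Projective P) (n : ℤ),
    Nonempty (Retract Q ((q n).obj P))

attribute [instance] AbelianModel.additive AbelianModel.isEquivalence

variable {Ω : A ⥤ A} [Ω.Additive]

instance (a : ℕ) : (Stabilization.iter Ω a).Additive where
  map_add {X Y f g} := by
    induction a with
    | zero => rfl
    | succ a ih => exact (congrArg Ω.map ih).trans Ω.map_add

theorem Stabilization.iter_shortExact
    (hΩ : ∀ {S : ShortComplex A}, S.ShortExact → (S.map Ω).ShortExact)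
    {S : ShortComplex A} (hS : S.ShortExact) (a : ℕ) : (S.map (iter Ω a)).ShortExact := by
  induction a with
  | zero => exact hS
  | succ a ih => exact hΩ ih

namespace DeltaLevels

variable {T : Type*} [Category* T]
    [Preadditive T] [HasZeroObject T] [HasShift T ℤ] [∀ n : ℤ, (shiftFunctor T n).Additive]
    [Pretriangulated T] (S : DeltaLevels Ω T)

omit [HasZeroObject T] [Pretriangulated T] [∀ n : ℤ, (shiftFunctor T n).Additive] in
theorem square_comp {X₁ X₃ Y₁ Y₃ Z₁ Z₃ : T} {x₁ : X₁ ⟶ Y₁} {x₃ : X₃ ⟶ Y₃} {y₁ : Y₁ ⟶ Z₁}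
    {y₃ : Y₃ ⟶ Z₃} {d : X₃ ⟶ X₁⟦(1 : ℤ)⟧} {d' : Y₃ ⟶ Y₁⟦(1 : ℤ)⟧} {d'' : Z₃ ⟶ Z₁⟦(1 : ℤ)⟧}
    (h : x₃ ≫ d' = d ≫ x₁⟦(1 : ℤ)⟧') (h' : y₃ ≫ d'' = d' ≫ y₁⟦(1 : ℤ)⟧') :
    (x₃ ≫ y₃) ≫ d'' = d ≫ (x₁ ≫ y₁)⟦(1 : ℤ)⟧' := by
  rw [Functor.map_comp, Category.assoc, h', reassoc_of% h]

omit [HasZeroObject T] [Pretriangulated T] [∀ n : ℤ, (shiftFunctor T n).Additive] in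
theorem square_inv {X₁ X₃ Y₁ Y₃ : T} (x₁ : X₁ ≅ Y₁) (x₃ : X₃ ≅ Y₃)
    {d : X₃ ⟶ X₁⟦(1 : ℤ)⟧} {d' : Y₃ ⟶ Y₁⟦(1 : ℤ)⟧}
    (h : x₃.hom ≫ d' = d ≫ x₁.hom⟦(1 : ℤ)⟧') : x₃.inv ≫ d = d' ≫ x₁.inv⟦(1 : ℤ)⟧' := by
  rw [Iso.inv_comp_eq, reassoc_of% h, ← Functor.map_comp, Iso.hom_inv_id,
    CategoryTheory.Functor.map_id, Category.comp_id]

/-- Iteration of the field `step`: the connecting morphism at level `n` is determined by that of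
`Ω^a E` at any higher level `p = n + a`. -/
theorem δ_iter {E : ShortComplex A} (hE : E.ShortExact) (n : ℤ) (a : ℕ) (p : ℤ) (h : n + a = p) :
    S.lift.map (Stabilization.shiftIso E.X₃ n a p h).hom ≫ S.δ hE n =
      S.δ (Stabilization.iter_shortExact S.exact hE a) p ≫
        (S.lift.map (Stabilization.shiftIso E.X₁ n a p h).hom)⟦(1 : ℤ)⟧' := by
  induction a generalizing p with
  | zero =>
    obtain rfl : n = p := by simpa using h
    have h1 : ∀ X : A, S.lift.map (Stabilization.shiftIso X n 0 n h).hom =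
        𝟙 (S.lift.obj ⟨X, n⟩) := fun X => S.lift.map_id ⟨X, n⟩
    refine ((congrArg (· ≫ _) (h1 _)).trans (Category.id_comp _)).trans ?_
    refine Eq.trans ?_ (congrArg (fun z => S.δ hE n ≫ z⟦(1 : ℤ)⟧') (h1 E.X₁)).symm
    exact ((congrArg (_ ≫ ·) ((shiftFunctor T (1 : ℤ)).map_id _)).trans (Category.comp_id _)).symm
  | succ a ih =>
    have hp : n + a + 1 = p := by rw [← h]; push_cast; ring
    have h1 : ∀ X : A, S.lift.map (Stabilization.shiftIso X n (a + 1) p h).hom =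
        (S.τ (n + a) p hp).hom.app (iterObj Ω X a) ≫
          S.lift.map (Stabilization.shiftIso X n a (n + a) rfl).hom := fun X => by
      rw [Stabilization.shiftIso_succ X n a (n + a) p rfl hp]
      exact (S.lift.map_comp _ _).trans
        (congrArg (· ≫ _) (S.lift_map_stepIso (iterObj Ω X a) (n + a) p hp))
    rw [h1, h1]
    exact square_comp (S.step (Stabilization.iter_shortExact S.exact hE a) (n + a) p hp)
      (ih (n + a) rfl)

omit [Ω.Additive] in
-- The square of representatives commutes only after `incMap`, because the stabilization may
-- identify different morphisms of `A`. A further power of `Ω` is needed to make it commute in `A`.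
theorem _root_.Stabilization.iter_comm {X X' Y Y' : A} (n m p : ℤ) (a b : ℕ) (ha : n + a = p)
    (hb : m + b = p) {f : X ⟶ X'} {g : Y ⟶ Y'} (u : iterObj Ω X a ⟶ iterObj Ω Y b)
    (u' : iterObj Ω X' a ⟶ iterObj Ω Y' b)
    (h : Stabilization.incMap n f ≫ ((Stabilization.shiftIso X' n a p ha).inv ≫
      Stabilization.incMap (Ω := Ω) p u' ≫ (Stabilization.shiftIso Y' m b p hb).hom) =
      ((Stabilization.shiftIso X n a p ha).inv ≫
      Stabilization.incMap p u ≫ (Stabilization.shiftIso Y m b p hb).hom) ≫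
        Stabilization.incMap m g) :
    Stabilization.incMap (Ω := Ω) p ((Stabilization.iter Ω a).map f ≫ u') =
      Stabilization.incMap (Ω := Ω) p (u ≫ (Stabilization.iter Ω b).map g) := by
  have h1 := Stabilization.shiftIso_naturality (Ω := Ω) f n a p ha
  have h2 := Stabilization.shiftIso_naturality (Ω := Ω) g m b p hb
  have h3 : ∀ {C : Type u} [Category.{v} C] {X₁ X₁' X₂ X₂' Y₁ Y₁' Y₂ Y₂' : C} (s : X₁ ≅ X₂)
      (s' : X₁' ≅ X₂') (t : Y₁ ≅ Y₂) (t' : Y₁' ≅ Y₂') (f₁ : X₁ ⟶ X₁') (f₂ : X₂ ⟶ X₂')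
      (g₁ : Y₁ ⟶ Y₁') (g₂ : Y₂ ⟶ Y₂') (u : X₁ ⟶ Y₁) (u' : X₁' ⟶ Y₁'),
      f₁ ≫ s'.hom = s.hom ≫ f₂ → g₁ ≫ t'.hom = t.hom ≫ g₂ →
      f₂ ≫ (s'.inv ≫ u' ≫ t'.hom) = (s.inv ≫ u ≫ t.hom) ≫ g₂ → f₁ ≫ u' = u ≫ g₁ := by
    intro C _ X₁ X₁' X₂ X₂' Y₁ Y₁' Y₂ Y₂' s s' t t' f₁ f₂ g₁ g₂ u u' h₁ h₂ h
    rw [← cancel_mono t'.hom, ← cancel_epi s.inv, Category.assoc, Category.assoc, h₂]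
    rw [← Iso.eq_comp_inv, Category.assoc] at h₁
    rw [h₁]
    simpa using h
  have h4 := h3 _ _ _ _ _ _ _ _ _ _ h1 h2 h
  exact ((Stabilization.inc Ω p).map_comp ((Stabilization.iter Ω a).map f) u').trans
    (h4.trans ((Stabilization.inc Ω p).map_comp u ((Stabilization.iter Ω b).map g)).symm)

theorem _root_.Stabilization.iter_eq_zero {X Y : A} (f : X ⟶ Y) {k l : ℕ} (hkl : k ≤ l)
    (h : (Stabilization.iter Ω k).map f = 0) : (Stabilization.iter Ω l).map f = 0 := by
  induction l, hkl using Nat.le_induction with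
  | base => exact h
  | succ l _ ih => exact (congrArg Ω.map ih).trans (Ω.map_zero _ _)

/-- Representatives of the three morphisms at a common level need not form a morphism of short exact
sequences. The abelian model detects equality up to a power of `Ω`, so they do after `Ω^k` for `k`
large; `nat` applies at level `p + k`, and `δ_iter` leads back to the original levels. -/
theorem δ_natural {B : Type*} [Category* B] [Abelian B] (G : AbelianModel Ω B)
    {E E' : ShortComplex A} (hE : E.ShortExact) (hE' : E'.ShortExact) (n m : ℤ)
    (φ₁ : (⟨E.X₁, n⟩ : Stabilization Ω) ⟶ ⟨E'.X₁, m⟩)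
    (φ₂ : (⟨E.X₂, n⟩ : Stabilization Ω) ⟶ ⟨E'.X₂, m⟩)
    (φ₃ : (⟨E.X₃, n⟩ : Stabilization Ω) ⟶ ⟨E'.X₃, m⟩)
    (h₁ : Stabilization.incMap n E.f ≫ φ₂ = φ₁ ≫ Stabilization.incMap m E'.f)
    (h₂ : Stabilization.incMap n E.g ≫ φ₃ = φ₂ ≫ Stabilization.incMap m E'.g) :
    S.lift.map φ₃ ≫ S.δ hE' m = S.δ hE n ≫ (S.lift.map φ₁)⟦(1 : ℤ)⟧' := by
  obtain ⟨p₁, hp₁⟩ := Stabilization.exists_eq_of_ge φ₁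
  obtain ⟨p₂, hp₂⟩ := Stabilization.exists_eq_of_ge φ₂
  obtain ⟨p₃, hp₃⟩ := Stabilization.exists_eq_of_ge φ₃
  obtain ⟨p, hp⟩ : ∃ p, p = max p₁ (max p₂ p₃) := ⟨_, rfl⟩
  obtain ⟨a, b, ha, hb, f₁, rfl⟩ := hp₁ p (by omega)
  obtain ⟨a', b', ha', hb', f₂, rfl⟩ := hp₂ p (by omega)
  obtain ⟨a'', b'', ha'', hb'', f₃, rfl⟩ := hp₃ p (by omega)
  dsimp only at ha hb ha' hb' ha'' hb''
  obtain rfl : a = a' := by omega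
  obtain rfl : a = a'' := by omega
  obtain rfl : b = b' := by omega
  obtain rfl : b = b'' := by omega
  have key : ∀ {X X' Y Y' : A} {f : X ⟶ X'} {g : Y ⟶ Y'} (u : iterObj Ω X a ⟶ iterObj Ω Y b)
      (u' : iterObj Ω X' a ⟶ iterObj Ω Y' b), Stabilization.incMap (Ω := Ω) p
        ((Stabilization.iter Ω a).map f ≫ u') =
      Stabilization.incMap p (u ≫ (Stabilization.iter Ω b).map g) →
      ∃ k : ℕ, ∀ l ≥ k, (Stabilization.iter Ω l).map ((Stabilization.iter Ω a).map f ≫ u') =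
        (Stabilization.iter Ω l).map (u ≫ (Stabilization.iter Ω b).map g) := by
    intro X X' Y Y' f g u u' h
    obtain ⟨v, hv⟩ : ∃ v : iterObj Ω X a ⟶ iterObj Ω Y' b,
      v = (Stabilization.iter Ω a).map f ≫ u' := ⟨_, rfl⟩
    obtain ⟨w, hw⟩ : ∃ w : iterObj Ω X a ⟶ iterObj Ω Y' b,
      w = u ≫ (Stabilization.iter Ω b).map g := ⟨_, rfl⟩
    suffices ∃ k : ℕ, ∀ l ≥ k, (Stabilization.iter Ω l).map v = (Stabilization.iter Ω l).map w by
      rwa [hv, hw] at this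
    have h' : (G.q p).map v = (G.q p).map w := by
      rw [hv, hw]
      exact
       (G.lift_map_inc p _).symm.trans ((congrArg G.lift.map h).trans (G.lift_map_inc p _))
    obtain ⟨k, hk⟩ := G.exists_iter_eq_zero p (v - w) (by rw [Functor.map_sub, h', sub_self])
    refine ⟨k, fun l hl => ?_⟩
    have := Stabilization.iter_eq_zero _ hl hk
    rwa [Functor.map_sub, sub_eq_zero] at this
  obtain ⟨k₁, hk₁⟩ := key f₁ f₂ (Stabilization.iter_comm n m p a b ha hb f₁ f₂ h₁)
  obtain ⟨k₂, hk₂⟩ := key f₂ f₃ (Stabilization.iter_comm n m p a b ha hb f₂ f₃ h₂)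
  obtain ⟨k, hk⟩ : ∃ k, k = max k₁ k₂ := ⟨_, rfl⟩
  let I := Stabilization.iter Ω k
  have hEa := Stabilization.iter_shortExact S.exact hE a
  have hEb := Stabilization.iter_shortExact S.exact hE' b
  let Ψ : (E.map (Stabilization.iter Ω a)).map I ⟶ (E'.map (Stabilization.iter Ω b)).map I :=
    { τ₁ := I.map f₁
      τ₂ := I.map f₂
      τ₃ := I.map f₃
      comm₁₂ := (I.map_comp _ _).symm.trans ((hk₁ k (by omega)).symm.trans (I.map_comp _ _))
      comm₂₃ := (I.map_comp _ _).symm.trans ((hk₂ k (by omega)).symm.trans (I.map_comp _ _)) }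
  have nat := S.nat (Stabilization.iter_shortExact S.exact hEa k)
    (Stabilization.iter_shortExact S.exact hEb k) Ψ (p + k)
  have hφ : ∀ {X Y : A} (f : iterObj Ω X a ⟶ iterObj Ω Y b),
      S.lift.map ((Stabilization.shiftIso X n a p ha).inv ≫ Stabilization.incMap p f ≫
        (Stabilization.shiftIso Y m b p hb).hom) =
      S.lift.map (Stabilization.shiftIso X n a p ha).inv ≫
        (S.lift.map (Stabilization.shiftIso (iterObj Ω X a) p k (p + k) rfl).inv ≫
        (S.q (p + k)).map (I.map f) ≫
        S.lift.map (Stabilization.shiftIso (iterObj Ω Y b) p k (p + k) rfl).hom) ≫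
        S.lift.map (Stabilization.shiftIso Y m b p hb).hom := by
    intro X Y f
    have h := congrArg S.lift.map (Stabilization.shiftIso_naturality (Ω := Ω) f p k (p + k) rfl)
    have h' := (S.lift.map_comp _ _).symm.trans (h.trans (S.lift.map_comp _ _))
    refine (S.lift.map_comp _ _).trans (congrArg (_ ≫ ·) ((S.lift.map_comp _ _).trans
      (congrArg (· ≫ _) ?_)))
    refine (Iso.eq_inv_comp (S.lift.mapIso (Stabilization.shiftIso (iterObj Ω X a) p k
      (p + k) rfl))).2 ?_
    exact h'.symm.trans (congrArg (· ≫ _) (S.lift_map_inc (p + k) (I.map f)))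
  have hα := S.δ_iter hE n a p ha
  have hβ := S.δ_iter hEa p k (p + k) rfl
  have hα' := S.δ_iter hE' m b p hb
  have hβ' := S.δ_iter hEb p k (p + k) rfl
  have hα₂ := square_inv (S.lift.mapIso (Stabilization.shiftIso E.X₁ n a p ha))
    (S.lift.mapIso (Stabilization.shiftIso E.X₃ n a p ha)) hα
  have hβ₂ := square_inv
    (S.lift.mapIso (Stabilization.shiftIso (iterObj Ω E.X₁ a) p k (p + k) rfl))
    (S.lift.mapIso (Stabilization.shiftIso (iterObj Ω E.X₃ a) p k (p + k) rfl)) hβ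
  refine (congrArg (· ≫ _) (hφ f₃)).trans (Eq.trans ?_
    (congrArg (fun z => _ ≫ z⟦(1 : ℤ)⟧') (hφ f₁)).symm)
  exact square_comp hα₂ (square_comp (square_comp hβ₂ (square_comp nat hβ')) hα')

end DeltaLevels

end AbelianModel

/-! ### The functor from the abelian model to the triangulated category -/

section StableDelta

open Pretriangulated

/-- An additive functor from a Frobenius abelian category to a triangulated category which sends
short exact sequences naturally to distinguished triangles and which identifies the triangulated
category with the stable category. -/
structure StableDeltaFunctor (B : Type*) [Category* B] [Abelian B] (T : Type*) [Category* T]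
    [Preadditive T] [HasZeroObject T] [HasShift T ℤ] [∀ n : ℤ, (shiftFunctor T n).Additive]
    [Pretriangulated T] where
  /-- the functor -/
  F : B ⥤ T
  additive : F.Additive
  full : F.Full
  essSurj : F.EssSurj
  isZero (P : B) : Projective P → IsZero (F.obj P)
  stableRel_of_map_eq {X Y : B} (f g : X ⟶ Y) : F.map f = F.map g → stableRel B f g
  /-- the connecting morphism -/
  δ {S : ShortComplex B} (hS : S.ShortExact) : F.obj S.X₃ ⟶ (F.obj S.X₁)⟦(1 : ℤ)⟧
  dist {S : ShortComplex B} (hS : S.ShortExact) :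
    Triangle.mk (F.map S.f) (F.map S.g) (δ hS) ∈ distTriang T
  nat {S S' : ShortComplex B} (hS : S.ShortExact) (hS' : S'.ShortExact) (φ : S ⟶ S') :
    F.map φ.τ₃ ≫ δ hS' = δ hS ≫ (F.map φ.τ₁)⟦(1 : ℤ)⟧'

attribute [instance] StableDeltaFunctor.additive StableDeltaFunctor.full
  StableDeltaFunctor.essSurj

variable {A : Type u} [Category.{v} A] [Abelian A] {Ω : A ⥤ A} [Ω.Additive]

namespace LevelFunctors

variable {B : Type*} [Category* B] [Preadditive B] (S : LevelFunctors Ω B)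

theorem lift_map_eq {X Y : A} {n m p : ℤ} {a b : ℕ} (ha : n + a = p) (hb : m + b = p)
    (f : iterObj Ω X a ⟶ iterObj Ω Y b) :
    S.lift.map ((Stabilization.shiftIso X n a p ha).inv ≫ Stabilization.incMap p f ≫
        (Stabilization.shiftIso Y m b p hb).hom) =
      S.lift.map (Stabilization.shiftIso X n a p ha).inv ≫ (S.q p).map f ≫
        S.lift.map (Stabilization.shiftIso Y m b p hb).hom :=
  (S.lift.map_comp _ _).trans (congrArg (_ ≫ ·) ((S.lift.map_comp _ _).trans
    (congrArg (· ≫ _) (S.lift_map_inc p f))))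

theorem lift_map_add (hS : ∀ n, (S.q n).Additive) {X Y : A} {n m p : ℤ} {a b : ℕ} (ha : n + a = p)
    (hb : m + b = p) (f g : iterObj Ω X a ⟶ iterObj Ω Y b) :
    S.lift.map ((Stabilization.shiftIso X n a p ha).inv ≫ Stabilization.incMap p (f + g) ≫
        (Stabilization.shiftIso Y m b p hb).hom) =
      S.lift.map ((Stabilization.shiftIso X n a p ha).inv ≫ Stabilization.incMap p f ≫
        (Stabilization.shiftIso Y m b p hb).hom) +
      S.lift.map ((Stabilization.shiftIso X n a p ha).inv ≫ Stabilization.incMap p g ≫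
        (Stabilization.shiftIso Y m b p hb).hom) := by
  refine (S.lift_map_eq ha hb (f + g)).trans (Eq.trans ?_
    (congrArg₂ (· + ·) (S.lift_map_eq ha hb f) (S.lift_map_eq ha hb g)).symm)
  refine (congrArg (fun z => _ ≫ z ≫ _) ((S.q p).map_add)).trans ?_
  refine (congrArg (_ ≫ ·) (Preadditive.add_comp _ _ _ _ _ _)).trans ?_
  exact Preadditive.comp_add _ _ _ _ _ _

end LevelFunctors

namespace Stabilization

theorem exists_eq_common {X Y : Stabilization Ω} (f g : X ⟶ Y) :
    ∃ (p : ℤ) (a b : ℕ) (h₁ : X.deg + a = p) (h₂ : Y.deg + b = p)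
      (f' g' : iterObj Ω X.obj a ⟶ iterObj Ω Y.obj b),
      f = (shiftIso X.obj X.deg a p h₁).inv ≫ incMap p f' ≫
        (shiftIso Y.obj Y.deg b p h₂).hom ∧
      g = (shiftIso X.obj X.deg a p h₁).inv ≫ incMap p g' ≫
        (shiftIso Y.obj Y.deg b p h₂).hom := by
  obtain ⟨p₁, hp₁⟩ := exists_eq_of_ge f
  obtain ⟨p₂, hp₂⟩ := exists_eq_of_ge g
  obtain ⟨a, b, ha, hb, f', hf⟩ := hp₁ (max p₁ p₂) (by omega)
  obtain ⟨a', b', ha', hb', g', hg⟩ := hp₂ (max p₁ p₂) (by omega)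
  obtain rfl : a = a' := by omega
  obtain rfl : b = b' := by omega
  exact ⟨_, a, b, ha, hb, f', g', hf, hg⟩

end Stabilization

namespace AbelianModel

variable {B : Type*} [Category* B] [Abelian B] (G : AbelianModel Ω B)

/-- The equivalence between the stabilization and its abelian model. -/
noncomputable abbrev equiv : Stabilization Ω ≌ B :=
  have := G.isEquivalence
  G.lift.asEquivalence

theorem epi_q (n : ℤ) {X Y : A} (f : X ⟶ Y) [Epi f] : Epi ((G.q n).map f) := by
  have h : (ShortComplex.mk (kernel.ι f) f (kernel.condition f)).ShortExact :=
    ShortComplex.ShortExact.mk' (ShortComplex.exact_kernel _) inferInstance inferInstance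
  exact (G.shortExact n h).epi_g

/-- Represent `φ` by some `f` at a level and replace `f` by its image. The projection onto the image
stays an epimorphism under the exact `q p`, and it becomes a monomorphism because `φ` is one; so it
becomes invertible. -/
theorem exists_iso_of_mono {M N : B} (φ : M ⟶ N) [Mono φ] : ∃ (n : ℤ) (E : ShortComplex A)
    (_ : E.ShortExact) (e₁ : (G.q n).obj E.X₁ ≅ M) (e₂ : (G.q n).obj E.X₂ ≅ N),
    (G.q n).map E.f ≫ e₂.hom = e₁.hom ≫ φ := by
  obtain ⟨a, b, p, ha, hb, f, hf⟩ := Stabilization.exists_eq (G.equiv.inverse.map φ)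
  have h1 := (congrArg G.lift.map hf).symm.trans (G.equiv.fun_inv_map M N φ)
  have h2 := (G.lift_map_eq ha hb f).symm.trans h1
  let i₁ : (G.q p).obj (iterObj Ω (G.equiv.inverse.obj M).obj a) ≅ M :=
    G.lift.mapIso (Stabilization.shiftIso _ _ a p ha) ≪≫ G.equiv.counitIso.app M
  let i₂ : (G.q p).obj (iterObj Ω (G.equiv.inverse.obj N).obj b) ≅ N :=
    G.lift.mapIso (Stabilization.shiftIso _ _ b p hb) ≪≫ G.equiv.counitIso.app N
  have h3 : (G.q p).map f ≫ i₂.hom = i₁.hom ≫ φ :=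
    DeltaEmbedding.conj_square (G.lift.mapIso (Stabilization.shiftIso _ _ a p ha))
      (G.equiv.counitIso.app M) (G.lift.mapIso (Stabilization.shiftIso _ _ b p hb))
      (G.equiv.counitIso.app N) h2
  let E : ShortComplex A := ShortComplex.mk (kernel.ι (cokernel.π f)) (cokernel.π f)
    (kernel.condition _)
  have hE : E.ShortExact :=
    ShortComplex.ShortExact.mk' (ShortComplex.exact_kernel _) inferInstance inferInstance
  have hf' : Abelian.factorThruImage f ≫ E.f = f := Abelian.image.fac f
  have h4 : (G.q p).map (Abelian.factorThruImage f) ≫ (G.q p).map E.f = (G.q p).map f :=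
    ((G.q p).map_comp _ _).symm.trans (congrArg _ hf')
  have : Epi ((G.q p).map (Abelian.factorThruImage f)) := G.epi_q p _
  have : Mono ((G.q p).map (Abelian.factorThruImage f)) := by
    have : Mono ((G.q p).map (Abelian.factorThruImage f) ≫ (G.q p).map E.f) := by
      rw [h4, (Iso.eq_comp_inv i₂).2 h3]
      infer_instance
    exact mono_of_mono _ ((G.q p).map E.f)
  have : IsIso ((G.q p).map (Abelian.factorThruImage f)) := isIso_of_mono_of_epi _
  refine ⟨p, E, hE, (asIso ((G.q p).map (Abelian.factorThruImage f))).symm ≪≫ i₁, i₂, ?_⟩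
  rw [Iso.trans_hom, Iso.symm_hom, Category.assoc, Iso.eq_inv_comp, asIso_hom, ← h3]
  exact (Category.assoc _ _ _).symm.trans (congrArg (· ≫ i₂.hom) h4)

/-- Only the monomorphism has to be lifted: both third terms are cokernels, and the exact functor `q
n` preserves them. -/
theorem exists_iso {S : ShortComplex B} (hS : S.ShortExact) : ∃ (n : ℤ) (E : ShortComplex A)
    (_ : E.ShortExact) (e₁ : (G.q n).obj E.X₁ ≅ S.X₁) (e₂ : (G.q n).obj E.X₂ ≅ S.X₂)
    (e₃ : (G.q n).obj E.X₃ ≅ S.X₃), (G.q n).map E.f ≫ e₂.hom = e₁.hom ≫ S.f ∧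
      (G.q n).map E.g ≫ e₃.hom = e₂.hom ≫ S.g := by
  have := hS.mono_f
  obtain ⟨n, E, hE, e₁, e₂, h⟩ := G.exists_iso_of_mono S.f
  have hqE := G.shortExact n hE
  have := hS.epi_g
  have : Epi ((G.q n).map E.g) := hqE.epi_g
  obtain ⟨u, hu⟩ : ∃ u : (G.q n).obj E.X₃ ⟶ S.X₃, (G.q n).map E.g ≫ u = e₂.hom ≫ S.g := by
    have := hqE.epi_g
    have h0 : (E.map (G.q n)).f ≫ e₂.hom ≫ S.g = 0 := by
      have : (G.q n).map E.f ≫ e₂.hom ≫ S.g = 0 := by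
        rw [reassoc_of% h, S.zero, comp_zero]
      exact this
    exact ⟨hqE.exact.desc (e₂.hom ≫ S.g) h0, hqE.exact.g_desc _ h0⟩
  obtain ⟨u', hu'⟩ : ∃ u' : S.X₃ ⟶ (G.q n).obj E.X₃, S.g ≫ u' = e₂.inv ≫ (G.q n).map E.g := by
    have h0 : S.f ≫ e₂.inv ≫ (G.q n).map E.g = 0 := by
      have h1 : S.f ≫ e₂.inv = e₁.inv ≫ (G.q n).map E.f := by
        rw [Iso.comp_inv_eq, Category.assoc, h, Iso.inv_hom_id_assoc]
      rw [reassoc_of% h1, ← Functor.map_comp, E.zero, Functor.map_zero, comp_zero]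
    exact ⟨hS.exact.desc _ h0, hS.exact.g_desc _ h0⟩
  refine ⟨n, E, hE, e₁, e₂, ⟨u, u', ?_, ?_⟩, h, hu⟩
  · rw [← cancel_epi ((G.q n).map E.g), reassoc_of% hu, hu', Iso.hom_inv_id_assoc, Category.comp_id]
  · rw [← cancel_epi S.g, reassoc_of% hu', hu, Iso.inv_hom_id_assoc, Category.comp_id]

end AbelianModel

end StableDelta

/-! ### Transport of connecting morphisms along the equivalence with the stabilization. -/

section StableDelta

open Pretriangulated

variable {A : Type u} [Category.{v} A] [Abelian A] {Ω : A ⥤ A} [Ω.Additive]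
  {B : Type*} [Category* B] [Abelian B] (G : AbelianModel Ω B)
  {T : Type*} [Category* T] [Preadditive T] [HasZeroObject T] [HasShift T ℤ]
  [∀ n : ℤ, (shiftFunctor T n).Additive] [Pretriangulated T] (S : DeltaLevels Ω T)

theorem eq_of_eq_conj {C : Type*} [Category* C] {X X' Y Y' : C} (i : X' ≅ X) (j : Y' ≅ Y)
    {k : X ⟶ Y}
    {k' : X' ⟶ Y'} (h : k' = i.hom ≫ k ≫ j.inv) : k = i.inv ≫ k' ≫ j.hom := by
  simp [h]

theorem conj_add {C : Type*} [Category* C] [Preadditive C] {X X' Y Y' : C} (i : X' ⟶ X) (j : Y ⟶ Y')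
    {k l : X ⟶ Y} {k' l' m' : X' ⟶ Y'} (hk : k' = i ≫ k ≫ j) (hl : l' = i ≫ l ≫ j)
    (hm : m' = i ≫ (k + l) ≫ j) : m' = k' + l' := by
  simp [hk, hl, hm]

theorem conj_sub {C : Type*} [Category* C] [Preadditive C] {X X' Y Y' P : C}
    (i : X' ⟶ X) (j : Y ⟶ Y')
    {k l : X ⟶ Y} {k' l' : X' ⟶ Y'} {r : X ⟶ P} {t : P ⟶ Y} (hk : k' = i ≫ k ≫ j)
    (hl : l' = i ≫ l ≫ j) (h : k - l = r ≫ t) : k' - l' = (i ≫ r) ≫ (t ≫ j) := by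
  rw [hk, hl, ← Preadditive.comp_sub, ← Preadditive.sub_comp, h]
  simp

theorem conj_comm {C : Type*} [Category* C] {X Y X' Y' M N M' N' : C} {f : X ⟶ Y} {f' : X' ⟶ Y'}
    {g : M ⟶ N} {g' : M' ⟶ N'} (e₁ : X ≅ M) (e₂ : Y ≅ N) (e₁' : X' ≅ M') (e₂' : Y' ≅ N')
    {a₁ : M ⟶ M'} {a₂ : N ⟶ N'} (h : f ≫ e₂.hom = e₁.hom ≫ g) (h' : f' ≫ e₂'.hom = e₁'.hom ≫ g')
    (ha : a₁ ≫ g' = g ≫ a₂) :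
    f ≫ (e₂.hom ≫ a₂ ≫ e₂'.inv) = (e₁.hom ≫ a₁ ≫ e₁'.inv) ≫ f' := by
  rw [← Iso.eq_comp_inv, Category.assoc] at h'
  rw [reassoc_of% h, ← reassoc_of% ha, h']
  simp

omit [HasZeroObject T] [Pretriangulated T] [∀ n : ℤ, (shiftFunctor T n).Additive] in
theorem conj_shift {X₁ X₃ Y₁ Y₃ X₁' X₃' Y₁' Y₃' : T} (α₁ : X₁ ≅ Y₁) (α₃ : X₃ ≅ Y₃) (α₁' : X₁' ≅ Y₁')
    (α₃' : X₃' ≅ Y₃') {d : X₃ ⟶ X₁⟦(1 : ℤ)⟧} {d' : X₃' ⟶ X₁'⟦(1 : ℤ)⟧} {k₁ : Y₁ ⟶ Y₁'}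
    {k₃ : Y₃ ⟶ Y₃'} (h : (α₃.hom ≫ k₃ ≫ α₃'.inv) ≫ d' =
      d ≫ (α₁.hom ≫ k₁ ≫ α₁'.inv)⟦(1 : ℤ)⟧') :
    k₃ ≫ α₃'.inv ≫ d' ≫ α₁'.hom⟦(1 : ℤ)⟧' =
      (α₃.inv ≫ d ≫ α₁.hom⟦(1 : ℤ)⟧') ≫ k₁⟦(1 : ℤ)⟧' := by
  simp only [Functor.map_comp, Category.assoc] at h
  rw [← cancel_epi α₃.hom, reassoc_of% h, ← Functor.map_comp, Iso.inv_hom_id,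
    CategoryTheory.Functor.map_id]
  simp

namespace AbelianModel

/-- The isomorphism in the stabilization given by an isomorphism in the abelian model. -/
noncomputable def preimage {X : A} {n : ℤ} {M : B} (e : (G.q n).obj X ≅ M) :
    (⟨X, n⟩ : Stabilization Ω) ≅ G.equiv.inverse.obj M :=
  G.equiv.unitIso.app _ ≪≫ G.equiv.inverse.mapIso e

theorem preimage_comm {X Y : A} {n : ℤ} {M N : B} (e : (G.q n).obj X ≅ M) (e' : (G.q n).obj Y ≅ N)
    {f : X ⟶ Y} {φ : M ⟶ N} (h : (G.q n).map f ≫ e'.hom = e.hom ≫ φ) :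
    Stabilization.incMap n f ≫ (G.preimage e').hom =
      (G.preimage e).hom ≫ G.equiv.inverse.map φ := by
  have h1 := G.equiv.unitIso.hom.naturality (Stabilization.incMap (Ω := Ω) n f)
  have h2 := congrArg G.equiv.inverse.map ((congrArg (· ≫ e'.hom) (G.lift_map_inc n f)).trans h)
  have h3 := (G.equiv.inverse.map_comp _ _).symm.trans (h2.trans (G.equiv.inverse.map_comp _ _))
  exact Stabilization.comp_square' (G.equiv.unitIso.app ⟨X, n⟩) (G.equiv.inverse.mapIso e)
    (G.equiv.unitIso.app ⟨Y, n⟩) (G.equiv.inverse.mapIso e') h1 h3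

/-- The functor from the abelian model to the triangulated category. -/
noncomputable abbrev toTriangulated : B ⥤ T := G.equiv.inverse ⋙ S.lift

theorem eq_of_inverse {M N : B} (f : M ⟶ N) : f = G.equiv.counitIso.inv.app M ≫
    G.lift.map (G.equiv.inverse.map f) ≫ G.equiv.counitIso.hom.app N :=
  eq_of_eq_conj (G.equiv.counitIso.app M) (G.equiv.counitIso.app N)
    (G.equiv.fun_inv_map M N f)

/-- No additive structure on the stabilization is used. Sums are formed at a common level, and
faithfulness of `G.lift` shows that the sum there is the image of `f + g`. -/
theorem toTriangulated_additive : (G.toTriangulated S).Additive where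
  map_add {M N f g} := by
    have := G.isEquivalence
    obtain ⟨p, a, b, ha, hb, f', g', hf, hg⟩ := Stabilization.exists_eq_common
      (G.equiv.inverse.map f) (G.equiv.inverse.map g)
    have h : G.equiv.inverse.map (f + g) =
        (Stabilization.shiftIso _ _ a p ha).inv ≫ Stabilization.incMap p (f' + g') ≫
          (Stabilization.shiftIso _ _ b p hb).hom := by
      refine G.lift.map_injective ?_
      refine Eq.trans ?_ (G.lift_map_add G.additive ha hb f' g').symm
      rw [← hf, ← hg]
      exact conj_add _ _ (G.equiv.fun_inv_map M N f) (G.equiv.fun_inv_map M N g)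
        (G.equiv.fun_inv_map M N (f + g))
    refine (congrArg S.lift.map h).trans ((S.lift_map_add S.additive ha hb f' g').trans ?_)
    rw [← hf, ← hg]
    rfl

theorem isZero_toTriangulated (Q : B) (hQ : Projective Q) :
    IsZero ((G.toTriangulated S).obj Q) := by
  obtain ⟨P, hP, n, ⟨r⟩⟩ := G.exists_retract Q hQ
  have h1 : IsZero ((G.toTriangulated S).obj ((G.q n).obj P)) :=
    (S.isZero n P hP).of_iso (S.lift.mapIso (G.preimage (Iso.refl ((G.q n).obj P)))).symm
  rw [IsZero.iff_id_eq_zero]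
  have h2 := (r.map (G.toTriangulated S)).retract
  rw [← h2, h1.eq_of_tgt ((r.map (G.toTriangulated S)).i) 0, zero_comp]

/-- The hypothesis `hS` is what `DeltaEmbedding.exists_factorization_of_map_eq` provides for the
Verdier quotient. A factorization through a projective `P` of `A` at level `p + k` becomes one
through the projective `q (p + k) P` of the model. -/
theorem stableRel_of_toTriangulated_map_eq
    (hS : ∀ {X V : A} {a b : ℕ} (f g : iterObj Ω X a ⟶ iterObj Ω V b) (p : ℤ),
      (S.q p).map f = (S.q p).map g → ∃ (k : ℕ) (P : A) (_ : Projective P)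
        (r : iterObj Ω X (a + k) ⟶ P) (t : P ⟶ iterObj Ω V (b + k)),
        Stabilization.raise f k - Stabilization.raise g k = r ≫ t)
    {M N : B} (f g : M ⟶ N) (h : (G.toTriangulated S).map f = (G.toTriangulated S).map g) :
    stableRel B f g := by
  obtain ⟨p, a, b, ha, hb, f', g', hf, hg⟩ := Stabilization.exists_eq_common
    (G.equiv.inverse.map f) (G.equiv.inverse.map g)
  have h1 : S.lift.map (G.equiv.inverse.map f) = S.lift.map (G.equiv.inverse.map g) := h
  rw [hf, hg] at h1
  have h2 := (S.lift_map_eq ha hb f').symm.trans (h1.trans (S.lift_map_eq ha hb g'))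
  have h3 : (S.q p).map f' = (S.q p).map g' :=
    (cancel_mono (S.lift.map (Stabilization.shiftIso _ _ b p hb).hom)).1
      ((cancel_epi (S.lift.map (Stabilization.shiftIso _ _ a p ha).inv)).1 h2)
  obtain ⟨k, P, hP, r, t, hrt⟩ := hS f' g' p h3
  have hak : (G.equiv.inverse.obj M).deg + (a + k : ℕ) = p + k := by rw [← ha]; push_cast; ring
  have hbk : (G.equiv.inverse.obj N).deg + (b + k : ℕ) = p + k := by rw [← hb]; push_cast; ring
  have raise_eq : ∀ u : iterObj Ω (G.equiv.inverse.obj M).obj a ⟶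
      iterObj Ω (G.equiv.inverse.obj N).obj b,
      (Stabilization.shiftIso _ _ a p ha).inv ≫ Stabilization.incMap p u ≫
        (Stabilization.shiftIso _ _ b p hb).hom =
      (Stabilization.shiftIso _ _ (a + k) (p + k) hak).inv ≫
        Stabilization.incMap (p + k) (Stabilization.raise u k) ≫
        (Stabilization.shiftIso _ _ (b + k) (p + k) hbk).hom := by
    intro u
    refine (Stabilization.cls_eq u p ha hb (ha.trans hb.symm)).symm.trans
      (Eq.trans ?_ (Stabilization.cls_eq _ (p + k) hak hbk (hak.trans hbk.symm)))
    exact (Stabilization.cls_raise (Stabilization.Rep.mk (X := G.equiv.inverse.obj M)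
      (Y := G.equiv.inverse.obj N) a b (ha.trans hb.symm) u) k).symm
  rw [raise_eq] at hf hg
  have h4 : G.lift.map (G.equiv.inverse.map f) - G.lift.map (G.equiv.inverse.map g) =
      (G.lift.map (Stabilization.shiftIso _ _ (a + k) (p + k) hak).inv ≫ (G.q (p + k)).map r) ≫
        ((G.q (p + k)).map t ≫
          G.lift.map (Stabilization.shiftIso _ _ (b + k) (p + k) hbk).hom) := by
    refine conj_sub _ _ ((congrArg G.lift.map hf).trans (G.lift_map_eq hak hbk _))
      ((congrArg G.lift.map hg).trans (G.lift_map_eq hak hbk _)) ?_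
    exact (G.q (p + k)).map_sub.symm.trans ((congrArg _ hrt).trans ((G.q (p + k)).map_comp r t))
  refine ⟨(G.q (p + k)).obj P, G.projective _ P hP, G.equiv.counitIso.inv.app M ≫
    (G.lift.map (Stabilization.shiftIso _ _ (a + k) (p + k) hak).inv ≫ (G.q (p + k)).map r),
    ((G.q (p + k)).map t ≫ G.lift.map (Stabilization.shiftIso _ _ (b + k) (p + k) hbk).hom) ≫
      G.equiv.counitIso.hom.app N, ?_⟩
  exact conj_sub _ _ (G.eq_of_inverse f) (G.eq_of_inverse g) h4

section δ

variable {E E' : ShortComplex B} (hE : E.ShortExact) (hE' : E'.ShortExact)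

/-- The connecting morphism of a short exact sequence in the abelian model. -/
noncomputable def δ :
    (G.toTriangulated S).obj E.X₃ ⟶ ((G.toTriangulated S).obj E.X₁)⟦(1 : ℤ)⟧ :=
  have h := G.exists_iso hE
  S.lift.map (G.preimage h.choose_spec.choose_spec.choose_spec.choose_spec.choose_spec.choose).inv ≫
    S.δ h.choose_spec.choose_spec.choose h.choose ≫
    (S.lift.map (G.preimage h.choose_spec.choose_spec.choose_spec.choose).hom)⟦(1 : ℤ)⟧'

theorem exists_δ_eq : ∃ (n : ℤ) (R : ShortComplex A) (hR : R.ShortExact)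
    (e₁ : (G.q n).obj R.X₁ ≅ E.X₁) (e₂ : (G.q n).obj R.X₂ ≅ E.X₂) (e₃ : (G.q n).obj R.X₃ ≅ E.X₃)
    (_ : (G.q n).map R.f ≫ e₂.hom = e₁.hom ≫ E.f) (_ : (G.q n).map R.g ≫ e₃.hom = e₂.hom ≫ E.g),
    G.δ S hE = S.lift.map (G.preimage e₃).inv ≫ S.δ hR n ≫
      (S.lift.map (G.preimage e₁).hom)⟦(1 : ℤ)⟧' :=
  have h := G.exists_iso hE
  ⟨h.choose, h.choose_spec.choose, h.choose_spec.choose_spec.choose, _, _, _,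
    h.choose_spec.choose_spec.choose_spec.choose_spec.choose_spec.choose_spec.1,
    h.choose_spec.choose_spec.choose_spec.choose_spec.choose_spec.choose_spec.2, rfl⟩

theorem δ_dist : Triangle.mk ((G.toTriangulated S).map E.f) ((G.toTriangulated S).map E.g)
    (G.δ S hE) ∈ distTriang T := by
  obtain ⟨n, R, hR, e₁, e₂, e₃, h₁, h₂, h⟩ := G.exists_δ_eq S hE
  have c₁ := congrArg S.lift.map (G.preimage_comm e₁ e₂ h₁)
  have c₂ := congrArg S.lift.map (G.preimage_comm e₂ e₃ h₂)
  have c₁' := (congrArg (· ≫ _) (S.lift_map_inc n R.f)).symm.trans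
    ((S.lift.map_comp _ _).symm.trans (c₁.trans (S.lift.map_comp _ _)))
  have c₂' := (congrArg (· ≫ _) (S.lift_map_inc n R.g)).symm.trans
    ((S.lift.map_comp _ _).symm.trans (c₂.trans (S.lift.map_comp _ _)))
  refine isomorphic_distinguished _ (S.dist hR n) _ (Iso.symm (Triangle.isoMk _ _
    (S.lift.mapIso (G.preimage e₁)) (S.lift.mapIso (G.preimage e₂))
    (S.lift.mapIso (G.preimage e₃)) c₁' c₂' ?_))
  refine Eq.trans ?_ (congrArg (S.lift.map (G.preimage e₃).hom ≫ ·) h).symm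
  exact ((S.lift.mapIso (G.preimage e₃)).hom_inv_id_assoc _).symm

/-- The chosen presentations of `E` and `E'` may sit at unrelated levels; this is why
`DeltaLevels.δ_natural` allows arbitrary morphisms of the stabilization between two levels. -/
theorem δ_nat (φ : E ⟶ E') : (G.toTriangulated S).map φ.τ₃ ≫ G.δ S hE' =
    G.δ S hE ≫ ((G.toTriangulated S).map φ.τ₁)⟦(1 : ℤ)⟧' := by
  obtain ⟨n, R, hR, e₁, e₂, e₃, h₁, h₂, h⟩ := G.exists_δ_eq S hE
  obtain ⟨n', R', hR', e₁', e₂', e₃', h₁', h₂', h'⟩ := G.exists_δ_eq S hE'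
  have c₁ := G.preimage_comm e₁ e₂ h₁
  have c₂ := G.preimage_comm e₂ e₃ h₂
  have c₁' := G.preimage_comm e₁' e₂' h₁'
  have c₂' := G.preimage_comm e₂' e₃' h₂'
  have key := S.δ_natural G hR hR' n n'
    ((G.preimage e₁).hom ≫ G.equiv.inverse.map φ.τ₁ ≫ (G.preimage e₁').inv)
    ((G.preimage e₂).hom ≫ G.equiv.inverse.map φ.τ₂ ≫ (G.preimage e₂').inv)
    ((G.preimage e₃).hom ≫ G.equiv.inverse.map φ.τ₃ ≫ (G.preimage e₃').inv)
    (conj_comm _ _ _ _ c₁ c₁' ((G.equiv.inverse.map_comp _ _).symm.trans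
      ((congrArg G.equiv.inverse.map φ.comm₁₂).trans (G.equiv.inverse.map_comp _ _))))
    (conj_comm _ _ _ _ c₂ c₂' ((G.equiv.inverse.map_comp _ _).symm.trans
      ((congrArg G.equiv.inverse.map φ.comm₂₃).trans (G.equiv.inverse.map_comp _ _))))
  have hm : ∀ {X Y : A} {M N : B} {l l' : ℤ} (e : (G.q l).obj X ≅ M) (e' : (G.q l').obj Y ≅ N)
      (u : M ⟶ N), S.lift.map ((G.preimage e).hom ≫ G.equiv.inverse.map u ≫ (G.preimage e').inv) =
      (S.lift.mapIso (G.preimage e)).hom ≫ (G.toTriangulated S).map u ≫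
        (S.lift.mapIso (G.preimage e')).inv := fun e e' u =>
    (S.lift.map_comp _ _).trans (congrArg (_ ≫ ·) (S.lift.map_comp _ _))
  rw [h, h']
  refine conj_shift (S.lift.mapIso (G.preimage e₁)) (S.lift.mapIso (G.preimage e₃))
    (S.lift.mapIso (G.preimage e₁')) (S.lift.mapIso (G.preimage e₃')) ?_
  exact (congrArg (· ≫ _) (hm e₃ e₃' φ.τ₃)).symm.trans (key.trans
    (congrArg (fun z => _ ≫ z⟦(1 : ℤ)⟧') (hm e₁ e₁' φ.τ₁)))

end δ

/-- The functor from the abelian model to the triangulated category identifies the latter with the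
stable category. -/
noncomputable def stableDeltaFunctor (hfull : S.lift.Full) (hess : S.lift.EssSurj)
    (hS : ∀ {X V : A} {a b : ℕ} (f g : iterObj Ω X a ⟶ iterObj Ω V b) (p : ℤ),
      (S.q p).map f = (S.q p).map g → ∃ (k : ℕ) (P : A) (_ : Projective P)
        (r : iterObj Ω X (a + k) ⟶ P) (t : P ⟶ iterObj Ω V (b + k)),
        Stabilization.raise f k - Stabilization.raise g k = r ≫ t) : StableDeltaFunctor B T where
  F := G.toTriangulated S
  additive := G.toTriangulated_additive S
  full := inferInstance
  essSurj := inferInstance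
  isZero P hP := G.isZero_toTriangulated S P hP
  stableRel_of_map_eq f g h := G.stableRel_of_toTriangulated_map_eq S hS f g h
  δ hE := G.δ S hE
  dist hE := G.δ_dist S hE
  nat hE hE' φ := G.δ_nat S hE hE' φ

end AbelianModel

end StableDelta

/-! ### The triangle equivalence with the stable category -/

section StableEquivalence

open Pretriangulated

variable {B : Type u} [Category.{v} B] [Abelian B] [IsFrobeniusAbelian B]
  {T : Type*} [Category* T] [Preadditive T] [HasZeroObject T] [HasShift T ℤ]
  [∀ n : ℤ, (shiftFunctor T n).Additive] [Pretriangulated T]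

namespace StableDeltaFunctor

variable (H : StableDeltaFunctor B T)

theorem map_eq_of_stableRel {X Y : B} (f g : X ⟶ Y) (h : stableRel B f g) :
    H.F.map f = H.F.map g := by
  obtain ⟨P, hP, s, t, h⟩ := h
  rw [← sub_eq_zero, ← Functor.map_sub, h, Functor.map_comp,
    (H.isZero P hP).eq_of_tgt (H.F.map s) 0,
    zero_comp]

/-- The induced functor on the stable category. -/
abbrev stableFunctor : StableCategory B ⥤ T :=
  CategoryTheory.Quotient.lift (stableRel B) H.F (fun _ _ => H.map_eq_of_stableRel)

instance : H.stableFunctor.Full where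
  map_surjective {X Y} f := by
    obtain ⟨g, hg⟩ := H.F.map_surjective f
    exact ⟨stableMap g, hg⟩

instance : H.stableFunctor.Faithful where
  map_injective {X Y} f g h := by
    obtain ⟨f, rfl⟩ := (CategoryTheory.Quotient.functor (stableRel B)).map_surjective f
    obtain ⟨g, rfl⟩ := (CategoryTheory.Quotient.functor (stableRel B)).map_surjective g
    exact stableMap_eq (H.stableRel_of_map_eq f g h)

instance : H.stableFunctor.EssSurj where
  mem_essImage t := ⟨StableCategory.of (H.F.objPreimage t), ⟨H.F.objObjPreimageIso t⟩⟩

instance : H.stableFunctor.IsEquivalence where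

/-- The short exact sequence `X ⟶ I(X) ⟶ Σ X`. -/
theorem shortExact_susp (X : B) : (ShortComplex.mk (Injective.ι X) (StableCategory.suspπ X)
    (StableCategory.ι_suspπ X)).ShortExact :=
  ShortComplex.ShortExact.mk' (ShortComplex.exact_cokernel _) inferInstance inferInstance

/-- The morphism `F(Σ X) ⟶ F(X)⟦1⟧`. -/
noncomputable def κ (X : B) : H.F.obj (StableCategory.suspObj X) ⟶ (H.F.obj X)⟦(1 : ℤ)⟧ :=
  -- This sign makes the standard triangle of the stable category distinguished with third morphism
  -- `F c ≫ κ`.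
  -H.δ (shortExact_susp X)

instance (X : B) : IsIso (H.κ X) := by
  have h0 : IsZero (H.F.obj (Injective.under X)) :=
    H.isZero _ ((IsFrobeniusAbelian.projective_iff_injective _).2 inferInstance)
  have h1 : IsIso (H.δ (shortExact_susp X)) :=
    (Triangle.isZero₂_iff_isIso₃ _ (H.dist (shortExact_susp X))).1 h0
  exact ⟨-inv (H.δ (shortExact_susp X)), by simp [κ], by simp [κ]⟩

/-- The isomorphism `F(Σ X) ≅ F(X)⟦1⟧`. -/
noncomputable def κIso (X : B) : H.F.obj (StableCategory.suspObj X) ≅ (H.F.obj X)⟦(1 : ℤ)⟧ :=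
  asIso (H.κ X)

theorem κ_natural {X Y : B} (f : X ⟶ Y) :
    H.F.map (StableCategory.suspMap f) ≫ H.κ Y = H.κ X ≫ (H.F.map f)⟦(1 : ℤ)⟧' := by
  have := H.nat (shortExact_susp X) (shortExact_susp Y)
    { τ₁ := f, τ₂ := StableCategory.underMap f, τ₃ := StableCategory.suspMap f
      comm₁₂ := (StableCategory.ι_underMap f).symm
      comm₂₃ := (StableCategory.suspπ_suspMap f).symm }
  unfold κ
  rw [Preadditive.neg_comp, ← this]
  exact Preadditive.comp_neg _ _

/-- The compatibility of the functor with the suspension. -/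
noncomputable def suspIso :
    StableCategory.susp B ⋙ H.stableFunctor ≅ H.stableFunctor ⋙ shiftFunctor T (1 : ℤ) :=
  NatIso.ofComponents (fun X => H.κIso X.as) (fun {X Y} f => by
    obtain ⟨f, rfl⟩ := (CategoryTheory.Quotient.functor (stableRel B)).map_surjective f
    exact H.κ_natural f)

/-- The pushout is a short exact sequence `A ⟶ C ⊕ I(A) ⟶ D`, and `I(A)` vanishes in `T`, so its
triangle has vertices `A`, `C`, `D`. Comparing it with `A ⟶ I(A) ⟶ Σ A` by `(1, -snd, -c)` evaluates
its connecting morphism as `-F c ≫ δ = F c ≫ κ`. -/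
theorem standard_distinguished {A C D : B} (a : A ⟶ C) (b : C ⟶ D) (i : Injective.under A ⟶ D)
    (c : D ⟶ StableCategory.suspObj A) (h : IsPushout a (Injective.ι A) b i) (hb : b ≫ c = 0)
    (hi : i ≫ c = StableCategory.suspπ A) :
    Triangle.mk (H.F.map a) (H.F.map b) (H.F.map c ≫ H.κ A) ∈ distTriang T := by
  let E : ShortComplex B := ShortComplex.mk (biprod.lift a (-Injective.ι A)) (biprod.desc b i) (by
    rw [biprod.lift_desc, h.w, Preadditive.neg_comp, add_neg_cancel])
  have hE : E.ShortExact := by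
    refine ShortComplex.ShortExact.mk' ?_ ?_ ?_
    · exact h.exact_shortComplex
    · have : Mono (biprod.lift a (-Injective.ι A) ≫ biprod.snd) := by
        rw [biprod.lift_snd]; infer_instance
      exact mono_of_mono _ (biprod.snd : C ⊞ Injective.under A ⟶ _)
    · exact h.epi_shortComplex_g
  have h0 : H.F.map (biprod.snd : C ⊞ Injective.under A ⟶ _) = 0 :=
    (H.isZero _ ((IsFrobeniusAbelian.projective_iff_injective _).2 inferInstance)).eq_of_tgt _ _
  let e : H.F.obj C ≅ H.F.obj (C ⊞ Injective.under A) := ⟨H.F.map biprod.inl, H.F.map biprod.fst, by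
    rw [← Functor.map_comp, biprod.inl_fst, CategoryTheory.Functor.map_id], by
    have := congrArg H.F.map (biprod.total (X := C) (Y := Injective.under A))
    rwa [Functor.map_add, Functor.map_comp, Functor.map_comp, h0, zero_comp, add_zero,
      CategoryTheory.Functor.map_id] at this⟩
  have n := H.nat hE (shortExact_susp A)
    { τ₁ := 𝟙 A, τ₂ := -biprod.snd, τ₃ := -c
      comm₁₂ := by
        refine (Category.id_comp _).trans ?_
        change _ = biprod.lift a (-Injective.ι A) ≫ (-biprod.snd)
        rw [Preadditive.comp_neg, biprod.lift_snd, neg_neg]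
      comm₂₃ := by
        change (-biprod.snd) ≫ StableCategory.suspπ A = biprod.desc b i ≫ (-c)
        ext
        · simp [hb]
        · simp [hi] }
  refine isomorphic_distinguished _ (H.dist hE) _ (Triangle.isoMk _ _ (Iso.refl (H.F.obj A)) e
    (Iso.refl (H.F.obj D)) ?_ ?_ ?_)
  · change H.F.map a ≫ e.hom = 𝟙 _ ≫ H.F.map (biprod.lift a (-Injective.ι A))
    rw [Category.id_comp, ← Iso.eq_comp_inv]
    change _ = H.F.map _ ≫ H.F.map biprod.fst
    rw [← Functor.map_comp, biprod.lift_fst]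
  · change H.F.map b ≫ 𝟙 _ = H.F.map biprod.inl ≫ H.F.map (biprod.desc b i)
    rw [← Functor.map_comp, biprod.inl_desc, Category.comp_id]
  · change (H.F.map c ≫ H.κ A) ≫ (𝟙 (H.F.obj A))⟦(1 : ℤ)⟧' = 𝟙 _ ≫ H.δ hE
    change H.F.map (-c) ≫ _ = H.δ hE ≫ (H.F.map (𝟙 A))⟦(1 : ℤ)⟧' at n
    rw [CategoryTheory.Functor.map_id] at n
    have e2 : (𝟙 (H.F.obj A))⟦(1 : ℤ)⟧' = 𝟙 _ := CategoryTheory.Functor.map_id _ _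
    rw [e2] at n ⊢
    rw [Category.comp_id, Category.id_comp]
    refine Eq.trans ?_ (n.trans (Category.comp_id _))
    rw [Functor.map_neg]
    exact (Preadditive.comp_neg _ _).trans (Preadditive.neg_comp _ _).symm

theorem suspIso_natural {X Y : StableCategory B} (f : X ⟶ Y) :
    H.stableFunctor.map ((StableCategory.susp B).map f) ≫ H.κ Y.as =
      H.κ X.as ≫ (H.stableFunctor.map f)⟦(1 : ℤ)⟧' :=
  H.suspIso.hom.naturality f

/-- For the converse, the first morphism lifts to some `a` in `B`. A distinguished triangle is
determined up to isomorphism by its first morphism, so it is isomorphic to the image of the standard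
triangle of `a`, and full faithfulness lifts the isomorphism of third vertices. -/
theorem isTriangle_iff {X Y Z : StableCategory B} (u : X ⟶ Y) (v : Y ⟶ Z)
    (w : Z ⟶ (StableCategory.susp B).obj X) : StableCategory.IsTriangle u v w ↔
      Triangle.mk (H.stableFunctor.map u) (H.stableFunctor.map v)
        (H.stableFunctor.map w ≫ H.κ X.as) ∈ distTriang T := by
  constructor
  · rintro ⟨A, C, D, a, b, i, c, hp, hb, hi, eX, eY, eZ, h₁, h₂, h₃⟩
    refine isomorphic_distinguished _ (H.standard_distinguished a b i c hp hb hi) _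
      (Triangle.isoMk _ _ (H.stableFunctor.mapIso eX) (H.stableFunctor.mapIso eY)
        (H.stableFunctor.mapIso eZ) ?_ ?_ ?_)
    · exact (H.stableFunctor.map_comp _ _).symm.trans
        ((congrArg H.stableFunctor.map h₁).trans (H.stableFunctor.map_comp _ _))
    · exact (H.stableFunctor.map_comp _ _).symm.trans
        ((congrArg H.stableFunctor.map h₂).trans (H.stableFunctor.map_comp _ _))
    · refine (Category.assoc _ _ _).trans
        ((congrArg (H.stableFunctor.map w ≫ ·) (H.suspIso_natural eX.hom)).symm.trans ?_)
      refine (Category.assoc _ _ _).symm.trans (Eq.trans ?_ (Category.assoc _ _ _))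
      refine congrArg (· ≫ H.κ A) ?_
      exact (H.stableFunctor.map_comp _ _).symm.trans
        ((congrArg H.stableFunctor.map h₃).trans (H.stableFunctor.map_comp _ _))
  · intro ht
    obtain ⟨a, rfl⟩ := (CategoryTheory.Quotient.functor (stableRel B)).map_surjective
      (X := X.as) (Y := Y.as) u
    let b := pushout.inl a (Injective.ι X.as)
    let i := pushout.inr a (Injective.ι X.as)
    let c : pushout a (Injective.ι X.as) ⟶ StableCategory.suspObj X.as :=
      pushout.desc 0 (StableCategory.suspπ X.as) (by rw [comp_zero, StableCategory.ι_suspπ])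
    have hp : IsPushout a (Injective.ι X.as) b i := IsPushout.of_hasPushout _ _
    have hb : b ≫ c = 0 := pushout.inl_desc _ _ _
    have hi : i ≫ c = StableCategory.suspπ X.as := pushout.inr_desc _ _ _
    let e := isoTriangleOfIso₁₂ _ _ ht (H.standard_distinguished a b i c hp hb hi) (Iso.refl _)
      (Iso.refl _) ((Category.comp_id _).trans (Category.id_comp _).symm)
    let e₃ : H.stableFunctor.obj Z ≅ H.stableFunctor.obj (StableCategory.of (pushout a _)) :=
      Triangle.π₃.mapIso e
    have c₂ : H.stableFunctor.map v ≫ e₃.hom = H.F.map b := by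
      refine e.hom.comm₂.trans ?_
      exact (congrArg (· ≫ H.F.map b) (isoTriangleOfIso₁₂_hom_hom₂ _ _ _ _ _ _ _)).trans
        (Category.id_comp _)
    have c₃ : H.stableFunctor.map w ≫ H.κ X.as = e₃.hom ≫ H.F.map c ≫ H.κ X.as := by
      refine Eq.trans ?_ e.hom.comm₃
      refine Eq.trans ?_ (congrArg (fun z => (H.stableFunctor.map w ≫ H.κ X.as) ≫ z⟦(1 : ℤ)⟧')
        (isoTriangleOfIso₁₂_hom_hom₁ _ _ _ _ _ _ _)).symm
      exact ((congrArg (_ ≫ ·) ((shiftFunctor T (1 : ℤ)).map_id _)).trans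
        (Category.comp_id _)).symm
    refine ⟨X.as, Y.as, _, a, b, i, c, hp, hb, hi, Iso.refl _, Iso.refl _,
      H.stableFunctor.preimageIso e₃, (Category.comp_id _).trans (Category.id_comp _).symm, ?_, ?_⟩
    · refine Eq.trans (H.stableFunctor.map_injective ?_) (Category.id_comp (stableMap b)).symm
      refine (H.stableFunctor.map_comp _ _).trans ?_
      exact (congrArg (_ ≫ ·) (H.stableFunctor.map_preimage _)).trans c₂
    · refine ((congrArg (w ≫ ·) ((StableCategory.susp B).map_id X)).trans
        (Category.comp_id w)).trans (H.stableFunctor.map_injective ?_)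
      refine Eq.trans ?_ (H.stableFunctor.map_comp _ _).symm
      refine Eq.trans ?_ (congrArg (· ≫ _) (H.stableFunctor.map_preimage _)).symm
      exact (cancel_mono (H.κ X.as)).1 (c₃.trans (Category.assoc _ _ _).symm)

/-- The equivalence between the stable category and the triangulated category. -/
noncomputable abbrev stableEquiv : StableCategory B ≌ T := H.stableFunctor.asEquivalence

/-- The compatibility of the quasi-inverse functor with the suspension. -/
noncomputable def shiftIso : shiftFunctor T (1 : ℤ) ⋙ H.stableEquiv.inverse ≅
    H.stableEquiv.inverse ⋙ StableCategory.susp B :=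
  NatIso.ofComponents (fun t => H.stableFunctor.preimageIso
    (H.stableEquiv.counitIso.app (t⟦(1 : ℤ)⟧) ≪≫
      ((shiftFunctor T (1 : ℤ)).mapIso (H.stableEquiv.counitIso.app t)).symm ≪≫
      (H.suspIso.app (H.stableEquiv.inverse.obj t)).symm)) (fun {t t'} f => by
    refine H.stableFunctor.map_injective ?_
    refine (H.stableFunctor.map_comp _ _).trans (Eq.trans ?_ (H.stableFunctor.map_comp _ _).symm)
    refine (congrArg (_ ≫ ·) (H.stableFunctor.map_preimage _)).trans
      (Eq.trans ?_ (congrArg (· ≫ _) (H.stableFunctor.map_preimage _)).symm)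
    have n₁ := H.stableEquiv.counitIso.hom.naturality (f⟦(1 : ℤ)⟧')
    have n₂ := ((shiftFunctor T (1 : ℤ)).map_comp _ _).symm.trans ((congrArg (fun z => z⟦(1 : ℤ)⟧')
      (H.stableEquiv.counitIso.inv.naturality f)).trans ((shiftFunctor T (1 : ℤ)).map_comp _ _))
    have n₃ := H.suspIso.inv.naturality (H.stableEquiv.inverse.map f)
    exact DeltaEmbedding.comp_square n₁ (DeltaEmbedding.comp_square n₂ n₃))

theorem comp_inv_inv_comp {C : Type*} [Category* C] {W X Y Z : C} (a : W ⟶ X) (β : Y ≅ X)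
    (κ : Z ≅ Y) :
    (a ≫ β.inv ≫ κ.inv) ≫ κ.hom ≫ β.hom = a := by
  simp

theorem shiftIso_spec (t : T) : H.stableFunctor.map (H.shiftIso.hom.app t) ≫
    H.κ (H.stableEquiv.inverse.obj t).as ≫ (H.stableEquiv.counitIso.hom.app t)⟦(1 : ℤ)⟧' =
      H.stableEquiv.counitIso.hom.app (t⟦(1 : ℤ)⟧) := by
  refine (congrArg (· ≫ _) (H.stableFunctor.map_preimage _)).trans ?_
  exact comp_inv_inv_comp _ ((shiftFunctor T (1 : ℤ)).mapIso (H.stableEquiv.counitIso.app t))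
    (H.κIso _)

/-- The triangle equivalence given by a stable delta functor. -/
noncomputable def triangleEquivalence : TriangleEquivalenceToStable T B where
  equiv := H.stableEquiv.symm
  commShift := H.shiftIso
  distinguished_iff t := by
    refine Iff.trans ?_ (H.isTriangle_iff _ _ _).symm
    let e := Triangle.isoMk (Triangle.mk (H.stableFunctor.map (H.stableEquiv.inverse.map t.mor₁))
      (H.stableFunctor.map (H.stableEquiv.inverse.map t.mor₂))
      (H.stableFunctor.map (H.stableEquiv.inverse.map t.mor₃ ≫ H.shiftIso.hom.app t.obj₁) ≫
        H.κ _)) t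
      (H.stableEquiv.counitIso.app t.obj₁) (H.stableEquiv.counitIso.app t.obj₂)
      (H.stableEquiv.counitIso.app t.obj₃) (H.stableEquiv.counitIso.hom.naturality _)
      (H.stableEquiv.counitIso.hom.naturality _) (by
        refine Eq.trans ?_ (H.stableEquiv.counitIso.hom.naturality t.mor₃)
        refine (Category.assoc _ _ _).trans ((congrArg (· ≫ _)
          (H.stableFunctor.map_comp _ _)).trans ((Category.assoc _ _ _).trans ?_))
        exact congrArg (_ ≫ ·) (H.shiftIso_spec t.obj₁))
    exact ⟨fun h => isomorphic_distinguished _ h _ e,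
      fun h => isomorphic_distinguished _ h _ e.symm⟩

end StableDeltaFunctor

end StableEquivalence

/-! ### The bounded derived category -/

section BoundedDerived

attribute [local instance] HasDerivedCategory.standard

open Pretriangulated DerivedCategory

variable {A : Type u} [Category.{v} A] [Abelian A]

/-- Morphisms in the derived category from a bounded below complex of projectives to a complex
concentrated in smaller degrees vanish. -/
theorem Q_hom_eq_zero_of_isKProjective (K L : CochainComplex A ℤ) [K.IsKProjective] (a b : ℤ)
    [K.IsStrictlyGE a] [L.IsStrictlyLE b] (h : b < a) (f : Q.obj K ⟶ Q.obj L) : f = 0 := by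
  let e := quotientCompQhIso A
  -- K-projectivity of the source represents the morphism by a chain map, which is zero in each
  -- degree because the two complexes have disjoint supports.
  obtain ⟨g, hg⟩ := (CochainComplex.IsKProjective.Qh_map_bijective K
    ((HomotopyCategory.quotient A (.up ℤ)).obj L)).surjective (e.hom.app K ≫ f ≫ e.inv.app L)
  obtain ⟨g, rfl⟩ := (HomotopyCategory.quotient _ _).map_surjective g
  have h0 : g = 0 := by
    ext i
    by_cases hi : i < a
    · exact (K.isZero_of_isStrictlyGE a i hi).eq_of_src _ _
    · exact (L.isZero_of_isStrictlyLE b i (by omega)).eq_of_tgt _ _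
  subst h0
  have h1 : e.hom.app K ≫ f ≫ e.inv.app L = 0 := by
    refine hg.symm.trans ?_
    simp only [CategoryTheory.Functor.map_zero]
  rw [← cancel_epi (e.hom.app K), ← cancel_mono (e.inv.app L), Category.assoc, h1]
  simp

theorem bounded_singleFunctor (X : A) :
    (TStructure.t : Triangulated.TStructure (DerivedCategory A)).bounded
      ((singleFunctor A 0).obj X) :=
  ⟨⟨0, inferInstance⟩, ⟨0, inferInstance⟩⟩

variable (A) in
/-- The functor sending an object to the complex concentrated in degree zero. -/
noncomputable abbrev DerivedCategory.Bounded.single : A ⥤ DerivedCategory.Bounded A :=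
  ObjectProperty.lift _ (singleFunctor A 0) bounded_singleFunctor

/-- The morphism of a full subcategory with a shift, given by a morphism to a shifted object. -/
noncomputable def homMkShift {D : Type*} [Category* D] [HasShift D ℤ]
    {P : ObjectProperty D} [P.IsStableUnderShift ℤ] {X Y : P.FullSubcategory} {n : ℤ}
    (h : X.obj ⟶ Y.obj⟦n⟧) : X ⟶ Y⟦n⟧ :=
  ObjectProperty.homMk (h ≫ (P.ι.commShiftIso n).inv.app Y)

theorem distinguished_homMkShift {D : Type*} [Category* D] [Preadditive D] [HasZeroObject D]
    [HasShift D ℤ] [∀ n : ℤ, (shiftFunctor D n).Additive] [Pretriangulated D]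
    (P : ObjectProperty D) [P.IsTriangulated] {X Y Z : P.FullSubcategory} (f : X ⟶ Y)
    (g : Y ⟶ Z) (h : Z.obj ⟶ X.obj⟦(1 : ℤ)⟧)
    (H : Triangle.mk f.hom g.hom h ∈ distTriang D) :
    Triangle.mk f g (homMkShift h : Z ⟶ X⟦(1 : ℤ)⟧) ∈ distTriang P.FullSubcategory := by
  refine isomorphic_distinguished _ H _ (Triangle.isoMk _ _ (Iso.refl _) (Iso.refl _) (Iso.refl _)
    ?_ ?_ ?_)
  · exact (Category.comp_id _).trans (Category.id_comp _).symm
  · exact (Category.comp_id _).trans (Category.id_comp _).symm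
  · have h1 : ((h ≫ (P.ι.commShiftIso (1 : ℤ)).inv.app X) ≫
        (P.ι.commShiftIso (1 : ℤ)).hom.app X) = h := by simp
    refine Eq.trans ?_ (h1.trans (Category.id_comp _).symm)
    exact (congrArg _ ((shiftFunctor D (1 : ℤ)).map_id _)).trans (Category.comp_id _)

variable (A) in
/-- The embedding of an abelian category in its bounded derived category. -/
noncomputable def boundedDeltaEmbedding : DeltaEmbedding A (DerivedCategory.Bounded A) where
  s := DerivedCategory.Bounded.single A
  additive := ⟨fun {X Y f g} => by
    ext
    exact (singleFunctor A 0).map_add⟩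
  full := inferInstance
  faithful := inferInstance
  δ {S} hS := homMkShift hS.singleδ
  dist {S} hS := distinguished_homMkShift _ _ _ _ hS.singleTriangle_distinguished
  nat {S S'} hS hS' φ := by
    have h1 : (singleFunctor A 0).map φ.τ₃ ≫ hS'.singleδ =
        hS.singleδ ≫ ((singleFunctor A 0).map φ.τ₁)⟦(1 : ℤ)⟧' :=
      (ShortComplex.ShortExact.singleTriangle.map hS hS' φ).comm₃.symm
    ext
    have h2 := (Bounded.ι (C := A)).commShiftIso_inv_naturality
      ((Bounded.single A).map φ.τ₁) (1 : ℤ)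
    refine (Category.assoc _ _ _).symm.trans ((congrArg (· ≫ _) h1).trans ?_)
    refine (Category.assoc _ _ _).trans (Eq.trans ?_ (Category.assoc _ _ _).symm)
    exact congrArg (hS.singleδ ≫ ·) h2

/-- The shift of a complex concentrated in degree zero, as the image of a complex. -/
noncomputable def boundedQObjIso (X : A) (n : ℤ) :
    (((boundedDeltaEmbedding A).q n).obj X).obj ≅
      Q.obj (((CochainComplex.singleFunctor A 0).obj X)⟦n⟧) :=
  (Bounded.ι.commShiftIso n).app _ ≪≫
    (shiftFunctor _ n).mapIso ((singleFunctorIsoCompQ A 0).app X) ≪≫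
    (Q.commShiftIso n).symm.app _

theorem eq_zero_of_iso_isKProjective {X Y : DerivedCategory.Bounded A} (K L : CochainComplex A ℤ)
    [K.IsKProjective] (a b : ℤ) [K.IsStrictlyGE a] [L.IsStrictlyLE b] (h : b < a)
    (e : X.obj ≅ Q.obj K) (e' : Y.obj ≅ Q.obj L) (f : X ⟶ Y) : f = 0 := by
  ext
  have := Q_hom_eq_zero_of_isKProjective K L a b h (e.inv ≫ f.hom ≫ e'.hom)
  rw [← cancel_epi e.inv, ← cancel_mono e'.hom, Category.assoc, this]
  exact (zero_comp.symm.trans (comp_zero.symm =≫ _)).trans rfl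

theorem projective_single_X (P : A) [Projective P] (i : ℤ) :
    Projective (((CochainComplex.singleFunctor A 0).obj P).X i) := by
  by_cases h : i = 0
  · subst h
    exact Projective.of_iso (HomologicalComplex.singleObjXSelf (.up ℤ) 0 P).symm inferInstance
  · exact (HomologicalComplex.isZero_single_obj_X (.up ℤ) 0 P i h).projective

variable (A) in
-- An object at level `n` sits in cohomological degree `-n`, so raising the level moves it below the
-- support of any fixed bounded complex of projectives.
theorem boundedDeltaEmbedding_isPerfect :
    (boundedDeltaEmbedding A).IsPerfect (boundedPerfect A) where
  of_projective P hP :=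
    ⟨(CochainComplex.singleFunctor A 0).obj P, 0, 0, inferInstance, inferInstance,
      projective_single_X P, ⟨(singleFunctorIsoCompQ A 0).app P⟩⟩
  hom_projective P V n p hP hnp f := by
    let K := ((CochainComplex.singleFunctor A 0).obj P)⟦n⟧
    have : K.IsStrictlyGE (-n) := CochainComplex.isStrictlyGE_shift _ 0 n (-n) (by lia)
    have : K.IsStrictlyLE (-n) := CochainComplex.isStrictlyLE_shift _ 0 n (-n) (by lia)
    have : ∀ i, Projective (K.X i) := fun i => projective_single_X P (i + n)
    have : K.IsKProjective := CochainComplex.isKProjective_of_projective K (-n)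
    have := CochainComplex.isStrictlyLE_shift ((CochainComplex.singleFunctor A 0).obj V) 0 p
      (-p) (by lia)
    exact eq_zero_of_iso_isKProjective K _ (-n) (-p) (by lia) (boundedQObjIso P n)
      (boundedQObjIso V p) f
  hom_perfect K hK := by
    obtain ⟨K', a, b, h₁, h₂, h₃, ⟨e⟩⟩ := hK
    have : K'.IsKProjective := CochainComplex.isKProjective_of_projective K' b
    -- The complex `K'` vanishes below degree `a`, and `p ≥ 1 - a` says that `-p < a`.
    refine ⟨1 - a, fun p hp V f => ?_⟩
    have := CochainComplex.isStrictlyLE_shift ((CochainComplex.singleFunctor A 0).obj V) 0 p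
      (-p) (by lia)
    exact eq_zero_of_iso_isKProjective K' _ a (-p) (by lia) e (boundedQObjIso V p) f

/-- Induction on the amplitude: the truncation triangle splits off the lowest degree. An object
whose cohomology is concentrated in one degree is a shift of an object of `A`. -/
theorem bounded_induction (P : ObjectProperty (DerivedCategory.Bounded A)) [P.IsTriangulated]
    [P.IsClosedUnderIsomorphisms] (h : ∀ X, P ((boundedDeltaEmbedding A).s.obj X))
    (K : DerivedCategory.Bounded A) : P K := by
  let t : Triangulated.TStructure (DerivedCategory A) := TStructure.t
  have h0 : ∀ (K : DerivedCategory.Bounded A) (a : ℤ), t.IsGE K.obj a → t.IsLE K.obj a → P K := by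
    intro K a _ _
    have : t.IsGE (K.obj⟦a⟧) 0 := t.isGE_shift _ a a 0
    have : t.IsLE (K.obj⟦a⟧) 0 := t.isLE_shift _ a a 0
    obtain ⟨X, ⟨e⟩⟩ := exists_iso_singleFunctor_obj_of_isGE_of_isLE (K.obj⟦a⟧) 0
    let e₁ : (K⟦a⟧).obj ≅ K.obj⟦a⟧ := (Bounded.ι.commShiftIso a).app K
    let e₂ : (K⟦a⟧).obj ≅ ((boundedDeltaEmbedding A).s.obj X).obj := e₁ ≪≫ e
    have h1 : P (K⟦a⟧) := P.prop_of_iso (ObjectProperty.isoMk _ e₂).symm (h X)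
    exact P.prop_of_iso ((shiftEquiv _ a).unitIso.symm.app K) (P.le_shift (-a) _ h1)
  have h1 : ∀ (n : ℕ) (K : DerivedCategory.Bounded A) (a : ℤ), t.IsGE K.obj a →
      t.IsLE K.obj (a + n) → P K := by
    intro n
    induction n with
    | zero => exact fun K a h₁ h₂ => h0 K a h₁ (by simpa using h₂)
    | succ n ih =>
      intro K a _ _
      have : t.IsLE ((t.truncLT (a + 1)).obj K.obj) a := by
        have : t.IsLE ((t.truncLT (a + 1)).obj K.obj) (a + 1 - 1) := inferInstance
        simpa using this
      let X : DerivedCategory.Bounded A := ⟨(t.truncLT (a + 1)).obj K.obj,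
        ⟨a, inferInstance⟩, ⟨a, inferInstance⟩⟩
      let Z : DerivedCategory.Bounded A := ⟨(t.truncGE (a + 1)).obj K.obj,
        ⟨a + 1, inferInstance⟩, ⟨a + (n + 1 : ℕ), inferInstance⟩⟩
      let f : X ⟶ K := ObjectProperty.homMk ((t.truncLTι (a + 1)).app K.obj)
      let g : K ⟶ Z := ObjectProperty.homMk ((t.truncGEπ (a + 1)).app K.obj)
      have hT := distinguished_homMkShift _ f g _ (t.triangleLTGE_distinguished (a + 1) K.obj)
      refine P.ext_of_isTriangulatedClosed₂ _ hT (h0 X a inferInstance inferInstance)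
        (ih Z (a + 1) inferInstance ?_)
      have h2 : t.IsLE ((t.truncGE (a + 1)).obj K.obj) (a + (n + 1 : ℕ)) := inferInstance
      have h3 : a + 1 + (n : ℤ) = a + (n + 1 : ℕ) := by push_cast; ring
      rw [h3]
      exact h2
  obtain ⟨⟨a, _⟩, ⟨b, _⟩⟩ := K.property
  have : t.IsLE K.obj (a + (b - a).toNat) := t.isLE_of_le K.obj b _ (by lia)
  exact h1 (b - a).toNat K a inferInstance inferInstance

end BoundedDerived

/-! ### Linear maps on tensor products -/

namespace BalTensor

section

variable {R S : Type*} [Ring R] [Ring S] {M N : Type*} [AddCommGroup M] [AddCommGroup N]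
  [Module Rᵐᵒᵖ M] [Module R N] [Module S M] [SMulCommClass S Rᵐᵒᵖ M]
  {A : Type*} [AddCommGroup A] [Module S A]

/-- The linear map out of `M ⊗_R N` given by a balanced biadditive map which is linear in the first
variable. -/
def liftLinear (f : M →+ N →+ A) (hf : ∀ (m : M) (r : R) (n : N), f (op r • m) n = f m (r • n))
    (hs : ∀ (s : S) (m : M) (n : N), f (s • m) n = s • f m n) : BalTensor R M N →ₗ[S] A where
  toFun := lift f hf
  map_add' := map_add _
  map_smul' s z := by
    induction z using induction_on with
    | h0 => simp
    | ht m n => exact hs s m n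
    | ha x y hx hy => simp only [smul_add, map_add, hx, hy]

theorem linearMap_ext {f g : BalTensor R M N →ₗ[S] A}
    (h : ∀ m n, f (tmul R m n) = g (tmul R m n)) : f = g :=
  LinearMap.toAddMonoidHom_injective (addHom_ext h)

theorem tmul_sum {ι : Type*} (s : Finset ι) (m : M) (n : ι → N) :
    tmul R m (∑ i ∈ s, n i) = ∑ i ∈ s, tmul R m (n i) :=
  map_sum (tmulHom (R := R) (N := N) m) n s

theorem sum_tmul {ι : Type*} (s : Finset ι) (m : ι → M) (n : N) :
    tmul R (∑ i ∈ s, m i) n = ∑ i ∈ s, tmul R (m i) n :=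
  map_sum ((tmulHom (R := R) (M := M)).flip n) m s

variable (R S M) in
/-- The linear map `M^k ⟶ M ⊗_R N` given by elements of `N`. -/
def ofTuple {k : ℕ} (v : Fin k → N) : (Fin k → M) →ₗ[S] BalTensor R M N where
  toFun m := ∑ j, tmul R (m j) (v j)
  map_add' m m' := by simp [add_tmul, Finset.sum_add_distrib]
  map_smul' s m := by simp [Finset.smul_sum, smul_tmul_left]

theorem ofTuple_surjective {k : ℕ} (v : Fin k → N) (hv : Submodule.span R (Set.range v) = ⊤) :
    Function.Surjective (ofTuple R S M v) := by
  rw [← LinearMap.range_eq_top, eq_top_iff]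
  rintro z -
  induction z using induction_on with
  | h0 => exact Submodule.zero_mem _
  | ht m n =>
    obtain ⟨c, rfl⟩ := (Submodule.mem_span_range_iff_exists_fun R).1
      (hv ▸ Submodule.mem_top : n ∈ Submodule.span R (Set.range v))
    refine ⟨fun j => op (c j) • m, ?_⟩
    change ∑ j, tmul R (op (c j) • m) (v j) = _
    simp only [smul_tmul, tmul_sum]
  | ha x y hx hy => exact Submodule.add_mem _ hx hy

theorem finite_of_finite [Module.Finite R N] [Module.Finite S M] :
    Module.Finite S (BalTensor R M N) := by
  obtain ⟨k, v, hv⟩ := Submodule.fg_iff_exists_fin_generating_family.1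
    (Module.Finite.fg_top (R := R) (M := N))
  exact Module.Finite.of_surjective _ (ofTuple_surjective (S := S) (M := M) v hv)

variable (R S M N) in
-- Tensoring a splitting of `R^k ⟶ N` makes `M ⊗_R N` a retract of `M ⊗_R R^k`, that is, of `M^k`.
theorem exists_retract [Module.Finite R N] [Module.Projective R N] :
    ∃ (k : ℕ) (i : BalTensor R M N →ₗ[S] (Fin k → M)) (r : (Fin k → M) →ₗ[S] BalTensor R M N),
      r ∘ₗ i = LinearMap.id := by
  obtain ⟨k, p, hp⟩ := Module.Finite.exists_fin' R N
  obtain ⟨s, hs⟩ := Module.projective_lifting_property p LinearMap.id hp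
  let f : M →+ N →+ (Fin k → M) := AddMonoidHom.mk' (fun m => AddMonoidHom.mk'
      (fun n j => op (s n j) • m) (fun n n' => by ext j; simp [add_smul]))
    (fun m m' => by ext n j; simp)
  let i : BalTensor R M N →ₗ[S] (Fin k → M) := liftLinear f
    (fun m r n => funext fun j => by
      change op (s n j) • op r • m = op (s (r • n) j) • m
      rw [map_smul, smul_smul]; rfl)
    (fun a m n => funext fun j => (smul_comm a (op (s n j)) m).symm)
  refine ⟨k, i, ofTuple R S M (fun j => p (Pi.single j 1)), linearMap_ext fun m n => ?_⟩
  change ∑ j, tmul R (op (s n j) • m) (p (Pi.single j 1)) = tmul R m n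
  have h1 : p (s n) = n := DFunLike.congr_fun hs n
  simp only [smul_tmul, ← tmul_sum]
  congr 1
  conv_rhs => rw [← h1, ← Finset.univ_sum_single (s n), map_sum]
  refine Finset.sum_congr rfl fun j _ => ?_
  rw [← map_smul, ← Pi.single_smul, smul_eq_mul, mul_one]

variable (R S M N) in
theorem projective_of_projective [Module.Finite R N] [Module.Projective R N]
    [Module.Projective S M] : Module.Projective S (BalTensor R M N) := by
  obtain ⟨k, i, r, h⟩ := exists_retract R S M N
  have : Module.Projective S (Fin k → M) :=
    Module.Projective.of_equiv (DFinsupp.linearEquivFunOnFintype (R := S) (M := fun _ : Fin k => M))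
  exact Module.Projective.of_split i r h

theorem lTensor_surjective {N' : Type*} [AddCommGroup N'] [Module R N'] (g : N →ₗ[R] N')
    (hg : Function.Surjective g) : Function.Surjective (lTensor S M g) := by
  rw [← LinearMap.range_eq_top, eq_top_iff]
  rintro z -
  induction z using induction_on with
  | h0 => exact Submodule.zero_mem _
  | ht m n =>
    obtain ⟨n, rfl⟩ := hg n
    exact ⟨tmul R m n, rfl⟩
  | ha x y hx hy => exact Submodule.add_mem _ hx hy

/-- The functor `M ⊗_R -` is right exact. -/
theorem lTensor_exact {N' N'' : Type*} [AddCommGroup N'] [Module R N'] [AddCommGroup N'']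
    [Module R N''] {f : N →ₗ[R] N'} {g : N' →ₗ[R] N''} (hfg : Function.Exact f g)
    (hg : Function.Surjective g) : Function.Exact (lTensor S M f) (lTensor S M g) := by
  intro z
  constructor
  · intro hz
    let W := LinearMap.range (lTensor S M f)
    let φ : M →+ N' →+ (BalTensor R M N' ⧸ W) := AddMonoidHom.mk' (fun m => AddMonoidHom.mk'
      (fun n => W.mkQ (tmul R m n)) (fun n n' => by rw [tmul_add, map_add]))
      (fun m m' => by ext n; exact (congrArg W.mkQ (add_tmul m m' n)).trans (map_add _ _ _))
    have hφ : ∀ m n n', g n = g n' → φ m n = φ m n' := by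
      intro m n n' h
      have h1 : g (n - n') = 0 := by rw [map_sub, h, sub_self]
      obtain ⟨x, hx⟩ := (hfg _).1 h1
      rw [← sub_eq_zero, ← map_sub, ← hx]
      exact (Submodule.Quotient.mk_eq_zero _).2 ⟨tmul R m x, rfl⟩
    -- A set-theoretic section suffices: by `hφ` the class modulo `W` does not depend on the
    -- preimage, which also gives additivity and balancedness.
    let s := Function.surjInv hg
    have hs : ∀ n, g (s n) = n := Function.surjInv_eq hg
    let ψ : M →+ N'' →+ (BalTensor R M N' ⧸ W) := AddMonoidHom.mk' (fun m => AddMonoidHom.mk'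
      (fun n => φ m (s n)) (fun n n' => by
        rw [← map_add]; exact hφ _ _ _ (by rw [map_add, hs, hs, hs])))
      (fun m m' => by ext n; exact (DFunLike.congr_fun (map_add φ m m') _))
    have hψ : ∀ m n, ψ m (g n) = φ m n := fun m n => hφ _ _ _ (hs _)
    let Ψ : BalTensor R M N'' →+ (BalTensor R M N' ⧸ W) := lift ψ (fun m r n => by
      obtain ⟨n, rfl⟩ := hg n
      rw [← map_smul, hψ, hψ]
      exact congrArg W.mkQ (smul_tmul m r n))
    have h2 : Ψ.comp (lTensor S M g).toAddMonoidHom = W.mkQ.toAddMonoidHom :=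
      addHom_ext fun m n => hψ m n
    have h3 := DFunLike.congr_fun h2 z
    have h4 : Ψ (lTensor S M g z) = 0 := by rw [hz, map_zero]
    exact (Submodule.Quotient.mk_eq_zero W).1 (h3.symm.trans h4)
  · rintro ⟨y, rfl⟩
    have h : lTensor S M g ∘ₗ lTensor S M f = 0 := linearMap_ext fun m n => by
      change tmul R m (g (f n)) = 0
      rw [hfg.apply_apply_eq_zero, tmul_zero]
    exact DFunLike.congr_fun h y

end

end BalTensor

/-! ### The relative bar resolution -/

namespace OmegaNC

variable {Λ : Type u} [Ring Λ] (E : Subring Λ) (V : Type v) [AddCommGroup V] [Module Λ V]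

instance : SMulCommClass Λ (E : Type u)ᵐᵒᵖ Λ :=
  ⟨fun a e x => (mul_assoc a x (e.unop : Λ)).symm⟩

/-- The biadditive map `(ā ⊗ b, v) ↦ a ⊗ b v - 1 ⊗ a b v`. -/
def inclHom : OmegaNC E →+ V →+ BalTensor E Λ V :=
  OmegaNC.lift E (AddMonoidHom.mk' (fun a => AddMonoidHom.mk' (fun b => AddMonoidHom.mk'
        (fun v => BalTensor.tmul E a (b • v) - BalTensor.tmul E 1 ((a * b) • v))
        (fun v v' => by simp only [smul_add, BalTensor.tmul_add]; abel))
      (fun b b' => by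
        ext v
        simp only [AddMonoidHom.mk'_apply, AddMonoidHom.add_apply, add_smul, mul_add,
          BalTensor.tmul_add]; abel))
      (fun a a' => by
        ext b v
        simp only [AddMonoidHom.mk'_apply, AddMonoidHom.add_apply, add_smul, add_mul,
          BalTensor.tmul_add, BalTensor.add_tmul]; abel))
      (fun a ha => by
        ext b v
        change BalTensor.tmul E a (b • v) - BalTensor.tmul E 1 ((a * b) • v) = 0
        have h := BalTensor.smul_tmul (R := E) (1 : Λ) ⟨a, ha⟩ (b • v)
        rw [op_smul_eq_mul_coe, one_mul] at h
        rw [h, sub_eq_zero, mul_smul]; rfl)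
      (fun a e b => by
        ext v
        change BalTensor.tmul E (a * e) (b • v) - BalTensor.tmul E 1 ((a * e * b) • v) =
          BalTensor.tmul E a ((e * b) • v) - BalTensor.tmul E 1 ((a * (e * b)) • v)
        rw [mul_assoc, mul_smul (e : Λ)]
        exact congrArg (· - _) (BalTensor.smul_tmul (R := E) a e (b • v)))

theorem inclHom_tmul (a b : Λ) (v : V) : inclHom E V (tmul a b) v =
    BalTensor.tmul E a (b • v) - BalTensor.tmul E 1 ((a * b) • v) := rfl

theorem inclHom_op_smul (m : OmegaNC E) (c : Λ) (v : V) :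
    inclHom E V (op c • m) v = inclHom E V m (c • v) := by
  induction m using OmegaNC.induction_on with
  | h0 => rw [smul_zero, map_zero]; rfl
  | ht a b => rw [op_smul_tmul, inclHom_tmul, inclHom_tmul, smul_smul, smul_smul, mul_assoc]
  | ha x y hx hy =>
    rw [smul_add, map_add, map_add, AddMonoidHom.add_apply, AddMonoidHom.add_apply, hx, hy]

theorem inclHom_smul (c : Λ) (m : OmegaNC E) (v : V) :
    inclHom E V (c • m) v = c • inclHom E V m v := by
  induction m using OmegaNC.induction_on with
  | h0 => rw [smul_zero, map_zero]; exact (smul_zero c).symm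
  | ht a b =>
    rw [OmegaNC.smul_tmul, map_sub, AddMonoidHom.sub_apply, inclHom_tmul, inclHom_tmul,
      inclHom_tmul, smul_sub, BalTensor.smul_tmul_left, BalTensor.smul_tmul_left, smul_eq_mul,
      smul_eq_mul, mul_one, mul_assoc]
    abel
  | ha x y hx hy =>
    rw [smul_add, map_add, map_add, AddMonoidHom.add_apply, AddMonoidHom.add_apply, hx, hy,
      smul_add]

/-- The inclusion `(ā ⊗ b) ⊗ v ↦ a ⊗ b v - 1 ⊗ a b v` of `Ω ⊗_Λ V` in `Λ ⊗_E V`. -/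
def incl : BalTensor Λ (OmegaNC E) V →ₗ[Λ] BalTensor E Λ V :=
  BalTensor.liftLinear (inclHom E V) (inclHom_op_smul E V) (inclHom_smul E V)

theorem incl_tmul (a b : Λ) (v : V) : incl E V (BalTensor.tmul Λ (tmul a b) v) =
    BalTensor.tmul E a (b • v) - BalTensor.tmul E 1 ((a * b) • v) := rfl

/-- The additive retraction `a ⊗ v ↦ (ā ⊗ 1) ⊗ v` of the inclusion. -/
def retr : BalTensor E Λ V →+ BalTensor Λ (OmegaNC E) V :=
  BalTensor.lift (AddMonoidHom.mk' (fun a => AddMonoidHom.mk'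
      (fun v => BalTensor.tmul Λ (tmul a 1) v) (BalTensor.tmul_add _))
    (fun a a' => by
      ext v
      change BalTensor.tmul Λ (tmul (a + a') 1) v = _
      rw [OmegaNC.add_tmul, BalTensor.add_tmul]; rfl))
    (fun a e v => by
      change BalTensor.tmul Λ (tmul (a * e) 1) v = BalTensor.tmul Λ (tmul a 1) ((e : Λ) • v)
      rw [OmegaNC.mul_tmul, ← BalTensor.smul_tmul, OmegaNC.op_smul_tmul, mul_one, one_mul])

theorem retr_incl (z : BalTensor Λ (OmegaNC E) V) : retr E V (incl E V z) = z := by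
  refine DFunLike.congr_fun (f := (retr E V).comp (incl E V).toAddMonoidHom)
    (g := AddMonoidHom.id _) (BalTensor.addHom_ext fun m v => ?_) z
  induction m using OmegaNC.induction_on with
  | h0 => simp [BalTensor.zero_tmul]
  | ht a b =>
    change retr E V (incl E V (BalTensor.tmul Λ (tmul a b) v)) = BalTensor.tmul Λ (tmul a b) v
    rw [incl_tmul, map_sub]
    change BalTensor.tmul Λ (tmul a 1) (b • v) - BalTensor.tmul Λ (tmul 1 1) ((a * b) • v) = _
    rw [OmegaNC.tmul_of_mem E E.one_mem, BalTensor.zero_tmul, sub_zero, ← BalTensor.smul_tmul,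
      OmegaNC.op_smul_tmul, one_mul]
  | ha x y hx hy => rw [BalTensor.add_tmul, map_add, map_add, hx, hy]

/-- The projection `a ⊗ v ↦ a v` from `Λ ⊗_E V` to `V`. -/
def proj : BalTensor E Λ V →ₗ[Λ] V :=
  BalTensor.liftLinear (AddMonoidHom.mk' (fun a => AddMonoidHom.mk' (fun v => a • v) (smul_add a))
    (fun a a' => by ext v; exact add_smul a a' v))
    (fun a e v => mul_smul a (e : Λ) v) (fun c a v => mul_smul c a v)

theorem proj_tmul (a : Λ) (v : V) : proj E V (BalTensor.tmul E a v) = a • v := rfl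

theorem proj_surjective : Function.Surjective (proj E V) := fun v =>
  ⟨BalTensor.tmul E 1 v, by rw [proj_tmul, one_smul]⟩

theorem proj_incl (z : BalTensor Λ (OmegaNC E) V) : proj E V (incl E V z) = 0 := by
  refine DFunLike.congr_fun (f := proj E V ∘ₗ incl E V) (g := 0)
    (BalTensor.linearMap_ext fun m v => ?_) z
  induction m using OmegaNC.induction_on with
  | h0 => rw [BalTensor.zero_tmul, map_zero, map_zero]
  | ht a b =>
    change proj E V (incl E V (BalTensor.tmul Λ (tmul a b) v)) = 0
    rw [incl_tmul, map_sub, proj_tmul, proj_tmul, smul_smul, one_smul, sub_self]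
  | ha x y hx hy => rw [BalTensor.add_tmul, map_add, map_add, hx, hy]

/-- Together with `v ↦ 1 ⊗ v`, the map `retr` is an additive contracting homotopy of the bar
sequence. Exactness therefore holds for every subring `E`; semisimplicity enters only through
projectivity and splitting. -/
theorem incl_retr (z : BalTensor E Λ V) :
    incl E V (retr E V z) = z - BalTensor.tmul E 1 (proj E V z) := by
  induction z using BalTensor.induction_on with
  | h0 => simp [BalTensor.tmul_zero]
  | ht a v =>
    change incl E V (BalTensor.tmul Λ (tmul a 1) v) = _
    rw [incl_tmul, one_smul, mul_one]; rfl
  | ha x y hx hy => rw [map_add, map_add, map_add, hx, hy, BalTensor.tmul_add]; abel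

theorem exact_incl_proj : Function.Exact (incl E V) (proj E V) := fun z =>
  ⟨fun hz => ⟨retr E V z, by rw [incl_retr, hz, BalTensor.tmul_zero, sub_zero]⟩, by
    rintro ⟨y, rfl⟩; exact proj_incl E V y⟩

theorem incl_injective : Function.Injective (incl E V) :=
  Function.LeftInverse.injective (retr_incl E V)

variable {V}

theorem incl_naturality {W : Type*} [AddCommGroup W] [Module Λ W] (g : V →ₗ[Λ] W)
    (z : BalTensor Λ (OmegaNC E) V) :
    incl E W (BalTensor.lTensor Λ (OmegaNC E) g z) =
      BalTensor.lTensor Λ Λ (g.restrictScalars E) (incl E V z) := by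
  refine DFunLike.congr_fun (f := incl E W ∘ₗ BalTensor.lTensor Λ (OmegaNC E) g)
    (g := BalTensor.lTensor Λ Λ (g.restrictScalars E) ∘ₗ incl E V)
    (BalTensor.linearMap_ext fun m v => ?_) z
  induction m using OmegaNC.induction_on with
  | h0 => rw [BalTensor.zero_tmul, map_zero, map_zero]
  | ht a b =>
    change incl E W (BalTensor.tmul Λ (tmul a b) (g v)) = BalTensor.lTensor Λ Λ
      (g.restrictScalars E) (incl E V (BalTensor.tmul Λ (tmul a b) v))
    rw [incl_tmul, incl_tmul, map_sub, BalTensor.lTensor_tmul, BalTensor.lTensor_tmul]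
    simp
  | ha x y hx hy => rw [BalTensor.add_tmul, map_add, map_add, hx, hy]

theorem proj_naturality {W : Type*} [AddCommGroup W] [Module Λ W] (g : V →ₗ[Λ] W)
    (z : BalTensor E Λ V) :
    proj E W (BalTensor.lTensor Λ Λ (g.restrictScalars E) z) = g (proj E V z) := by
  refine DFunLike.congr_fun (f := proj E W ∘ₗ BalTensor.lTensor Λ Λ (g.restrictScalars E))
    (g := g ∘ₗ proj E V) (BalTensor.linearMap_ext fun a v => ?_) z
  change proj E W (BalTensor.tmul E a (g v)) = g (proj E V (BalTensor.tmul E a v))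
  rw [proj_tmul, proj_tmul, map_smul]

variable (V) in
theorem projective_extension [IsSemisimpleRing E] [Module.Finite E V] :
    Module.Projective Λ (BalTensor E Λ V) :=
  have : Module.Projective E V := Module.projective_of_isSemisimpleRing E V
  BalTensor.projective_of_projective E Λ Λ V

variable (Λ) in
/-- The isomorphism `M ⊗_Λ Λ ≅ M`. -/
def _root_.BalTensor.rid (M : Type*) [AddCommGroup M] [Module Λ M] [Module Λᵐᵒᵖ M]
    [SMulCommClass Λ Λᵐᵒᵖ M] : BalTensor Λ M Λ ≃ₗ[Λ] M :=
  LinearEquiv.ofLinearMap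
    (BalTensor.liftLinear (AddMonoidHom.mk' (fun m => AddMonoidHom.mk' (fun a => op a • m)
      (fun a b => by rw [← add_smul]; rfl)) (fun m m' => by ext a; simp))
      (fun m r a => by simp [smul_smul]) (fun s m a => (smul_comm s (op a) m).symm))
    { toFun m := BalTensor.tmul Λ m 1
      map_add' m m' := BalTensor.add_tmul m m' 1
      map_smul' a m := rfl }
    (LinearMap.ext fun m => one_smul Λᵐᵒᵖ m)
    (BalTensor.linearMap_ext fun m a => by
      change BalTensor.tmul Λ (op a • m) (1 : Λ) = BalTensor.tmul Λ m a
      rw [BalTensor.smul_tmul, smul_eq_mul, mul_one])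

/-- For `V = Λ` the bar sequence ends in a projective module and splits, so `Ω ⊗_Λ Λ ≅ Ω` is a
direct summand of the projective module `Λ ⊗_E Λ`. -/
instance [IsSemisimpleRing E] [Module.Finite E Λ] : Module.Projective Λ (OmegaNC E) := by
  have := projective_extension E (V := Λ)
  obtain ⟨s, hs⟩ := Module.projective_lifting_property (proj E Λ) LinearMap.id (proj_surjective E Λ)
  have hs' : ∀ v, proj E Λ (s v) = v := fun v => DFunLike.congr_fun hs v
  let r : BalTensor E Λ Λ →ₗ[Λ] BalTensor E Λ Λ := LinearMap.id - s ∘ₗ proj E Λ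
  have hr : ∀ z, ∃ y, incl E Λ y = r z := fun z =>
    (exact_incl_proj E Λ _).1 (by simp [r, hs'])
  choose t ht using hr
  let t' : BalTensor E Λ Λ →ₗ[Λ] BalTensor Λ (OmegaNC E) Λ :=
    { toFun := t
      map_add' x y := incl_injective E Λ (by simp [ht])
      map_smul' a x := incl_injective E Λ (by simp [ht]) }
  have h : t' ∘ₗ incl E Λ = LinearMap.id := LinearMap.ext fun x => incl_injective E Λ (by
    refine (ht _).trans ?_
    simp [r, proj_incl])
  have := Module.Projective.of_split (incl E Λ) t' h
  exact Module.Projective.of_equiv (BalTensor.rid Λ (OmegaNC E))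

end OmegaNC

/-! ### Exact sequences of finitely presented modules -/

section FinitelyPresented

variable (R : Type u) [Ring R]

instance : (isFP R).ContainsZero where
  exists_zero := ⟨ModuleCat.of R PUnit, ModuleCat.isZero_of_subsingleton _,
    (inferInstance : Module.FinitePresentation R PUnit.{u + 1})⟩

instance : (isFP R).IsClosedUnderIsomorphisms where
  of_iso e h := by
    have : Module.FinitePresentation R _ := h
    exact Module.FinitePresentation.of_equiv e.toLinearEquiv

instance : (isFP R).IsClosedUnderCokernels where
  cokernels_le := by
    rintro _ ⟨f, k, hk, hX, hY⟩
    have : Module.FinitePresentation R _ := hX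
    have : Module.FinitePresentation R _ := hY
    have hQ : isFP R (ModuleCat.of R (_ ⧸ LinearMap.range f.hom)) :=
      Module.finitePresentation_of_surjective _ (Submodule.mkQ_surjective _) (by
        rw [Submodule.ker_mkQ, ← Submodule.map_top]
        exact Submodule.FG.map _ Module.Finite.fg_top)
    exact (isFP R).prop_of_iso
      ((ModuleCat.cokernelIsColimit f).coconePointUniqueUpToIso hk) hQ

instance : (isFP R).IsClosedUnderFiniteProducts :=
  have : (isFP R).IsClosedUnderBinaryProducts :=
    { limitsOfShape_le := by
        rintro X ⟨p⟩
        have : Module.FinitePresentation R (p.diag.obj ⟨.left⟩) := p.prop_diag_obj _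
        have : Module.FinitePresentation R (p.diag.obj ⟨.right⟩) := p.prop_diag_obj _
        exact (isFP R).prop_of_iso (IsLimit.conePointsIsoOfNatIso p.isLimit
          (ModuleCat.binaryProductLimitCone _ _).isLimit (diagramIsoPair p.diag)).symm
          (inferInstance : Module.FinitePresentation R (p.diag.obj ⟨.left⟩ × p.diag.obj ⟨.right⟩)) }
  .mk'

namespace FPMod

variable {R}

instance (X : FPMod R) : Module.FinitePresentation R X.obj := X.property

variable (R) in
/-- The free module of rank one. -/
abbrev self : FPMod R := ⟨ModuleCat.of R R, (inferInstance : Module.FinitePresentation R R)⟩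

/-- The morphism from the free module of rank one given by an element. -/
def ofElem {X : FPMod R} (x : X.obj) : self R ⟶ X :=
  ObjectProperty.homMk (ModuleCat.ofHom (LinearMap.toSpanSingleton R X.obj x))

theorem hom_self_ext {X : FPMod R} {f g : self R ⟶ X} (h : f.hom.hom (1 : R) = g.hom.hom (1 : R)) :
    f = g := by
  ext
  exact h

theorem ofElem_comp {X Y : FPMod R} (x : X.obj) (f : X ⟶ Y) :
    ofElem x ≫ f = ofElem (f.hom.hom x) :=
  hom_self_ext (by
    change f.hom.hom ((1 : R) • x) = (1 : R) • f.hom.hom x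
    rw [one_smul, one_smul])

theorem ofElem_eq_zero_iff {X : FPMod R} {x : X.obj} : ofElem x = 0 ↔ x = 0 := by
  constructor
  · intro h
    have h1 := congrArg (fun k : self R ⟶ X => k.hom.hom (1 : R)) h
    exact (one_smul R x).symm.trans h1
  · rintro rfl
    exact hom_self_ext (smul_zero (1 : R))

/-- Elements are morphisms from the free module of rank one, which is finitely presented; so
monomorphisms can be tested on elements over any ring, whether or not kernels stay finitely
presented. -/
theorem mono_iff_injective {X Y : FPMod R} (f : X ⟶ Y) :
    Mono f ↔ Function.Injective f.hom.hom := by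
  constructor
  · intro h
    rw [injective_iff_map_eq_zero]
    intro x hx
    rw [← ofElem_eq_zero_iff, ← cancel_mono f, ofElem_comp, hx, zero_comp]
    exact ofElem_eq_zero_iff.2 rfl
  · intro h
    exact ⟨fun a b hab => by
      ext x
      exact h (congrArg (fun k : _ ⟶ Y => k.hom.hom x) hab)⟩

theorem epi_iff_surjective {X Y : FPMod R} (f : X ⟶ Y) :
    Epi f ↔ Function.Surjective f.hom.hom := by
  refine ⟨fun _ => surjective_of_epi R f, fun h => ⟨fun a b hab => ?_⟩⟩
  ext y
  obtain ⟨x, rfl⟩ := h y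
  exact congrArg (fun k : X ⟶ _ => k.hom.hom x) hab

theorem exists_lift {X Y Z T : FPMod R} {f : X ⟶ Y} {g : Y ⟶ Z} (hf : Function.Injective f.hom.hom)
    (hfg : Function.Exact f.hom.hom g.hom.hom) (k : T ⟶ Y) (hk : k ≫ g = 0) :
    ∃ l : T ⟶ X, l ≫ f = k := by
  have h : ∀ t, ∃ x, f.hom.hom x = k.hom.hom t := fun t =>
    (hfg _).1 (congrArg (fun k : T ⟶ Z => k.hom.hom t) hk)
  choose l hl using h
  refine ⟨ObjectProperty.homMk (ModuleCat.ofHom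
    { toFun := l
      map_add' a b := hf (by simp only [map_add, hl])
      map_smul' c a := hf (by
        rw [RingHom.id_apply, map_smul, hl, hl, map_smul]) }), ?_⟩
  ext t
  exact hl t

theorem shortExact_iff [(isFP R).IsClosedUnderKernels] (S : ShortComplex (FPMod R)) :
    S.ShortExact ↔ Function.Injective S.f.hom.hom ∧ Function.Exact S.f.hom.hom S.g.hom.hom ∧
      Function.Surjective S.g.hom.hom := by
  constructor
  · intro h
    have := h.mono_f
    have := h.epi_g
    refine ⟨(mono_iff_injective _).1 inferInstance, fun y => ⟨fun hy => ?_, ?_⟩,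
      (epi_iff_surjective _).1 inferInstance⟩
    · obtain ⟨l, hl⟩ := h.exact.lift' (ofElem y) (by
        rw [ofElem_comp, hy]; exact ofElem_eq_zero_iff.2 rfl)
      exact ⟨l.hom.hom (1 : R), (congrArg (fun k : self R ⟶ S.X₂ => k.hom.hom (1 : R)) hl).trans
        (one_smul R y)⟩
    · rintro ⟨x, rfl⟩
      exact congrArg (fun k : S.X₁ ⟶ S.X₃ => k.hom.hom x) S.zero
  · rintro ⟨h₁, h₂, h₃⟩
    have := (mono_iff_injective S.f).2 h₁
    have := (epi_iff_surjective S.g).2 h₃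
    refine ⟨S.exact_of_f_is_kernel (KernelFork.IsLimit.ofι' _ _ fun k hk => ?_)⟩
    exact ⟨(exists_lift h₁ h₂ k hk).choose, (exists_lift h₁ h₂ k hk).choose_spec⟩

end FPMod

end FinitelyPresented

/-! ### The syzygy functor of noncommutative differential forms -/

namespace OmegaNC

variable {Λ : Type u} [Ring Λ] (E : Subring Λ) [IsSemisimpleRing E] [Module.Finite E Λ]
  [IsNoetherianRing Λ]

/-- The functor `Λ ⊗_E -`. -/
def extension : FPMod Λ ⥤ FPMod Λ where
  obj X := ⟨ModuleCat.of Λ (BalTensor E Λ X.obj), by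
    have : Module.Finite E X.obj := Module.Finite.trans Λ X.obj
    have := BalTensor.finite_of_finite (R := E) (S := Λ) (M := Λ) (N := X.obj)
    exact isFP_of_finite Λ _⟩
  map f := ObjectProperty.homMk (ModuleCat.ofHom
    (BalTensor.lTensor Λ Λ (f.hom.hom.restrictScalars E)))
  map_id X := by
    ext z
    exact LinearMap.congr_fun (f := BalTensor.lTensor Λ Λ (LinearMap.id.restrictScalars E))
      (g := LinearMap.id) (BalTensor.linearMap_ext fun m n => rfl) z
  map_comp {X Y Z} f g := by
    ext z
    exact LinearMap.congr_fun (f := BalTensor.lTensor Λ Λ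
        ((g.hom.hom ∘ₗ f.hom.hom).restrictScalars E))
      (g := BalTensor.lTensor Λ Λ (g.hom.hom.restrictScalars E) ∘ₗ
        BalTensor.lTensor Λ Λ (f.hom.hom.restrictScalars E))
      (BalTensor.linearMap_ext fun m n => rfl) z

instance (R M : Type u) [Ring R] [IsNoetherianRing R] [AddCommGroup M]
    [Module R M] [Module Rᵐᵒᵖ M] [SMulCommClass R Rᵐᵒᵖ M] [Module.Finite R M] :
    (tensorFunctor R M).Additive where
  map_add {X Y f g} := by
    ext z
    exact LinearMap.congr_fun (f := BalTensor.lTensor R M (f.hom.hom + g.hom.hom))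
      (g := BalTensor.lTensor R M f.hom.hom + BalTensor.lTensor R M g.hom.hom)
      (BalTensor.linearMap_ext fun m n => BalTensor.tmul_add _ _ _) z

/-- The relative bar resolution provides functorial syzygies. -/
def syzygyData : SyzygyData (tensorFunctor Λ (OmegaNC E)) where
  P := extension E
  i :=
    { app X := ObjectProperty.homMk (ModuleCat.ofHom (incl E X.obj))
      naturality X Y f := by
        ext z
        exact incl_naturality E f.hom.hom z }
  p :=
    { app X := ObjectProperty.homMk (ModuleCat.ofHom (proj E X.obj))
      naturality X Y f := by
        ext z
        exact proj_naturality E f.hom.hom z }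
  w X := by
    ext z
    exact proj_incl E X.obj z
  exact X := (FPMod.shortExact_iff _).2 ⟨incl_injective E X.obj, exact_incl_proj E X.obj,
    proj_surjective E X.obj⟩
  projective X := (FPMod.projective_iff _ _).2 (by
    have : Module.Finite E X.obj := Module.Finite.trans Λ X.obj
    exact projective_extension E X.obj)

/-- A monomorphism splits over the semisimple ring `E`, and `Λ ⊗_E -` carries the splitting to `Λ`.
This gives exactness of the functorial cover, preservation of monomorphisms by `Ω`, and the
injectivity of projectives in the Frobenius category. -/
theorem exists_retraction_extension {X Y : FPMod Λ} (f : X ⟶ Y) [Mono f] :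
    ∃ r, (extension E).map f ≫ r = 𝟙 _ := by
  obtain ⟨r, hr⟩ := IsSemisimpleModule.extension_property (f.hom.hom.restrictScalars E)
    ((FPMod.mono_iff_injective f).1 inferInstance) LinearMap.id
  refine ⟨ObjectProperty.homMk (ModuleCat.ofHom (BalTensor.lTensor Λ Λ r)), ?_⟩
  ext z
  refine LinearMap.congr_fun (f := BalTensor.lTensor Λ Λ r ∘ₗ BalTensor.lTensor Λ Λ
    (f.hom.hom.restrictScalars E)) (g := LinearMap.id) (BalTensor.linearMap_ext fun m n => ?_) z
  exact congrArg (BalTensor.tmul E m) (DFunLike.congr_fun hr n)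

theorem extension_shortExact {S : ShortComplex (FPMod Λ)} (hS : S.ShortExact) :
    Function.Injective ((extension E).map S.f).hom.hom ∧
      Function.Exact ((extension E).map S.f).hom.hom ((extension E).map S.g).hom.hom := by
  have := hS.mono_f
  obtain ⟨r, hr⟩ := exists_retraction_extension E S.f
  obtain ⟨h₁, h₂, h₃⟩ := (FPMod.shortExact_iff _).1 hS
  refine ⟨(FPMod.mono_iff_injective _).1 (mono_of_mono_fac hr), ?_⟩
  exact BalTensor.lTensor_exact (R := E) (S := Λ) (M := Λ) (f := S.f.hom.hom.restrictScalars E)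
    (g := S.g.hom.hom.restrictScalars E) h₂ h₃

/-- The bar sequence embeds `Ω ⊗_Λ f` into the split monomorphism `Λ ⊗_E f`. -/
theorem tensorFunctor_map_injective {X Y : FPMod Λ} (f : X ⟶ Y) [Mono f] :
    Function.Injective ((tensorFunctor Λ (OmegaNC E)).map f).hom.hom := by
  obtain ⟨r, hr⟩ := exists_retraction_extension E f
  have h := (FPMod.mono_iff_injective ((extension E).map f)).1 (mono_of_mono_fac hr)
  intro x y hxy
  refine incl_injective E X.obj (h ?_)
  have h1 := incl_naturality E f.hom.hom
  exact (h1 x).symm.trans ((congrArg _ hxy).trans (h1 y))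

theorem syzygyData_isExact : (syzygyData E).IsExact where
  map_shortExact {S} hS := by
    have := hS.mono_f
    obtain ⟨h₁, h₂, h₃⟩ := (FPMod.shortExact_iff _).1 hS
    exact (FPMod.shortExact_iff _).2 ⟨tensorFunctor_map_injective E S.f,
      BalTensor.lTensor_exact h₂ h₃, BalTensor.lTensor_surjective _ h₃⟩
  map_P {S} hS := by
    ext z
    exact (extension_shortExact E hS).2.apply_apply_eq_zero z
  mono_P hS := (FPMod.mono_iff_injective _).2 (extension_shortExact E hS).1
  exact_P hS _ a ha :=
    FPMod.exists_lift (extension_shortExact E hS).1 (extension_shortExact E hS).2 a ha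

end OmegaNC

/-! ### The universal property of the Leavitt ring -/

namespace TensorRing

variable {R : Type u} [Ring R] {N : Type v} [AddCommGroup N] [Module R N] [Module Rᵐᵒᵖ N]

/-- The universal property of the tensor ring. -/
def lift {A : Type*} [Ring A] (i : R →+* A) (φ : N →+ A) (hl : ∀ r x, φ (r • x) = i r * φ x)
    (hr : ∀ r x, φ (op r • x) = φ x * i r) : TensorRing R N →+* A :=
  RingQuot.lift ⟨(FreeAlgebra.lift ℤ (Sum.elim i φ)).toRingHom, by
    intro x y h
    cases h <;> simp [hl, hr]⟩

variable {A : Type*} [Ring A] (i : R →+* A) (φ : N →+ A) (hl : ∀ r x, φ (r • x) = i r * φ x)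
  (hr : ∀ r x, φ (op r • x) = φ x * i r)

theorem lift_scalar (r : R) : lift i φ hl hr (scalar R N r) = i r :=
  (RingQuot.lift_mkRingHom_apply _ _ _).trans (FreeAlgebra.lift_ι_apply _ _)

theorem lift_vec (x : N) : lift i φ hl hr (vec R N x) = φ x :=
  (RingQuot.lift_mkRingHom_apply _ _ _).trans (FreeAlgebra.lift_ι_apply _ _)

theorem vec_add (x y : N) : vec R N (x + y) = vec R N x + vec R N y :=
  (RingQuot.mkRingHom_rel (Rel.vadd x y)).trans (map_add _ _ _)

theorem vec_smul (r : R) (x : N) : vec R N (r • x) = scalar R N r * vec R N x :=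
  (RingQuot.mkRingHom_rel (Rel.left r x)).trans (map_mul _ _ _)

theorem vec_op_smul (r : R) (x : N) : vec R N (op r • x) = vec R N x * scalar R N r :=
  (RingQuot.mkRingHom_rel (Rel.right r x)).trans (map_mul _ _ _)

theorem closure_eq_top :
    Subring.closure (Set.range (scalar R N) ∪ Set.range (vec R N)) = ⊤ := by
  refine eq_top_iff.2 fun z _ => ?_
  obtain ⟨z, rfl⟩ := RingQuot.mkRingHom_surjective _ z
  induction z using FreeAlgebra.induction with
  | grade0 k =>
    rw [eq_intCast, map_intCast]
    exact intCast_mem _ k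
  | grade1 x =>
    refine Subring.subset_closure ?_
    cases x with
    | inl r => exact Or.inl ⟨r, rfl⟩
    | inr x => exact Or.inr ⟨x, rfl⟩
  | mul a b ha hb => rw [map_mul]; exact Subring.mul_mem _ (ha trivial) (hb trivial)
  | add a b ha hb => rw [map_add]; exact Subring.add_mem _ (ha trivial) (hb trivial)

end TensorRing

namespace LeavittRing

variable (R : Type u) [Ring R] (M : Type v) [AddCommGroup M] [Module R M] [Module Rᵐᵒᵖ M]
  [SMulCommClass R Rᵐᵒᵖ M]

/-- The ring homomorphism from the base ring to the Leavitt ring. -/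
def scalar : R →+* LeavittRing R M := (proj R M).comp (TensorRing.scalar R _)

/-- The map from the bimodule to the Leavitt ring. -/
def vec : M →+ LeavittRing R M :=
  AddMonoidHom.mk' (fun x => proj R M (TensorRing.vec R _ (0, x))) (fun x y => by
    rw [← map_add, ← TensorRing.vec_add, Prod.mk_add_mk, add_zero])

/-- The map from the dual of the bimodule to the Leavitt ring. -/
def dual : LeftDual R M →+ LeavittRing R M :=
  AddMonoidHom.mk' (fun f => proj R M (TensorRing.vec R _ (f, 0))) (fun x y => by
    rw [← map_add, ← TensorRing.vec_add, Prod.mk_add_mk, add_zero])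

variable {R M}

theorem vec_smul (r : R) (x : M) : vec R M (r • x) = scalar R M r * vec R M x := by
  change proj R M (TensorRing.vec R _ (0, r • x)) =
    proj R M (TensorRing.scalar R _ r) * proj R M (TensorRing.vec R _ (0, x))
  rw [← map_mul, ← TensorRing.vec_smul, Prod.smul_mk, smul_zero]

theorem vec_op_smul (r : R) (x : M) : vec R M (op r • x) = vec R M x * scalar R M r := by
  change proj R M (TensorRing.vec R _ (0, op r • x)) =
    proj R M (TensorRing.vec R _ (0, x)) * proj R M (TensorRing.scalar R _ r)
  rw [← map_mul, ← TensorRing.vec_op_smul, Prod.smul_mk, smul_zero]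

theorem dual_smul (r : R) (f : LeftDual R M) :
    dual R M (r • f) = scalar R M r * dual R M f := by
  change proj R M (TensorRing.vec R _ (r • f, 0)) =
    proj R M (TensorRing.scalar R _ r) * proj R M (TensorRing.vec R _ (f, 0))
  rw [← map_mul, ← TensorRing.vec_smul, Prod.smul_mk, smul_zero]

theorem dual_op_smul (r : R) (f : LeftDual R M) :
    dual R M (op r • f) = dual R M f * scalar R M r := by
  change proj R M (TensorRing.vec R _ (op r • f, 0)) =
    proj R M (TensorRing.vec R _ (f, 0)) * proj R M (TensorRing.scalar R _ r)
  rw [← map_mul, ← TensorRing.vec_op_smul, Prod.smul_mk, smul_zero]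

theorem vec_mul_dual (x : M) (f : LeftDual R M) :
    vec R M x * dual R M f = scalar R M (f x) :=
  (map_mul (proj R M) _ _).symm.trans (RingQuot.mkRingHom_rel (Rel.eval x f))

theorem sum_dual_mul_vec {n : ℕ} {α : Fin n → M} {α' : Fin n → LeftDual R M}
    (h : IsDualBasis α α') : ∑ j, dual R M (α' j) * vec R M (α j) = 1 := by
  have h1 := RingQuot.mkRingHom_rel (Rel.casimir α α' h)
  rw [map_one, map_sum] at h1
  simp only [map_mul] at h1
  exact h1

/-- The universal property of the Leavitt ring. -/
def lift {A : Type*} [Ring A] (i : R →+* A) (φ : M →+ A) (ψ : LeftDual R M →+ A)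
    (hφl : ∀ r x, φ (r • x) = i r * φ x) (hφr : ∀ r x, φ (op r • x) = φ x * i r)
    (hψl : ∀ r f, ψ (r • f) = i r * ψ f) (hψr : ∀ r f, ψ (op r • f) = ψ f * i r)
    (h : ∀ x f, φ x * ψ f = i (f x))
    (h' : ∀ (n : ℕ) (α : Fin n → M) (α' : Fin n → LeftDual R M), IsDualBasis α α' →
      ∑ j, ψ (α' j) * φ (α j) = 1) : LeavittRing R M →+* A :=
  RingQuot.lift ⟨TensorRing.lift i (ψ.coprod φ)
    (fun r x => by simp [hφl, hψl, mul_add]) (fun r x => by simp [hφr, hψr, add_mul]), by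
      intro x y h
      cases h with
      | eval x f =>
        rw [map_mul, TensorRing.lift_vec, TensorRing.lift_vec, TensorRing.lift_scalar]
        simp [h]
      | casimir α α' hα =>
        rw [map_sum, map_one, ← h' _ α α' hα]
        refine Finset.sum_congr rfl fun j _ => ?_
        rw [map_mul, TensorRing.lift_vec, TensorRing.lift_vec]
        simp⟩

section lift

variable {A : Type*} [Ring A] (i : R →+* A) (φ : M →+ A) (ψ : LeftDual R M →+ A)
    (hφl : ∀ r x, φ (r • x) = i r * φ x) (hφr : ∀ r x, φ (op r • x) = φ x * i r)
    (hψl : ∀ r f, ψ (r • f) = i r * ψ f) (hψr : ∀ r f, ψ (op r • f) = ψ f * i r)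
    (h : ∀ x f, φ x * ψ f = i (f x))
    (h' : ∀ (n : ℕ) (α : Fin n → M) (α' : Fin n → LeftDual R M), IsDualBasis α α' →
      ∑ j, ψ (α' j) * φ (α j) = 1)

theorem lift_scalar (r : R) : lift i φ ψ hφl hφr hψl hψr h h' (scalar R M r) = i r :=
  (RingQuot.lift_mkRingHom_apply _ _ _).trans (TensorRing.lift_scalar _ _ _ _ _)

theorem lift_vec (x : M) : lift i φ ψ hφl hφr hψl hψr h h' (vec R M x) = φ x :=
  (RingQuot.lift_mkRingHom_apply _ _ _).trans ((TensorRing.lift_vec _ _ _ _ _).trans (by simp))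

theorem lift_dual (f : LeftDual R M) : lift i φ ψ hφl hφr hψl hψr h h' (dual R M f) = ψ f :=
  (RingQuot.lift_mkRingHom_apply _ _ _).trans ((TensorRing.lift_vec _ _ _ _ _).trans (by simp))

end lift

theorem closure_eq_top : Subring.closure
    (Set.range (scalar R M) ∪ (Set.range (vec R M) ∪ Set.range (dual R M))) = ⊤ := by
  have h1 := congrArg (Subring.map (proj R M))
    (TensorRing.closure_eq_top (R := R) (N := LeftDual R M × M))
  rw [RingHom.map_closure, ← RingHom.range_eq_map,
    RingHom.range_eq_top_of_surjective _ (RingQuot.mkRingHom_surjective _)] at h1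
  rw [eq_top_iff, ← h1, Subring.closure_le]
  rintro _ ⟨_, ⟨r, rfl⟩ | ⟨⟨f, x⟩, rfl⟩, rfl⟩
  · exact Subring.subset_closure (Or.inl ⟨r, rfl⟩)
  · have h2 : proj R M (TensorRing.vec R _ (f, x)) = dual R M f + vec R M x := by
      change _ = proj R M (TensorRing.vec R _ (f, 0)) + proj R M (TensorRing.vec R _ (0, x))
      rw [← map_add, ← TensorRing.vec_add, Prod.mk_add_mk, add_zero, zero_add]
    rw [h2]
    exact Subring.add_mem _ (Subring.subset_closure (Or.inr (Or.inr ⟨f, rfl⟩)))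
      (Subring.subset_closure (Or.inr (Or.inl ⟨x, rfl⟩)))

theorem scalar_mem (r : R) : scalar R M r ∈ component R M 0 :=
  AddSubgroup.subset_closure (.scalar r)

theorem vec_mem (x : M) : vec R M x ∈ component R M (-1) := AddSubgroup.subset_closure (.vec x)

theorem dual_mem (f : LeftDual R M) : dual R M f ∈ component R M 1 :=
  AddSubgroup.subset_closure (.dual f)

theorem mul_mem_component {m n p : ℤ} (h : m + n = p) {y z : LeavittRing R M}
    (hy : y ∈ component R M m) (hz : z ∈ component R M n) : y * z ∈ component R M p :=
  h ▸ SetLike.mul_mem_graded hy hz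

/-! ### The grading of the Leavitt ring -/

open AddMonoidAlgebra in
variable (R M) in
/-- The homomorphism to the ring of Laurent polynomials which multiplies elements of degree `n` by
the `n`th power of the variable. -/
noncomputable def coaction : LeavittRing R M →+* AddMonoidAlgebra (LeavittRing R M) ℤ :=
  lift (singleZeroRingHom.comp (scalar R M)) ((singleAddHom (-1)).comp (vec R M))
    ((singleAddHom 1).comp (dual R M))
    (fun r x => by
      change single (-1) (vec R M (r • x)) = single 0 (scalar R M r) * single (-1) (vec R M x)
      rw [single_mul_single, vec_smul, zero_add])
    (fun r x => by
      change single (-1) (vec R M (op r • x)) = single (-1) (vec R M x) * single 0 (scalar R M r)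
      rw [single_mul_single, vec_op_smul, add_zero])
    (fun r f => by
      change single 1 (dual R M (r • f)) = single 0 (scalar R M r) * single 1 (dual R M f)
      rw [single_mul_single, dual_smul, zero_add])
    (fun r f => by
      change single 1 (dual R M (op r • f)) = single 1 (dual R M f) * single 0 (scalar R M r)
      rw [single_mul_single, dual_op_smul, add_zero])
    (fun x f => by
      change single (-1) (vec R M x) * single 1 (dual R M f) = single 0 (scalar R M (f x))
      rw [single_mul_single, vec_mul_dual, neg_add_cancel])
    (fun n α α' h => by
      simp only [AddMonoidHom.comp_apply, singleAddHom_apply, single_mul_single]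
      rw [add_neg_cancel, one_def, ← sum_dual_mul_vec h]
      exact (map_sum (singleAddHom (R := LeavittRing R M) (0 : ℤ)) _ _).symm)

theorem coaction_of_mem {n : ℤ} {z : LeavittRing R M} (hz : z ∈ component R M n) :
    coaction R M z = AddMonoidAlgebra.single n z := by
  have h : component R M n ≤
      (coaction R M).toAddMonoidHom.eqLocus (AddMonoidAlgebra.singleAddHom n) := by
    refine (AddSubgroup.closure_le _).2 fun y hy => ?_
    change IsMonomial R M n y at hy
    clear hz
    induction hy with
    | scalar r => exact lift_scalar _ _ _ _ _ _ _ _ _ r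
    | vec x => exact lift_vec _ _ _ _ _ _ _ _ _ x
    | dual f => exact lift_dual _ _ _ _ _ _ _ _ _ f
    | mul _ _ h₁ h₂ =>
      refine (map_mul (coaction R M) _ _).trans ?_
      refine (congrArg₂ (· * ·) h₁ h₂).trans ?_
      exact AddMonoidAlgebra.single_mul_single _ _ _ _
  exact h hz

open DirectSum in
-- The coaction multiplies degree `n` by the `n`th power of the variable, so its coefficients
-- recover homogeneous components and the sum is direct. The components span because the generators
-- are homogeneous.
theorem isInternal : DirectSum.IsInternal (component R M) := by
  constructor
  · let π (n : ℤ) : LeavittRing R M →+ LeavittRing R M :=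
      AddMonoidHom.mk' (fun z => (coaction R M z).coeff n) (fun y z => by simp)
    have h (n : ℤ) : ∀ x : ⨁ n, component R M n,
        π n (DirectSum.coeAddMonoidHom (component R M) x) = x n := by
      intro x
      induction x using DirectSum.induction_on with
      | zero => simp
      | of m y =>
        rw [DirectSum.coeAddMonoidHom_of]
        change (coaction R M y).coeff n = _
        rw [coaction_of_mem y.2, AddMonoidAlgebra.coeff_single, DirectSum.coe_of_apply,
          Finsupp.single_apply]
        split_ifs <;> rfl
      | add x y hx hy => rw [map_add, map_add, hx, hy]; rfl
    intro x y hxy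
    refine DFunLike.ext _ _ fun n => Subtype.ext ?_
    rw [← h, ← h]
    exact congrArg (π n) hxy
  · let S := (DirectSum.coeRingHom (component R M)).range
    have hS : S = ⊤ := by
      rw [eq_top_iff, ← closure_eq_top, Subring.closure_le]
      rintro _ (⟨r, rfl⟩ | ⟨x, rfl⟩ | ⟨f, rfl⟩)
      · exact ⟨DirectSum.of (fun n => component R M n) 0 ⟨_, scalar_mem r⟩,
          DirectSum.coeAddMonoidHom_of _ _ _⟩
      · exact ⟨DirectSum.of (fun n => component R M n) (-1) ⟨_, vec_mem x⟩,
          DirectSum.coeAddMonoidHom_of _ _ _⟩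
      · exact ⟨DirectSum.of (fun n => component R M n) 1 ⟨_, dual_mem f⟩,
          DirectSum.coeAddMonoidHom_of _ _ _⟩
    intro z
    exact (hS ▸ Subring.mem_top z : z ∈ S)

/-! ### The strong grading -/

variable (R M) in
/-- The homogeneous component of degree `n`, as a `ℤ`-submodule. -/
abbrev comp (n : ℤ) : Submodule ℤ (LeavittRing R M) := (component R M n).toIntSubmodule

theorem comp_mul_le {m n p : ℤ} (h : m + n = p) : comp R M m * comp R M n ≤ comp R M p :=
  Submodule.mul_le.2 fun _ hy _ hz => mul_mem_component h hy hz

theorem closure_image2_eq (m n : ℤ) :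
    AddSubgroup.closure (Set.image2 (· * ·) (component R M m : Set (LeavittRing R M))
      (component R M n)) = (comp R M m * comp R M n).toAddSubgroup := by
  rw [Submodule.mul_eq_span_mul_set, Submodule.span_int_eq_addSubgroupClosure]
  rfl

variable (R M) in
/-- The image of the base ring in the Leavitt ring. -/
def scalars : Submodule ℤ (LeavittRing R M) :=
  LinearMap.range (scalar R M).toAddMonoidHom.toIntLinearMap

variable (R M) in
/-- The image of the bimodule in the Leavitt ring. -/
def vecs : Submodule ℤ (LeavittRing R M) := LinearMap.range (vec R M).toIntLinearMap

variable (R M) in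
/-- The image of the dual of the bimodule in the Leavitt ring. -/
def duals : Submodule ℤ (LeavittRing R M) := LinearMap.range (dual R M).toIntLinearMap

theorem one_le_scalars : 1 ≤ scalars R M := Submodule.one_le.2 ⟨1, map_one (scalar R M)⟩

theorem vecs_mul_duals_le : vecs R M * duals R M ≤ scalars R M :=
  Submodule.mul_le.2 (by rintro _ ⟨x, rfl⟩ _ ⟨f, rfl⟩; exact ⟨f x, (vec_mul_dual x f).symm⟩)

theorem scalars_mul_vecs_le : scalars R M * vecs R M ≤ vecs R M :=
  Submodule.mul_le.2 (by rintro _ ⟨r, rfl⟩ _ ⟨x, rfl⟩; exact ⟨r • x, vec_smul r x⟩)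

theorem vecs_mul_scalars_le : vecs R M * scalars R M ≤ vecs R M :=
  Submodule.mul_le.2 (by rintro _ ⟨x, rfl⟩ _ ⟨r, rfl⟩; exact ⟨op r • x, vec_op_smul r x⟩)

theorem scalars_mul_duals_le : scalars R M * duals R M ≤ duals R M :=
  Submodule.mul_le.2 (by rintro _ ⟨r, rfl⟩ _ ⟨f, rfl⟩; exact ⟨r • f, dual_smul r f⟩)

theorem one_le_duals_mul_vecs {n : ℕ} {α : Fin n → M} {α' : Fin n → LeftDual R M}
    (h : IsDualBasis α α') : 1 ≤ duals R M * vecs R M := by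
  rw [Submodule.one_le, ← sum_dual_mul_vec h]
  exact Submodule.sum_mem _ fun j _ => Submodule.mul_mem_mul ⟨_, rfl⟩ ⟨_, rfl⟩

/-- The Casimir relation is inserted repeatedly in the middle of the product. This half of the
strong grading needs no chain condition. -/
theorem one_le_duals_pow_mul_vecs_pow {n : ℕ} {α : Fin n → M} {α' : Fin n → LeftDual R M}
    (h : IsDualBasis α α') (k : ℕ) : 1 ≤ duals R M ^ k * vecs R M ^ k := by
  induction k with
  | zero => simp
  | succ k ih =>
    calc 1 ≤ duals R M ^ k * vecs R M ^ k := ih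
      _ = duals R M ^ k * 1 * vecs R M ^ k := by rw [mul_one]
      _ ≤ duals R M ^ k * (duals R M * vecs R M) * vecs R M ^ k := by
        gcongr; exact one_le_duals_mul_vecs h
      _ = _ := by rw [pow_succ, pow_succ' (vecs R M)]; simp only [mul_assoc]

theorem vecs_le : vecs R M ≤ comp R M (-1) := by rintro _ ⟨x, rfl⟩; exact vec_mem x

theorem duals_le : duals R M ≤ comp R M 1 := by rintro _ ⟨f, rfl⟩; exact dual_mem f

theorem scalars_le : scalars R M ≤ comp R M 0 := by rintro _ ⟨r, rfl⟩; exact scalar_mem r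

theorem vecs_pow_le (k : ℕ) : vecs R M ^ k ≤ comp R M (-k) := by
  induction k with
  | zero =>
    rw [pow_zero]
    exact one_le_scalars.trans (by simpa using scalars_le)
  | succ k ih =>
    rw [pow_succ]
    exact (mul_le_mul' ih vecs_le).trans (comp_mul_le (by push_cast; ring))

theorem duals_pow_le (k : ℕ) : duals R M ^ k ≤ comp R M k := by
  induction k with
  | zero =>
    rw [pow_zero]
    exact one_le_scalars.trans (by simpa using scalars_le)
  | succ k ih =>
    rw [pow_succ]
    exact (mul_le_mul' ih duals_le).trans (comp_mul_le (by push_cast; ring))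

variable (R M) in
/-- The trace ideal of a tensor power of the bimodule, in the Leavitt ring. -/
def traces (k : ℕ) : Submodule ℤ (LeavittRing R M) := vecs R M ^ (k + 1) * duals R M ^ (k + 1)

/-- Evaluating the innermost factor of `M` on the innermost factor of `M^*` gives a scalar, which is
absorbed by the next factor of `M^*`. -/
theorem traces_succ_le (k : ℕ) : traces R M (k + 1) ≤ traces R M k :=
  calc vecs R M ^ (k + 2) * duals R M ^ (k + 2)
      = vecs R M ^ (k + 1) * ((vecs R M * duals R M) * duals R M ^ (k + 1)) := by
        rw [pow_succ, pow_succ' (duals R M)]; simp only [mul_assoc]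
    _ ≤ vecs R M ^ (k + 1) * (scalars R M * duals R M ^ (k + 1)) := by
        gcongr; exact vecs_mul_duals_le
    _ = vecs R M ^ (k + 1) * ((scalars R M * duals R M) * duals R M ^ k) := by
        rw [pow_succ' (duals R M), mul_assoc]
    _ ≤ vecs R M ^ (k + 1) * (duals R M * duals R M ^ k) := by
        gcongr; exact scalars_mul_duals_le
    _ = traces R M k := by rw [← pow_succ']; rfl

theorem scalars_mul_traces_le (k : ℕ) : scalars R M * traces R M k ≤ traces R M k :=
  calc scalars R M * (vecs R M ^ (k + 1) * duals R M ^ (k + 1))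
      = (scalars R M * vecs R M) * (vecs R M ^ k * duals R M ^ (k + 1)) := by
        rw [pow_succ' (vecs R M)]; simp only [mul_assoc]
    _ ≤ vecs R M * (vecs R M ^ k * duals R M ^ (k + 1)) := by
        gcongr; exact scalars_mul_vecs_le
    _ = traces R M k := by rw [← mul_assoc, ← pow_succ']; rfl

theorem traces_le_scalars (k : ℕ) : traces R M k ≤ scalars R M := by
  induction k with
  | zero => simpa [traces] using vecs_mul_duals_le
  | succ k ih => exact (traces_succ_le k).trans ih

variable (R M) in
-- The preimages in `R` of the trace ideals form a descending chain of left ideals. This is the only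
-- place where the proof of strong grading uses that `R` is artinian.
theorem exists_traces_succ_eq [IsArtinian R R] : ∃ k, traces R M k = traces R M (k + 1) := by
  let J (k : ℕ) : Submodule R R :=
    { carrier := {r | scalar R M r ∈ traces R M k}
      add_mem' {a b} ha hb := by
        change scalar R M _ ∈ traces R M k
        rw [map_add]
        exact Submodule.add_mem _ ha hb
      zero_mem' := by
        change scalar R M _ ∈ traces R M k
        rw [map_zero]
        exact Submodule.zero_mem _
      smul_mem' a b hb := by
        change scalar R M _ ∈ traces R M k
        rw [smul_eq_mul, map_mul]
        exact scalars_mul_traces_le k (Submodule.mul_mem_mul ⟨a, rfl⟩ hb) }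
  obtain ⟨k, hk⟩ := IsArtinian.monotone_stabilizes (R := R) (M := R)
    ⟨J, monotone_nat_of_le_succ fun k _ hr => traces_succ_le k hr⟩
  refine ⟨k, le_antisymm (fun z hz => ?_) (traces_succ_le k)⟩
  obtain ⟨r, rfl⟩ := traces_le_scalars k hz
  have h1 : r ∈ J k := hz
  have h2 : J k = J (k + 1) := hk (k + 1) k.le_succ
  rw [h2] at h1
  exact h1

theorem one_mem_comp_mul_comp_neg {n : ℕ} {α : Fin n → M} {α' : Fin n → LeftDual R M}
    (h : IsDualBasis α α') (k : ℕ) : 1 ≤ comp R M k * comp R M (-k) :=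
  (one_le_duals_pow_mul_vecs_pow h k).trans (mul_le_mul' (duals_pow_le k) (vecs_pow_le k))

/-- Squaring `1 ∈ D^(k + 1) V^(k + 1)`, with `V` and `D` the images of `M` and `M^*`, exposes a
trace ideal `V^(k + 1) D^(k + 1)` in the middle. When the chain is stationary at `k`, it may be
lengthened to `V^(k + 2) D^(k + 2)`, and cutting in its middle gives factors of degrees `-1` and
`1`. -/
theorem one_le_comp_neg_one_mul_comp_one [IsArtinian R R] {n : ℕ} {α : Fin n → M}
    {α' : Fin n → LeftDual R M} (h : IsDualBasis α α') : 1 ≤ comp R M (-1) * comp R M 1 := by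
  obtain ⟨k, hk⟩ := exists_traces_succ_eq R M
  have h1 := one_le_duals_pow_mul_vecs_pow h (k + 1)
  calc 1 ≤ duals R M ^ (k + 1) * vecs R M ^ (k + 1) := h1
    _ = duals R M ^ (k + 1) * (vecs R M ^ (k + 1) * 1) := by rw [mul_one]
    _ ≤ duals R M ^ (k + 1) * (vecs R M ^ (k + 1) *
        (duals R M ^ (k + 1) * vecs R M ^ (k + 1))) := by gcongr
    _ = duals R M ^ (k + 1) * (traces R M k * vecs R M ^ (k + 1)) := by
        rw [traces]; simp only [mul_assoc]
    -- Stationarity `hk` replaces the trace ideal of index `k` by that of index `k + 1`.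
    _ = (duals R M ^ (k + 1) * vecs R M ^ (k + 2)) *
        (duals R M ^ (k + 2) * vecs R M ^ (k + 1)) := by
        rw [hk, traces]; simp only [mul_assoc]
    _ ≤ (comp R M (k + 1 : ℕ) * comp R M (-(k + 2 : ℕ))) *
        (comp R M (k + 2 : ℕ) * comp R M (-(k + 1 : ℕ))) := by
        gcongr <;> first | exact duals_pow_le _ | exact vecs_pow_le _
    _ ≤ _ := mul_le_mul' (comp_mul_le (by push_cast; ring)) (comp_mul_le (by push_cast; ring))

theorem one_le_comp_mul_comp [IsArtinian R R] {n : ℕ} {α : Fin n → M}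
    {α' : Fin n → LeftDual R M} (h : IsDualBasis α α') (m : ℤ) :
    1 ≤ comp R M m * comp R M (-m) := by
  obtain ⟨k, rfl | rfl⟩ := m.eq_nat_or_neg
  · exact one_mem_comp_mul_comp_neg h k
  · rw [neg_neg]
    induction k with
    | zero => simpa using one_mem_comp_mul_comp_neg h 0
    | succ k ih =>
      calc 1 ≤ comp R M (-k) * comp R M k := ih
        _ = comp R M (-k) * (1 * comp R M k) := by rw [one_mul]
        _ ≤ comp R M (-k) * ((comp R M (-1) * comp R M 1) * comp R M k) := by
          gcongr; exact one_le_comp_neg_one_mul_comp_one h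
        _ = (comp R M (-k) * comp R M (-1)) * (comp R M 1 * comp R M k) := by
          simp only [mul_assoc]
        _ ≤ _ := mul_le_mul' (comp_mul_le (by push_cast; ring)) (comp_mul_le (by push_cast; ring))

theorem comp_mul_comp [IsArtinian R R] {n : ℕ} {α : Fin n → M}
    {α' : Fin n → LeftDual R M} (h : IsDualBasis α α') (l m : ℤ) :
    comp R M l * comp R M m = comp R M (l + m) := by
  refine le_antisymm (comp_mul_le rfl) ?_
  calc comp R M (l + m) = 1 * comp R M (l + m) := (one_mul _).symm
    _ ≤ (comp R M l * comp R M (-l)) * comp R M (l + m) := by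
      gcongr; exact one_le_comp_mul_comp h l
    _ ≤ _ := by
      rw [mul_assoc]
      exact mul_le_mul_right (comp_mul_le (by ring)) _

/-- The Leavitt ring of a finitely generated projective bimodule over an artinian ring is strongly
graded. -/
theorem isStronglyGraded [IsArtinian R R] {n : ℕ} {α : Fin n → M}
    {α' : Fin n → LeftDual R M} (h : IsDualBasis α α') : IsStronglyGraded (component R M) where
  graded := inferInstance
  isInternal := isInternal
  mul_eq l m := by
    rw [closure_image2_eq, comp_mul_comp h]
    rfl

/-- A partition of unity in a product of opposite homogeneous components. -/
theorem exists_sum_eq_one [IsArtinian R R] {n : ℕ} {α : Fin n → M}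
    {α' : Fin n → LeftDual R M} (h : IsDualBasis α α') (m : ℤ) :
    ∃ (k : ℕ) (y z : Fin k → LeavittRing R M), (∀ j, y j ∈ component R M m) ∧
      (∀ j, z j ∈ component R M (-m)) ∧ ∑ j, y j * z j = 1 := by
  have h1 : (1 : LeavittRing R M) ∈ comp R M m * comp R M (-m) :=
    Submodule.one_le.1 (one_le_comp_mul_comp h m)
  obtain ⟨k, c, hc⟩ : ∃ (k : ℕ) (c : Fin k → component R M m × component R M (-m)),
      ∑ j, (c j).1.1 * (c j).2.1 = 1 := by
    generalize (1 : LeavittRing R M) = w at h1 ⊢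
    induction h1 using Submodule.mul_induction_on' with
    | mem_mul_mem y hy z hz => exact ⟨1, fun _ => (⟨y, hy⟩, ⟨z, hz⟩), by simp⟩
    | add x _ y _ hx hy =>
      obtain ⟨k, c, rfl⟩ := hx
      obtain ⟨k', c', rfl⟩ := hy
      exact ⟨k + k', Fin.append c c', by simp [Fin.sum_univ_add]⟩
  exact ⟨k, fun j => (c j).1.1, fun j => (c j).2.1, fun j => (c j).1.2, fun j => (c j).2.2, hc⟩

end LeavittRing

/-! ### Germs of sequences -/

section Germ

variable (X : ℕ → Type*) [∀ q, AddCommGroup (X q)]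

/-- The sequences which are eventually zero. -/
def eventuallyZero : AddSubgroup (∀ q, X q) where
  carrier := {a | ∃ N, ∀ q ≥ N, a q = 0}
  add_mem' := by
    rintro a b ⟨N, hN⟩ ⟨N', hN'⟩
    exact ⟨max N N', fun q hq => by
      rw [Pi.add_apply, hN q (le_of_max_le_left hq), hN' q (le_of_max_le_right hq), add_zero]⟩
  zero_mem' := ⟨0, fun _ _ => rfl⟩
  neg_mem' := by
    rintro a ⟨N, hN⟩
    exact ⟨N, fun q hq => by rw [Pi.neg_apply, hN q hq, neg_zero]⟩

/-- Sequences modulo sequences which are eventually zero. -/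
abbrev SeqGerm : Type _ := (∀ q, X q) ⧸ eventuallyZero X

namespace SeqGerm

variable {X} {Y Z : ℕ → Type*} [∀ q, AddCommGroup (Y q)] [∀ q, AddCommGroup (Z q)]

/-- The germ of a sequence. -/
abbrev mk (a : ∀ q, X q) : SeqGerm X := QuotientAddGroup.mk' (eventuallyZero X) a

theorem mk_surjective : Function.Surjective (mk (X := X)) := QuotientAddGroup.mk'_surjective _

theorem mk_eq_zero {a : ∀ q, X q} : mk a = 0 ↔ ∃ N, ∀ q ≥ N, a q = 0 :=
  QuotientAddGroup.eq_zero_iff (N := eventuallyZero X) a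

theorem mk_eq_mk {a b : ∀ q, X q} (h : ∀ q, a (q + 1) = b (q + 1)) : mk a = mk b := by
  rw [← sub_eq_zero, ← map_sub]
  refine mk_eq_zero.2 ⟨1, fun q hq => ?_⟩
  obtain ⟨q, rfl⟩ := Nat.exists_eq_add_of_le' hq
  rw [Pi.sub_apply, h, sub_self]

/-- The map on germs given by a family of homomorphisms. -/
def diag (e : ∀ q, X q →+ Y q) : SeqGerm X →+ SeqGerm Y :=
  QuotientAddGroup.map _ _ (AddMonoidHom.mk' (fun a q => e q (a q)) (fun a b => by ext; simp)) (by
    rintro a ⟨N, hN⟩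
    exact ⟨N, fun q hq => (congrArg (e q) (hN q hq)).trans (map_zero _)⟩)

/-- The map on germs given by a family of homomorphisms raising the index. -/
def up (e : ∀ q, X q →+ Y (q + 1)) : SeqGerm X →+ SeqGerm Y :=
  -- Index `0` receives nothing from below and is filled with `0`; germs do not see this choice.
  QuotientAddGroup.map _ _ (AddMonoidHom.mk' (fun a q => Nat.casesOn q 0 fun q => e q (a q))
    (fun a b => by ext (_ | q) <;> simp)) (by
    rintro a ⟨N, hN⟩
    refine ⟨N + 1, fun q hq => ?_⟩
    obtain ⟨q, rfl⟩ := Nat.exists_eq_add_of_le' (Nat.one_le_of_lt hq)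
    exact (congrArg (e q) (hN q (by omega))).trans (map_zero _))

/-- The map on germs given by a family of homomorphisms lowering the index. -/
def down (e : ∀ q, X (q + 1) →+ Y q) : SeqGerm X →+ SeqGerm Y :=
  QuotientAddGroup.map _ _ (AddMonoidHom.mk' (fun a q => e q (a (q + 1)))
    (fun a b => by ext; simp)) (by
    rintro a ⟨N, hN⟩
    exact ⟨N, fun q hq => (congrArg (e q) (hN (q + 1) (by omega))).trans (map_zero _)⟩)

theorem hom_ext {A : Type*} [AddCommGroup A] {f g : SeqGerm X →+ A}
    (h : ∀ a, f (mk a) = g (mk a)) : f = g := by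
  ext z
  exact h z

end SeqGerm

end Germ

/-! ### Comparison of two ways of iterating an endofunctor. -/

namespace CategoryTheory.Functor

variable {C : Type u} [Category.{v} C] (Ω : C ⥤ C)

/-- The iterates of an endofunctor, with the last factor applied first. -/
def innerIter : ℕ → (C ⥤ C)
  | 0 => 𝟭 C
  | q + 1 => Ω ⋙ innerIter q

/-- The iterates of an endofunctor commute with it. -/
def iterCommIso : (q : ℕ) → (Ω ⋙ Stabilization.iter Ω q ≅ Stabilization.iter Ω q ⋙ Ω)
  | 0 => Iso.refl _
  | q + 1 => isoWhiskerRight (iterCommIso q) Ω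

/-- The two definitions of the iterates agree. -/
def innerIterIso : (q : ℕ) → (Ω.innerIter q ≅ Stabilization.iter Ω q)
  | 0 => Iso.refl _
  | q + 1 => isoWhiskerLeft Ω (innerIterIso q) ≪≫ Ω.iterCommIso q

instance [Preadditive C] [Ω.Additive] (q : ℕ) : (Ω.innerIter q).Additive := by
  induction q with
  | zero => exact inferInstanceAs (𝟭 C).Additive
  | succ q ih => exact inferInstanceAs (Ω ⋙ Ω.innerIter q).Additive

/-- The action on germs operates on the tensor factor nearest to the argument and so needs
`innerIter`, whereas the stabilization is built with the outermost factor added last. The natural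
isomorphism transfers vanishing between the two. -/
theorem iter_map_eq_zero_of_innerIter [Preadditive C] {X Y : C} {q : ℕ} {f : X ⟶ Y}
    (h : (Ω.innerIter q).map f = 0) : (Stabilization.iter Ω q).map f = 0 := by
  rw [← cancel_epi ((Ω.innerIterIso q).hom.app X), ← (Ω.innerIterIso q).hom.naturality, h,
    zero_comp, comp_zero]

end CategoryTheory.Functor

/-! ### The action of the Leavitt ring on germs of iterated tensor products -/

namespace LeavittRing

section

variable {R M : Type u} [Ring R] [AddCommGroup M] [Module R M]
  [Module Rᵐᵒᵖ M] [SMulCommClass R Rᵐᵒᵖ M] {A : Type*} [Ring A] (i : R → A) (φ : M → A)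
  (ψ : LeftDual R M → A) (h0 : i 0 = 0) (h1 : i 1 = 1) (hi : ∀ r s, i (r + s) = i r + i s)
  (hi' : ∀ r s, i (r * s) = i s * i r) (hφ : ∀ x y, φ (x + y) = φ x + φ y)
  (hψ : ∀ f g, ψ (f + g) = ψ f + ψ g) (hφl : ∀ r x, φ (r • x) = φ x * i r)
  (hφr : ∀ r x, φ (op r • x) = i r * φ x) (hψl : ∀ r f, ψ (r • f) = ψ f * i r)
  (hψr : ∀ r f, ψ (op r • f) = i r * ψ f) (h : ∀ x f, ψ f * φ x = i (f x))
  (h' : ∀ (n : ℕ) (α : Fin n → M) (α' : Fin n → LeftDual R M), IsDualBasis α α' →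
    ∑ j, φ (α j) * ψ (α' j) = 1)

/-- A homomorphism from the Leavitt ring to the opposite of a ring. -/
def liftOp : LeavittRing R M →+* Aᵐᵒᵖ :=
  lift { toFun r := op (i r)
         map_one' := congrArg op h1
         map_mul' r s := congrArg op (hi' r s)
         map_zero' := congrArg op h0
         map_add' r s := congrArg op (hi r s) }
    (AddMonoidHom.mk' (fun x => op (φ x)) fun x y => congrArg op (hφ x y))
    (AddMonoidHom.mk' (fun f => op (ψ f)) fun f g => congrArg op (hψ f g))
    (fun r x => congrArg op (hφl r x)) (fun r x => congrArg op (hφr r x))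
    (fun r f => congrArg op (hψl r f)) (fun r f => congrArg op (hψr r f))
    (fun x f => congrArg op (h x f)) (fun n α α' hα => by
      refine Eq.trans ?_ (congrArg op (h' n α α' hα))
      exact (map_sum opAddEquiv _ _).symm)

theorem liftOp_scalar (r : R) :
    liftOp i φ ψ h0 h1 hi hi' hφ hψ hφl hφr hψl hψr h h' (scalar R M r) = op (i r) :=
  lift_scalar _ _ _ _ _ _ _ _ _ r

end

section

variable (R M : Type u) [Ring R] [AddCommGroup M] [Module R M]
  [Module Rᵐᵒᵖ M] [SMulCommClass R Rᵐᵒᵖ M]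

/-- The Leavitt ring as a right module over the base ring. -/
instance : Module Rᵐᵒᵖ (LeavittRing R M) := Module.compHom _ (scalar R M).op

variable [IsNoetherianRing R] [Module.Finite R M]

/-- The underlying group of an iterated tensor product. -/
abbrev IterTensor (V : FPMod R) (q : ℕ) : Type u :=
  (((tensorFunctor R M).innerIter q).obj V).obj

/-- The map induced on iterated tensor products. -/
abbrev iterMap {V W : FPMod R} (f : V ⟶ W) (q : ℕ) : IterTensor R M V q →+ IterTensor R M W q :=
  (((tensorFunctor R M).innerIter q).map f).hom.hom.toAddMonoidHom

variable {R M}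

theorem iterMap_comp {V W U : FPMod R} (f : V ⟶ W) (g : W ⟶ U) (q : ℕ) (a) :
    iterMap R M g q (iterMap R M f q a) = iterMap R M (f ≫ g) q a :=
  (congrArg (fun k : _ ⟶ ((tensorFunctor R M).innerIter q).obj U => k.hom.hom a)
    (((tensorFunctor R M).innerIter q).map_comp f g)).symm

theorem iterMap_add {V W : FPMod R} (f g : V ⟶ W) (q : ℕ) :
    iterMap R M (f + g) q = iterMap R M f q + iterMap R M g q := by
  ext a
  exact congrArg (fun k : _ ⟶ ((tensorFunctor R M).innerIter q).obj W => k.hom.hom a)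
    ((tensorFunctor R M).innerIter q).map_add

theorem iterMap_id (V : FPMod R) (q : ℕ) (a) : iterMap R M (𝟙 V) q a = a :=
  congrArg (fun k : _ ⟶ ((tensorFunctor R M).innerIter q).obj V => k.hom.hom a)
    (((tensorFunctor R M).innerIter q).map_id V)

/-- The morphism `R ⟶ M ⊗ R` given by an element of `M`. -/
abbrev vecHom (x : M) : FPMod.self R ⟶ (tensorFunctor R M).obj (FPMod.self R) :=
  FPMod.ofElem (X := (tensorFunctor R M).obj (FPMod.self R)) (BalTensor.tmul R x (1 : R))

/-- The morphism `M ⊗ R ⟶ R` given by an element of the dual of `M`. -/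
def dualHom (f : LeftDual R M) : (tensorFunctor R M).obj (FPMod.self R) ⟶ FPMod.self R :=
  ObjectProperty.homMk (ModuleCat.ofHom
    (LinearMap.comp (show M →ₗ[R] R from f) (BalTensor.rid R M).toLinearMap))

variable (R M) in
/-- The right module of germs. -/
abbrev GermModule (V : FPMod R) : Type u := SeqGerm (IterTensor R M V)

theorem ofElem_add {V : FPMod R} (v w : V.obj) :
    FPMod.ofElem (v + w) = FPMod.ofElem v + FPMod.ofElem w :=
  FPMod.hom_self_ext (smul_add (1 : R) v w)

theorem iterMap_congr {V W U : FPMod R} {f : V ⟶ W} {g : W ⟶ U} {h : V ⟶ U} (e : f ≫ g = h)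
    (q : ℕ) (a) : iterMap R M h q a = iterMap R M g q (iterMap R M f q a) := by
  rw [iterMap_comp, e]

theorem iterMap_add_apply {V W : FPMod R} (f g : V ⟶ W) (q : ℕ) (a) :
    iterMap R M (f + g) q a = iterMap R M f q a + iterMap R M g q a :=
  DFunLike.congr_fun (iterMap_add f g q) a

variable (R M) in
/-- The endomorphisms of the group of germs. -/
abbrev GermEnd : Type u := AddMonoid.End (GermModule R M (FPMod.self R))

/-- The endomorphism of the group of germs given by a scalar. -/
def germScalar (r : R) : GermEnd R M :=
  SeqGerm.diag fun q => iterMap R M (FPMod.ofElem (X := FPMod.self R) r) q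

/-- The endomorphism of the group of germs given by an element of the bimodule. -/
def germVec (x : M) : GermEnd R M := SeqGerm.up fun q => iterMap R M (vecHom x) q

/-- The endomorphism of the group of germs given by an element of the dual of the bimodule. -/
def germDual (f : LeftDual R M) : GermEnd R M := SeqGerm.down fun q => iterMap R M (dualHom f) q

theorem germEnd_ext {f g : GermEnd R M} (h : ∀ a, f (SeqGerm.mk a) = g (SeqGerm.mk a)) : f = g :=
  SeqGerm.hom_ext h

theorem germScalar_one : germScalar (M := M) (1 : R) = 1 :=
  germEnd_ext fun a => congrArg SeqGerm.mk (funext fun q => by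
    have h : FPMod.ofElem (X := FPMod.self R) (1 : R) = 𝟙 _ :=
      FPMod.hom_self_ext (one_smul R (1 : R))
    exact (congrArg (fun k => iterMap R M k q (a q)) h).trans (iterMap_id _ _ _))

theorem germScalar_mul (r s : R) :
    germScalar (M := M) (r * s) = germScalar s * germScalar r :=
  germEnd_ext fun a => congrArg SeqGerm.mk (funext fun q =>
    iterMap_congr (f := FPMod.ofElem (X := FPMod.self R) r)
      (g := FPMod.ofElem (X := FPMod.self R) s) (FPMod.ofElem_comp _ _) q (a q))

theorem germScalar_add (r s : R) :
    germScalar (M := M) (r + s) = germScalar r + germScalar s :=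
  germEnd_ext fun a => congrArg SeqGerm.mk (funext fun q =>
    (congrArg (fun k => iterMap R M k q (a q)) (ofElem_add (V := FPMod.self R) r s)).trans
      (iterMap_add_apply _ _ _ _))

theorem germVec_add (x y : M) : germVec (R := R) (x + y) = germVec x + germVec y :=
  germEnd_ext fun a => SeqGerm.mk_eq_mk fun q => by
    have h : vecHom (x + y) = vecHom x + vecHom y :=
      (congrArg FPMod.ofElem (BalTensor.add_tmul x y (1 : R))).trans (ofElem_add _ _)
    exact (congrArg (fun k => iterMap R M k q (a q)) h).trans (iterMap_add_apply _ _ _ _)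

theorem germDual_add (f g : LeftDual R M) : germDual (f + g) = germDual f + germDual g :=
  germEnd_ext fun a => congrArg SeqGerm.mk (funext fun q =>
    iterMap_add_apply (dualHom f) (dualHom g) q (a (q + 1)))

theorem germVec_smul (r : R) (x : M) : germVec (r • x) = germVec x * germScalar r :=
  germEnd_ext fun a => SeqGerm.mk_eq_mk fun q =>
    iterMap_congr (f := FPMod.ofElem (X := FPMod.self R) r) (g := vecHom x)
      ((FPMod.ofElem_comp _ _).trans
        (congrArg FPMod.ofElem (BalTensor.smul_tmul_left (R := R) r x (1 : R)))) q (a q)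

theorem germVec_op_smul (r : R) (x : M) : germVec (op r • x) = germScalar r * germVec x :=
  germEnd_ext fun a => SeqGerm.mk_eq_mk fun q =>
    iterMap_congr (f := vecHom x)
      (g := (tensorFunctor R M).map (FPMod.ofElem (X := FPMod.self R) r))
      ((FPMod.ofElem_comp _ _).trans (congrArg FPMod.ofElem (by
        change BalTensor.tmul R x ((1 : R) • r) = BalTensor.tmul R (op r • x) (1 : R)
        rw [BalTensor.smul_tmul, smul_eq_mul, smul_eq_mul, one_mul, mul_one]))) q (a q)

theorem map_ofElem_comp_dualHom (r : R) (f : LeftDual R M) :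
    (tensorFunctor R M).map (FPMod.ofElem (X := FPMod.self R) r) ≫ dualHom f =
      dualHom (r • f) := by
  ext z
  refine LinearMap.congr_fun (f := (dualHom f).hom.hom ∘ₗ
    ((tensorFunctor R M).map (FPMod.ofElem (X := FPMod.self R) r)).hom.hom)
    (g := (dualHom (r • f)).hom.hom) (BalTensor.linearMap_ext fun m b => ?_) z
  change f (op (b * r) • m) = f (op r • op b • m)
  rw [smul_smul]
  rfl

theorem dualHom_comp_ofElem (r : R) (f : LeftDual R M) :
    dualHom f ≫ FPMod.ofElem (X := FPMod.self R) r = dualHom (op r • f) := by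
  ext z
  exact LinearMap.congr_fun (f := (FPMod.ofElem (X := FPMod.self R) r).hom.hom ∘ₗ
    (dualHom f).hom.hom) (g := (dualHom (op r • f)).hom.hom)
    (BalTensor.linearMap_ext fun m b => rfl) z

theorem germDual_smul (r : R) (f : LeftDual R M) :
    germDual (r • f) = germDual f * germScalar r :=
  germEnd_ext fun a => congrArg SeqGerm.mk (funext fun q =>
    iterMap_congr (map_ofElem_comp_dualHom r f) q (a (q + 1)))

theorem germDual_op_smul (r : R) (f : LeftDual R M) :
    germDual (op r • f) = germScalar r * germDual f :=
  germEnd_ext fun a => congrArg SeqGerm.mk (funext fun q =>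
    iterMap_congr (dualHom_comp_ofElem r f) q (a (q + 1)))

theorem germScalar_apply (f : LeftDual R M) (x : M) :
    germScalar (f x) = germDual f * germVec x :=
  germEnd_ext fun a => congrArg SeqGerm.mk (funext fun q =>
    iterMap_congr (f := vecHom x) (g := dualHom f) ((FPMod.ofElem_comp _ _).trans
      (congrArg FPMod.ofElem (by
        change f (op (1 : R) • x) = f x
        rw [op_one, one_smul]))) q (a q))

theorem _root_.FPMod.sum_apply {ι : Type*} {V W : FPMod R} (s : Finset ι) (f : ι → (V ⟶ W))
    (x : V.obj) : (∑ j ∈ s, f j).hom.hom x = ∑ j ∈ s, (f j).hom.hom x :=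
  map_sum (AddMonoidHom.mk' (fun k : V ⟶ W => k.hom.hom x) fun _ _ => rfl) f s

theorem sum_dualHom_comp_vecHom {n : ℕ} {α : Fin n → M} {α' : Fin n → LeftDual R M}
    (h : IsDualBasis α α') : ∑ j, dualHom (α' j) ≫ vecHom (α j) = 𝟙 _ := by
  ext z
  refine LinearMap.congr_fun (f := (∑ j, dualHom (α' j) ≫ vecHom (α j)).hom.hom)
    (g := LinearMap.id) (BalTensor.linearMap_ext fun m b => ?_) z
  refine (FPMod.sum_apply _ _ _).trans ?_
  change ∑ j, BalTensor.tmul R ((α' j (op b • m)) • α j) (1 : R) = BalTensor.tmul R m b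
  rw [← BalTensor.sum_tmul, ← h, BalTensor.smul_tmul, smul_eq_mul, mul_one]

/-- The endomorphism of the group of germs given by an endomorphism of `M ⊗ R`. -/
def germShift : ((tensorFunctor R M).obj (FPMod.self R) ⟶ (tensorFunctor R M).obj (FPMod.self R))
    →+ GermEnd R M :=
  AddMonoidHom.mk' (fun k => (SeqGerm.up (X := fun q => IterTensor R M (FPMod.self R) (q + 1))
    (fun q => iterMap R M k q)).comp (SeqGerm.down fun _ => AddMonoidHom.id _)) (fun k l =>
      germEnd_ext fun a => SeqGerm.mk_eq_mk fun q => iterMap_add_apply k l q (a (q + 1)))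

/-- This is the dual basis identity in the innermost factor. On sequences it fails at index `0`,
where lowering and then raising the index gives zero; this is why germs are used. -/
theorem sum_germVec_mul_germDual {n : ℕ} {α : Fin n → M} {α' : Fin n → LeftDual R M}
    (h : IsDualBasis α α') : ∑ j, germVec (α j) * germDual (α' j) = 1 := by
  have h1 : ∀ j, germVec (α j) * germDual (α' j) =
      germShift (dualHom (α' j) ≫ vecHom (α j)) := fun j =>
    germEnd_ext fun a => SeqGerm.mk_eq_mk fun q => iterMap_comp _ _ q (a (q + 1))
  have h2 : germShift (𝟙 ((tensorFunctor R M).obj (FPMod.self R))) = 1 :=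
    germEnd_ext fun a => SeqGerm.mk_eq_mk fun q => iterMap_id _ q (a (q + 1))
  rw [Finset.sum_congr rfl fun j _ => h1 j, ← h2, ← sum_dualHom_comp_vecHom h, map_sum]

theorem germScalar_zero : germScalar (M := M) (0 : R) = 0 :=
  germEnd_ext fun a => congrArg SeqGerm.mk (funext fun q =>
    (congrArg (fun k => iterMap R M k q (a q)) (FPMod.ofElem_eq_zero_iff.2 rfl)).trans
      (congrArg (fun k : _ ⟶ ((tensorFunctor R M).innerIter q).obj (FPMod.self R) =>
        k.hom.hom (a q)) (((tensorFunctor R M).innerIter q).map_zero _ _)))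

/-- The right action of the Leavitt ring on germs. -/
def germAct : LeavittRing R M →+* (GermEnd R M)ᵐᵒᵖ :=
  liftOp germScalar germVec germDual germScalar_zero germScalar_one germScalar_add germScalar_mul
    germVec_add germDual_add germVec_smul germVec_op_smul germDual_smul germDual_op_smul
    (fun x f => (germScalar_apply f x).symm) (fun _ _ _ h => sum_germVec_mul_germDual h)

theorem germAct_scalar (r : R) : germAct (scalar R M r) = op (germScalar r) :=
  liftOp_scalar _ _ _ _ _ _ _ _ _ _ _ _ _ _ _ _

/-- The pairing between germs and a module. -/
def germPairing (V : FPMod R) (v : V.obj) :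
    GermModule R M (FPMod.self R) →+ GermModule R M V :=
  SeqGerm.diag fun q => iterMap R M (FPMod.ofElem v) q

theorem germPairing_add {V : FPMod R} (v w : V.obj) :
    germPairing (M := M) V (v + w) = germPairing V v + germPairing V w :=
  SeqGerm.hom_ext fun a => congrArg SeqGerm.mk (funext fun q =>
    (congrArg (fun k => iterMap R M k q (a q)) (ofElem_add v w)).trans
      (iterMap_add_apply _ _ _ _))

theorem germPairing_germScalar {V : FPMod R} (φ : GermModule R M (FPMod.self R)) (r : R)
    (v : V.obj) : germPairing V v (germScalar r φ) = germPairing V (r • v) φ := by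
  obtain ⟨a, rfl⟩ := SeqGerm.mk_surjective φ
  exact congrArg SeqGerm.mk (funext fun q => (iterMap_congr (FPMod.ofElem_comp _ _) q (a q)).symm)

/-- The pairing of a germ with a tensor over the Leavitt ring. -/
def germTensor {V : FPMod R} (φ : GermModule R M (FPMod.self R)) :
    BalTensor R (LeavittRing R M) V.obj →+ GermModule R M V :=
  BalTensor.lift (AddMonoidHom.mk' (fun l => AddMonoidHom.mk'
      (fun v => germPairing V v ((germAct l).unop φ)) (fun v w => by
        rw [germPairing_add, AddMonoidHom.add_apply]))
      (fun l l' => by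
        ext v
        change germPairing V v ((germAct (l + l')).unop φ) = germPairing V v ((germAct l).unop φ) +
          germPairing V v ((germAct l').unop φ)
        rw [map_add, ← map_add (germPairing V v)]
        rfl))
    (fun l r v => by
      change germPairing V v ((germAct (l * scalar R M r)).unop φ) =
        germPairing V (r • v) ((germAct l).unop φ)
      rw [map_mul, ← germPairing_germScalar, germAct_scalar]
      rfl)

/-- Elements which vanish over the Leavitt ring vanish after tensoring with a power of the
bimodule. -/
theorem exists_iter_ofElem_eq_zero {V : FPMod R} (v : V.obj)
    (h : BalTensor.tmul R (1 : LeavittRing R M) v = 0) :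
    ∃ k, (Stabilization.iter (tensorFunctor R M) k).map (FPMod.ofElem v) = 0 := by
  suffices H : ∃ k, ((tensorFunctor R M).innerIter k).map (FPMod.ofElem v) = 0 from
    H.imp fun k => Functor.iter_map_eq_zero_of_innerIter _
  by_contra! H
  have H' : ∀ q, ∃ a, iterMap R M (FPMod.ofElem v) q a ≠ 0 := fun q => by
    by_contra! H''
    refine H q ?_
    ext a
    exact H'' a
  -- If every power of the bimodule leaves `v` nonzero, choose a tensor `a q` detecting this for
  -- each `q`. The pairing of the germ of `a` with `1 ⊗ v = 0` would be the germ of a sequence with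
  -- no zero entry.
  choose a ha using H'
  have h1 : germTensor (SeqGerm.mk a) (BalTensor.tmul R (1 : LeavittRing R M) v) = 0 := by
    rw [h, map_zero]
  have h2 : germPairing V v ((germAct (1 : LeavittRing R M)).unop (SeqGerm.mk a)) = 0 := h1
  rw [map_one] at h2
  obtain ⟨N, hN⟩ := SeqGerm.mk_eq_zero.1 h2
  exact ha N (hN N le_rfl)

end

end LeavittRing

/-! ### The homogeneous components of the Leavitt ring as bimodules -/

/-- Tensoring a presentation of `N` keeps it exact, and `M ⊗_R R^m` is finitely generated projective
over `S`, hence finitely presented; the kernel of its map onto `M ⊗_R N` is an image of a finite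
module. -/
theorem BalTensor.finitePresentation (R S M N : Type*) [Ring R] [Ring S] [AddCommGroup M]
    [Module Rᵐᵒᵖ M] [Module S M] [SMulCommClass S Rᵐᵒᵖ M] [AddCommGroup N] [Module R N]
    [Module.Finite S M] [Module.Projective S M] [Module.FinitePresentation R N] :
    Module.FinitePresentation S (BalTensor R M N) := by
  obtain ⟨m, f, hf⟩ := Module.Finite.exists_fin' R N
  have h1 : Module.Finite R (LinearMap.ker f) :=
    Module.Finite.iff_fg.2 (Module.FinitePresentation.fg_ker f hf)
  have := finite_of_finite (R := R) (S := S) (M := M) (N := LinearMap.ker f)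
  have := finite_of_finite (R := R) (S := S) (M := M) (N := Fin m → R)
  have := projective_of_projective R S M (Fin m → R)
  have := Module.finitePresentation_of_projective S (BalTensor R M (Fin m → R))
  refine Module.finitePresentation_of_surjective (lTensor S M f) (lTensor_surjective f hf) ?_
  rw [LinearMap.exact_iff.1 (lTensor_exact (S := S) (M := M)
    (LinearMap.exact_subtype_ker_map f) hf),
    LinearMap.range_eq_map]
  exact Submodule.FG.map _ Module.Finite.fg_top

/-- Projective modules which are finitely generated have finite dual bases. -/
theorem exists_isDualBasis (R : Type u) (M : Type v) [Ring R] [AddCommGroup M] [Module R M]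
    [Module.Finite R M] [Module.Projective R M] :
    ∃ (n : ℕ) (α : Fin n → M) (α' : Fin n → LeftDual R M), IsDualBasis α α' := by
  obtain ⟨n, p, hp⟩ := Module.Finite.exists_fin' R M
  obtain ⟨s, hs⟩ := Module.projective_lifting_property p LinearMap.id hp
  refine ⟨n, fun j => p (Pi.single j 1), fun j => LinearMap.proj j ∘ₗ s, fun x => ?_⟩
  have h1 : p (s x) = x := DFunLike.congr_fun hs x
  conv_lhs => rw [← h1, LinearMap.pi_apply_eq_sum_univ p (s x)]
  refine Finset.sum_congr rfl fun j _ => congrArg (fun z => s x j • p z) (funext fun i => ?_)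
  rw [Pi.single_apply]
  exact if_congr eq_comm rfl rfl

namespace LeavittRing

variable (R M : Type u) [Ring R] [AddCommGroup M] [Module R M]
  [Module Rᵐᵒᵖ M] [SMulCommClass R Rᵐᵒᵖ M]

/-- The homogeneous component of degree `n`, as a bimodule. -/
def Part (n : ℤ) : Type u := component R M n

namespace Part

instance (n : ℤ) : AddCommGroup (Part R M n) := inferInstanceAs (AddCommGroup (component R M n))

variable {R M}

/-- The underlying element of the Leavitt ring. -/
def val {n : ℤ} : Part R M n →+ LeavittRing R M := (component R M n).subtype

theorem val_injective {n : ℤ} : Function.Injective (val (R := R) (M := M) (n := n)) :=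
  Subtype.val_injective

theorem val_mem {n : ℤ} (l : Part R M n) : l.val ∈ component R M n := l.2

instance (n : ℤ) : Module (DegreeZero R M) (Part R M n) where
  smul a l := ⟨a.1 * l.1, mul_mem_component (zero_add n) a.2 l.2⟩
  one_smul l := Subtype.ext (one_mul l.1)
  mul_smul a b l := Subtype.ext (mul_assoc a.1 b.1 l.1)
  smul_zero a := Subtype.ext (mul_zero a.1)
  smul_add a l l' := Subtype.ext (mul_add a.1 l.1 l'.1)
  add_smul a b l := Subtype.ext (_root_.add_mul a.1 b.1 l.1)
  zero_smul l := Subtype.ext (zero_mul l.1)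

instance (n : ℤ) : Module Rᵐᵒᵖ (Part R M n) where
  smul r l := ⟨l.1 * scalar R M r.unop, mul_mem_component (add_zero n) l.2 (scalar_mem _)⟩
  one_smul l := Subtype.ext (one_smul Rᵐᵒᵖ l.1)
  mul_smul r s l := Subtype.ext (mul_smul r s l.1)
  smul_zero r := Subtype.ext (smul_zero r)
  smul_add r l l' := Subtype.ext (smul_add r l.1 l'.1)
  add_smul r s l := Subtype.ext (add_smul r s l.1)
  zero_smul l := Subtype.ext (zero_smul Rᵐᵒᵖ l.1)

instance (n : ℤ) : SMulCommClass (DegreeZero R M) Rᵐᵒᵖ (Part R M n) where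
  smul_comm a r l := Subtype.ext (mul_assoc a.1 l.1 (scalar R M r.unop)).symm

theorem val_op_smul {n : ℤ} (r : R) (l : Part R M n) :
    (op r • l).val = l.val * scalar R M r := rfl

/-- The product of homogeneous elements. -/
def mul {a b c : ℤ} (h : a + b = c) (l : Part R M a) (m : Part R M b) : Part R M c :=
  ⟨l.1 * m.1, mul_mem_component h l.2 m.2⟩

theorem val_mul {a b c : ℤ} (h : a + b = c) (l : Part R M a) (m : Part R M b) :
    (mul h l m).val = l.val * m.val := rfl

theorem add_mul {a b c : ℤ} (h : a + b = c) (l l' : Part R M a) (m : Part R M b) :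
    mul h (l + l') m = mul h l m + mul h l' m := val_injective (_root_.add_mul l.1 l'.1 m.1)

variable (R M) in
/-- The unit. -/
def one : Part R M 0 := ⟨1, SetLike.GradedOne.one_mem⟩

theorem val_one : (one R M).val = 1 := rfl

/-- The left multiplication by a homogeneous element. -/
def mulLeft {a b c : ℤ} (h : a + b = c) (l : Part R M a) : Part R M b →ₗ[Rᵐᵒᵖ] Part R M c where
  toFun m := mul h l m
  map_add' m m' := val_injective (mul_add l.1 m.1 m'.1)
  map_smul' r m := val_injective (mul_assoc l.1 m.1 (scalar R M r.unop)).symm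

section act

variable {X Y : Type*} [AddCommGroup X] [Module R X] [AddCommGroup Y] [Module R Y]

/-- The left multiplication by a homogeneous element on a tensor product. -/
def act {a b c : ℤ} (h : a + b = c) (l : Part R M a) :
    BalTensor R (Part R M b) X →+ BalTensor R (Part R M c) X :=
  BalTensor.map (mulLeft h l) LinearMap.id

theorem act_act {a b c d e f : ℤ} (h : a + b = c) (h' : c + d = e) (k : b + d = f)
    (k' : a + f = e)
    (l : Part R M a) (m : Part R M b) (z : BalTensor R (Part R M d) X) :
    act k' l (act k m z) = act h' (mul h l m) z := by
  refine DFunLike.congr_fun (f := (act k' l).comp (act k m)) (g := act h' (mul h l m))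
    (BalTensor.addHom_ext fun p x => ?_) z
  exact congrArg (fun q => BalTensor.tmul R q x) (Subtype.ext (mul_assoc l.1 m.1 p.1).symm)

theorem act_add {a b c : ℤ} (h : a + b = c) (l l' : Part R M a)
    (z : BalTensor R (Part R M b) X) : act h (l + l') z = act h l z + act h l' z := by
  refine DFunLike.congr_fun (f := act h (l + l')) (g := act h l + act h l')
    (BalTensor.addHom_ext fun p x => ?_) z
  exact (congrArg (fun q => BalTensor.tmul R q x) (add_mul h l l' p)).trans
    (BalTensor.add_tmul _ _ _)

theorem act_one {b : ℤ} (z : BalTensor R (Part R M b) X) : act (zero_add b) (one R M) z = z := by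
  refine DFunLike.congr_fun (f := act (zero_add b) (one R M)) (g := AddMonoidHom.id _)
    (BalTensor.addHom_ext fun p x => ?_) z
  exact congrArg (fun q => BalTensor.tmul R q x) (Subtype.ext (one_mul p.1))

theorem act_lTensor {a b c : ℤ} (h : a + b = c) (l : Part R M a) (f : X →ₗ[R] Y)
    (z : BalTensor R (Part R M b) X) :
    act h l (BalTensor.lTensor (DegreeZero R M) (Part R M b) f z) =
      BalTensor.lTensor (DegreeZero R M) (Part R M c) f (act h l z) := by
  refine DFunLike.congr_fun (f := (act h l).comp
      (BalTensor.lTensor (DegreeZero R M) (Part R M b) f).toAddMonoidHom)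
    (g := (BalTensor.lTensor (DegreeZero R M) (Part R M c) f).toAddMonoidHom.comp (act h l))
    (BalTensor.addHom_ext fun p x => rfl) z

variable (X) in
/-- The left multiplication on a tensor product, as a biadditive map. -/
def actHom {a b c : ℤ} (h : a + b = c) :
    Part R M a →+ BalTensor R (Part R M b) X →+ BalTensor R (Part R M c) X :=
  AddMonoidHom.mk' (act h) fun l l' => by
    ext z
    exact act_add h l l' z

end act

section unity

variable (R M) [IsArtinianRing R] [Module.Finite R M] [Module.Projective R M]

/-- A partition of unity in a product of opposite homogeneous components. -/
theorem exists_sum_mul_eq_one {m n : ℤ} (h : m + n = 0) :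
    ∃ (k : ℕ) (y : Fin k → Part R M m) (z : Fin k → Part R M n),
      ∑ j, mul h (y j) (z j) = one R M := by
  obtain ⟨_, _, _, hα⟩ := exists_isDualBasis R M
  obtain ⟨k, y, z, hy, hz, hyz⟩ := exists_sum_eq_one hα m
  obtain rfl : n = -m := by omega
  refine ⟨k, fun j => ⟨y j, hy j⟩, fun j => ⟨z j, hz j⟩, val_injective ?_⟩
  rw [map_sum, val_one, ← hyz]
  rfl

/-- With `∑ y_j z_j = 1`, where `y_j ∈ L_{-n}` and `z_j ∈ L_n`, the maps `l ↦ (l y_j)_j` and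
`(a_j)_j ↦ ∑ a_j z_j` exhibit `L_n` as a retract of a free `L_0`-module. -/
theorem exists_retract (n : ℤ) : ∃ (k : ℕ) (i : Part R M n →ₗ[DegreeZero R M]
    (Fin k → DegreeZero R M)) (r : (Fin k → DegreeZero R M) →ₗ[DegreeZero R M] Part R M n),
    r ∘ₗ i = LinearMap.id := by
  obtain ⟨k, y, z, hyz⟩ := exists_sum_mul_eq_one R M (neg_add_cancel n)
  refine ⟨k,
    { toFun := fun l j => mul (add_neg_cancel n) l (y j)
      map_add' := fun l l' => funext fun j => Subtype.ext (_root_.add_mul l.1 l'.1 (y j).1)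
      map_smul' := fun a l => funext fun j => Subtype.ext (mul_assoc a.1 l.1 (y j).1) },
    ∑ j, (LinearMap.toSpanSingleton (DegreeZero R M) (Part R M n) (z j)).comp
      (LinearMap.proj j), ?_⟩
  ext1 l
  refine val_injective ?_
  have h1 := congrArg val hyz
  rw [map_sum, val_one] at h1
  rw [LinearMap.comp_apply, LinearMap.sum_apply, map_sum, LinearMap.id_apply]
  calc _ = ∑ j, l.val * (mul (neg_add_cancel n) (y j) (z j)).val :=
        Finset.sum_congr rfl fun j _ => mul_assoc l.1 (y j).1 (z j).1
    _ = l.val := by rw [← Finset.mul_sum, h1, mul_one]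

instance (n : ℤ) : Module.Finite (DegreeZero R M) (Part R M n) := by
  obtain ⟨k, i, r, h⟩ := exists_retract R M n
  exact Module.Finite.of_surjective r fun x => ⟨i x, DFunLike.congr_fun h x⟩

instance (n : ℤ) : Module.Projective (DegreeZero R M) (Part R M n) := by
  obtain ⟨k, i, r, h⟩ := exists_retract R M n
  exact Module.Projective.of_split i r h

theorem exists_sum_act_act {m n : ℤ} (h : m + n = 0) :
    ∃ (k : ℕ) (y : Fin k → Part R M m) (z : Fin k → Part R M n),
      ∀ (b c : ℤ) (h₁ : n + b = c) (h₂ : m + c = b) (X : Type u) [AddCommGroup X] [Module R X]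
        (t : BalTensor R (Part R M b) X), ∑ j, act h₂ (y j) (act h₁ (z j) t) = t := by
  obtain ⟨k, y, z, hyz⟩ := exists_sum_mul_eq_one R M h
  refine ⟨k, y, z, fun b c h₁ h₂ X _ _ t => ?_⟩
  calc _ = ∑ j, actHom X (zero_add b) (mul h (y j) (z j)) t :=
        Finset.sum_congr rfl fun j _ => act_act h (zero_add b) h₁ h₂ (y j) (z j) t
    _ = t := by
      rw [← AddMonoidHom.finsetSum_apply, ← map_sum, hyz]
      exact act_one t

end unity

/-- The map `m ↦ l m` on the bimodule. -/
def mulVec {p n : ℤ} (h : n + 1 = p) (l : Part R M p) : M →ₗ[Rᵐᵒᵖ] Part R M n where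
  toFun m := mul (by omega) l ⟨vec R M m, vec_mem m⟩
  map_add' m m' := val_injective
    ((congrArg (l.1 * ·) (map_add (vec R M) m m')).trans (mul_add _ _ _))
  map_smul' r m := val_injective ((congrArg (l.1 * ·) (vec_op_smul r.unop m)).trans
    (mul_assoc _ _ _).symm)

/-- The product with an element of the dual. -/
def mulDual {p n : ℤ} (h : n + 1 = p) (l : Part R M n) (f : LeftDual R M) : Part R M p :=
  mul h l ⟨dual R M f, dual_mem f⟩

variable (M) in
/-- The contraction `l ⊗ (m ⊗ x) ↦ l m ⊗ x`. -/
def contract {p n : ℤ} (h : n + 1 = p) (X : Type*) [AddCommGroup X] [Module R X] :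
    BalTensor R (Part R M p) (BalTensor R M X) →ₗ[DegreeZero R M] BalTensor R (Part R M n) X :=
  BalTensor.liftLinear
    (AddMonoidHom.mk' (fun l => BalTensor.map (mulVec h l) LinearMap.id) (fun l l' =>
      BalTensor.addHom_ext fun m x =>
        (congrArg (fun z => BalTensor.tmul R z x) (add_mul (show p + -1 = n by omega) l l' _)).trans
          (BalTensor.add_tmul _ _ _)))
    (fun l r z => by
      refine DFunLike.congr_fun (f := BalTensor.map (mulVec h (op r • l)) LinearMap.id)
        (g := (BalTensor.map (mulVec h l) LinearMap.id).comp (DistribSMul.toAddMonoidHom _ r))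
        (BalTensor.addHom_ext fun m x => ?_) z
      refine congrArg (fun z => BalTensor.tmul R z x) (Subtype.ext ?_)
      exact (mul_assoc _ _ _).trans (congrArg (l.1 * ·) (vec_smul r m).symm))
    (fun a l z => by
      refine DFunLike.congr_fun (f := BalTensor.map (mulVec h (a • l)) LinearMap.id)
        (g := (DistribSMul.toAddMonoidHom _ a).comp (BalTensor.map (mulVec h l) LinearMap.id))
        (BalTensor.addHom_ext fun m x => ?_) z
      exact congrArg (fun z => BalTensor.tmul R z x) (Subtype.ext (mul_assoc a.1 l.1 (vec R M m))))

theorem contract_tmul {p n : ℤ} (h : n + 1 = p) {X : Type*} [AddCommGroup X] [Module R X]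
    (l : Part R M p) (m : M) (x : X) : contract M h X (BalTensor.tmul R l (BalTensor.tmul R m x)) =
      BalTensor.tmul R (mulVec h l m) x := rfl

theorem val_sum_mulVec_mulDual {p n : ℤ} (h : n + 1 = p) {k : ℕ} {α : Fin k → M}
    {α' : Fin k → LeftDual R M} (hα : IsDualBasis α α') (l : Part R M n) :
    ∑ j, mulVec h (mulDual h l (α' j)) (α j) = l := by
  refine val_injective ?_
  rw [map_sum]
  calc _ = ∑ j, l.val * (dual R M (α' j) * vec R M (α j)) :=
        Finset.sum_congr rfl fun j _ => mul_assoc _ _ _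
    _ = l.val := by rw [← Finset.mul_sum, sum_dual_mul_vec hα, mul_one]

/-- The inverse of the contraction. -/
def expand {p n : ℤ} (h : n + 1 = p) (X : Type*) [AddCommGroup X] [Module R X] {k : ℕ}
    {α : Fin k → M} {α' : Fin k → LeftDual R M} (hα : IsDualBasis α α') :
    BalTensor R (Part R M n) X →+ BalTensor R (Part R M p) (BalTensor R M X) :=
  BalTensor.lift (AddMonoidHom.mk' (fun l => AddMonoidHom.mk'
      (fun x => ∑ j, BalTensor.tmul R (mulDual h l (α' j)) (BalTensor.tmul R (α j) x))
      (fun x y => by simp only [BalTensor.tmul_add, Finset.sum_add_distrib]))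
      (fun l l' => by
        ext x
        change ∑ j, BalTensor.tmul R (mulDual h (l + l') (α' j)) (BalTensor.tmul R (α j) x) =
          (∑ j, BalTensor.tmul R (mulDual h l (α' j)) (BalTensor.tmul R (α j) x)) +
            ∑ j, BalTensor.tmul R (mulDual h l' (α' j)) (BalTensor.tmul R (α j) x)
        rw [← Finset.sum_add_distrib]
        exact Finset.sum_congr rfl fun j _ =>
          (congrArg (fun z => BalTensor.tmul R z (BalTensor.tmul R (α j) x))
            (add_mul h l l' _)).trans (BalTensor.add_tmul _ _ _)))
    (fun l r x => by
      -- Balancedness says that the Casimir element commutes with `R`: expanding `r α'_j` and `α_i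
      -- r` in the dual basis produces the same coefficients `α'_j(α_i r)`.
      have h1 (j : Fin k) : r • α' j = ∑ i, op (α' j (op r • α i)) • α' i := by
        refine LinearMap.ext fun y => ?_
        have h2 : (r • α' j) y = α' j (op r • y) := rfl
        refine h2.trans ?_
        conv_lhs => rw [hα y, Finset.smul_sum]
        refine (map_sum (show M →ₗ[R] R from α' j) _ _).trans ?_
        refine Eq.trans ?_ (LinearMap.sum_apply _ _ _).symm
        refine Finset.sum_congr rfl fun i _ => ?_
        rw [← smul_comm]
        exact LinearMap.map_smul (show M →ₗ[R] R from α' j) _ _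
      have h3 (f : LeftDual R M) : mulDual h (op r • l) f = mulDual h l (r • f) :=
        Subtype.ext ((mul_assoc _ _ _).trans (congrArg (l.1 * ·) (dual_smul r f).symm))
      have h4 (c : R) (f : LeftDual R M) : mulDual h l (op c • f) = op c • mulDual h l f :=
        Subtype.ext ((congrArg (l.1 * ·) (dual_op_smul c f)).trans (mul_assoc _ _ _).symm)
      have h5 (j : Fin k) : mulDual h (op r • l) (α' j) =
          ∑ i, op (α' j (op r • α i)) • mulDual h l (α' i) := by
        rw [h3, h1]
        refine Eq.trans ?_ (Finset.sum_congr rfl fun i _ => h4 _ _)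
        refine val_injective ?_
        rw [map_sum]
        exact (congrArg (l.1 * ·) (map_sum (dual R M) _ _)).trans (Finset.mul_sum _ _ _)
      change ∑ j, BalTensor.tmul R (mulDual h (op r • l) (α' j)) (BalTensor.tmul R (α j) x) =
        ∑ j, BalTensor.tmul R (mulDual h l (α' j)) (BalTensor.tmul R (α j) (r • x))
      have h6 (i : Fin k) : BalTensor.tmul R (α i) (r • x) =
          ∑ j, (α' j (op r • α i)) • BalTensor.tmul R (α j) x := by
        rw [← BalTensor.smul_tmul]
        conv_lhs => rw [hα (op r • α i), BalTensor.sum_tmul]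
        rfl
      simp only [h5, h6, BalTensor.sum_tmul, BalTensor.tmul_sum, BalTensor.smul_tmul]
      exact Finset.sum_comm)

/-- The inverse is `l ⊗ x ↦ ∑ l α'_j ⊗ α_j ⊗ x`. One composite is the identity by the relation `x f
= f(x)`, the other by the Casimir relation. -/
theorem contract_bijective [Module.Finite R M] [Module.Projective R M] {p n : ℤ} (h : n + 1 = p)
    (X : Type*) [AddCommGroup X] [Module R X] :
    Function.Bijective (contract (R := R) M h X) := by
  obtain ⟨k, α, α', hα⟩ := exists_isDualBasis R M
  refine Function.bijective_iff_has_inverse.2 ⟨expand h X hα, fun z => ?_, fun z => ?_⟩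
  · refine DFunLike.congr_fun (f := (expand h X hα).comp (contract M h X).toAddMonoidHom)
      (g := AddMonoidHom.id _) (BalTensor.addHom_ext fun l w => ?_) z
    refine DFunLike.congr_fun (f := ((expand h X hα).comp (contract M h X).toAddMonoidHom).comp
      (BalTensor.tmulHom (R := R) l)) (g := BalTensor.tmulHom (R := R) l)
      (BalTensor.addHom_ext fun m x => ?_) w
    change ∑ j, BalTensor.tmul R (mulDual h (mulVec h l m) (α' j)) (BalTensor.tmul R (α j) x) =
      BalTensor.tmul R l (BalTensor.tmul R m x)
    have h1 (f : LeftDual R M) : mulDual h (mulVec h l m) f = op (f m) • l :=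
      Subtype.ext ((mul_assoc _ _ _).trans (congrArg (l.1 * ·) (vec_mul_dual m f)))
    simp only [h1, BalTensor.smul_tmul]
    rw [← BalTensor.tmul_sum]
    refine congrArg (BalTensor.tmul R l) ?_
    conv_rhs => rw [hα m, BalTensor.sum_tmul]
    rfl
  · refine DFunLike.congr_fun (f := (contract M h X).toAddMonoidHom.comp (expand h X hα))
      (g := AddMonoidHom.id _) (BalTensor.addHom_ext fun l x => ?_) z
    change contract M h X (∑ j, BalTensor.tmul R (mulDual h l (α' j)) (BalTensor.tmul R (α j) x)) =
      BalTensor.tmul R l x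
    rw [map_sum]
    simp only [contract_tmul]
    rw [← BalTensor.sum_tmul, val_sum_mulVec_mulDual h hα l]

theorem contract_act {a p n p' n' : ℤ} (h : n + 1 = p) (h' : n' + 1 = p') (k : a + p = p')
    (k' : a + n = n') {X : Type*} [AddCommGroup X] [Module R X] (l : Part R M a)
    (z : BalTensor R (Part R M p) (BalTensor R M X)) :
    contract M h' X (act k l z) = act k' l (contract M h X z) := by
  refine DFunLike.congr_fun (f := (contract M h' X).toAddMonoidHom.comp (act k l))
    (g := (act k' l).comp (contract M h X).toAddMonoidHom) (BalTensor.addHom_ext fun q w => ?_) z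
  refine DFunLike.congr_fun (f := ((contract M h' X).toAddMonoidHom.comp (act k l)).comp
    (BalTensor.tmulHom (R := R) q)) (g := ((act k' l).comp (contract M h X).toAddMonoidHom).comp
    (BalTensor.tmulHom (R := R) q)) (BalTensor.addHom_ext fun m x => ?_) w
  exact congrArg (fun z => BalTensor.tmul R z x) (Subtype.ext (mul_assoc l.1 q.1 (vec R M m)))

theorem contract_naturality {p n : ℤ} (h : n + 1 = p) {X Y : Type*} [AddCommGroup X] [Module R X]
    [AddCommGroup Y] [Module R Y] (f : X →ₗ[R] Y)
    (z : BalTensor R (Part R M p) (BalTensor R M X)) :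
    contract M h Y (BalTensor.lTensor (DegreeZero R M) (Part R M p) (BalTensor.lTensor R M f) z) =
      BalTensor.lTensor (DegreeZero R M) (Part R M n) f (contract M h X z) := by
  refine DFunLike.congr_fun (f := (contract M h Y ∘ₗ BalTensor.lTensor (DegreeZero R M)
      (Part R M p) (BalTensor.lTensor R M f)).toAddMonoidHom)
    (g := (BalTensor.lTensor (DegreeZero R M) (Part R M n) f ∘ₗ contract M h X).toAddMonoidHom)
    (BalTensor.addHom_ext fun l w => ?_) z
  refine DFunLike.congr_fun (f := ((contract M h Y ∘ₗ BalTensor.lTensor (DegreeZero R M)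
      (Part R M p) (BalTensor.lTensor R M f)).toAddMonoidHom).comp (BalTensor.tmulHom (R := R) l))
    (g := ((BalTensor.lTensor (DegreeZero R M) (Part R M n) f ∘ₗ
      contract M h X).toAddMonoidHom).comp (BalTensor.tmulHom (R := R) l))
    (BalTensor.addHom_ext fun m x => rfl) w

end Part

section levels

variable [IsNoetherianRing R] [IsArtinianRing R] [Module.Finite R M] [Module.Projective R M]

/-- The functor `L_n ⊗_R -`. -/
def partFunctor (n : ℤ) : FPMod R ⥤ FPMod (DegreeZero R M) where
  obj X := ⟨ModuleCat.of (DegreeZero R M) (BalTensor R (Part R M n) X.obj),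
    BalTensor.finitePresentation R (DegreeZero R M) (Part R M n) X.obj⟩
  map f := ObjectProperty.homMk (ModuleCat.ofHom
    (BalTensor.lTensor (DegreeZero R M) (Part R M n) f.hom.hom))
  map_id X := by
    ext z
    exact LinearMap.congr_fun (f := BalTensor.lTensor (DegreeZero R M) (Part R M n)
      (LinearMap.id (M := X.obj))) (g := LinearMap.id)
      (BalTensor.linearMap_ext fun m x => rfl) z
  map_comp {X Y Z} f g := by
    ext z
    exact LinearMap.congr_fun (f := BalTensor.lTensor (DegreeZero R M) (Part R M n)
      (g.hom.hom ∘ₗ f.hom.hom)) (g := BalTensor.lTensor (DegreeZero R M) (Part R M n) g.hom.hom ∘ₗ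
        BalTensor.lTensor (DegreeZero R M) (Part R M n) f.hom.hom)
      (BalTensor.linearMap_ext fun m x => rfl) z

instance (n : ℤ) : (partFunctor R M n).Additive where
  map_add {X Y f g} := by
    ext z
    exact LinearMap.congr_fun (f := BalTensor.lTensor (DegreeZero R M) (Part R M n)
      (f.hom.hom + g.hom.hom)) (g := BalTensor.lTensor (DegreeZero R M) (Part R M n) f.hom.hom +
        BalTensor.lTensor (DegreeZero R M) (Part R M n) g.hom.hom)
      (BalTensor.linearMap_ext fun m x => BalTensor.tmul_add _ _ _) z

/-- The functors `L_n ⊗_R -` and the isomorphisms `L_{n + 1} ⊗_R M ≅ L_n`. -/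
noncomputable def levelFunctors : LevelFunctors (tensorFunctor R M) (FPMod (DegreeZero R M)) where
  q := partFunctor R M
  τ n p h := NatIso.ofComponents (fun X => ObjectProperty.isoMk _
      (LinearEquiv.ofBijective (Part.contract M h X.obj)
        (Part.contract_bijective h X.obj)).toModuleIso)
    (fun {X Y} f => by
      ext z
      exact Part.contract_naturality h f.hom.hom z)

end levels

end LeavittRing

namespace LeavittRing

/-! ### Elements of negative degree -/

section powers

variable {R M : Type u} [Ring R] [AddCommGroup M] [Module R M]
  [Module Rᵐᵒᵖ M] [SMulCommClass R Rᵐᵒᵖ M]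

/-- For `k = 0` the power on the right is only the image of the integers, so `1 ≤ k` is needed to
absorb scalars. -/
theorem vecs_pow_mul_scalars_le {k : ℕ} (hk : 1 ≤ k) :
    vecs R M ^ k * scalars R M ≤ vecs R M ^ k := by
  obtain ⟨k, rfl⟩ : ∃ j, k = j + 1 := ⟨k - 1, by omega⟩
  rw [pow_succ, mul_assoc]
  gcongr
  exact vecs_mul_scalars_le

/-- A dual element is absorbed by the last factor of `M`, leaving a scalar that the factor before it
absorbs; so after multiplication by enough factors of `M` on the left, no dual elements remain. -/
theorem IsMonomial.exists_mul_mem {d : ℤ} {l : LeavittRing R M} (hl : IsMonomial R M d l) :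
    ∃ N : ℕ, ∀ a b : ℕ, N ≤ a → N ≤ b → (a : ℤ) = d + b → ∀ m ∈ vecs R M ^ a,
      m * l ∈ vecs R M ^ b := by
  induction hl with
  | scalar r =>
    refine ⟨1, fun a b ha hb h m hm => ?_⟩
    obtain rfl : a = b := by omega
    exact vecs_pow_mul_scalars_le ha (Submodule.mul_mem_mul hm ⟨r, rfl⟩)
  | vec x =>
    refine ⟨0, fun a b ha hb h m hm => ?_⟩
    obtain rfl : b = a + 1 := by omega
    rw [pow_succ]
    exact Submodule.mul_mem_mul hm ⟨x, rfl⟩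
  | dual f =>
    refine ⟨1, fun a b ha hb h m hm => ?_⟩
    obtain rfl : a = b + 1 := by omega
    have h1 : vecs R M ^ (b + 1) * duals R M ≤ vecs R M ^ b := by
      rw [pow_succ, mul_assoc]
      exact (mul_le_mul' le_rfl vecs_mul_duals_le).trans (vecs_pow_mul_scalars_le hb)
    exact h1 (Submodule.mul_mem_mul hm ⟨f, rfl⟩)
  | @mul m n y z _ _ hy hz =>
    obtain ⟨N, hN⟩ := hy
    obtain ⟨N', hN'⟩ := hz
    -- The bound ensures that the intermediate exponent `c = n + b` is a natural number exceeding
    -- both `N` and `N'`.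
    refine ⟨N + N' + m.natAbs + n.natAbs, fun a b ha hb h w hw => ?_⟩
    obtain ⟨c, hc⟩ : ∃ c : ℕ, (c : ℤ) = n + b := ⟨(n + b).toNat, by omega⟩
    rw [← mul_assoc]
    exact hN' c b (by omega) (by omega) hc _ (hN a c (by omega) (by omega) (by omega) w hw)

/-- Multiplication by a homogeneous element maps large powers of the bimodule to powers of the
bimodule. -/
theorem exists_mul_mem {d : ℤ} {l : LeavittRing R M} (hl : l ∈ component R M d) :
    ∃ N : ℕ, ∀ a b : ℕ, N ≤ a → N ≤ b → (a : ℤ) = d + b → ∀ m ∈ vecs R M ^ a,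
      m * l ∈ vecs R M ^ b := by
  induction hl using AddSubgroup.closure_induction with
  | mem l hl => exact IsMonomial.exists_mul_mem hl
  | zero => exact ⟨0, fun a b _ _ _ m _ => by rw [mul_zero]; exact Submodule.zero_mem _⟩
  | add l l' _ _ h h' =>
    obtain ⟨N, hN⟩ := h
    obtain ⟨N', hN'⟩ := h'
    refine ⟨N + N', fun a b ha hb e m hm => ?_⟩
    rw [mul_add]
    exact Submodule.add_mem _ (hN a b (by omega) (by omega) e m hm)
      (hN' a b (by omega) (by omega) e m hm)
  | neg l _ h =>
    obtain ⟨N, hN⟩ := h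
    refine ⟨N, fun a b ha hb e m hm => ?_⟩
    rw [mul_neg]
    exact Submodule.neg_mem _ (hN a b ha hb e m hm)

end powers

section

variable {R M : Type u} [Ring R] [AddCommGroup M] [Module R M]
  [Module Rᵐᵒᵖ M] [SMulCommClass R Rᵐᵒᵖ M] [Module.Finite R M] [Module.Projective R M]

theorem Part.exists_sum_vecs_mul_eq_one (k : ℕ) :
    ∃ (r : ℕ) (y : Fin r → Part R M k) (z : Fin r → Part R M (-k)),
      (∀ j, (z j).val ∈ vecs R M ^ k) ∧ ∑ j, mul (add_neg_cancel _) (y j) (z j) = one R M := by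
  obtain ⟨_, _, _, hα⟩ := exists_isDualBasis R M
  suffices H : ∀ w ∈ duals R M ^ k * vecs R M ^ k, ∃ (r : ℕ) (y : Fin r → Part R M k)
      (z : Fin r → Part R M (-k)), (∀ j, (z j).val ∈ vecs R M ^ k) ∧
        (∑ j, mul (add_neg_cancel _) (y j) (z j)).val = w by
    obtain ⟨r, y, z, hz, h⟩ := H 1 (Submodule.one_le.1 (one_le_duals_pow_mul_vecs_pow hα k))
    exact ⟨r, y, z, hz, val_injective h⟩
  intro w hw
  induction hw using Submodule.mul_induction_on' with
  | mem_mul_mem y hy z hz =>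
    refine ⟨1, fun _ => ⟨y, duals_pow_le k hy⟩, fun _ => ⟨z, vecs_pow_le k hz⟩, fun _ => hz, ?_⟩
    rw [map_sum, Finset.sum_const, Finset.card_univ, Fintype.card_fin, one_smul]
    rfl
  | add a _ b _ ha hb =>
    obtain ⟨r, y, z, h, rfl⟩ := ha
    obtain ⟨r', y', z', h', rfl⟩ := hb
    refine ⟨r + r', Fin.append y y', Fin.append z z', fun j => ?_, ?_⟩
    · induction j using Fin.addCases with
      | left j => rw [Fin.append_left]; exact h j
      | right j => rw [Fin.append_right]; exact h' j
    · simp [Fin.sum_univ_add]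

/-- Since `1 = ∑ y_j z_j` with `z_j` in the `k`th power of `M`, and not merely in `L_{-k}`, such
elements detect zero. -/
theorem Part.eq_zero_of_act_eq_zero {k : ℕ} {n n' : ℤ} (h : -(k : ℤ) + n = n') {X : Type u}
    [AddCommGroup X] [Module R X] (u : BalTensor R (Part R M n) X)
    (hu : ∀ m : Part R M (-k), m.val ∈ vecs R M ^ k → act h m u = 0) : u = 0 := by
  obtain ⟨r, y, z, hz, h1⟩ := exists_sum_vecs_mul_eq_one (R := R) (M := M) k
  have h2 : actHom X (zero_add n) (one R M) u = 0 := by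
    rw [← h1, map_sum, AddMonoidHom.finsetSum_apply]
    refine Finset.sum_eq_zero fun j _ => ?_
    have h3 := act_act (add_neg_cancel (k : ℤ)) (zero_add n) h (by omega) (y j) (z j) u
    rw [hu _ (hz j), map_zero] at h3
    exact h3.symm
  exact (act_one u).symm.trans h2

end

/-! ### Iterated contractions -/

section sig

variable {R M : Type u} [Ring R] [AddCommGroup M] [Module R M]
  [Module Rᵐᵒᵖ M] [SMulCommClass R Rᵐᵒᵖ M] [IsNoetherianRing R] [IsArtinianRing R]
  [Module.Finite R M] [Module.Projective R M]

variable (M) in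
/-- The iterated contraction. -/
noncomputable abbrev sig (X : FPMod R) (n : ℤ) (b : ℕ) (p : ℤ) (h : n + b = p) :
    BalTensor R (Part R M p) (iterObj (tensorFunctor R M) X b).obj →ₗ[DegreeZero R M]
      BalTensor R (Part R M n) X.obj :=
  ((levelFunctors R M).σ X n b p h).hom.hom.hom

theorem sig_zero (X : FPMod R) (n : ℤ) (h : n + (0 : ℕ) = n)
    (z : BalTensor R (Part R M n) X.obj) : sig M X n 0 n h z = z := rfl

theorem sig_succ (X : FPMod R) (n p p' : ℤ) (b : ℕ) (h : n + b = p) (h' : p + 1 = p')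
    (h'' : n + (b + 1 : ℕ) = p')
    (z : BalTensor R (Part R M p') (iterObj (tensorFunctor R M) X (b + 1)).obj) :
    sig M X n (b + 1) p' h'' z =
      sig M X n b p h (Part.contract M h' (iterObj (tensorFunctor R M) X b).obj z) :=
  congrArg (fun e : ((partFunctor R M p').obj (iterObj (tensorFunctor R M) X (b + 1)) ≅
    (partFunctor R M n).obj X) => e.hom.hom.hom z)
    ((levelFunctors R M).σ_succ X n p p' b h h' h'')

theorem sig_bijective (X : FPMod R) (n : ℤ) (b : ℕ) (p : ℤ) (h : n + b = p) :
    Function.Bijective (sig M X n b p h) :=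
  let e := (levelFunctors R M).σ X n b p h
  Function.bijective_iff_has_inverse.2 ⟨e.inv.hom.hom,
    fun z => congrArg (fun k : (partFunctor R M p).obj _ ⟶ (partFunctor R M p).obj _ =>
      k.hom.hom z) e.hom_inv_id,
    fun z => congrArg (fun k : (partFunctor R M n).obj X ⟶ (partFunctor R M n).obj X =>
      k.hom.hom z) e.inv_hom_id⟩

theorem sig_act (X : FPMod R) {a n p n' p' : ℤ} {b : ℕ} (h : n + b = p) (h' : n' + b = p')
    (k : a + p = p') (k' : a + n = n') (l : Part R M a)
    (z : BalTensor R (Part R M p) (iterObj (tensorFunctor R M) X b).obj) :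
    sig M X n' b p' h' (Part.act k l z) = Part.act k' l (sig M X n b p h z) := by
  induction b generalizing p p' with
  | zero =>
    obtain rfl : n = p := by simpa using h
    obtain rfl : n' = p' := by simpa using h'
    rfl
  | succ b ih =>
    rw [sig_succ X n (n + b) p b rfl (by rw [← h]; push_cast; ring),
      sig_succ X n' (n' + b) p' b rfl (by rw [← h']; push_cast; ring)]
    refine Eq.trans ?_ (ih rfl rfl (by omega) _)
    exact congrArg _ (Part.contract_act _ _ k (by omega) l z)

theorem sig_naturality {X Y : FPMod R} (f : X ⟶ Y) {n p : ℤ} {b : ℕ} (h : n + b = p)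
    (z : BalTensor R (Part R M p) (iterObj (tensorFunctor R M) X b).obj) :
    sig M Y n b p h (BalTensor.lTensor (DegreeZero R M) (Part R M p)
      ((Stabilization.iter (tensorFunctor R M) b).map f).hom.hom z) =
    BalTensor.lTensor (DegreeZero R M) (Part R M n) f.hom.hom (sig M X n b p h z) := by
  induction b generalizing p with
  | zero =>
    obtain rfl : n = p := by simpa using h
    rfl
  | succ b ih =>
    have hp : n + b + 1 = p := by rw [← h]; push_cast; ring
    refine (sig_succ Y n (n + b) p b rfl hp h _).trans ?_
    refine Eq.trans ?_ (congrArg _ (sig_succ X n (n + b) p b rfl hp h z).symm)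
    refine Eq.trans ?_ (ih rfl _)
    exact congrArg _ (Part.contract_naturality _
      ((Stabilization.iter (tensorFunctor R M) b).map f).hom.hom z)

variable (M) in
/-- The element `w` of an iterated tensor product represents `m ⊗ x`. -/
def Represents (X : FPMod R) (b : ℕ) (m : LeavittRing R M) (x : X.obj)
    (w : (iterObj (tensorFunctor R M) X b).obj) : Prop :=
  ∀ (n p : ℤ) (h : n + b = p) (l : Part R M p) (c : Part R M n), c.val = l.val * m →
    sig M X n b p h (BalTensor.tmul R l w) = BalTensor.tmul R c x

theorem Represents.tmul {X : FPMod R} {b : ℕ} {m : LeavittRing R M} {x : X.obj}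
    {w : (iterObj (tensorFunctor R M) X b).obj} (hw : Represents M X b m x w) (y : M) :
    Represents M X (b + 1) (vec R M y * m) x (BalTensor.tmul R y w) := fun n p h l c hc => by
  rw [sig_succ X n (n + b) p b rfl (by rw [← h]; push_cast; ring)]
  exact hw n (n + b) rfl _ c (hc.trans (mul_assoc _ _ _).symm)

/-- Tensors with elements of powers of the bimodule are iterated contractions. -/
theorem exists_represents (X : FPMod R) {b : ℕ} {m : LeavittRing R M} (hm : m ∈ vecs R M ^ b)
    (x : X.obj) : ∃ w, Represents M X b m x w := by
  induction b generalizing m with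
  | zero =>
    rw [pow_zero] at hm
    obtain ⟨k, rfl⟩ := Submodule.mem_one.1 hm
    refine ⟨k • x, fun n p h l c hc => ?_⟩
    obtain rfl : n = p := by simpa using h
    refine (sig_zero X n h _).trans ?_
    have h1 : c = k • l := Part.val_injective (by
      rw [hc, map_zsmul, zsmul_eq_mul]
      exact ((Int.cast_commute k l.val).eq).symm)
    rw [h1]
    exact (map_zsmul (BalTensor.tmulHom (R := R) (N := X.obj) l) k x).trans
      (map_zsmul ((BalTensor.tmulHom (R := R) (M := Part R M n)).flip x) k l).symm
  | succ b ih =>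
    rw [pow_succ'] at hm
    induction hm using Submodule.mul_induction_on' with
    | mem_mul_mem y hy z hz =>
      obtain ⟨y, rfl⟩ := hy
      obtain ⟨w, hw⟩ := ih hz
      exact ⟨_, hw.tmul y⟩
    | add y hy z hz h₁ h₂ =>
      obtain ⟨w, hw⟩ := h₁
      obtain ⟨w', hw'⟩ := h₂
      refine ⟨w + w', fun n p h l c hc => ?_⟩
      have hle : ∀ {y : LeavittRing R M}, y ∈ vecs R M * vecs R M ^ b →
          ∃ c : Part R M n, c.val = l.val * y := fun {y} hy =>
        ⟨⟨l.val * y, mul_mem_component (by omega) l.2 (vecs_pow_le (b + 1) (by rwa [pow_succ']))⟩,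
          rfl⟩
      obtain ⟨c₁, h₁⟩ := hle hy
      obtain ⟨c₂, h₂⟩ := hle hz
      have h3 : c = c₁ + c₂ :=
        Part.val_injective (by rw [hc, map_add, h₁, h₂, mul_add])
      rw [h3, BalTensor.tmul_add, BalTensor.add_tmul, map_add, hw n p h l c₁ h₁,
        hw' n p h l c₂ h₂]

variable (M) in
-- Iterated tensor products are additively generated by pure tensors, and a pure tensor represents
-- the product of its factors from `M`, tensored with its last entry.
theorem closure_represents_eq_top (X : FPMod R) (b : ℕ) : AddSubgroup.closure
    {w | ∃ m ∈ vecs R M ^ b, ∃ x, Represents M X b m x w} = ⊤ := by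
  induction b with
  | zero =>
    refine eq_top_iff.2 fun w _ => AddSubgroup.subset_closure ⟨1, ?_, w, fun n p h l c hc => ?_⟩
    · rw [pow_zero]; exact Submodule.one_le.1 le_rfl
    · obtain rfl : n = p := by simpa using h
      rw [mul_one] at hc
      rw [Part.val_injective hc]
      rfl
  | succ b ih =>
    refine eq_top_iff.2 fun w _ => ?_
    refine BalTensor.induction_on (R := R) (M := M) (N := (iterObj (tensorFunctor R M) X b).obj) w
      (AddSubgroup.zero_mem _) (fun y w => ?_) fun _ _ => AddSubgroup.add_mem _
    have hw : w ∈ AddSubgroup.closure {w | ∃ m ∈ vecs R M ^ b, ∃ x, Represents M X b m x w} := by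
      rw [ih]; trivial
    induction hw using AddSubgroup.closure_induction with
    | mem w hw =>
      obtain ⟨m, hm, x, hw⟩ := hw
      exact AddSubgroup.subset_closure ⟨_, by
        rw [pow_succ']; exact Submodule.mul_mem_mul ⟨y, rfl⟩ hm, x, hw.tmul y⟩
    | zero => rw [BalTensor.tmul_zero]; exact AddSubgroup.zero_mem _
    | add w w' _ _ h h' => rw [BalTensor.tmul_add]; exact AddSubgroup.add_mem _ h h'
    | neg w _ h =>
      have h1 : BalTensor.tmul R y (-w) = -BalTensor.tmul R y w :=
        map_neg (BalTensor.tmulHom (R := R) y) w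
      rw [h1]
      exact AddSubgroup.neg_mem _ h

/-- Large powers of the bimodule map every tensor to an iterated contraction. -/
theorem exists_act_eq_sig {X : FPMod R} {n : ℤ} (u : BalTensor R (Part R M n) X.obj) :
    ∃ N : ℕ, ∀ a b : ℕ, N ≤ a → N ≤ b → ∀ (h : -(a : ℤ) + n = -b) (m : Part R M (-a)),
      m.val ∈ vecs R M ^ a → ∃ w : (iterObj (tensorFunctor R M) X b).obj,
        Part.act h m u =
          sig M X (-b) b 0 (neg_add_cancel _) (BalTensor.tmul R (Part.one R M) w) := by
  induction u using BalTensor.induction_on with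
  | h0 => exact ⟨0, fun a b _ _ h m _ => ⟨0, by rw [map_zero, BalTensor.tmul_zero, map_zero]⟩⟩
  | ht l x =>
    obtain ⟨N, hN⟩ := exists_mul_mem l.val_mem
    refine ⟨N, fun a b ha hb h m hm => ?_⟩
    obtain ⟨w, hw⟩ := exists_represents X (hN a b ha hb (by omega) _ hm) x
    exact ⟨w, (hw (-b) 0 _ (Part.one R M) (Part.mul h m l) (one_mul _).symm).symm⟩
  | ha u u' hu hu' =>
    obtain ⟨N, hN⟩ := hu
    obtain ⟨N', hN'⟩ := hu'
    refine ⟨N + N', fun a b ha hb h m hm => ?_⟩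
    obtain ⟨w, hw⟩ := hN a b (by omega) (by omega) h m hm
    obtain ⟨w', hw'⟩ := hN' a b (by omega) (by omega) h m hm
    refine ⟨w + w', ?_⟩
    rw [map_add, hw, hw', BalTensor.tmul_add, map_add]

/-! ### Morphisms annihilated by the level functors -/

/-- The inclusion of a homogeneous component. -/
def Part.incl (n : ℤ) : Part R M n →ₗ[Rᵐᵒᵖ] LeavittRing R M where
  toFun := val
  map_add' := map_add _
  map_smul' _ _ := rfl

theorem exists_iter_ofElem_eq_zero_of_part {X : FPMod R} (x : X.obj)
    (h : BalTensor.tmul R (Part.one R M) x = 0) :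
    ∃ k, (Stabilization.iter (tensorFunctor R M) k).map (FPMod.ofElem x) = 0 :=
  exists_iter_ofElem_eq_zero x ((congrArg (BalTensor.map (Part.incl 0) LinearMap.id) h).trans
    (map_zero _))

/-- The iterated contraction conjugates `L_{n+k} ⊗ Ω^k f` to `L_n ⊗ f`. This is the easy converse to
`exists_iter_eq_zero`. -/
theorem partFunctor_map_eq_zero {X Y : FPMod R} (f : X ⟶ Y) {k : ℕ}
    (h : (Stabilization.iter (tensorFunctor R M) k).map f = 0) (n : ℤ) :
    (partFunctor R M n).map f = 0 := by
  ext z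
  obtain ⟨z, rfl⟩ := (sig_bijective X n k (n + k) rfl).2 z
  refine (sig_naturality f rfl z).symm.trans ?_
  have h1 : BalTensor.lTensor (DegreeZero R M) (Part R M (n + k))
      ((Stabilization.iter (tensorFunctor R M) k).map f).hom.hom z = 0 := by
    have h2 : (partFunctor R M (n + k)).map
        ((Stabilization.iter (tensorFunctor R M) k).map f) = 0 := by
      rw [h]; exact (partFunctor R M (n + k)).map_zero _ _
    exact congrArg (fun g : (partFunctor R M (n + k)).obj _ ⟶ (partFunctor R M (n + k)).obj _ =>
      g.hom.hom z) h2
  exact (congrArg _ h1).trans (map_zero _)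

theorem tmul_eq_zero_of_iter {X : FPMod R} {x : X.obj} {k : ℕ}
    (h : (Stabilization.iter (tensorFunctor R M) k).map (FPMod.ofElem x) = 0) {n : ℤ}
    (l : Part R M n) : BalTensor.tmul R l x = 0 := by
  have h1 := congrArg (fun g : (partFunctor R M n).obj (FPMod.self R) ⟶ (partFunctor R M n).obj X =>
    g.hom.hom (BalTensor.tmul R l (1 : R))) (partFunctor_map_eq_zero _ h n)
  refine Eq.trans ?_ h1
  exact (congrArg (BalTensor.tmul R l) (one_smul R x)).symm

end sig

end LeavittRing

/-! ### Detection of zero morphisms on finitely many generators. -/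

theorem BalTensor.iSup_range_lTensor_eq_top {R S M X ι : Type*} [Ring R] [Ring S]
    [AddCommGroup M] [Module Rᵐᵒᵖ M] [Module S M] [SMulCommClass S Rᵐᵒᵖ M] [AddCommGroup X]
    [Module R X] {A : ι → Type*} [∀ i, AddCommGroup (A i)] [∀ i, Module R (A i)]
    (g : ∀ i, A i →ₗ[R] X) (hg : ⨆ i, LinearMap.range (g i) = ⊤) :
    ⨆ i, LinearMap.range (lTensor S M (g i)) = ⊤ := by
  rw [eq_top_iff]
  rintro z -
  induction z using BalTensor.induction_on with
  | h0 => exact Submodule.zero_mem _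
  | ht m w =>
    have hw : w ∈ ⨆ i, LinearMap.range (g i) := by rw [hg]; trivial
    induction hw using Submodule.iSup_induction' with
    | mem i w hw =>
      obtain ⟨a, rfl⟩ := hw
      exact Submodule.mem_iSup_of_mem i ⟨BalTensor.tmul R m a, rfl⟩
    | zero => rw [BalTensor.tmul_zero]; exact Submodule.zero_mem _
    | add w w' _ _ h h' => rw [BalTensor.tmul_add]; exact Submodule.add_mem _ h h'
  | ha z z' h h' => exact Submodule.add_mem _ h h'

namespace LeavittRing

variable {R M : Type u} [Ring R] [AddCommGroup M] [Module R M]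
  [Module Rᵐᵒᵖ M] [SMulCommClass R Rᵐᵒᵖ M] [IsNoetherianRing R] [Module.Finite R M]

theorem iSup_range_iter_eq_top {ι : Type*} {A : ι → FPMod R} {X : FPMod R} (g : ∀ i, A i ⟶ X)
    (hg : ⨆ i, LinearMap.range (g i).hom.hom = ⊤) (k : ℕ) :
    ⨆ i, LinearMap.range ((Stabilization.iter (tensorFunctor R M) k).map (g i)).hom.hom = ⊤ := by
  induction k with
  | zero => exact hg
  | succ k ih => exact BalTensor.iSup_range_lTensor_eq_top (R := R) (S := R) (M := M) _ ih

theorem hom_ext_of_iSup_range {ι : Type*} {A : ι → FPMod R} {X Y : FPMod R} (g : ∀ i, A i ⟶ X)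
    (hg : ⨆ i, LinearMap.range (g i).hom.hom = ⊤) {f : X ⟶ Y} (h : ∀ i, g i ≫ f = 0) : f = 0 := by
  ext x
  have hx : x ∈ ⨆ i, LinearMap.range (g i).hom.hom := by rw [hg]; trivial
  induction hx using Submodule.iSup_induction' with
  | mem i x hx =>
    obtain ⟨a, rfl⟩ := hx
    exact congrArg (fun k : A i ⟶ Y => k.hom.hom a) (h i)
  | zero => exact map_zero f.hom.hom
  | add x y _ _ h h' =>
    exact (map_add f.hom.hom x y).trans ((congrArg₂ (· + ·) h h').trans (add_zero _))

variable [IsArtinianRing R] [Module.Projective R M]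

/-- The partition of unity in `L_{-n} L_n` transfers vanishing from degree `n` to degree `0`, where
the germ argument applies. -/
theorem tmul_one_eq_zero {X Y : FPMod R} {f : X ⟶ Y} {n : ℤ}
    (h : (partFunctor R M n).map f = 0) (x : X.obj) :
    BalTensor.tmul R (Part.one R M) (f.hom.hom x) = 0 := by
  obtain ⟨k, y, z, hyz⟩ := Part.exists_sum_act_act R M (neg_add_cancel n)
  refine (hyz 0 n (add_zero n) (neg_add_cancel n) Y.obj (BalTensor.tmul R (Part.one R M)
    (f.hom.hom x))).symm.trans ?_
  refine Finset.sum_eq_zero fun j _ => ?_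
  have h1 : Part.act (add_zero n) (z j) (BalTensor.tmul R (Part.one R M) (f.hom.hom x)) = 0 :=
    congrArg (fun g : (partFunctor R M n).obj X ⟶ (partFunctor R M n).obj Y =>
      g.hom.hom (BalTensor.tmul R (Part.mul (add_zero n) (z j) (Part.one R M)) x)) h
  rw [h1, map_zero]

/-- The germ argument gives an exponent for each element of `X`. Finitely many generators have a
common exponent, and they remain jointly surjective after tensoring. -/
theorem exists_iter_eq_zero {X Y : FPMod R} {f : X ⟶ Y} {n : ℤ}
    (h : (partFunctor R M n).map f = 0) :
    ∃ k, (Stabilization.iter (tensorFunctor R M) k).map f = 0 := by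
  obtain ⟨r, x, hx⟩ := Submodule.fg_iff_exists_fin_generating_family.1
    (Module.Finite.fg_top (R := R) (M := X.obj))
  have hx' : ⨆ i, LinearMap.range (FPMod.ofElem (x i)).hom.hom = ⊤ := by
    rw [← hx, Submodule.span_range_eq_iSup]
    exact iSup_congr fun i => LinearMap.range_toSpanSingleton (x i)
  have h1 (i : Fin r) : ∃ k, (Stabilization.iter (tensorFunctor R M) k).map
      (FPMod.ofElem (x i) ≫ f) = 0 := by
    rw [FPMod.ofElem_comp]
    exact exists_iter_ofElem_eq_zero_of_part _ (tmul_one_eq_zero h (x i))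
  choose k hk using h1
  refine ⟨Finset.univ.sup k, hom_ext_of_iSup_range _ (iSup_range_iter_eq_top _ hx' _) fun i => ?_⟩
  have h2 := Stabilization.iter_eq_zero _ (Finset.le_sup (f := k) (Finset.mem_univ i)) (hk i)
  exact ((Stabilization.iter _ _).map_comp _ _).symm.trans h2

/-! ### Exactness of the level functors -/

variable [(tensorFunctor R M).PreservesMonomorphisms]

instance (k : ℕ) : (Stabilization.iter (tensorFunctor R M) k).PreservesMonomorphisms where
  preserves {X Y} f hf := by
    induction k with
    | zero => exact hf
    | succ k ih =>
      exact Functor.map_mono (tensorFunctor R M) ((Stabilization.iter (tensorFunctor R M) k).map f)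

theorem tensorFunctor_shortExact {S : ShortComplex (FPMod R)} (hS : S.ShortExact) :
    (S.map (tensorFunctor R M)).ShortExact := by
  have := hS.mono_f
  obtain ⟨h₁, h₂, h₃⟩ := (FPMod.shortExact_iff _).1 hS
  exact (FPMod.shortExact_iff _).2 ⟨(FPMod.mono_iff_injective _).1
    (Functor.map_mono (tensorFunctor R M) S.f), BalTensor.lTensor_exact h₂ h₃,
    BalTensor.lTensor_surjective _ h₃⟩

/-- If `1 ⊗ f(x) = 0`, then some power of `Ω` kills the composite of `f` with the morphism `R ⟶ X`
at `x`; as that power preserves the monomorphism `f`, it already kills `x`. -/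
theorem tmul_eq_zero_of_mono {X Y : FPMod R} (f : X ⟶ Y) [Mono f] (x : X.obj)
    (h : BalTensor.tmul R (Part.one R M) (f.hom.hom x) = 0) {n : ℤ} (l : Part R M n) :
    BalTensor.tmul R l x = 0 := by
  obtain ⟨k, hk⟩ := exists_iter_ofElem_eq_zero_of_part _ h
  rw [← FPMod.ofElem_comp, Functor.map_comp] at hk
  exact tmul_eq_zero_of_iter (zero_of_comp_mono _ hk) l

/-- An element `u` of the kernel, multiplied by a high power of `M`, becomes `1 ⊗ w` with `w ∈ Ω^b
X`. Then `tmul_eq_zero_of_mono` for the monomorphism `Ω^b f` gives `1 ⊗ w = 0`, and high powers of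
`M` detect `u = 0`. No flatness of `L_n` is presupposed. -/
theorem partFunctor_map_injective {X Y : FPMod R} (f : X ⟶ Y) [Mono f] (n : ℤ) :
    Function.Injective ((partFunctor R M n).map f).hom.hom := by
  refine (injective_iff_map_eq_zero ((partFunctor R M n).map f).hom.hom).2 fun u hu => ?_
  obtain ⟨N, hN⟩ := exists_act_eq_sig u
  obtain ⟨a, b, ha, hb, h⟩ : ∃ a b : ℕ, N ≤ a ∧ N ≤ b ∧ -(a : ℤ) + n = -b :=
    ⟨N + n.natAbs, (N + n.natAbs - n).toNat, by omega, by omega, by omega⟩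
  refine Part.eq_zero_of_act_eq_zero h u fun m hm => ?_
  obtain ⟨w, hw⟩ := hN a b ha hb h m hm
  rw [hw]
  have h1 := (Part.act_lTensor h m f.hom.hom u).trans
    (congrArg (BalTensor.lTensor (DegreeZero R M) (Part R M (-b)) f.hom.hom) hw)
  have h2 := (((congrArg (Part.act h m) hu).symm.trans h1).trans
    (sig_naturality f (neg_add_cancel (b : ℤ)) (BalTensor.tmul R (Part.one R M) w)).symm)
  have h3 := (sig_bijective Y (-b) b 0 (neg_add_cancel _)).1
    ((h2.symm.trans (map_zero (Part.act h m))).trans (map_zero _).symm)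
  have h4 := tmul_eq_zero_of_mono ((Stabilization.iter (tensorFunctor R M) b).map f) w h3
    (Part.one R M)
  exact (congrArg _ h4).trans (map_zero _)

theorem partFunctor_exact {X Y Z : FPMod R} {f : X ⟶ Y} {g : Y ⟶ Z}
    (hfg : Function.Exact f.hom.hom g.hom.hom) (n : ℤ) :
    Function.Exact ((partFunctor R M n).map f).hom.hom ((partFunctor R M n).map g).hom.hom := by
  have hI : isFP R (ModuleCat.of R (LinearMap.range g.hom.hom)) := isFP_of_finite R _
  let I : FPMod R := ⟨_, hI⟩
  let i : I ⟶ Z := ObjectProperty.homMk (ModuleCat.ofHom (Submodule.subtype _))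
  let p : Y ⟶ I := ObjectProperty.homMk (ModuleCat.ofHom g.hom.hom.rangeRestrict)
  have : Mono i := (FPMod.mono_iff_injective i).2 Subtype.val_injective
  have hp : Function.Exact f.hom.hom p.hom.hom := fun y =>
    Iff.trans (Subtype.ext_iff (a1 := p.hom.hom y) (a2 := 0)) (hfg y)
  have h1 := BalTensor.lTensor_exact (S := DegreeZero R M) (M := Part R M n) hp
    (LinearMap.surjective_rangeRestrict _)
  have h2 : (partFunctor R M n).map g = (partFunctor R M n).map p ≫ (partFunctor R M n).map i :=
    (partFunctor R M n).map_comp p i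
  intro z
  rw [h2]
  refine Iff.trans ⟨fun hz => ?_, fun hz => ?_⟩ (h1 z)
  · exact partFunctor_map_injective i n (hz.trans (map_zero _).symm)
  · exact (congrArg ((partFunctor R M n).map i).hom.hom hz).trans (map_zero _)

end LeavittRing

/-! ### Fully faithful functors out of a stabilization -/

namespace Stabilization

variable {C : Type u} [Category.{v} C] {Ω : C ⥤ C}

theorem eq_of_comp_eq {D : Type*} [Category* D] {X X' Y Y' : D} {f f' : X ⟶ Y} {g : X' ⟶ Y'}
    (a : X' ≅ X) (b : Y' ≅ Y) (h : g ≫ b.hom = a.hom ≫ f) (h' : g ≫ b.hom = a.hom ≫ f') :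
    f = f' := by
  rw [← cancel_epi a.hom, ← h, h']

theorem incMap_eq_of_iter {X Y : C} (n : ℤ) {f g : X ⟶ Y} {k : ℕ}
    (h : (iter Ω k).map f = (iter Ω k).map g) : incMap (Ω := Ω) n f = incMap n g := by
  have h1 := shiftIso_naturality (Ω := Ω) f n k (n + k) rfl
  rw [h] at h1
  exact eq_of_comp_eq _ _ h1 (shiftIso_naturality (Ω := Ω) g n k (n + k) rfl)

theorem isIso_of_comp_eq {D : Type*} [Category* D] {X X' Y Y' : D} {f : X ⟶ Y} {g : X' ⟶ Y'}
    [IsIso g] (a : X' ≅ X) (b : Y' ≅ Y) (h : g ≫ b.hom = a.hom ≫ f) : IsIso f := by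
  rw [← Iso.inv_comp_eq] at h
  rw [← h]
  infer_instance

theorem isIso_incMap {X Y : C} (n : ℤ) (f : X ⟶ Y) (k : ℕ) [IsIso ((iter Ω k).map f)] :
    IsIso (incMap (Ω := Ω) n f) :=
  have : IsIso (incMap (Ω := Ω) (n + k) ((iter Ω k).map f)) :=
    Functor.map_isIso (inc Ω (n + k)) ((iter Ω k).map f)
  isIso_of_comp_eq _ _ (shiftIso_naturality (Ω := Ω) f n k (n + k) rfl)

end Stabilization

namespace LevelFunctors

variable {C : Type u} [Category.{v} C] {Ω : C ⥤ C} {B : Type*} [Category* B]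
  (S : LevelFunctors Ω B)

theorem lift_map_shiftIso (X : C) (n : ℤ) (a : ℕ) (p : ℤ) (h : n + a = p) :
    S.lift.map (Stabilization.shiftIso X n a p h).hom = (S.σ X n a p h).hom := by
  refine (S.lift_map_cls (X := ⟨iterObj Ω X a, p⟩) (Y := ⟨X, n⟩) (a := 0) (b := a) (by simp [h])
    (𝟙 (iterObj Ω X a)) p (by simp) h).trans ?_
  exact (Category.id_comp _).trans ((congrArg (· ≫ _) ((S.q p).map_id (iterObj Ω X a))).trans
    (Category.id_comp _))

theorem map_eq_of_conj {D : Type*} [Category* D] (F : D ⥤ B) {X X' Y Y' : D} (a : X' ≅ X)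
    (b : Y' ≅ Y) {f g : X' ⟶ Y'} (h : F.map (a.inv ≫ f ≫ b.hom) = F.map (a.inv ≫ g ≫ b.hom)) :
    F.map f = F.map g := by
  rw [← cancel_mono (F.map b.hom), ← cancel_epi (F.map a.inv)]
  simpa using h

theorem exists_map_eq_of_conj {D : Type*} [Category* D] (F : D ⥤ B) {X X' Y Y' : D} (a : X' ≅ X)
    (b : Y' ≅ Y) (h : ∀ g : F.obj X' ⟶ F.obj Y', ∃ f, F.map f = g) (g : F.obj X ⟶ F.obj Y) :
    ∃ f, F.map f = g := by
  obtain ⟨f, hf⟩ := h (F.map a.hom ≫ g ≫ F.map b.inv)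
  refine ⟨a.inv ≫ f ≫ b.hom, ?_⟩
  rw [F.map_comp, F.map_comp, hf]
  simp [← F.map_comp, ← F.map_comp_assoc]

theorem lift_faithful (H : ∀ (n : ℤ) {X Y : C} (f g : X ⟶ Y), (S.q n).map f = (S.q n).map g →
    ∃ k, (Stabilization.iter Ω k).map f = (Stabilization.iter Ω k).map g) : S.lift.Faithful where
  map_injective {X Y f g} h := by
    obtain ⟨p₁, hp₁⟩ := Stabilization.exists_eq_of_ge f
    obtain ⟨p₂, hp₂⟩ := Stabilization.exists_eq_of_ge g
    obtain ⟨p, hp⟩ : ∃ p, p = max p₁ p₂ := ⟨_, rfl⟩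
    obtain ⟨a, b, ha, hb, f, rfl⟩ := hp₁ p (by omega)
    obtain ⟨a', b', ha', hb', g, rfl⟩ := hp₂ p (by omega)
    obtain rfl : a = a' := by omega
    obtain rfl : b = b' := by omega
    have h1 := map_eq_of_conj S.lift _ _ h
    obtain ⟨k, hk⟩ := H p f g
      ((S.lift_map_inc p f).symm.trans (h1.trans (S.lift_map_inc p g)))
    exact congrArg (fun z => _ ≫ z ≫ _) (Stabilization.incMap_eq_of_iter p hk)

theorem lift_full (H : ∀ (n : ℤ) (X Y : C) (g : (S.q n).obj X ⟶ (S.q n).obj Y),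
    ∃ f : (⟨X, n⟩ : Stabilization Ω) ⟶ ⟨Y, n⟩, S.lift.map f = g) : S.lift.Full where
  map_surjective {X Y} := by
    obtain ⟨p, hp⟩ : ∃ p, p = max X.deg Y.deg := ⟨_, rfl⟩
    obtain ⟨a, ha⟩ : ∃ a : ℕ, X.deg + a = p := ⟨(p - X.deg).toNat, by omega⟩
    obtain ⟨b, hb⟩ : ∃ b : ℕ, Y.deg + b = p := ⟨(p - Y.deg).toNat, by omega⟩
    exact exists_map_eq_of_conj S.lift (Stabilization.shiftIso X.obj X.deg a p ha)
      (Stabilization.shiftIso Y.obj Y.deg b p hb) (H p _ _)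

theorem exists_arrow_aux {D : Type*} [Category* D] (F : D ⥤ B) {X X' Y Y' : D} (a : X' ≅ X)
    (b : Y' ≅ Y) (f : X' ⟶ Y') :
    F.map f ≫ (F.mapIso b).hom = (F.mapIso a).hom ≫ F.map (a.inv ≫ f ≫ b.hom) := by
  simp

/-- Up to isomorphism, every morphism between objects in the image of the stabilization comes from
a level. -/
theorem exists_arrow_of_lift [S.lift.Full] {X Y : Stabilization Ω}
    (φ : S.lift.obj X ⟶ S.lift.obj Y) :
    ∃ (p : ℤ) (X' Y' : C) (f : X' ⟶ Y') (e₁ : (S.q p).obj X' ≅ S.lift.obj X)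
      (e₂ : (S.q p).obj Y' ≅ S.lift.obj Y), (S.q p).map f ≫ e₂.hom = e₁.hom ≫ φ := by
  obtain ⟨ψ, rfl⟩ := S.lift.map_surjective φ
  obtain ⟨a, b, p, ha, hb, f, rfl⟩ := Stabilization.exists_eq ψ
  refine ⟨p, _, _, f, S.lift.mapIso (Stabilization.shiftIso X.obj X.deg a p ha),
    S.lift.mapIso (Stabilization.shiftIso Y.obj Y.deg b p hb), ?_⟩
  refine (congrArg (· ≫ _) (S.lift_map_inc p f).symm).trans ?_
  exact exists_arrow_aux S.lift _ _ _

theorem arrow_trans {X X' X'' Y Y' Y'' : B} {a : X ⟶ Y} {c : X'' ⟶ Y''} {e : X ≅ X'}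
    {e' : X' ≅ X''} {d : Y ≅ Y'} {d' : Y' ≅ Y''} (h : a ≫ d.hom = e.hom ≫ e'.hom ≫ c ≫ d'.inv) :
    a ≫ (d ≪≫ d').hom = (e ≪≫ e').hom ≫ c := by
  simp [reassoc_of% h]

/-- Up to isomorphism, every morphism comes from a level. -/
theorem exists_arrow [S.lift.Full] [S.lift.EssSurj] {N N' : B} (φ : N ⟶ N') :
    ∃ (p : ℤ) (X Y : C) (f : X ⟶ Y) (e₁ : (S.q p).obj X ≅ N) (e₂ : (S.q p).obj Y ≅ N'),
      (S.q p).map f ≫ e₂.hom = e₁.hom ≫ φ := by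
  let e := S.lift.objObjPreimageIso N
  let e' := S.lift.objObjPreimageIso N'
  obtain ⟨p, X, Y, f, e₁, e₂, h⟩ := S.exists_arrow_of_lift (e.hom ≫ φ ≫ e'.inv)
  exact ⟨p, X, Y, f, e₁ ≪≫ e, e₂ ≪≫ e', arrow_trans h⟩

theorem σ_naturality {X Y : C} (f : X ⟶ Y) (n : ℤ) (a : ℕ) (p : ℤ) (h : n + a = p) :
    (S.q p).map ((Stabilization.iter Ω a).map f) ≫ (S.σ Y n a p h).hom =
      (S.σ X n a p h).hom ≫ (S.q n).map f := by
  induction a generalizing p with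
  | zero =>
    obtain rfl : n = p := by simpa using h
    exact (Category.comp_id _).trans (Category.id_comp _).symm
  | succ a ih =>
    have hp : n + a + 1 = p := by rw [← h]; push_cast; ring
    rw [S.σ_succ X n (n + a) p a rfl hp, S.σ_succ Y n (n + a) p a rfl hp]
    exact Stabilization.comp_square' _ _ _ _ ((S.τ (n + a) p hp).hom.naturality _) (ih _ rfl)

/-- Every morphism between objects at two levels is represented at a common level. -/
theorem exists_representative [S.lift.Full] {X Y : C} {n m : ℤ}
    (g : (S.q n).obj X ⟶ (S.q m).obj Y) : ∃ (a b : ℕ) (p : ℤ) (h₁ : n + a = p) (h₂ : m + b = p)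
      (f : iterObj Ω X a ⟶ iterObj Ω Y b), g = S.lev f n m p h₁ h₂ := by
  obtain ⟨φ, hφ⟩ := S.lift.map_surjective
    (show S.lift.obj (Stabilization.mk X n) ⟶ S.lift.obj (Stabilization.mk Y m) from g)
  obtain ⟨a, b, h, f, rfl⟩ := Stabilization.exists_cls φ
  exact ⟨a, b, _, rfl, h.symm, f, hφ.symm.trans (S.lift_map_cls h f _ rfl h.symm)⟩

end LevelFunctors

/-! ### The level functors of a Leavitt ring -/

namespace LeavittRing

variable {R M : Type u} [Ring R] [AddCommGroup M] [Module R M]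
  [Module Rᵐᵒᵖ M] [SMulCommClass R Rᵐᵒᵖ M] [IsNoetherianRing R] [Module.Finite R M]
  [IsArtinianRing R] [Module.Projective R M]

variable (R M) in
theorem lift_faithful : (levelFunctors R M).lift.Faithful :=
  (levelFunctors R M).lift_faithful fun n X Y f g h => by
    obtain ⟨k, hk⟩ := exists_iter_eq_zero (R := R) (M := M) (f := f - g) (n := n)
      (((partFunctor R M n).map_sub).trans (sub_eq_zero.2 h))
    exact ⟨k, sub_eq_zero.1 (((Stabilization.iter _ k).map_sub).symm.trans hk)⟩

/-- A linear map is determined by values in degree zero. -/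
theorem exists_values {X Y : FPMod R} {n : ℤ}
    (g : (partFunctor R M n).obj X ⟶ (partFunctor R M n).obj Y) :
    ∃ T : X.obj →+ BalTensor R (Part R M 0) Y.obj,
      (∀ (r : R) (x : X.obj), T (r • x) =
        Part.act (zero_add 0) (op r • Part.one R M : Part R M 0) (T x)) ∧
      ∀ (l : Part R M n) (x : X.obj), g.hom.hom (BalTensor.tmul R l x) =
        Part.act (add_zero n) l (T x) := by
  obtain ⟨k, y, z, hyz⟩ := Part.exists_sum_mul_eq_one R M (neg_add_cancel n)
  let g' : BalTensor R (Part R M n) X.obj →ₗ[DegreeZero R M] BalTensor R (Part R M n) Y.obj :=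
    g.hom.hom
  -- With `∑ y_j z_j = 1` in `L_{-n} L_n`, the sum `∑ y_j g(z_j ⊗ x)` is the value at `1 ⊗ x` of the
  -- extension of `g` to degree zero.
  let T : X.obj →+ BalTensor R (Part R M 0) Y.obj :=
    ∑ j, (Part.act (neg_add_cancel n) (y j)).comp
      (g'.toAddMonoidHom.comp (BalTensor.tmulHom (R := R) (z j)))
  have hT (x : X.obj) : T x = ∑ j, Part.act (neg_add_cancel n) (y j)
      (g' (BalTensor.tmul R (z j) x)) := AddMonoidHom.finsetSum_apply _ _ _
  have h1 (l : Part R M n) (x : X.obj) : g' (BalTensor.tmul R l x) =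
      Part.act (add_zero n) l (T x) := by
    have h2 : ∑ j, Part.mul (zero_add n) (Part.mul (add_neg_cancel n) l (y j)) (z j) = l := by
      refine Part.val_injective ?_
      have h3 := congrArg Part.val hyz
      rw [map_sum, Part.val_one] at h3
      rw [map_sum]
      calc _ = ∑ j, l.val * (Part.mul (neg_add_cancel n) (y j) (z j)).val :=
            Finset.sum_congr rfl fun j _ => mul_assoc l.1 (y j).1 (z j).1
        _ = l.val := by rw [← Finset.mul_sum, h3, mul_one]
    conv_lhs => rw [← h2, BalTensor.sum_tmul, map_sum]
    rw [hT, map_sum]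
    refine Finset.sum_congr rfl fun j _ => ?_
    rw [Part.act_act (add_neg_cancel n) (zero_add n) (neg_add_cancel n) (add_zero n)]
    exact map_smul g' (show DegreeZero R M from Part.mul (add_neg_cancel n) l (y j))
      (BalTensor.tmul R (z j) x)
  refine ⟨T, fun r x => ?_, h1⟩
  obtain ⟨k', y', z', hyz'⟩ := Part.exists_sum_act_act R M (neg_add_cancel n)
  rw [← hyz' 0 n (add_zero n) (neg_add_cancel n) Y.obj (T (r • x)),
    ← hyz' 0 n (add_zero n) (neg_add_cancel n) Y.obj (Part.act _ _ _)]
  refine Finset.sum_congr rfl fun j _ => congrArg _ ?_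
  rw [← h1, Part.act_act (add_zero n) (add_zero n) (zero_add 0) (add_zero n), ← BalTensor.smul_tmul,
    h1]
  refine congrArg (fun l => Part.act (add_zero n) l (T x)) (Part.val_injective ?_)
  rw [Part.val_mul, Part.val_op_smul, Part.val_op_smul, Part.val_one, one_mul]

/-- Large iterates make a linear map compatible with the maps `x ↦ l ⊗ x`. -/
theorem exists_sig_eq {X Y : FPMod R} {n : ℤ}
    (g : (partFunctor R M n).obj X ⟶ (partFunctor R M n).obj Y) :
    ∃ k : ℕ, ∀ w : (iterObj (tensorFunctor R M) X k).obj,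
      ∃ w' : (iterObj (tensorFunctor R M) Y k).obj, ∀ l : Part R M (n + k),
        g.hom.hom (sig M X n k (n + k) rfl (BalTensor.tmul R l w)) =
          sig M Y n k (n + k) rfl (BalTensor.tmul R l w') := by
  obtain ⟨T, hT, hgT⟩ := exists_values g
  obtain ⟨r, x, hx⟩ := Submodule.fg_iff_exists_fin_generating_family.1
    (Module.Finite.fg_top (R := R) (M := X.obj))
  choose N hN using fun i => exists_act_eq_sig (T (x i))
  -- The exponent must serve all generators of `X`. It is positive so that the `k`th power of `M`
  -- absorbs scalars from the right, which extends the claim from generators to their multiples.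
  obtain ⟨k, hk, hk1⟩ : ∃ k, (∀ i, N i ≤ k) ∧ 1 ≤ k := ⟨Finset.univ.sup N + 1, fun i =>
    (Finset.le_sup (f := N) (Finset.mem_univ i)).trans (Nat.le_succ _), by omega⟩
  have h1 : ∀ (x : X.obj) (m : Part R M (-k)), m.val ∈ vecs R M ^ k →
      ∃ w' : (iterObj (tensorFunctor R M) Y k).obj, Part.act (add_zero _) m (T x) =
        sig M Y (-k) k 0 (neg_add_cancel _) (BalTensor.tmul R (Part.one R M) w') := by
    intro x'
    have hx' : x' ∈ Submodule.span R (Set.range x) := by rw [hx]; trivial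
    induction hx' using Submodule.span_induction with
    | mem x' hx' =>
      obtain ⟨i, rfl⟩ := hx'
      exact hN i k k (hk i) (hk i) _
    | zero =>
      exact fun m hm => ⟨0, by rw [map_zero, map_zero, BalTensor.tmul_zero, map_zero]⟩
    | add x y _ _ h h' =>
      intro m hm
      obtain ⟨w, hw⟩ := h m hm
      obtain ⟨w', hw'⟩ := h' m hm
      exact ⟨w + w', by rw [map_add, map_add, hw, hw', BalTensor.tmul_add, map_add]⟩
    | smul r x _ h =>
      intro m hm
      obtain ⟨w, hw⟩ := h (op r • m) (vecs_pow_mul_scalars_le hk1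
        (Submodule.mul_mem_mul hm ⟨r, rfl⟩))
      refine ⟨w, ?_⟩
      rw [← hw, hT, Part.act_act (add_zero _) (add_zero _) (zero_add 0) (add_zero _)]
      refine congrArg (fun l => Part.act (add_zero _) l (T x)) (Part.val_injective ?_)
      rw [Part.val_mul, Part.val_op_smul, Part.val_op_smul, Part.val_one, one_mul]
  refine ⟨k, fun w => ?_⟩
  have hw : w ∈ AddSubgroup.closure {w | ∃ m ∈ vecs R M ^ k, ∃ x, Represents M X k m x w} := by
    rw [closure_represents_eq_top]; trivial
  let g' : BalTensor R (Part R M n) X.obj →ₗ[DegreeZero R M] BalTensor R (Part R M n) Y.obj :=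
    g.hom.hom
  change ∃ w', ∀ l : Part R M (n + k), g' (sig M X n k (n + k) rfl (BalTensor.tmul R l w)) =
    sig M Y n k (n + k) rfl (BalTensor.tmul R l w')
  induction hw using AddSubgroup.closure_induction with
  | mem w hw =>
    obtain ⟨m, hm, x, hw⟩ := hw
    obtain ⟨m', rfl⟩ : ∃ m' : Part R M (-k), m'.val = m := ⟨⟨m, vecs_pow_le k hm⟩, rfl⟩
    obtain ⟨w', hw'⟩ := h1 x m' hm
    refine ⟨w', fun l => ?_⟩
    have e : n + k + -k = n := by omega
    rw [hw n (n + k) rfl l (Part.mul e l m') rfl]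
    refine (hgT _ _).trans ?_
    rw [← Part.act_act e (add_zero n) (add_zero _) e, hw',
      ← sig_act Y (neg_add_cancel _) rfl (add_zero _) e]
    refine congrArg (sig M Y n k (n + k) rfl) ?_
    exact congrArg (fun l => BalTensor.tmul R l w') (Part.val_injective (mul_one l.1))
  | zero => exact ⟨0, fun l => by rw [BalTensor.tmul_zero, BalTensor.tmul_zero]; simp⟩
  | add w w' _ _ h h' =>
    obtain ⟨v, hv⟩ := h
    obtain ⟨v', hv'⟩ := h'
    exact ⟨v + v', fun l => by
      rw [BalTensor.tmul_add, BalTensor.tmul_add, map_add, map_add, map_add, hv, hv']⟩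
  | neg w _ h =>
    obtain ⟨v, hv⟩ := h
    have e {Z : FPMod R} (l : Part R M (n + k)) (z : Z.obj) :
        BalTensor.tmul R l (-z) = -BalTensor.tmul R l z :=
      map_neg (BalTensor.tmulHom (R := R) l) z
    exact ⟨-v, fun l => by rw [e, e, map_neg, map_neg, map_neg, hv]⟩

end LeavittRing

/-! ### Free modules, kernels and cokernels of finitely presented modules. -/

/-- The map `M ⊗_R R^k → M^k`. -/
def BalTensor.toPi (R S M : Type*) [Ring R] [Ring S] [AddCommGroup M] [Module Rᵐᵒᵖ M]
    [Module S M] [SMulCommClass S Rᵐᵒᵖ M] (k : ℕ) :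
    BalTensor R M (Fin k → R) →ₗ[S] (Fin k → M) :=
  liftLinear (S := S) (AddMonoidHom.mk' (fun m => AddMonoidHom.mk'
      (fun (v : Fin k → R) j => op (v j) • m)
      (fun v v' => funext fun j => add_smul (op (v j)) (op (v' j)) m))
      (fun m m' => AddMonoidHom.ext fun v => funext fun j => smul_add (op (v j)) m m'))
    (fun m r v => funext fun j => smul_smul (op (v j)) (op r) m)
    (fun s m v => funext fun j => (smul_comm s (op (v j)) m).symm)

/-- The isomorphism `M ⊗_R R^k ≅ M^k`. -/
def BalTensor.piEquiv (R S M : Type*) [Ring R] [Ring S] [AddCommGroup M] [Module Rᵐᵒᵖ M]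
    [Module S M] [SMulCommClass S Rᵐᵒᵖ M] (k : ℕ) :
    BalTensor R M (Fin k → R) ≃ₗ[S] (Fin k → M) :=
  LinearEquiv.ofLinearMap (toPi R S M k) (ofTuple R S M fun j => Pi.single j 1)
    (LinearMap.ext fun m => by
      change toPi R S M k (∑ j, tmul R (m j) (Pi.single j 1)) = m
      rw [map_sum]
      funext i
      rw [Finset.sum_apply, Finset.sum_eq_single i]
      · change op ((Pi.single i 1 : Fin k → R) i) • m i = m i
        rw [Pi.single_eq_same, op_one, one_smul]
      · intro j _ hj
        change op ((Pi.single j 1 : Fin k → R) i) • m j = 0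
        rw [Pi.single_eq_of_ne hj.symm, MulOpposite.op_zero, zero_smul]
      · simp)
    (linearMap_ext fun m v => by
      change ∑ j, tmul R (op (v j) • m) (Pi.single j 1) = tmul R m v
      simp only [smul_tmul]
      rw [← tmul_sum]
      refine congrArg (tmul R m) (funext fun i => ?_)
      rw [Finset.sum_apply, Finset.sum_eq_single i]
      · simp
      · intro j _ hj
        simp [Pi.single_eq_of_ne hj.symm]
      · simp)

/-- A ring over which kernels of maps of finitely presented modules are finitely presented. -/
theorem FPMod.isClosedUnderKernels {S : Type u} [Ring S]
    (H : ∀ {X Y : FPMod S} (f : X ⟶ Y), Module.FinitePresentation S (LinearMap.ker f.hom.hom)) :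
    (isFP S).IsClosedUnderKernels where
  kernels_le := by
    rintro _ ⟨f, k, hk, hX, hY⟩
    exact (isFP S).prop_of_iso ((ModuleCat.kernelIsLimit f).conePointUniqueUpToIso hk)
      (H (X := ⟨_, hX⟩) (Y := ⟨_, hY⟩) (ObjectProperty.homMk f))

/-- The isomorphism between two cokernels. -/
noncomputable def LinearMap.equivOfExact {S A B C C' : Type*} [Ring S] [AddCommGroup A]
    [AddCommGroup B] [AddCommGroup C] [AddCommGroup C'] [Module S A] [Module S B] [Module S C]
    [Module S C'] {f : A →ₗ[S] B} {g : B →ₗ[S] C} {g' : B →ₗ[S] C'} (h : Function.Exact f g)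
    (h' : Function.Exact f g') (hg : Function.Surjective g) (hg' : Function.Surjective g') :
    C ≃ₗ[S] C' :=
  (g.quotKerEquivOfSurjective hg).symm ≪≫ₗ
    (Submodule.quotEquivOfEq _ _ (by rw [LinearMap.exact_iff.1 h, LinearMap.exact_iff.1 h'])) ≪≫ₗ
    (g'.quotKerEquivOfSurjective hg')

/-- The isomorphism between two kernels. -/
noncomputable def LinearMap.equivKerOfExact {S K A B : Type*} [Ring S] [AddCommGroup A]
    [AddCommGroup B] [AddCommGroup K] [Module S A] [Module S B] [Module S K]
    {f : A →ₗ[S] B} {i : K →ₗ[S] A} (h : Function.Exact i f) (hi : Function.Injective i) :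
    K ≃ₗ[S] LinearMap.ker f :=
  LinearEquiv.ofInjective i hi ≪≫ₗ LinearEquiv.ofEq _ _ (LinearMap.exact_iff.1 h).symm

/-- The linear equivalence of an isomorphism of finitely presented modules. -/
abbrev FPMod.toLinearEquiv {S : Type u} [Ring S] {X Y : FPMod S} (e : X ≅ Y) : X.obj ≃ₗ[S] Y.obj :=
  ((isFP S).ι.mapIso e).toLinearEquiv

/-! ### The equivalence between the stabilization and `L_0`-mod. -/

namespace LeavittRing

variable {R M : Type u} [Ring R] [AddCommGroup M] [Module R M]
  [Module Rᵐᵒᵖ M] [SMulCommClass R Rᵐᵒᵖ M] [IsNoetherianRing R] [Module.Finite R M]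
  [IsArtinianRing R] [Module.Projective R M] [(tensorFunctor R M).PreservesMonomorphisms]

theorem isIso_iter_of_kernel {X Y : FPMod R} (f : X ⟶ Y) [Epi f] {k : ℕ}
    (h : (Stabilization.iter (tensorFunctor R M) k).map (kernel.ι f) = 0) :
    IsIso ((Stabilization.iter (tensorFunctor R M) k).map f) := by
  have h1 := Stabilization.iter_shortExact (tensorFunctor_shortExact (R := R) (M := M))
    (S := ShortComplex.mk (kernel.ι f) f (kernel.condition f))
    { exact := ShortComplex.exact_kernel f } k
  have h2 : Mono ((Stabilization.iter (tensorFunctor R M) k).map f) := h1.exact.mono_g h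
  have h3 : Epi ((Stabilization.iter (tensorFunctor R M) k).map f) := h1.epi_g
  exact isIso_of_mono_of_epi _

/-- The pairs `(x, y)` with `g (l ⊗ x) = l ⊗ y` for all `l` form a submodule, with projections `π₁`
and `π₂`. By hypothesis `π₁` is onto; its kernel dies under a power of `Ω`, so `π₁` becomes
invertible in the stabilization and `g` comes from `π₁⁻¹ ≫ π₂`. -/
theorem exists_lift_map_eq_of_correspondence {X Y : FPMod R} {n : ℤ}
    (g : (partFunctor R M n).obj X ⟶ (partFunctor R M n).obj Y)
    (hg : ∀ x : X.obj, ∃ y : Y.obj, ∀ l : Part R M n,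
      g.hom.hom (BalTensor.tmul R l x) = BalTensor.tmul R l y) :
    ∃ f : (⟨X, n⟩ : Stabilization (tensorFunctor R M)) ⟶ ⟨Y, n⟩,
      (levelFunctors R M).lift.map f = g := by
  let g' : BalTensor R (Part R M n) X.obj →ₗ[DegreeZero R M] BalTensor R (Part R M n) Y.obj :=
    g.hom.hom
  let P : Submodule R (X.obj × Y.obj) :=
    { carrier := {w | ∀ l : Part R M n, g' (BalTensor.tmul R l w.1) = BalTensor.tmul R l w.2}
      add_mem' := fun {a b} ha hb l => by
        change g' (BalTensor.tmul R l (a.1 + b.1)) = BalTensor.tmul R l (a.2 + b.2)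
        rw [BalTensor.tmul_add, map_add, ha, hb, BalTensor.tmul_add]
      zero_mem' := fun l => by
        change g' (BalTensor.tmul R l 0) = BalTensor.tmul R l 0
        rw [BalTensor.tmul_zero, BalTensor.tmul_zero, map_zero]
      smul_mem' := fun r a ha l => by
        change g' (BalTensor.tmul R l (r • a.1)) = BalTensor.tmul R l (r • a.2)
        rw [← BalTensor.smul_tmul, ← BalTensor.smul_tmul, ha] }
  let Q : FPMod R := ⟨ModuleCat.of R P, isFP_of_finite R _⟩
  let π₁ : Q ⟶ X :=
    ObjectProperty.homMk (ModuleCat.ofHom (LinearMap.fst R X.obj Y.obj ∘ₗ P.subtype))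
  let π₂ : Q ⟶ Y :=
    ObjectProperty.homMk (ModuleCat.ofHom (LinearMap.snd R X.obj Y.obj ∘ₗ P.subtype))
  have hπ : (partFunctor R M n).map π₁ ≫ g = (partFunctor R M n).map π₂ := by
    ext z
    exact LinearMap.congr_fun
      (f := g' ∘ₗ BalTensor.lTensor (DegreeZero R M) (Part R M n) π₁.hom.hom)
      (g := BalTensor.lTensor (DegreeZero R M) (Part R M n) π₂.hom.hom)
      (BalTensor.linearMap_ext fun l w => w.2 l) z
  have : Epi π₁ := (FPMod.epi_iff_surjective _).2 fun x => by
    obtain ⟨y, hy⟩ := hg x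
    exact ⟨⟨(x, y), hy⟩, rfl⟩
  have : Mono (kernel.ι π₁ ≫ π₂) := by
    refine Preadditive.mono_of_cancel_zero _ fun {Z} a ha => ?_
    rw [← cancel_mono (kernel.ι π₁), zero_comp]
    have h1 := (Category.assoc a _ _).trans
      ((congrArg (a ≫ ·) (kernel.condition π₁)).trans comp_zero)
    have h2 := (Category.assoc _ _ _).trans ha
    refine ObjectProperty.hom_ext _ (ModuleCat.hom_ext (LinearMap.ext fun z =>
      Subtype.ext (Prod.ext ?_ ?_)))
    · exact congrArg (fun k : Z ⟶ X => k.hom.hom z) h1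
    · exact congrArg (fun k : Z ⟶ Y => k.hom.hom z) h2
  -- On the kernel of `π₁` the functor kills `π₂`, because it sends `π₂` to the image of `π₁`
  -- followed by `g`. So a power of `Ω` kills this monomorphism and, preserving monomorphisms, kills
  -- the kernel itself.
  have hk : (partFunctor R M n).map (kernel.ι π₁ ≫ π₂) = 0 := by
    rw [Functor.map_comp, ← hπ, ← Functor.map_comp_assoc, kernel.condition, Functor.map_zero,
      zero_comp]
  obtain ⟨k, hk⟩ := exists_iter_eq_zero hk
  have h1 : (Stabilization.iter (tensorFunctor R M) k).map (kernel.ι π₁) = 0 := by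
    have := Functor.map_mono (Stabilization.iter (tensorFunctor R M) k) (kernel.ι π₁ ≫ π₂)
    have h2 : 𝟙 ((Stabilization.iter (tensorFunctor R M) k).obj (kernel π₁)) = 0 := by
      rw [← cancel_mono ((Stabilization.iter (tensorFunctor R M) k).map (kernel.ι π₁ ≫ π₂)), hk,
        comp_zero, comp_zero]
    rw [← Category.id_comp ((Stabilization.iter (tensorFunctor R M) k).map (kernel.ι π₁)), h2,
      zero_comp]
  have := isIso_iter_of_kernel π₁ h1
  have := Stabilization.isIso_incMap (Ω := tensorFunctor R M) n π₁ k
  refine ⟨inv (Stabilization.incMap n π₁) ≫ Stabilization.incMap n π₂, ?_⟩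
  have h2 : ∀ {C D : Type (u + 1)} [Category.{u} C] [Category.{u} D] (F : C ⥤ D) {X Y Z : C}
      (a : X ⟶ Y) (b : X ⟶ Z) (c : F.obj Y ⟶ F.obj Z) [IsIso a], F.map a ≫ c = F.map b →
      F.map (inv a ≫ b) = c := by
    intro C D _ _ F X Y Z a b c _ h
    rw [F.map_comp, ← h, ← F.map_comp_assoc, IsIso.inv_hom_id, F.map_id, Category.id_comp]
  refine h2 (levelFunctors R M).lift _ _ _ ?_
  refine (congrArg (· ≫ _) ((levelFunctors R M).lift_map_inc n π₁)).trans (hπ.trans ?_)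
  exact ((levelFunctors R M).lift_map_inc n π₂).symm

variable (R M)

theorem exists_map_eq_of_mapIso_conj {C D : Type*} [Category* C] [Category* D] (F : C ⥤ D)
    {X X' Y Y' : C} (a : X' ≅ X) (b : Y' ≅ Y) {a' : F.obj X' ≅ F.obj X} {b' : F.obj Y' ≅ F.obj Y}
    (ha : F.map a.hom = a'.hom) (hb : F.map b.hom = b'.hom) (g : F.obj X ⟶ F.obj Y)
    (h : ∃ f, F.map f = a'.hom ≫ g ≫ b'.inv) : ∃ f, F.map f = g := by
  obtain ⟨f, hf⟩ := h
  refine ⟨a.inv ≫ f ≫ b.hom, ?_⟩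
  obtain rfl : F.mapIso a = a' := Iso.ext ha
  obtain rfl : F.mapIso b = b' := Iso.ext hb
  simp [hf]

/-- A morphism at level `n` need not satisfy the correspondence on elements, but `exists_sig_eq`
provides it after passing to level `n + k`, which changes objects only up to isomorphism. -/
theorem lift_full : (levelFunctors R M).lift.Full :=
  (levelFunctors R M).lift_full fun n X Y g => by
    obtain ⟨k, hk⟩ := exists_sig_eq (R := R) (M := M) g
    refine exists_map_eq_of_mapIso_conj (levelFunctors R M).lift
      (Stabilization.shiftIso X n k (n + k) rfl) (Stabilization.shiftIso Y n k (n + k) rfl)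
      ((levelFunctors R M).lift_map_shiftIso X n k (n + k) rfl)
      ((levelFunctors R M).lift_map_shiftIso Y n k (n + k) rfl) g
      (exists_lift_map_eq_of_correspondence _ fun w => ?_)
    obtain ⟨w', hw'⟩ := hk w
    refine ⟨w', fun l => ?_⟩
    refine (congrArg (((levelFunctors R M).σ Y n k (n + k) rfl).inv.hom.hom) (hw' l)).trans ?_
    exact congrArg (fun f : (partFunctor R M (n + k)).obj (iterObj (tensorFunctor R M) Y k) ⟶
      (partFunctor R M (n + k)).obj (iterObj (tensorFunctor R M) Y k) =>
        f.hom.hom (BalTensor.tmul R l w')) ((levelFunctors R M).σ Y n k (n + k) rfl).hom_inv_id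

variable {R} in
/-- The free module of rank `k`. -/
abbrev _root_.FPMod.free (R : Type u) [Ring R] (k : ℕ) : FPMod R :=
  ⟨ModuleCat.of R (Fin k → R), (inferInstance : Module.FinitePresentation R (Fin k → R))⟩

/-- The free modules are images of free modules. -/
def freeIso (k : ℕ) : (partFunctor R M 0).obj (FPMod.free R k) ≅ FPMod.free (DegreeZero R M) k :=
  ObjectProperty.isoMk _ (BalTensor.piEquiv R (DegreeZero R M) (Part R M 0) k).toModuleIso

/-- A finitely presented module is the cokernel of a map of free `L_0`-modules, and these are images
of free `R`-modules. By fullness that map comes from a level `p`, and right exactness of `L_p ⊗_R -`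
turns the cokernel over `R` into the given module. -/
theorem lift_essSurj : (levelFunctors R M).lift.EssSurj where
  mem_essImage N := by
    have := lift_full R M
    obtain ⟨m, k, g, f, hg, hfg⟩ := Module.FinitePresentation.exists_fin' (DegreeZero R M) N.obj
    let φ : FPMod.free (DegreeZero R M) k ⟶ FPMod.free (DegreeZero R M) m :=
      ObjectProperty.homMk (ModuleCat.ofHom f)
    let π : FPMod.free (DegreeZero R M) m ⟶ N := ObjectProperty.homMk (ModuleCat.ofHom g)
    obtain ⟨p, X, Y, ψ, e₁, e₂, h⟩ := (levelFunctors R M).exists_arrow_of_lift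
      (X := ⟨FPMod.free R k, 0⟩) (Y := ⟨FPMod.free R m, 0⟩)
      ((freeIso R M k).hom ≫ φ ≫ (freeIso R M m).inv)
    let E₁ : (partFunctor R M p).obj X ≅ FPMod.free (DegreeZero R M) k := e₁ ≪≫ freeIso R M k
    let E₂ : (partFunctor R M p).obj Y ≅ FPMod.free (DegreeZero R M) m := e₂ ≪≫ freeIso R M m
    have hE : (partFunctor R M p).map ψ ≫ E₂.hom = E₁.hom ≫ φ :=
      LevelFunctors.arrow_trans h
    have hex : Function.Exact ((partFunctor R M p).map ψ).hom.hom (E₂.hom ≫ π).hom.hom := by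
      refine (Function.Exact.iff_of_ladder_linearEquiv (e₁ := FPMod.toLinearEquiv E₁)
        (e₂ := FPMod.toLinearEquiv E₂) (e₃ := LinearEquiv.refl _ _) ?_ ?_).1 hfg
      · exact congrArg (fun k : (partFunctor R M p).obj X ⟶ FPMod.free (DegreeZero R M) m =>
          k.hom.hom) hE.symm
      · rfl
    let Z : FPMod R := ⟨ModuleCat.of R (Y.obj ⧸ LinearMap.range ψ.hom.hom), isFP_of_finite R _⟩
    let c : Y ⟶ Z := ObjectProperty.homMk (ModuleCat.ofHom (Submodule.mkQ _))
    have hc : Function.Exact ψ.hom.hom c.hom.hom :=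
      LinearMap.exact_map_mkQ_range ψ.hom.hom
    have hc' : Function.Surjective c.hom.hom := Submodule.mkQ_surjective _
    exact ⟨⟨Z, p⟩, ⟨ObjectProperty.isoMk _ (LinearMap.equivOfExact
      (BalTensor.lTensor_exact (S := DegreeZero R M) (M := Part R M p) hc hc') hex
      (BalTensor.lTensor_surjective _ hc')
      (hg.comp (FPMod.toLinearEquiv E₂).surjective)).toModuleIso⟩⟩

instance : (levelFunctors R M).lift.IsEquivalence where
  faithful := lift_faithful R M
  full := lift_full R M
  essSurj := lift_essSurj R M

variable {R M} in
-- Up to isomorphism `φ` comes from a morphism over the noetherian ring `R`, where kernels are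
-- finitely generated, and the exact functor `L_p ⊗_R -` preserves the kernel. So kernels are
-- finitely presented over `L_0`, although `L_0` itself is not assumed noetherian.
theorem exists_equiv_ker {N N' : FPMod (DegreeZero R M)} (φ : N ⟶ N') :
    ∃ (p : ℤ) (K : FPMod R), Nonempty ((((partFunctor R M p).obj K).obj : Type u)
      ≃ₗ[DegreeZero R M] LinearMap.ker φ.hom.hom) := by
  obtain ⟨p, X, Y, f, e₁, e₂, h⟩ := (levelFunctors R M).exists_arrow φ
  let K : FPMod R := ⟨ModuleCat.of R (LinearMap.ker f.hom.hom), isFP_of_finite R _⟩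
  let i : K ⟶ X := ObjectProperty.homMk (ModuleCat.ofHom (Submodule.subtype _))
  have : Mono i := (FPMod.mono_iff_injective i).2 Subtype.val_injective
  have hi : Function.Exact i.hom.hom f.hom.hom := LinearMap.exact_subtype_ker_map f.hom.hom
  have hex : Function.Exact ((partFunctor R M p).map i ≫ e₁.hom).hom.hom φ.hom.hom := by
    refine (Function.Exact.iff_of_ladder_linearEquiv (e₁ := LinearEquiv.refl _ _)
      (e₂ := FPMod.toLinearEquiv e₁) (e₃ := FPMod.toLinearEquiv e₂) ?_ ?_).2
        (partFunctor_exact hi p)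
    · rfl
    · exact congrArg (fun k : (partFunctor R M p).obj X ⟶ N' => k.hom.hom) h.symm
  exact ⟨p, K, ⟨LinearMap.equivKerOfExact hex
    ((FPMod.toLinearEquiv e₁).injective.comp (partFunctor_map_injective i p))⟩⟩

instance : (isFP (DegreeZero R M)).IsClosedUnderKernels :=
  FPMod.isClosedUnderKernels fun f => by
    obtain ⟨p, K, ⟨e⟩⟩ := exists_equiv_ker f
    exact Module.FinitePresentation.of_equiv e

noncomputable instance : Abelian (FPMod (DegreeZero R M)) := inferInstance

theorem partFunctor_shortExact (n : ℤ) {S : ShortComplex (FPMod R)} (hS : S.ShortExact) :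
    (S.map (partFunctor R M n)).ShortExact := by
  have := hS.mono_f
  obtain ⟨h₁, h₂, h₃⟩ := (FPMod.shortExact_iff _).1 hS
  exact (FPMod.shortExact_iff _).2 ⟨partFunctor_map_injective S.f n,
    BalTensor.lTensor_exact h₂ h₃, BalTensor.lTensor_surjective _ h₃⟩

/-- The finitely presented modules over the degree zero part of the Leavitt ring are a model of
the stabilization. -/
noncomputable def abelianModel : AbelianModel (tensorFunctor R M) (FPMod (DegreeZero R M)) where
  toLevelFunctors := levelFunctors R M
  additive n := inferInstanceAs (partFunctor R M n).Additive
  isEquivalence := inferInstance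
  shortExact n S hS := partFunctor_shortExact R M n hS
  exists_iter_eq_zero n X Y f h := exists_iter_eq_zero h
  projective n P hP := (FPMod.projective_iff _ _).2 (by
    have := (FPMod.projective_iff _ _).1 hP
    exact BalTensor.projective_of_projective R (DegreeZero R M) (Part R M n) P.obj)
  exists_retract Q hQ := by
    obtain ⟨m, g, hg⟩ := Module.Finite.exists_fin' (DegreeZero R M) Q.obj
    let π : FPMod.free (DegreeZero R M) m ⟶ Q := ObjectProperty.homMk (ModuleCat.ofHom g)
    have : Epi π := (FPMod.epi_iff_surjective π).2 hg
    refine ⟨FPMod.free R m, (FPMod.projective_iff _ _).2 (inferInstanceAs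
      (Module.Projective R (Fin m → R))), 0, ⟨?_⟩⟩
    have h1 : ∀ {B : Type (u + 1)} [Category.{u} B] {Q X Y : B} (s : Q ⟶ Y) (e : X ≅ Y)
        (π : Y ⟶ Q), s ≫ π = 𝟙 Q → (s ≫ e.inv) ≫ e.hom ≫ π = 𝟙 Q := by
      intro B _ Q X Y s e π h
      simpa using h
    exact { i := Projective.factorThru (𝟙 Q) π ≫ (freeIso R M m).inv
            r := (freeIso R M m).hom ≫ π
            retract := h1 _ _ _ (Projective.factorThru_comp _ _) }

end LeavittRing

/-! ### Frobenius categories from syzygy functors -/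

namespace LevelFunctors

variable {C : Type u} [Category.{v} C] {Ω : C ⥤ C} {B : Type*} [Category* B]
  (S : LevelFunctors Ω B)

theorem lev_iter_map {X Y : C} (f : X ⟶ Y) (n : ℤ) (a : ℕ) (p : ℤ) (h : n + a = p) :
    S.lev ((Stabilization.iter Ω a).map f) n n p h h = (S.q n).map f :=
  (Iso.inv_comp_eq _).2 (S.σ_naturality f n a p h)

end LevelFunctors

section Frobenius

variable {A : Type u} [Category.{v} A] [Abelian A] {Ω : A ⥤ A}

theorem shortExact_cokernel_π {X Y : A} (f : X ⟶ Y) [Mono f] :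
    (ShortComplex.mk f (cokernel.π f) (cokernel.condition f)).ShortExact :=
  ShortComplex.ShortExact.mk' (ShortComplex.exact_cokernel f) inferInstance inferInstance

theorem projective_iterObj (hΩ : ∀ P : A, Projective P → Projective (Ω.obj P)) {P : A}
    (hP : Projective P) (a : ℕ) : Projective (iterObj Ω P a) := by
  induction a with
  | zero => exact hP
  | succ a ih => exact hΩ _ ih

theorem SyzygyData.projective_obj (Y : SyzygyData Ω) (P : A) (hP : Projective P) :
    Projective (Ω.obj P) := by
  have := Y.projective P
  exact Retract.projective ⟨Y.i.app P, ((Y.exact P).splittingOfProjective).r,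
    ((Y.exact P).splittingOfProjective).f_r⟩

/-- If `P` turns a monomorphism into a split monomorphism, then morphisms to projective objects
extend along it after applying `Ω`. -/
theorem SyzygyData.exists_extension (Y : SyzygyData Ω) {X X' Q : A} (f : X ⟶ X')
    (hf : ∃ r, Y.P.map f ≫ r = 𝟙 _) (hQ : Projective Q) (g : X ⟶ Q) :
    ∃ h : Ω.obj X' ⟶ Ω.obj Q, Ω.map f ≫ h = Ω.map g := by
  obtain ⟨r, hr⟩ := hf
  obtain ⟨ρ, hρ⟩ : ∃ ρ, Y.i.app Q ≫ ρ = 𝟙 _ :=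
    ⟨_, ((Y.exact Q).splittingOfProjective).f_r⟩
  refine ⟨Y.i.app X' ≫ r ≫ Y.P.map g ≫ ρ, ?_⟩
  rw [Y.i.naturality_assoc, reassoc_of% hr, ← Y.i.naturality_assoc, hρ, Category.comp_id]

variable [Ω.Additive]

namespace SyzygyData.IsExact

variable {Y : SyzygyData Ω} (hY : Y.IsExact)
include hY

theorem mono_iter {X X' : A} (f : X ⟶ X') [Mono f] (a : ℕ) :
    Mono ((Stabilization.iter Ω a).map f) :=
  (Stabilization.iter_shortExact hY.map_shortExact (shortExact_cokernel_π f) a).mono_f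

/-- Factor `f` through its coimage: the second factor is a monomorphism and stays one, and the first
becomes a monomorphism once its kernel is annihilated. -/
theorem mono_iter_of_kernel {X X' : A} (f : X ⟶ X') {a : ℕ}
    (h : (Stabilization.iter Ω a).map (kernel.ι f) = 0) :
    Mono ((Stabilization.iter Ω a).map f) := by
  have h1 := (Stabilization.iter_shortExact hY.map_shortExact
    (shortExact_cokernel_π (kernel.ι f)) a).exact.mono_g h
  have h2 := hY.mono_iter (Abelian.factorThruCoimage f) a
  have h3 := mono_comp' h1 h2
  have h4 : (Stabilization.iter Ω a).map (cokernel.π (kernel.ι f)) ≫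
      (Stabilization.iter Ω a).map (Abelian.factorThruCoimage f) =
        (Stabilization.iter Ω a).map f :=
    ((Stabilization.iter Ω a).map_comp _ _).symm.trans
      (congrArg _ (Abelian.coimage.fac f))
  rwa [← h4]

end SyzygyData.IsExact

namespace AbelianModel

variable {B : Type*} [Category* B] [Abelian B] (G : AbelianModel Ω B)

theorem mono_of_square {D : Type*} [Category* D] {X X' Y Y' : D} {f : X ⟶ Y} {g : X' ⟶ Y'} [Mono g]
    (a : X ≅ X') (b : Y ≅ Y') (h : f ≫ b.hom = a.hom ≫ g) : Mono f := by
  have : Mono (f ≫ b.hom) := by rw [h]; infer_instance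
  exact mono_of_mono f b.hom

theorem square_trans {D : Type*} [Category* D] {X X' X'' Y Y' Y'' : D} {f : X ⟶ Y} {f' : X' ⟶ Y'}
    {f'' : X'' ⟶ Y''} {a : X ⟶ X'} {a' : X' ⟶ X''} {b : Y ⟶ Y'} {b' : Y' ⟶ Y''}
    (h : f ≫ b = a ≫ f') (h' : f' ≫ b' = a' ≫ f'') : f ≫ b ≫ b' = (a ≫ a') ≫ f'' := by
  rw [reassoc_of% h, h', Category.assoc]

/-- Up to isomorphism, every monomorphism comes from a monomorphism at a level. -/
theorem exists_mono_arrow {Y : SyzygyData Ω} (hY : Y.IsExact) {N N' : B} (m : N ⟶ N') [Mono m] :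
    ∃ (p : ℤ) (X X' : A) (f : X ⟶ X') (_ : Mono f) (e₁ : (G.q p).obj X ≅ N)
      (e₂ : (G.q p).obj X' ≅ N'), (G.q p).map f ≫ e₂.hom = e₁.hom ≫ m := by
  obtain ⟨p, X, X', f, e₁, e₂, h⟩ := G.exists_arrow m
  have h1 := mono_of_square e₁ e₂ h
  have h2 : (G.q p).map (kernel.ι f) = 0 := by
    rw [← cancel_mono ((G.q p).map f), ← Functor.map_comp, kernel.condition, Functor.map_zero,
      zero_comp]
  obtain ⟨k, hk⟩ := G.exists_iter_eq_zero p _ h2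
  exact ⟨p + k, _, _, _, hY.mono_iter_of_kernel f hk, G.σ X p k _ rfl ≪≫ e₁,
    G.σ X' p k _ rfl ≪≫ e₂, square_trans (G.σ_naturality f p k _ rfl) h⟩

/-- Both the monomorphism and the map to be extended are represented at levels. The extension exists
after one application of `Ω`, by `SyzygyData.exists_extension`, and this costs nothing in the
stabilization. -/
theorem injective_obj {Y : SyzygyData Ω} (hY : Y.IsExact)
    (hs : ∀ {X X' : A} (f : X ⟶ X') [Mono f], ∃ r, Y.P.map f ≫ r = 𝟙 _) {P : A}
    (hP : Projective P) (n : ℤ) : Injective ((G.q n).obj P) where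
  factors {N N'} g m _ := by
    obtain ⟨p, X, X', f, hf, e₁, e₂, h⟩ := G.exists_mono_arrow hY m
    obtain ⟨a, b, l, h₁, h₂, g', hg⟩ := G.exists_representative (e₁.hom ≫ g)
    have hf' := hY.mono_iter f a
    -- The extension `d` is a morphism between the objects `Ω^(a + 1)` and `Ω^(b + 1)`, hence the
    -- levels `l + 1` below.
    obtain ⟨d, hd⟩ := Y.exists_extension _ (hs ((Stabilization.iter Ω a).map f))
      (projective_iterObj Y.projective_obj hP b) g'
    have k₁ : p + (a + 1 : ℕ) = l + 1 := by rw [← h₁]; push_cast; ring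
    have k₂ : n + (b + 1 : ℕ) = l + 1 := by rw [← h₂]; push_cast; ring
    have h3 : (G.q p).map f ≫ G.lev (a := a + 1) (b := b + 1) d p n (l + 1) k₁ k₂ =
        e₁.hom ≫ g := by
      rw [hg, ← G.lev_step g' p n l (l + 1) h₁ h₂ rfl k₁ k₂,
        ← G.lev_iter_map f p (a + 1) (l + 1) k₁]
      exact (G.lev_comp _ _ _ _ _ _ _ _ _).trans
        (congrArg (fun z => G.lev (a := a + 1) (b := b + 1) z _ _ _ k₁ k₂) hd)
    refine ⟨e₂.inv ≫ G.lev (a := a + 1) (b := b + 1) d p n (l + 1) k₁ k₂, ?_⟩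
    rw [← cancel_epi e₁.hom, ← h3, ← reassoc_of% h, Iso.hom_inv_id_assoc]

include G

theorem exists_iso_obj (N : B) : ∃ (X : A) (n : ℤ), Nonempty ((G.q n).obj X ≅ N) :=
  ⟨_, _, ⟨G.lift.objObjPreimageIso N⟩⟩

/-- An object `X` at level `n` is `Ω X` at level `n + 1`, where it embeds into the image of the
projective `P X`. The same embedding later makes every injective a retract of a projective. -/
theorem enoughInjectives {Y : SyzygyData Ω} (hY : Y.IsExact)
    (hs : ∀ {X X' : A} (f : X ⟶ X') [Mono f], ∃ r, Y.P.map f ≫ r = 𝟙 _) :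
    EnoughInjectives B where
  presentation N := by
    obtain ⟨X, n, ⟨e⟩⟩ := G.exists_iso_obj N
    have := (G.shortExact (n + 1) (Y.exact X)).mono_f
    have h : Mono ((G.q (n + 1)).map (Y.i.app X)) := this
    exact ⟨{ J := (G.q (n + 1)).obj (Y.P.obj X)
             injective := G.injective_obj hY hs (Y.projective X) _
             f := e.inv ≫ ((G.τ n (n + 1) rfl).app X).inv ≫ (G.q (n + 1)).map (Y.i.app X)
             mono := mono_comp _ _ }⟩

theorem exists_epi (Y : SyzygyData Ω) (N : B) : ∃ (X : A) (n : ℤ)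
    (f : (G.q n).obj (Y.P.obj X) ⟶ N), Epi f := by
  obtain ⟨X, n, ⟨e⟩⟩ := G.exists_iso_obj N
  have h : Epi ((G.q n).map (Y.p.app X)) := (G.shortExact n (Y.exact X)).epi_g
  exact ⟨X, n, (G.q n).map (Y.p.app X) ≫ e.hom, epi_comp _ _⟩

theorem enoughProjectives (Y : SyzygyData Ω) : EnoughProjectives B where
  presentation N := by
    obtain ⟨X, n, f, hf⟩ := G.exists_epi Y N
    exact ⟨{ p := _, projective := G.projective n _ (Y.projective X), f := f, epi := hf }⟩

theorem isFrobeniusAbelian {Y : SyzygyData Ω} (hY : Y.IsExact)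
    (hs : ∀ {X X' : A} (f : X ⟶ X') [Mono f], ∃ r, Y.P.map f ≫ r = 𝟙 _) :
    IsFrobeniusAbelian B where
  hasFiniteProducts := inferInstance
  hasKernels := inferInstance
  hasCokernels := inferInstance
  isNormalMono := inferInstance
  isNormalEpi := inferInstance
  enoughProjectives := G.enoughProjectives Y
  enoughInjectives := G.enoughInjectives hY hs
  projective_iff_injective N := by
    refine ⟨fun h => ?_, fun h => ?_⟩
    · obtain ⟨P, hP, n, ⟨r⟩⟩ := G.exists_retract N h
      have := G.injective_obj hY hs hP n
      exact ⟨fun {X X'} g f _ => ⟨Injective.factorThru (g ≫ r.i) f ≫ r.r, by simp⟩⟩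
    · obtain ⟨X, n, ⟨e⟩⟩ := G.exists_iso_obj N
      have h1 : Mono ((G.q (n + 1)).map (Y.i.app X)) := (G.shortExact (n + 1) (Y.exact X)).mono_f
      have h2 := G.projective (n + 1) _ (Y.projective X)
      let f := e.inv ≫ ((G.τ n (n + 1) rfl).app X).inv ≫ (G.q (n + 1)).map (Y.i.app X)
      have hf : Mono f := mono_comp _ _
      exact Retract.projective ⟨f, Injective.factorThru (𝟙 N) f, Injective.comp_factorThru _ _⟩

end AbelianModel

end Frobenius

/-! ### FC rings from matrices -/

open Matrix in
theorem LinearMap.exists_dotProduct {S : Type*} [Ring S] {k : ℕ} (φ : (Fin k → S) →ₗ[S] S) :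
    ∃ x : Fin k → S, ∀ r, φ r = r ⬝ᵥ x :=
  ⟨_, fun r => LinearMap.pi_apply_eq_sum_univ φ r⟩

open Matrix Abelian in
/-- A ring is left FC if for every matrix `B` there is a matrix `A` such that `A` and `B` form an
exact sequence of row modules and an exact sequence of column modules. -/
theorem IsLeftFC.of_matrix {S : Type u} [Ring S]
    (H : ∀ {k n : ℕ} (B : Matrix (Fin k) (Fin n) S), ∃ (l : ℕ) (A : Matrix (Fin l) (Fin k) S),
      A * B = 0 ∧ (∀ r, r ᵥ* B = 0 → ∃ s, s ᵥ* A = r) ∧ ∀ x, A *ᵥ x = 0 → ∃ y, B *ᵥ y = x) :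
    IsLeftFC S where
  coherent I hI := by
    have : Module.Finite S I := Module.Finite.iff_fg.2 hI
    obtain ⟨k, g, hg⟩ := Module.Finite.exists_fin' S I
    obtain ⟨b, hb⟩ := (I.subtype ∘ₗ g).exists_dotProduct
    -- Generators of the ideal form a matrix with one column, and the rows of `A` generate their
    -- relations.
    obtain ⟨l, A, hAB, hr, -⟩ := H (Matrix.of fun i (_ : Fin 1) => b i)
    refine Module.finitePresentation_of_surjective g hg ?_
    have : LinearMap.ker g = LinearMap.range A.vecMulLinear := by
      ext r
      rw [LinearMap.mem_ker, LinearMap.mem_range, ← Subtype.coe_inj]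
      have h1 : ((g r : I) : S) = (r ᵥ* Matrix.of fun i (_ : Fin 1) => b i) 0 := hb r
      rw [h1]
      refine ⟨fun h => hr r (funext fun j => ?_), ?_⟩
      · obtain rfl : j = 0 := Subsingleton.elim _ _
        exact h
      · rintro ⟨s, rfl⟩
        rw [vecMulLinear_apply, vecMul_vecMul, hAB, vecMul_zero]
        rfl
    rw [this, LinearMap.range_eq_map]
    exact Module.Finite.fg_top.map _
  ext_eq_zero M _ := by
    obtain ⟨k, m, f, g, hf, hfg⟩ := Module.FinitePresentation.exists_fin' S M
    obtain ⟨A₀, rfl⟩ : ∃ A₀ : Matrix (Fin m) (Fin k) S, g = A₀.vecMulLinear :=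
      ⟨_, (LinearMap.toMatrixRight'.symm_apply_apply g).symm⟩
    obtain ⟨l, A, hA, -, hc⟩ := H A₀
    have hS := f.shortExact_shortComplexKer hf
    have hext (ψ : LinearMap.ker f →ₗ[S] S) : ∃ Ψ : (Fin k → S) →ₗ[S] S,
        Ψ ∘ₗ (LinearMap.ker f).subtype = ψ := by
      let c : (Fin m → S) →ₗ[S] LinearMap.ker f := LinearMap.codRestrict _ A₀.vecMulLinear
        fun s => hfg.apply_apply_eq_zero s
      obtain ⟨x, hx⟩ := (ψ ∘ₗ c).exists_dotProduct
      -- A form on the kernel pulls back to a vector `x` that respects the relations `A` between the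
      -- rows of `A₀`, so `A x = 0`. A solution of `A₀ y = x` is then an extension of the form to
      -- the free module.
      obtain ⟨y, hy⟩ := hc x (by
        funext i
        have h1 : c (A i) = 0 := Subtype.ext (congrFun hA i)
        have h2 := hx (A i)
        rw [LinearMap.comp_apply, h1, map_zero] at h2
        exact h2.symm)
      refine ⟨Fintype.linearCombination S y, LinearMap.ext fun z => ?_⟩
      obtain ⟨s, hs⟩ := (hfg z.1).1 z.2
      obtain rfl : c s = z := Subtype.ext hs
      refine Eq.trans ?_ (hx s).symm
      rw [← hy, dotProduct_mulVec]
      rfl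
    -- Every extension class is the class of the presentation pushed out along a form on the kernel;
    -- the form extends to the free module, so the class vanishes.
    refine subsingleton_of_forall_eq 0 fun e => ?_
    obtain ⟨e', rfl⟩ := Ext.contravariant_sequence_exact₃ hS (ModuleCat.of S S) e
      (Ext.eq_zero_of_projective (P := ModuleCat.of S (Fin k → S)) _) (add_zero 1)
    obtain ⟨ψ, rfl⟩ := Ext.homEquiv₀.symm.surjective e'
    obtain ⟨Ψ, hΨ⟩ := hext ψ.hom
    have h1 : ψ = f.shortComplexKer.f ≫ ModuleCat.ofHom Ψ := ModuleCat.hom_ext hΨ.symm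
    rw [h1]
    refine (congrArg (hS.extClass.comp · (add_zero 1))
      (Ext.mk₀_comp_mk₀ f.shortComplexKer.f (ModuleCat.ofHom Ψ)).symm).trans ?_
    exact hS.extClass_comp_assoc _

open Matrix in
theorem Matrix.op_mulVec {S : Type*} [Ring S] {k n : ℕ} (B : Matrix (Fin k) (Fin n) S)
    (x : Fin n → S) :
    (fun j => op (x j)) ᵥ* (B.map op)ᵀ = fun i => op ((B *ᵥ x) i) := by
  funext i
  simp [Matrix.vecMul, Matrix.mulVec, dotProduct]

open Matrix in
theorem Matrix.op_vecMul {S : Type*} [Ring S] {k n : ℕ} (B : Matrix (Fin k) (Fin n) S)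
    (r : Fin k → S) :
    (B.map op)ᵀ *ᵥ (fun j => op (r j)) = fun i => op ((r ᵥ* B) i) := by
  funext i
  simp [Matrix.vecMul, Matrix.mulVec, dotProduct]

open Matrix in
/-- A ring is right FC if for every matrix `B` there is a matrix `A` such that `B` and `A` form an
exact sequence of column modules and an exact sequence of row modules. -/
theorem IsLeftFC.op_of_matrix {S : Type u} [Ring S]
    (H : ∀ {k n : ℕ} (B : Matrix (Fin n) (Fin k) S), ∃ (l : ℕ) (A : Matrix (Fin k) (Fin l) S),
      B * A = 0 ∧ (∀ x, B *ᵥ x = 0 → ∃ y, A *ᵥ y = x) ∧ ∀ r, r ᵥ* A = 0 → ∃ s, s ᵥ* B = r) :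
    IsLeftFC Sᵐᵒᵖ :=
  IsLeftFC.of_matrix fun {k n} B => by
    obtain ⟨B, rfl⟩ : ∃ B' : Matrix (Fin n) (Fin k) S, B = (B'.map op)ᵀ := ⟨(B.map unop)ᵀ, rfl⟩
    obtain ⟨l, A, hAB, hc, hr⟩ := H B
    have op_eq {m : ℕ} {x y : Fin m → S} : (fun i => op (x i)) = (fun i => op (y i)) ↔ x = y := by
      simp [funext_iff]
    have op_eq_zero {m : ℕ} {x : Fin m → S} : (fun i => op (x i)) = 0 ↔ x = 0 := by
      simp [funext_iff]
    refine ⟨l, (A.map op)ᵀ, ?_, fun r h => ?_, fun x h => ?_⟩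
    · ext i j
      have h1 : ((A.map op)ᵀ * (B.map op)ᵀ) i j = op ((B * A) j i) := by simp [Matrix.mul_apply]
      rw [h1, hAB]
      rfl
    · obtain ⟨r, rfl⟩ : ∃ r' : Fin k → S, r = fun i => op (r' i) := ⟨fun i => unop (r i), rfl⟩
      rw [op_mulVec, op_eq_zero] at h
      obtain ⟨s, hs⟩ := hc r h
      exact ⟨_, (op_mulVec A s).trans (op_eq.2 hs)⟩
    · obtain ⟨x, rfl⟩ : ∃ r' : Fin k → S, x = fun i => op (r' i) := ⟨fun i => unop (x i), rfl⟩
      rw [op_vecMul, op_eq_zero] at h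
      obtain ⟨s, hs⟩ := hr x h
      exact ⟨_, (op_vecMul B s).trans (op_eq.2 hs)⟩

open Matrix in
/-- A ring is FC if kernels of matrices are finitely generated, linear forms on finitely generated
submodules of free modules extend, and finitely presented modules embed in free modules. -/
theorem IsFCRing.of_embedding {S : Type u} [Ring S]
    (hK : ∀ {k n : ℕ} (f : (Fin k → S) →ₗ[S] (Fin n → S)), (LinearMap.ker f).FG)
    (hI : ∀ {n : ℕ} (N : Submodule S (Fin n → S)), N.FG → ∀ φ : N →ₗ[S] S,
      ∃ Φ : (Fin n → S) →ₗ[S] S, Φ ∘ₗ N.subtype = φ)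
    (hT : ∀ (N : Type u) [AddCommGroup N] [Module S N] [Module.FinitePresentation S N],
      ∃ (l : ℕ) (j : N →ₗ[S] (Fin l → S)), Function.Injective j) : IsFCRing S := by
  -- A form vanishing on the kernel of `f` descends to the image, a finitely generated submodule of
  -- a free module, and extends from there by `hI`.
  have key {k n : ℕ} (f : (Fin k → S) →ₗ[S] (Fin n → S)) (φ : (Fin k → S) →ₗ[S] S)
      (h : LinearMap.ker f ≤ LinearMap.ker φ) : ∃ y : Fin n → S, ∀ r, φ r = f r ⬝ᵥ y := by
    obtain ⟨Φ, hΦ⟩ := hI (LinearMap.range f)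
      (by rw [LinearMap.range_eq_map]; exact Module.Finite.fg_top.map _)
      ((LinearMap.ker f).liftQ φ h ∘ₗ f.quotKerEquivRange.symm.toLinearMap)
    obtain ⟨y, hy⟩ := Φ.exists_dotProduct
    refine ⟨y, fun r => ?_⟩
    rw [← hy]
    have h1 := LinearMap.congr_fun hΦ ⟨f r, r, rfl⟩
    refine Eq.trans ?_ h1.symm
    have h2 : f.quotKerEquivRange.symm ⟨f r, r, rfl⟩ = (LinearMap.ker f).mkQ r := by
      rw [LinearEquiv.symm_apply_eq]
      rfl
    change _ = (LinearMap.ker f).liftQ φ h (f.quotKerEquivRange.symm ⟨f r, r, rfl⟩)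
    rw [h2]
    rfl
  have dot_ext {k : ℕ} {x y : Fin k → S} (h : ∀ r : Fin k → S, r ⬝ᵥ x = r ⬝ᵥ y) : x = y := by
    classical
    funext i
    simpa using h (Pi.single i 1)
  refine ⟨IsLeftFC.of_matrix fun {k n} B => ?_, IsLeftFC.op_of_matrix fun {k n} B => ?_⟩
  -- For the left half, the rows of `A` generate the kernel of right multiplication by `B`;
  -- exactness on columns is `key` applied to `B`.
  · have : Module.Finite S (LinearMap.ker B.vecMulLinear) := Module.Finite.iff_fg.2 (hK _)
    obtain ⟨l, g, hg⟩ := Module.Finite.exists_fin' S (LinearMap.ker B.vecMulLinear)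
    obtain ⟨A, hA⟩ : ∃ A : Matrix (Fin l) (Fin k) S,
        (LinearMap.ker B.vecMulLinear).subtype ∘ₗ g = A.vecMulLinear :=
      ⟨_, (LinearMap.toMatrixRight'.symm_apply_apply _).symm⟩
    have hA' (s) : s ᵥ* A = (g s : Fin k → S) := (LinearMap.congr_fun hA s).symm
    refine ⟨l, A, ?_, fun r h => ?_, fun x hx => ?_⟩
    · funext i
      have h1 : A i = Pi.single i 1 ᵥ* A := by rw [single_one_vecMul]; rfl
      refine Eq.trans (b := A i ᵥ* B) rfl ?_
      rw [h1, hA']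
      exact (g (Pi.single i 1)).2
    · obtain ⟨s, hs⟩ := hg ⟨r, h⟩
      exact ⟨s, by rw [hA', hs]⟩
    · obtain ⟨y, hy⟩ := key B.vecMulLinear (Fintype.linearCombination S x) fun r hr => by
        obtain ⟨s, hs⟩ := hg ⟨r, hr⟩
        have h1 : s ᵥ* A = r := by rw [hA', hs]
        change r ⬝ᵥ x = 0
        rw [← h1, ← dotProduct_mulVec, hx, dotProduct_zero]
      refine ⟨y, dot_ext fun r => ?_⟩
      rw [dotProduct_mulVec]
      exact (hy r).symm
  -- For the right half, the cokernel of `B` acting on rows is embedded in a free module, and `A` is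
  -- the matrix of the composite. Exactness on rows is injectivity of the embedding, and exactness
  -- on columns is `key` applied to `A`.
  · let N := (Fin k → S) ⧸ LinearMap.range B.vecMulLinear
    have : Module.FinitePresentation S N := Module.finitePresentation_of_surjective
      (Submodule.mkQ _) (Submodule.mkQ_surjective _) (by
        rw [Submodule.ker_mkQ, LinearMap.range_eq_map]
        exact Module.Finite.fg_top.map _)
    obtain ⟨l, j, hj⟩ := hT N
    obtain ⟨A, hA⟩ : ∃ A : Matrix (Fin k) (Fin l) S,
        j ∘ₗ Submodule.mkQ _ = A.vecMulLinear :=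
      ⟨_, (LinearMap.toMatrixRight'.symm_apply_apply _).symm⟩
    have hker (r : Fin k → S) : r ᵥ* A = 0 ↔ ∃ s, s ᵥ* B = r := by
      have h1 : r ᵥ* A = j (Submodule.mkQ _ r) := (LinearMap.congr_fun hA r).symm
      rw [h1, map_eq_zero_iff j hj]
      exact Submodule.Quotient.mk_eq_zero _
    refine ⟨l, A, ?_, fun x hx => ?_, fun r h => (hker r).1 h⟩
    · funext i
      have h1 : B i = Pi.single i 1 ᵥ* B := by rw [single_one_vecMul]; rfl
      exact (hker (B i)).2 ⟨_, h1.symm⟩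
    · obtain ⟨y, hy⟩ := key A.vecMulLinear (Fintype.linearCombination S x) fun r hr => by
        obtain ⟨s, rfl⟩ := (hker r).1 hr
        change (s ᵥ* B) ⬝ᵥ x = 0
        rw [← dotProduct_mulVec, hx, dotProduct_zero]
      refine ⟨y, dot_ext fun r => ?_⟩
      rw [dotProduct_mulVec]
      exact (hy r).symm

/-- If the finitely presented modules form a Frobenius category and kernels of morphisms between
them are finitely presented, then the ring is an FC ring. -/
theorem IsFCRing.of_isFrobeniusAbelian {S : Type u} [Ring S] [IsFrobeniusAbelian (FPMod S)]
    (hK : ∀ {X Y : FPMod S} (f : X ⟶ Y), Module.FinitePresentation S (LinearMap.ker f.hom.hom)) :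
    IsFCRing S := by
  have hker {k n : ℕ} (f : (Fin k → S) →ₗ[S] (Fin n → S)) : (LinearMap.ker f).FG := by
    have : Module.FinitePresentation S (LinearMap.ker f) :=
      hK (X := FPMod.free S k) (Y := FPMod.free S n) (ObjectProperty.homMk (ModuleCat.ofHom f))
    exact Module.Finite.iff_fg.1 inferInstance
  refine IsFCRing.of_embedding hker (fun {n} N hN φ => ?_) fun N _ _ _ => ?_
  · have : Module.Finite S N := Module.Finite.iff_fg.2 hN
    obtain ⟨k, g, hg⟩ := Module.Finite.exists_fin' S N
    have hN' : Module.FinitePresentation S N := by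
      refine Module.finitePresentation_of_surjective g hg ?_
      rw [← LinearMap.ker_comp_of_ker_eq_bot g N.ker_subtype]
      exact hker _
    let X : FPMod S := ⟨ModuleCat.of S N, hN'⟩
    let i : X ⟶ FPMod.free S n := ObjectProperty.homMk (ModuleCat.ofHom N.subtype)
    let f : X ⟶ FPMod.self S := ObjectProperty.homMk (ModuleCat.ofHom φ)
    have hi : Mono i := (FPMod.mono_iff_injective i).2 N.injective_subtype
    -- Extension of forms is the self-injectivity of `S` within finitely presented modules, which
    -- the Frobenius property supplies.
    have : Injective (FPMod.self S) := (IsFrobeniusAbelian.projective_iff_injective _).1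
      ((FPMod.projective_iff S _).2 (inferInstanceAs (Module.Projective S S)))
    exact ⟨(Injective.factorThru f i).hom.hom,
      congrArg (fun h : X ⟶ FPMod.self S => h.hom.hom) (Injective.comp_factorThru f i)⟩
  · let X : FPMod S := ⟨ModuleCat.of S N, ‹_›⟩
    obtain ⟨J, hJ, j, hj⟩ := (IsFrobeniusAbelian.enoughInjectives (C := FPMod S)).presentation X
    have hP : Module.Projective S J.obj := (FPMod.projective_iff S J).1
      ((IsFrobeniusAbelian.projective_iff_injective J).2 hJ)
    have : Module.Finite S J.obj := isFP.finite J.property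
    -- The injective hull-like object `J` is projective and finitely generated, hence a summand of a
    -- free module; this embeds `N` in a free module.
    obtain ⟨n, f, g, -, hg, -⟩ := Module.Finite.exists_comp_eq_id_of_projective S J.obj
    exact ⟨n, g ∘ₗ j.hom.hom, hg.comp ((FPMod.mono_iff_injective j).1 hj)⟩

/-! ### The triangle equivalence -/

section TriangleEquivalence

attribute [local instance] HasDerivedCategory.standard

/-- The Verdier quotient of the bounded derived category by the perfect complexes is triangle
equivalent to the stable category of an abelian model of the stabilization. -/
theorem AbelianModel.nonempty_triangleEquivalence {A : Type u} [Category.{v} A] [Abelian A]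
    {Ω : A ⥤ A} [Ω.Additive] {B : Type w} [Category.{v} B] [Abelian B] [IsFrobeniusAbelian B]
    (G : AbelianModel Ω B) {Y : SyzygyData Ω} (hY : Y.IsExact) :
    Nonempty (TriangleEquivalenceToStable (AbelianSingularityCategory A) B) := by
  let F := boundedDeltaEmbedding A
  have hF : F.IsPerfect (boundedPerfect A) := boundedDeltaEmbedding_isPerfect A
  have hP (X : A) : ∃ (P : A) (_ : Projective P) (π : P ⟶ X), Epi π :=
    ⟨_, Y.projective X, Y.p.app X, (Y.exact X).epi_g⟩
  exact ⟨(G.stableDeltaFunctor (F.deltaLevels Y hF hY) (F.lift_full Y hF)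
    (F.lift_essSurj Y hF hY hP bounded_induction)
    (F.exists_factorization_of_map_eq Y hF)).triangleEquivalence⟩

end TriangleEquivalence

theorem Subring.isArtinianRing {Λ : Type u} [Ring Λ] (E : Subring Λ) [IsSemisimpleRing E]
    [Module.Finite E Λ] : IsArtinianRing Λ :=
  isArtinian_of_tower E (inferInstance : IsArtinian E Λ)

instance {Λ : Type u} [Ring Λ] (E : Subring Λ) [IsSemisimpleRing E] [Module.Finite E Λ]
    [IsNoetherianRing Λ] : (tensorFunctor Λ (OmegaNC E)).PreservesMonomorphisms where
  preserves f _ := (FPMod.mono_iff_injective _).2 (OmegaNC.tensorFunctor_map_injective E f)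

theorem theoremB {Λ : Type u} [Ring Λ] (E : Subring Λ) [IsSemisimpleRing E] [Module.Finite E Λ] :
    haveI : IsNoetherianRing Λ := isNoetherianRing_of_finite_subring E
    IsStronglyGraded (LeavittRing.component Λ (OmegaNC E)) ∧
    IsFCRing (LeavittRing.DegreeZero Λ (OmegaNC E)) ∧
    Nonempty (Stabilization (tensorFunctor Λ (OmegaNC E)) ≌
      FPMod (LeavittRing.DegreeZero Λ (OmegaNC E))) ∧
    ∃ _ : IsFrobeniusAbelian (FPMod (LeavittRing.DegreeZero Λ (OmegaNC E))),
      Nonempty (TriangleEquivalenceToStable (SingularityCategory Λ)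
        (FPMod (LeavittRing.DegreeZero Λ (OmegaNC E)))) := by
  have : IsNoetherianRing Λ := isNoetherianRing_of_finite_subring E
  have := E.isArtinianRing
  obtain ⟨_, _, _, hα⟩ := exists_isDualBasis Λ (OmegaNC E)
  let G := LeavittRing.abelianModel Λ (OmegaNC E)
  have hY := OmegaNC.syzygyData_isExact E
  have hB : IsFrobeniusAbelian (FPMod (LeavittRing.DegreeZero Λ (OmegaNC E))) :=
    G.isFrobeniusAbelian hY fun f _ => OmegaNC.exists_retraction_extension E f
  refine ⟨LeavittRing.isStronglyGraded hα, IsFCRing.of_isFrobeniusAbelian fun f => ?_,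
    ⟨(LeavittRing.levelFunctors Λ (OmegaNC E)).lift.asEquivalence⟩, hB,
    G.nonempty_triangleEquivalence hY⟩
  obtain ⟨p, K, ⟨e⟩⟩ := LeavittRing.exists_equiv_ker f
  have := ((LeavittRing.partFunctor Λ (OmegaNC E) p).obj K).property
  exact Module.FinitePresentation.of_equiv e
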